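/- Let $s\in\{1,2\}$ (Maxwell field, linearized gravity). On Minkowski space use retarded time $u$, the radial coordinate $r$, angles $(\theta,\varphi)$ and the null tetrad $l=\partial_r$, $n=\partial_u-\frac12\partial_r$, $m=2^{-1/2}r^{-1}(\partial_\theta-i\csc\theta\,\partial_\varphi)$. A polyhomogeneous spin-$s$ zero-rest-mass field is a family of formal series $$\phi_n=\sum_{k\ge1}\sum_{j=0}^{N_{n,k}}\phi_n^{k,j}(u,\theta,\varphi)\,r^{-k}\ln^j r,\qquad n=0,\dots,2s,$$ with $\phi_n^{k,j}$ a smooth function of spin weight $s-n$ on $\mathbb R\times S^2$, which satisfies order by order, for $n=1,\dots,2s$, the field equations $$\partial_r\phi_n-\bar\eth\phi_{n-1}=-\frac{2s-n+1}{r}\phi_n,\qquad \big(\partial_u-\tfrac12\partial_r\big)\phi_{n-1}-\eth\phi_n=\frac{n}{2r}\phi_{n-1},$$ where $\eth=r^{-1}\eth_1$ and $\bar\eth=r^{-1}\bar\eth_1$; on spin weight $p$, $\eth_1=2^{-1/2}(\partial_\theta-i\csc\theta\,\partial_\varphi-p\cot\theta)$ and $\bar\eth_1=2^{-1/2}(\partial_\theta+i\csc\theta\,\partial_\varphi+p\cot\theta)$.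 The field peels if $\phi_n=O(r^{-(2s+1-n)})$ for all $n$, i.e. if $\phi_n^{k,j}=0$ whenever $k<2s+1-n$, or $k=2s+1-n$ and $j\ge1$. Let ${}_pY_{lm}$ be the orthonormal spin-weighted harmonics, with phases such that $\bar\eth_1\,{}_pY_{lm}=(\frac12(l+p)(l-p+1))^{1/2}\,{}_{p-1}Y_{lm}$ and $\eth_1\,{}_pY_{lm}=-(\frac12(l-p)(l+p+1))^{1/2}\,{}_{p+1}Y_{lm}$, and put $K_p=\big(2^p\frac{(l-p)!}{(l+p)!}\big)^{1/2}$. An advanced field is a superposition of the Torrence–Janis solutions ($l\ge s$, $|m|\le l$) $$\phi_n=K_{s-n}\;{}_{s-n}Y_{lm}\;r^{l-s}\,\partial_r^{\,l+s-n}\Big(\frac{B^{lm}(v)}{r^{l-s+n+1}}\Big),\qquad v=u+2r,$$ where $B^{lm}$ is a formal series in powers of $v$ (bounded above), each multiplied by a polynomial in $\ln v$, expanded in powers of $1/r$ and $\ln r$. A retarded field is a superposition of the time-reversed solutions $$\phi_n=\Big(2^{s-n}\tfrac{(l+s-n)!}{(l-s+n)!}\Big)^{1/2}\,{}_{s-n}Y_{lm}\;r^{l-s}(\partial_r-2\partial_u)^{l-s+n}\Big(\frac{b^{lm}(u)}{r^{l+s-n+1}}\Big),\qquad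 |s-n|\le l,\ |m|\le l,$$ with smooth $b^{lm}$ (for $l<s$ the components with $|s-n|>l$ vanish, and $b^{lm}$ is restricted by the field equations). A mixed field is the sum of a retarded field and an advanced field whose profiles $B^{lm}$ contain only powers $v^{q}$ with $q\le l-s$. In all these superpositions the sum over $l,m$ converges absolutely at each order in $1/r$ and $\ln r$. Let $\phi$ be a polyhomogeneous spin-$s$ zero-rest-mass field. (1) $\phi=\phi^{\rm adv}+\phi^{\rm mix}$, where both summands are polyhomogeneous spin-$s$ zero-rest-mass fields, $\phi^{\rm adv}$ is an advanced field with profiles $B^{lm}(v)=\sum_{q=l-s}^{l+s}v^{q}P^{lm}_q(\ln v)$ ($P_q^{lm}$ polynomials), and $\phi^{\rm mix}$ is a mixed field that peels. Thus the advanced field accounts for all the coefficients that violate peeling. (2) Suppose that $\phi$ is minimally non-peeling: $\phi_0=\phi_0^{2s}r^{-2s}+\cdots$ with $\phi_0^{2s}$ free of $\ln r$. Then $\phi_0^{2s}=\sum_{l\ge s,\,|m|\le l}(\phi_0^{2s})_{lm}\,{}_sY_{lm}$, the multipole moments $(\phi_0^{2s})_{lm}$ do not depend on $u$, and there are constants $B_0^{lm}$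 such that $$(\phi_0^{2s})_{lm}=(-1)^{l+s+1}\,2^{\,l+1-s}\,(l+s-1)!\,K_s\,B_0^{lm},$$ which for $s=2$ reads $(\phi_0^4)_{lm}=(-1)^{l+1}2^{l-1}(l+1)!\,K_2B_0^{lm}$, and $\phi=\phi^{\rm adv}+\phi^{\rm mix}$, both summands being polyhomogeneous spin-$s$ zero-rest-mass fields, where $\phi^{\rm adv}$ is the advanced field with profiles $$B^{lm}(v)=B_0^{lm}\,v^{\,l+1-s}\ln v$$ (for $s=2$: $B_0^{lm}(u+2r)^{l-1}\ln(u+2r)$) and is itself minimally non-peeling, and $\phi^{\rm mix}$ is a mixed field whose component $\phi^{\rm mix}_0$ has no terms $r^{-k}\ln^jr$ with $k\le 2s$ and whose components $\phi_n^{\rm mix}$, $n\ge1$, peel. Moreover, for the actual functions $B^{lm}(v)=B_0^{lm}v^{l+1-s}\ln v$ and every $u$, $$\lim_{r\to\infty}r^{2s}\,K_s\,r^{l-s}\partial_r^{\,l+s}\Big(\frac{B^{lm}(u+2r)}{r^{l-s+1}}\Big)=(\phi_0^{2s})_{lm}.$$ -/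

import Mathlib

open scoped ContDiff

noncomputable section

namespace ZRM

/-! ### Formal polyhomogeneous series in the radial variable -/

/-- Formal series `∑ f k j * r ^ (-k) * (log r) ^ j` with coefficients `f k j` in `A`. -/
abbrev PolyLog (A : Type) : Type := ℤ → ℕ → A

/-- The formal derivative `∂/∂r`:
`∂_r (r ^ (-k) log ^ j r) = -k r ^ (-k-1) log ^ j r + j r ^ (-k-1) log ^ (j-1) r`. -/
def dr {A : Type} [AddCommGroup A] [Module ℂ A] (f : PolyLog A) : PolyLog A :=
  fun k j => (-((k : ℂ) - 1)) • f (k - 1) j + ((j : ℂ) + 1) • f (k - 1) (j + 1)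

/-- Multiplication of a formal series by `r ^ a`. -/
def rmul {A : Type} (a : ℤ) (f : PolyLog A) : PolyLog A := fun k j => f (k + a) j

/-! ### Spin-weighted functions on the sphere, `eth`, spin-weighted harmonics -/

/-- The operator `ð` of the unit sphere on quantities of spin weight `p`, for the tetrad vector
`m = 2 ^ (-1/2) (∂_θ - i csc θ ∂_ϕ)` (so `β = -α = 2 ^ (-3/2) cot θ`). -/
def eth (p : ℤ) (g : ℝ → ℝ → ℂ) : ℝ → ℝ → ℂ := fun θ ϕ =>
  ((√2 : ℝ) : ℂ)⁻¹ * (deriv (fun t => g t ϕ) θ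
    - Complex.I / (Real.sin θ : ℂ) * deriv (fun t => g θ t) ϕ
    - (p : ℂ) * ((Real.cos θ / Real.sin θ : ℝ) : ℂ) * g θ ϕ)

/-- The operator `ð̄` of the unit sphere on quantities of spin weight `p`. -/
def ethBar (p : ℤ) (g : ℝ → ℝ → ℂ) : ℝ → ℝ → ℂ := fun θ ϕ =>
  ((√2 : ℝ) : ℂ)⁻¹ * (deriv (fun t => g t ϕ) θ
    + Complex.I / (Real.sin θ : ℂ) * deriv (fun t => g θ t) ϕ
    + (p : ℂ) * ((Real.cos θ / Real.sin θ : ℝ) : ℂ) * g θ ϕ)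

/-- `ð ^ q` applied to a quantity of spin weight `0`. -/
def ethIter : ℕ → (ℝ → ℝ → ℂ) → (ℝ → ℝ → ℂ)
  | 0, g => g
  | q + 1, g => eth q (ethIter q g)

/-- `ð̄ ^ q` applied to a quantity of spin weight `0`. -/
def ethBarIter : ℕ → (ℝ → ℝ → ℂ) → (ℝ → ℝ → ℂ)
  | 0, g => g
  | q + 1, g => ethBar (-(q : ℤ)) (ethBarIter q g)

/-- The associated Legendre function `P_l^m (cos θ)` (Rodrigues' formula with the
Condon-Shortley phase), for `-l ≤ m ≤ l`. -/
def legendreP (l : ℕ) (m : ℤ) (θ : ℝ) : ℝ :=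
  (-1 : ℝ) ^ m / (2 ^ l * (l.factorial : ℝ)) * Real.sin θ ^ m *
    (Polynomial.derivative^[((l : ℤ) + m).toNat]
      ((Polynomial.X ^ 2 - 1 : Polynomial ℝ) ^ l)).eval (Real.cos θ)

/-- The scalar spherical harmonic `Y_{lm}`, for `-l ≤ m ≤ l`. -/
def sphY (l : ℕ) (m : ℤ) (θ ϕ : ℝ) : ℂ :=
  ((√((2 * l + 1) / (4 * Real.pi) *
      ((((l : ℤ) - m).toNat.factorial : ℝ) / (((l : ℤ) + m).toNat.factorial : ℝ))) * legendreP l m θ : ℝ) : ℂ)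
    * Complex.exp (Complex.I * m * ϕ)

/-- `K_p = (2 ^ p (l - p)! / (l + p)!) ^ (1/2)`, for `|p| ≤ l`. -/
def K (p : ℤ) (l : ℕ) : ℝ :=
  √((2 : ℝ) ^ p * (((l : ℤ) - p).toNat.factorial : ℝ) / (((l : ℤ) + p).toNat.factorial : ℝ))

/-- The spin-weighted spherical harmonic of spin weight `p`. It vanishes unless `|p| ≤ l` and
`|m| ≤ l`. The phases are such that `ð _pY = -((l - p)(l + p + 1) / 2) ^ (1/2) _{p+1}Y` and
`ð̄ _pY = ((l + p)(l - p + 1) / 2) ^ (1/2) _{p-1}Y`. -/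
def spinY (p : ℤ) (l : ℕ) (m : ℤ) (θ ϕ : ℝ) : ℂ :=
  if |p| ≤ (l : ℤ) ∧ |m| ≤ (l : ℤ) then
    if 0 ≤ p then (-1 : ℂ) ^ p * (K p l : ℂ) * ethIter p.toNat (sphY l m) θ ϕ
    else (K (-p) l : ℂ) * ethBarIter (-p).toNat (sphY l m) θ ϕ
  else 0

/-- The `(l, m)` multipole moment `∮ f conj(_pY_{lm}) dS` of a quantity of spin weight `p`. -/
def multipole (p : ℤ) (l : ℕ) (m : ℤ) (g : ℝ → ℝ → ℂ) : ℂ :=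
  ∫ θ in (0 : ℝ)..Real.pi, ∫ ϕ in (0 : ℝ)..(2 * Real.pi),
    g θ ϕ * (starRingEnd ℂ) (spinY p l m θ ϕ) * (Real.sin θ : ℂ)

/-- Functions of retarded time and of the angles, `f u θ ϕ`. Only the values for `0 < θ < π`
are meaningful. -/
abbrev ScriFun : Type := ℝ → ℝ → ℝ → ℂ

/-- Smooth functions of spin weight `p` on `ℝ × S²`: `f` comes from a smooth function `F` of `u`
and of a two-component spinor `(z, w)`, which picks up the phase `exp (2 i p ψ)` if the spinor is
multiplied by `exp (i ψ)`; the coordinate frame at `(θ, ϕ)` belongs to the unit spinor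
`(cos (θ/2) exp (i ϕ/2), sin (θ/2) exp (-i ϕ/2))`. This includes regularity at the poles. -/
def IsSmoothSpinWeighted (p : ℤ) (f : ScriFun) : Prop :=
  ∃ F : ℝ × ℂ × ℂ → ℂ, ContDiff ℝ ∞ F ∧
    (∀ (u ψ : ℝ) (z w : ℂ),
      F (u, Complex.exp (Complex.I * ψ) * z, Complex.exp (Complex.I * ψ) * w)
        = Complex.exp (2 * Complex.I * p * ψ) * F (u, z, w)) ∧
    ∀ u ϕ : ℝ, ∀ θ ∈ Set.Ioo (0 : ℝ) Real.pi,
      f u θ ϕ = F (u, (Real.cos (θ / 2) : ℂ) * Complex.exp (Complex.I * (ϕ / 2)),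
        (Real.sin (θ / 2) : ℂ) * Complex.exp (-(Complex.I * (ϕ / 2))))

/-! ### Zero-rest-mass fields of spin `s` on Minkowski space -/

/-- The formal expansions of the components of a field: `φ n k j` is the coefficient of
`r ^ (-k) (log r) ^ j` in the component `φ_n`, `n = 0, …, 2s`, a quantity of spin weight
`s - n`. -/
abbrev FieldExp : Type := ℕ → PolyLog ScriFun

/-- Two functions agree on `ℝ × S²` (with the poles removed). -/
def SphEq (f g : ScriFun) : Prop :=
  ∀ u ϕ : ℝ, ∀ θ ∈ Set.Ioo (0 : ℝ) Real.pi, f u θ ϕ = g u θ ϕ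

/-- `∂/∂u`, coefficientwise. -/
def duField (f : PolyLog ScriFun) : PolyLog ScriFun :=
  fun k j u θ ϕ => deriv (fun t => f k j t θ ϕ) u

/-- `r⁻¹ ð` on the expansion of a quantity of spin weight `p`. -/
def ethField (p : ℤ) (f : PolyLog ScriFun) : PolyLog ScriFun :=
  rmul (-1) (fun k j u => eth p (f k j u))

/-- `r⁻¹ ð̄` on the expansion of a quantity of spin weight `p`. -/
def ethBarField (p : ℤ) (f : PolyLog ScriFun) : PolyLog ScriFun :=
  rmul (-1) (fun k j u => ethBar p (f k j u))

/-- The spin-`s` massless free field equations on Minkowski space, order by order: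
`D φ_n - ð̄ φ_{n-1} = (2s - n + 1) ρ φ_n` and `Δ φ_{n-1} - ð φ_n = -n μ φ_{n-1}`, `1 ≤ n ≤ 2s`,
with `D = ∂_r`, `Δ = ∂_u - ½ ∂_r`, `ρ = -1/r`, `μ = -1/(2r)`. -/
def SatisfiesZRM (s : ℕ) (φ : FieldExp) : Prop :=
  ∀ n : ℕ, 1 ≤ n → n ≤ 2 * s → ∀ (k : ℤ) (j : ℕ),
    SphEq (dr (φ n) k j - ethBarField ((s : ℤ) - n + 1) (φ (n - 1)) k j)
      ((-(2 * (s : ℂ) - n + 1)) • rmul (-1) (φ n) k j) ∧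
    SphEq (duField (φ (n - 1)) k j - (1 / 2 : ℂ) • dr (φ (n - 1)) k j
        - ethField ((s : ℤ) - n) (φ n) k j)
      (((n : ℂ) / 2) • rmul (-1) (φ (n - 1)) k j)

/-- Polyhomogeneous zero-rest-mass fields of spin `s`: every component is a formal series
`∑_{k ≥ 1} φ_n^k r ^ (-k)` with `φ_n^k` a polynomial in `log r` whose coefficients are smooth
functions of spin weight `s - n` on `ℝ × S²`, and the field equations hold. -/
def IsPolyhomField (s : ℕ) (φ : FieldExp) : Prop :=
  (∀ n ≤ 2 * s,
    (∀ k < (1 : ℤ), ∀ j, SphEq (φ n k j) 0) ∧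
    (∀ k : ℤ, ∃ N : ℕ, ∀ j > N, SphEq (φ n k j) 0) ∧
    ∀ (k : ℤ) (j : ℕ), IsSmoothSpinWeighted ((s : ℤ) - n) (φ n k j)) ∧
  SatisfiesZRM s φ

/-- The coefficient of `r ^ (-k) (log r) ^ j` in `φ_n` is forbidden by the peeling behaviour
`φ_n = O(r ^ (-(2s + 1 - n)))`. -/
def ViolatesPeeling (s n : ℕ) (k : ℤ) (j : ℕ) : Prop :=
  k < 2 * (s : ℤ) + 1 - n ∨ (k = 2 * (s : ℤ) + 1 - n ∧ 1 ≤ j)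

/-- `φ_n = O(r ^ (-(2s + 1 - n)))` for `n = 0, …, 2s`. -/
def Peels (s : ℕ) (φ : FieldExp) : Prop :=
  ∀ n ≤ 2 * s, ∀ (k : ℤ) (j : ℕ), ViolatesPeeling s n k j → SphEq (φ n k j) 0

/-- Minimal violation of peeling: `φ_0 = φ_0^{2s} r ^ (-2s) + …` with `φ_0^{2s}` free of
logarithms. -/
def IsMinimal (s : ℕ) (φ : FieldExp) : Prop :=
  (∀ k < 2 * (s : ℤ), ∀ j, SphEq (φ 0 k j) 0) ∧ ∀ j ≥ 1, SphEq (φ 0 (2 * s) j) 0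

/-! ### Torrence-Janis advanced and retarded solutions -/

/-- Expansion in `r` of `B (u + 2 r)`, where `B v = ∑ B k q * v ^ (-k) * (log v) ^ q`: the Taylor
series `∑_d u ^ d / d! * B^{(d)} (2 r)`, with `(2 r) ^ (-k) = 2 ^ (-k) r ^ (-k)` and
`log (2 r) = log 2 + log r`. The sums are finite if `IsProfile B`. -/
def atAdvancedTime (B : PolyLog ℂ) : PolyLog (ℝ → ℂ) := fun k j u =>
  ∑ᶠ d : ℕ, ((u : ℂ) ^ d / (d.factorial : ℂ)) * (2 : ℂ) ^ (-k) *
    ∑ᶠ q : ℕ, (q.choose j : ℂ) * ((Real.log 2 : ℝ) : ℂ) ^ (q - j) * (dr^[d] B) k q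

/-- Formal series in `1/v` and `log v` with powers of `v` bounded above and, at each power,
polynomial in `log v`. -/
def IsProfile (B : PolyLog ℂ) : Prop :=
  (∃ k₀ : ℤ, ∀ k < k₀, ∀ q, B k q = 0) ∧ ∀ k : ℤ, ∃ N : ℕ, ∀ q > N, B k q = 0

/-- The `(l, m)` advanced solution with profile `B (v)`, `v = u + 2 r`:
`φ_n = K_{s-n} r ^ (l-s) ∂_r ^ (l+s-n) (B (v) / r ^ (l-s+n+1)) _{s-n}Y_{lm}`. -/
def advTerm (s l : ℕ) (m : ℤ) (B : PolyLog ℂ) : FieldExp := fun n k j u θ ϕ =>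
  (K ((s : ℤ) - n) l : ℂ) *
    rmul ((l : ℤ) - s) (dr^[l + s - n] (rmul (-((l : ℤ) - s + n + 1)) (atAdvancedTime B))) k j u
    * spinY ((s : ℤ) - n) l m θ ϕ

/-- The operator `∂_r - 2 ∂_u`. -/
def drMinusTwoDu (f : PolyLog (ℝ → ℂ)) : PolyLog (ℝ → ℂ) :=
  fun k j u => dr f k j u - 2 * deriv (f k j) u

/-- `b (u) r ^ (-a)`. -/
def retSeed (b : ℝ → ℂ) (a : ℤ) : PolyLog (ℝ → ℂ) :=
  fun k j => if k = a ∧ j = 0 then b else 0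

/-- The normalization `(2 ^ p (l + p)! / (l - p)!) ^ (1/2)` of the retarded solutions. -/
def KRet (p : ℤ) (l : ℕ) : ℝ :=
  √((2 : ℝ) ^ p * (((l : ℤ) + p).toNat.factorial : ℝ) / (((l : ℤ) - p).toNat.factorial : ℝ))

/-- The `(l, m)` retarded solution, the time reversal of the advanced one:
`φ_n = KRet_{s-n} r ^ (l-s) (∂_r - 2 ∂_u) ^ (l-s+n) (b (u) / r ^ (l+s-n+1)) _{s-n}Y_{lm}`. -/
def retTerm (s l : ℕ) (m : ℤ) (b : ℝ → ℂ) : FieldExp := fun n k j u θ ϕ =>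
  (KRet ((s : ℤ) - n) l : ℂ) *
    rmul ((l : ℤ) - s) (drMinusTwoDu^[l + n - s] (retSeed b ((l : ℤ) + s - n + 1))) k j u
    * spinY ((s : ℤ) - n) l m θ ϕ

/-- `φ = ∑_{l,m} T l m`: at every order in `1/r` and `log r` the sum over the multipoles converges
(absolutely) to the coefficient of `φ`. -/
def IsMultipoleSum (s : ℕ) (T : ℕ → ℤ → FieldExp) (φ : FieldExp) : Prop :=
  ∀ n ≤ 2 * s, ∀ (k : ℤ) (j : ℕ) (u ϕ : ℝ), ∀ θ ∈ Set.Ioo (0 : ℝ) Real.pi,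
    HasSum (fun lm : ℕ × ℤ => T lm.1 lm.2 n k j u θ ϕ) (φ n k j u θ ϕ)

/-- `φ` is the superposition of the advanced solutions with profiles `B^{lm}`, `l ≥ s`. -/
def IsAdvanced (s : ℕ) (B : ℕ → ℤ → PolyLog ℂ) (φ : FieldExp) : Prop :=
  (∀ l m, IsProfile (B l m)) ∧ (∀ l < s, ∀ m, B l m = 0) ∧
  (∀ l m, SatisfiesZRM s (advTerm s l m (B l m))) ∧
  IsMultipoleSum s (fun l m => advTerm s l m (B l m)) φ

/-- `φ` is the superposition of the retarded solutions with profiles `b^{lm}`. The non-radiative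
multipoles `l < s` (Coulomb-type fields) are included: there the field equations restrict
`b^{lm}`. -/
def IsRetarded (s : ℕ) (b : ℕ → ℤ → ℝ → ℂ) (φ : FieldExp) : Prop :=
  (∀ l m, ContDiff ℝ ∞ (b l m)) ∧
  (∀ l m, SatisfiesZRM s (retTerm s l m (b l m))) ∧
  IsMultipoleSum s (fun l m => retTerm s l m (b l m)) φ

/-- `φ = χ + ψ` as expansions of spin-`s` fields. -/
def IsSum (s : ℕ) (φ χ ψ : FieldExp) : Prop :=
  ∀ n ≤ 2 * s, ∀ (k : ℤ) (j : ℕ), SphEq (φ n k j) (χ n k j + ψ n k j)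

/-- Mixed fields: superpositions of a retarded field and an advanced field whose profiles contain
only powers `v ^ p` with `p ≤ l - s`, so that the advanced part is `O(r ^ (-2s-1))` up to
logarithms. -/
def IsMixed (s : ℕ) (φ : FieldExp) : Prop :=
  ∃ (b : ℕ → ℤ → ℝ → ℂ) (B : ℕ → ℤ → PolyLog ℂ) (φret φadv : FieldExp),
    IsRetarded s b φret ∧ IsAdvanced s B φadv ∧
    (∀ l m k q, B l m k q ≠ 0 → (s : ℤ) - l ≤ k) ∧
    IsSum s φ φret φadv

/-- The profile `B^{lm} (v) = B₀^{lm} v ^ (l+1-s) log v`, `l ≥ s`. -/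
def logProfile (s : ℕ) (B₀ : ℕ → ℤ → ℂ) (l : ℕ) (m : ℤ) : PolyLog ℂ := fun k q =>
  if s ≤ l ∧ k = -((l : ℤ) + 1 - s) ∧ q = 1 then B₀ l m else 0

/-- The radial part `K_s r ^ (l-s) ∂_r ^ (l+s) (B (u + 2 r) / r ^ (l-s+1))` of the component `φ_0`
of the advanced solution for an actual function `B`, `l ≥ s`. -/
def advRadialZero (s l : ℕ) (B : ℝ → ℂ) (u r : ℝ) : ℂ :=
  (K s l : ℂ) * (r : ℂ) ^ (l - s) *
    iteratedDeriv (l + s) (fun x : ℝ => B (u + 2 * x) / (x : ℂ) ^ (l - s + 1)) r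

end ZRM

end

/-! Expanding every coefficient in spin-weighted harmonics decouples the field equations into
sectors `(l, m)`, see `satisfiesZRM_iff`. In a sector they have two kinds of content. The radial
equations couple neighbouring components at one and the same order `k` of `r ^ (-k)`; for `l ≥ s`
the component `φ_{2s}` fixes all others through them. The evolution equations express the
`u`-derivative of the order `k + 1` part of `φ_n`, `n < 2s`, by parts of order `k`. Induction on the
order shows that a mode with `l ≥ s` is determined by `φ_{2s}` at `u = 0` and by the `r⁻¹`
coefficient of `φ_{2s}` as a function of `u` (`IsMode.eq_zero`).

At `u = 0` the power `v ^ q` in an advanced profile contributes only at order `l + s + 1 - q`, in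
every component. Any data for `φ_{2s}` at `u = 0` with orders `k ≥ 1` come from an advanced profile
(`exists_profile`), because the derivatives that have to be inverted never require the integral of
`1/r`. For the first claim the profile is matched to the data of order at most `2s + 1`, that is, to
the powers `l - s ≤ q ≤ l + s`. The difference has no data up to order `2s + 1` and therefore peels
for all `u` (`IsMode.peels`).

A peeling mode with `l ≥ s` is mixed (`IsMode.exists_mixed`): `b ^ (l+s)` is read off from the `r⁻¹`
coefficient of `φ_{2s}`, some constants of integration are adjusted to the data of orders `2, …,
2s`, the others vanish, and the data of order at least `2s + 1` go into an advanced profile with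
powers `q ≤ l - s`. For `l < s` the equations force a retarded solution (`IsMode.exists_retMode`).

In the minimal case the leading coefficient of `φ_0` is constant in `u` (`IsMode.leading_const`).
The profile `v ^ (l+1-s) log v` has data at the single order `2s`, and in `φ_0` all `l + s`
derivatives fall on `log (2r)`, which yields the stated constant. After subtraction `φ_0` has no
term of order at most `2s`, and the radial equations make the other components peel
(`IsMode.peels_of_first`).

The superposed modes must again form a smooth field. Quantities of spin weight `p` are treated as
functions of a spinor `(z, w)`, and the harmonics as coefficients of `(z t - w) ^ (l+p) (w̄ t + z̄)
^ (l-p)`. On these `ð` is a ladder operator, and unitarity bounds the harmonics by `l + 1`. Hence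
smooth functions correspond to rapidly decreasing moments (`SmoothWeighted.rapidDecay_multipole`,
`RapidDecay.smoothWeighted_synth`), and completeness follows from Stone-Weierstrass on the
three-sphere (`SmoothWeighted.eq_zero`). The advanced data are truncations of moments of the given
field, or are controlled by its leading moments, so they decrease rapidly. Evolution multiplies only
by factors of polynomial growth in `l`, which makes `IsSummableFamily.exists_field` applicable. -/

noncomputable section

/-! ### Coefficients of products of linear forms -/

namespace ZRM

open Polynomial in
/-- `(z t - w) ^ a (w̄ t + z̄) ^ b`, a polynomial in `t`, at the spinor `q = (z, w)`. -/
def spinPoly (a b : ℕ) (q : ℂ × ℂ) : Polynomial ℂ :=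
  (C q.1 * X - C q.2) ^ a * (C ((starRingEnd ℂ) q.2) * X + C ((starRingEnd ℂ) q.1)) ^ b

/-- The coefficient of `t ^ c` in `spinPoly a b`. -/
def spinCoeff (a b c : ℕ) (q : ℂ × ℂ) : ℂ := (spinPoly a b q).coeff c

/-- The spinor orthogonal to `q = (z, w)`. -/
def perp (q : ℂ × ℂ) : ℂ × ℂ := (-(starRingEnd ℂ) q.2, (starRingEnd ℂ) q.1)

/-- The unit spinor which represents the coordinate frame at `(θ, ϕ)`. -/
def spinor (θ ϕ : ℝ) : ℂ × ℂ :=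
  ((Real.cos (θ / 2) : ℂ) * Complex.exp (Complex.I * (ϕ / 2)),
    (Real.sin (θ / 2) : ℂ) * Complex.exp (-(Complex.I * (ϕ / 2))))

section CoeffDeriv

open Polynomial

/-- Coefficientwise differentiability of a family of polynomials. -/
def CoeffHasDerivAt (P : ℝ → ℂ[X]) (P' : ℂ[X]) (t : ℝ) : Prop :=
  ∀ c, HasDerivAt (fun x => (P x).coeff c) (P'.coeff c) t

theorem CoeffHasDerivAt.mul {P Q : ℝ → ℂ[X]} {P' Q' : ℂ[X]} {t : ℝ}
    (hP : CoeffHasDerivAt P P' t) (hQ : CoeffHasDerivAt Q Q' t) :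
    CoeffHasDerivAt (fun x => P x * Q x) (P' * Q t + P t * Q') t := by
  intro c
  simp only [coeff_mul, coeff_add, ← Finset.sum_add_distrib]
  exact HasDerivAt.fun_sum fun i _ => (hP i.1).mul (hQ i.2)

theorem CoeffHasDerivAt.pow {P : ℝ → ℂ[X]} {P' : ℂ[X]} {t : ℝ}
    (hP : CoeffHasDerivAt P P' t) (n : ℕ) :
    CoeffHasDerivAt (fun x => P x ^ n) (C (n : ℂ) * P t ^ (n - 1) * P') t := by
  induction n with
  | zero => intro c; simpa using hasDerivAt_const t ((1 : ℂ[X]).coeff c)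
  | succ n ih =>
    have h := ih.mul hP
    simp only [← pow_succ] at h
    convert h using 1
    rcases n with _ | n
    · simp
    · simp only [Nat.add_sub_cancel, pow_succ]
      push_cast
      simp only [map_add, map_one]
      ring

/-- Coefficientwise smoothness of a family of polynomials on `ℂ²`. -/
def CoeffSmooth (P : ℂ × ℂ → ℂ[X]) : Prop := ∀ c, ContDiff ℝ ∞ (fun x => (P x).coeff c)

theorem CoeffSmooth.mul {P Q : ℂ × ℂ → ℂ[X]} (hP : CoeffSmooth P) (hQ : CoeffSmooth Q) :
    CoeffSmooth (fun x => P x * Q x) := by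
  intro c
  simp only [coeff_mul]
  exact ContDiff.sum fun i _ => (hP i.1).mul (hQ i.2)

theorem CoeffSmooth.pow {P : ℂ × ℂ → ℂ[X]} (hP : CoeffSmooth P) (n : ℕ) :
    CoeffSmooth (fun x => P x ^ n) := by
  induction n with
  | zero => intro c; simpa using contDiff_const
  | succ n ih => simpa only [pow_succ] using ih.mul hP

theorem coeffSmooth_linear {f g : ℂ × ℂ → ℂ} (hf : ContDiff ℝ ∞ f) (hg : ContDiff ℝ ∞ g) :
    CoeffSmooth (fun x => C (f x) * X + C (g x)) := by
  intro c
  simp only [coeff_add, coeff_C_mul, coeff_C, coeff_X]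
  split_ifs <;> simp <;> first | exact hf.add hg | exact hf | exact hg | exact contDiff_const

end CoeffDeriv

theorem contDiff_conj : ContDiff ℝ ∞ (fun z : ℂ => (starRingEnd ℂ) z) :=
  Complex.conjCLE.contDiff

theorem contDiff_spinCoeff (a b c : ℕ) : ContDiff ℝ ∞ (spinCoeff a b c) := by
  have h1 : CoeffSmooth fun q : ℂ × ℂ =>
      Polynomial.C q.1 * Polynomial.X - Polynomial.C q.2 := by
    have := coeffSmooth_linear (f := fun q => q.1) (g := fun q => -q.2) contDiff_fst
      contDiff_snd.neg
    simpa only [map_neg, ← sub_eq_add_neg] using this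
  have h2 : CoeffSmooth fun q : ℂ × ℂ =>
      Polynomial.C ((starRingEnd ℂ) q.2) * Polynomial.X + Polynomial.C ((starRingEnd ℂ) q.1) :=
    coeffSmooth_linear (contDiff_conj.comp contDiff_snd) (contDiff_conj.comp contDiff_fst)
  exact (h1.pow a).mul (h2.pow b) c

section Directional

open Polynomial

/-- Both linear forms depend real-linearly on the spinor; the second involves conjugates, so
differentiation is over `ℝ` along a direction. Working coefficient by coefficient avoids a topology
on polynomials. -/
theorem spinPoly_coeffHasDerivAt (a b : ℕ) (q v : ℂ × ℂ) :
    CoeffHasDerivAt (fun t : ℝ => spinPoly a b (q + t • v))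
      (C (a : ℂ) * (C v.1 * X - C v.2) * spinPoly (a - 1) b q
        + C (b : ℂ) * (C ((starRingEnd ℂ) v.2) * X + C ((starRingEnd ℂ) v.1))
          * spinPoly a (b - 1) q) 0 := by
  have lin : ∀ x y x' y' : ℂ, CoeffHasDerivAt
      (fun t : ℝ => C (x + t * x') * X + C (y + t * y')) (C x' * X + C y') 0 := by
    intro x y x' y' c
    have hd : ∀ x x' : ℂ, HasDerivAt (fun t : ℝ => x + (t : ℂ) * x') x' 0 := fun x x' => by
      simpa using ((Complex.ofRealCLM.hasDerivAt (x := (0 : ℝ))).mul_const x').const_add x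
    simp only [coeff_add, coeff_C_mul, coeff_C, coeff_X]
    split_ifs
    · simpa using (hd x x').fun_add (hd y y')
    · simpa using hd x x'
    · simpa using hd y y'
    · simpa using hasDerivAt_const (0 : ℝ) (0 : ℂ)
  have h1 : CoeffHasDerivAt (fun t : ℝ => C (q + t • v).1 * X - C (q + t • v).2)
      (C v.1 * X - C v.2) 0 := by
    have := lin q.1 (-q.2) v.1 (-v.2)
    have e : (fun t : ℝ => C (q + t • v).1 * X - C (q + t • v).2)
        = fun t : ℝ => C (q.1 + t * v.1) * X + C (-q.2 + t * -v.2) := by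
      funext t
      simp
      ring
    rw [e]
    simpa [sub_eq_add_neg] using this
  have h2 : CoeffHasDerivAt (fun t : ℝ => C ((starRingEnd ℂ) (q + t • v).2) * X
        + C ((starRingEnd ℂ) (q + t • v).1))
      (C ((starRingEnd ℂ) v.2) * X + C ((starRingEnd ℂ) v.1)) 0 := by
    have := lin ((starRingEnd ℂ) q.2) ((starRingEnd ℂ) q.1) ((starRingEnd ℂ) v.2)
      ((starRingEnd ℂ) v.1)
    simpa using this
  have h := (h1.pow a).mul (h2.pow b)
  unfold spinPoly
  convert h using 1
  simp only [zero_smul, add_zero]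
  ring

theorem fderiv_spinCoeff (a b c : ℕ) (q v : ℂ × ℂ) :
    fderiv ℝ (spinCoeff a b c) q v = (C (a : ℂ) * (C v.1 * X - C v.2) * spinPoly (a - 1) b q
        + C (b : ℂ) * (C ((starRingEnd ℂ) v.2) * X + C ((starRingEnd ℂ) v.1))
          * spinPoly a (b - 1) q).coeff c := by
  have h1 := spinPoly_coeffHasDerivAt a b q v c
  have h2 : HasFDerivAt (spinCoeff a b c) (fderiv ℝ (spinCoeff a b c) q) (q + (0 : ℝ) • v) := by
    simpa using ((contDiff_spinCoeff a b c).differentiable (by simp) q).hasFDerivAt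
  have h3 : HasDerivAt (fun t : ℝ => q + t • v) v 0 := by
    simpa using ((hasDerivAt_id (0 : ℝ)).smul_const v).const_add q
  have h4 : HasDerivAt (fun t : ℝ => spinCoeff a b c (q + t • v))
      (fderiv ℝ (spinCoeff a b c) q v) 0 :=
    HasFDerivAt.comp_hasDerivAt (f := fun t : ℝ => q + t • v) (0 : ℝ) h2 h3
  exact h4.unique h1

theorem spinPoly_succ_left (a b : ℕ) (q : ℂ × ℂ) :
    spinPoly (a + 1) b q = (C q.1 * X - C q.2) * spinPoly a b q := by
  simp only [spinPoly, pow_succ]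
  ring

theorem spinPoly_succ_right (a b : ℕ) (q : ℂ × ℂ) :
    spinPoly a (b + 1) q
      = (C ((starRingEnd ℂ) q.2) * X + C ((starRingEnd ℂ) q.1)) * spinPoly a b q := by
  simp only [spinPoly, pow_succ]
  ring

/-- The substitution `q ↦ perp q` turns `z t - w` into `-(w̄ t + z̄)` and `w̄ t + z̄` into `z t -
w`, so each term trades a factor of one kind for one of the other. Combined with the direction `I •
perp q` this separates raising from lowering. -/
theorem fderiv_spinCoeff_perp (a b c : ℕ) (q : ℂ × ℂ) :
    fderiv ℝ (spinCoeff a b c) q (perp q)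
      = -(a : ℂ) * spinCoeff (a - 1) (b + 1) c q + b * spinCoeff (a + 1) (b - 1) c q := by
  rw [fderiv_spinCoeff, spinCoeff, spinCoeff, spinPoly_succ_left, spinPoly_succ_right,
    ← coeff_C_mul, ← coeff_C_mul, ← coeff_add]
  congr 1
  simp only [perp, map_neg, Complex.conj_conj]
  ring

theorem fderiv_spinCoeff_I_perp (a b c : ℕ) (q : ℂ × ℂ) :
    fderiv ℝ (spinCoeff a b c) q (Complex.I • perp q)
      = -Complex.I * a * spinCoeff (a - 1) (b + 1) c q
        - Complex.I * b * spinCoeff (a + 1) (b - 1) c q := by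
  rw [fderiv_spinCoeff, spinCoeff, spinCoeff, spinPoly_succ_left, spinPoly_succ_right,
    ← coeff_C_mul, ← coeff_C_mul, ← coeff_sub]
  congr 1
  simp only [perp, Prod.smul_mk, smul_eq_mul, map_neg, map_mul, Complex.conj_conj,
    Complex.conj_I]
  ring

/-- Euler's relation: the coefficients are homogeneous of degree `a + b` under real scaling. -/
theorem fderiv_spinCoeff_self (a b c : ℕ) (q : ℂ × ℂ) :
    fderiv ℝ (spinCoeff a b c) q q = ((a : ℂ) + b) * spinCoeff a b c q := by
  rw [fderiv_spinCoeff, spinCoeff, ← coeff_C_mul]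
  congr 1
  rw [map_add, add_mul]
  congr 1
  · rcases a with _ | a
    · simp
    · rw [spinPoly_succ_left, Nat.add_sub_cancel, mul_assoc]
  · rcases b with _ | b
    · simp
    · rw [spinPoly_succ_right, Nat.add_sub_cancel, mul_assoc]

theorem fderiv_spinCoeff_I_self (a b c : ℕ) (q : ℂ × ℂ) :
    fderiv ℝ (spinCoeff a b c) q (Complex.I • q)
      = Complex.I * ((a : ℂ) - b) * spinCoeff a b c q := by
  rw [fderiv_spinCoeff, spinCoeff, ← coeff_C_mul]
  congr 1
  rw [show Complex.I * ((a : ℂ) - b) = (a : ℂ) * Complex.I + (b : ℂ) * -Complex.I by ring,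
    map_add, add_mul]
  simp only [Prod.smul_fst, Prod.smul_snd, smul_eq_mul, map_mul, Complex.conj_I, map_neg]
  congr 1
  · rcases a with _ | a
    · simp
    · rw [spinPoly_succ_left, Nat.add_sub_cancel]
      ring
  · rcases b with _ | b
    · simp
    · rw [spinPoly_succ_right, Nat.add_sub_cancel]
      ring

end Directional

/-- Behaviour of the coefficients under independent phase shifts of the two components. -/
theorem spinCoeff_phase (a b c : ℕ) (z w e f : ℂ) (he : (starRingEnd ℂ) e * e = 1)
    (hf : (starRingEnd ℂ) f * f = 1) :
    spinCoeff a b c (e * z, f * w)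
      = f ^ a * (starRingEnd ℂ) e ^ b * (e * (starRingEnd ℂ) f) ^ c * spinCoeff a b c (z, w) := by
  -- For unit phases the forms become `f ((e f̄) z t - w)` and `ē ((e f̄) w̄ t + z̄)`, that is,
  -- phase factors times the old forms at the rescaled variable `(e f̄) t`.
  have h : spinPoly a b (e * z, f * w)
      = Polynomial.C (f ^ a * (starRingEnd ℂ) e ^ b)
        * (spinPoly a b (z, w)).comp
          (Polynomial.C (e * (starRingEnd ℂ) f) * Polynomial.X) := by
    simp only [spinPoly, Polynomial.mul_comp, Polynomial.pow_comp, Polynomial.add_comp,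
      Polynomial.sub_comp, Polynomial.C_comp, Polynomial.X_comp, map_mul, map_pow]
    rw [mul_mul_mul_comm, ← mul_pow, ← mul_pow]
    have hf' : Polynomial.C f * Polynomial.C ((starRingEnd ℂ) f) = 1 := by
      rw [← Polynomial.C_mul, mul_comm, hf, Polynomial.C_1]
    have he' : Polynomial.C e * Polynomial.C ((starRingEnd ℂ) e) = 1 := by
      rw [← Polynomial.C_mul, mul_comm, he, Polynomial.C_1]
    congr 2
    · linear_combination (-Polynomial.C e * Polynomial.C z * Polynomial.X) * hf'
    · linear_combination
        (-Polynomial.C ((starRingEnd ℂ) f) * Polynomial.C ((starRingEnd ℂ) w)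
          * Polynomial.X) * he'
  rw [spinCoeff, h, Polynomial.coeff_C_mul, Polynomial.comp_C_mul_X_coeff, spinCoeff]
  ring

theorem spinCoeff_real_smul (a b c : ℕ) (r : ℝ) (q : ℂ × ℂ) :
    spinCoeff a b c (r • q) = (r : ℂ) ^ (a + b) * spinCoeff a b c q := by
  have h : spinPoly a b (r • q) = Polynomial.C ((r : ℂ) ^ (a + b)) * spinPoly a b q := by
    simp only [spinPoly, Prod.smul_fst, Prod.smul_snd, Complex.real_smul, map_mul,
      Complex.conj_ofReal, map_pow, pow_add]
    rw [mul_mul_mul_comm, ← mul_pow, ← mul_pow]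
    congr 2 <;> ring
  rw [spinCoeff, h, Polynomial.coeff_C_mul, spinCoeff]

theorem spinCoeff_eq_zero {a b c : ℕ} (h : a + b < c) (q : ℂ × ℂ) : spinCoeff a b c q = 0 := by
  refine Polynomial.coeff_eq_zero_of_natDegree_lt (lt_of_le_of_lt ?_ h)
  refine Polynomial.natDegree_mul_le.trans (add_le_add ?_ ?_)
  · refine Polynomial.natDegree_pow_le.trans ?_
    have : (Polynomial.C q.1 * Polynomial.X - Polynomial.C q.2).natDegree ≤ 1 := by
      compute_degree
    nlinarith
  · refine Polynomial.natDegree_pow_le.trans ?_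
    have : (Polynomial.C ((starRingEnd ℂ) q.2) * Polynomial.X
      + Polynomial.C ((starRingEnd ℂ) q.1)).natDegree ≤ 1 := by compute_degree
    nlinarith

end ZRM

/-! ### `eth` in terms of spinors -/

namespace ZRM

/-- `ð` on functions of spinors. -/
def spinorEth (H : ℂ × ℂ → ℂ) (q : ℂ × ℂ) : ℂ :=
  ((√2 : ℝ) : ℂ)⁻¹ * (1 / 2) *
    (fderiv ℝ H q (perp q) + Complex.I * fderiv ℝ H q (Complex.I • perp q))

/-- `ð̄` on functions of spinors. -/
def spinorEthBar (H : ℂ × ℂ → ℂ) (q : ℂ × ℂ) : ℂ :=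
  ((√2 : ℝ) : ℂ)⁻¹ * (1 / 2) *
    (fderiv ℝ H q (perp q) - Complex.I * fderiv ℝ H q (Complex.I • perp q))

/-- The transformation law of functions of spinors which represent quantities of spin
weight `p`. -/
def HasSpinWeight (p : ℤ) (H : ℂ × ℂ → ℂ) : Prop :=
  ∀ (ψ : ℝ) (q : ℂ × ℂ), H (Complex.exp (Complex.I * ψ) • q)
    = Complex.exp (2 * Complex.I * p * ψ) * H q

theorem hasDerivAt_cexp_I_mul (a : ℂ) (t : ℝ) :
    HasDerivAt (fun t : ℝ => Complex.exp (a * t)) (a * Complex.exp (a * t)) t := by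
  have h : HasDerivAt (fun t : ℝ => a * (t : ℂ)) a t := by
    simpa using (Complex.ofRealCLM.hasDerivAt (x := t)).const_mul a
  simpa [mul_comm] using h.cexp

theorem HasSpinWeight.fderiv_I_smul {p : ℤ} {H : ℂ × ℂ → ℂ} (hw : HasSpinWeight p H)
    {q : ℂ × ℂ} (hd : DifferentiableAt ℝ H q) :
    fderiv ℝ H q (Complex.I • q) = 2 * Complex.I * p * H q := by
  have h1 : HasDerivAt (fun ψ : ℝ => Complex.exp (Complex.I * ψ) • q) (Complex.I • q) 0 := by
    simpa using (hasDerivAt_cexp_I_mul Complex.I 0).smul_const q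
  have h2 : HasFDerivAt H (fderiv ℝ H q)
      ((fun ψ : ℝ => Complex.exp (Complex.I * ψ) • q) 0) := by
    simpa using hd.hasFDerivAt
  have h3 := h2.comp_hasDerivAt (0 : ℝ) h1
  have h4 : HasDerivAt (fun ψ : ℝ => Complex.exp (2 * Complex.I * p * ψ) * H q)
      (2 * Complex.I * p * H q) 0 := by
    simpa using (hasDerivAt_cexp_I_mul (2 * Complex.I * p) 0).mul_const (H q)
  refine h3.unique (h4.congr_of_eventuallyEq (Filter.Eventually.of_forall fun ψ => hw ψ q))

theorem hasDerivAt_spinor_left (θ ϕ : ℝ) :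
    HasDerivAt (fun t => spinor t ϕ) ((1 / 2 : ℝ) • perp (spinor θ ϕ)) θ := by
  have h2 : HasDerivAt (fun t : ℝ => t / 2) (1 / 2) θ := (hasDerivAt_id θ).div_const 2
  have hc := ((Real.hasDerivAt_cos (θ / 2)).comp θ h2).ofReal_comp
  have hs := ((Real.hasDerivAt_sin (θ / 2)).comp θ h2).ofReal_comp
  refine HasDerivAt.congr_deriv
    ((hc.mul_const (Complex.exp (Complex.I * (ϕ / 2)))).prodMk
    (hs.mul_const (Complex.exp (-(Complex.I * (ϕ / 2)))))) ?_
  simp only [spinor, perp, Prod.smul_mk, map_mul, Complex.conj_ofReal, ← Complex.exp_conj, map_neg,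
    Complex.conj_I, map_div₀, Complex.real_smul, map_ofNat]
  push_cast
  ext
  · simp only [neg_mul, neg_neg]
    ring
  · simp only [neg_mul]
    ring

theorem hasDerivAt_spinor_right (θ ϕ : ℝ) :
    HasDerivAt (fun t => spinor θ t)
      (Complex.I / 2 * (spinor θ ϕ).1, -(Complex.I / 2) * (spinor θ ϕ).2) ϕ := by
  have h1 := (hasDerivAt_cexp_I_mul (Complex.I / 2) ϕ).const_mul (Real.cos (θ / 2) : ℂ)
  have h2 := (hasDerivAt_cexp_I_mul (-(Complex.I / 2)) ϕ).const_mul (Real.sin (θ / 2) : ℂ)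
  have h := h1.prodMk h2
  have e : (fun t => spinor θ t) = fun t : ℝ =>
      ((Real.cos (θ / 2) : ℂ) * Complex.exp (Complex.I / 2 * t),
        (Real.sin (θ / 2) : ℂ) * Complex.exp (-(Complex.I / 2) * t)) := by
    funext t
    simp only [spinor]
    congr 3 <;> ring_nf
  have e' := congrFun e ϕ
  rw [e]
  refine h.congr_deriv ?_
  rw [e']
  ext <;> simp only <;> ring

/-- The direction `I • perp` is not tangent to the coordinate section of the frames: it is a
multiple of `∂_ϕ` plus `cot θ` times the phase rotation. On functions of spin weight `p` the
rotation produces the term `p cot θ` of `ð`. -/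
theorem I_smul_perp_spinor {θ : ℝ} (hθ : θ ∈ Set.Ioo (0 : ℝ) Real.pi) (ϕ : ℝ) :
    Complex.I • perp (spinor θ ϕ)
      = (-2 / Real.sin θ) •
          ((Complex.I / 2 * (spinor θ ϕ).1, -(Complex.I / 2) * (spinor θ ϕ).2) : ℂ × ℂ)
        + (Real.cos θ / Real.sin θ) • (Complex.I • spinor θ ϕ) := by
  have hs : Real.sin (θ / 2) ≠ 0 :=
    (Real.sin_pos_of_pos_of_lt_pi (by linarith [hθ.1]) (by linarith [hθ.2, hθ.1])).ne'
  have hc : Real.cos (θ / 2) ≠ 0 :=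
    (Real.cos_pos_of_mem_Ioo ⟨by linarith [hθ.1, Real.pi_pos], by linarith [hθ.2]⟩).ne'
  have e1 : Real.sin θ = 2 * Real.sin (θ / 2) * Real.cos (θ / 2) := by
    rw [← Real.sin_two_mul]; ring_nf
  have e2 : Real.cos θ = 2 * Real.cos (θ / 2) ^ 2 - 1 := by
    rw [← Real.cos_two_mul]; ring_nf
  have e3 := Real.sin_sq_add_cos_sq (θ / 2)
  have hs' : (Real.sin (θ / 2) : ℂ) ≠ 0 := by exact_mod_cast hs
  have hc' : (Real.cos (θ / 2) : ℂ) ≠ 0 := by exact_mod_cast hc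
  have e3' : (Real.sin (θ / 2) : ℂ) ^ 2 + (Real.cos (θ / 2) : ℂ) ^ 2 = 1 := by exact_mod_cast e3
  rw [e1, e2]
  simp only [spinor]
  generalize Real.sin (θ / 2) = x at *
  generalize Real.cos (θ / 2) = y at *
  simp only [perp, Prod.smul_mk, map_mul, Complex.conj_ofReal, ← Complex.exp_conj, map_neg,
    Complex.conj_I, map_div₀, map_ofNat, Complex.real_smul, smul_eq_mul, Prod.mk_add_mk]
  push_cast
  simp only [neg_mul, neg_neg]
  ext
  · simp only
    field_simp
    linear_combination (-2) * e3'
  · simp only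
    field_simp
    ring

section Chain

variable {p : ℤ} {H : ℂ × ℂ → ℂ} {g : ℝ → ℝ → ℂ} {θ ϕ : ℝ}

theorem deriv_left_of_spinor (hθ : θ ∈ Set.Ioo (0 : ℝ) Real.pi)
    (hd : DifferentiableAt ℝ H (spinor θ ϕ))
    (hg : ∀ θ ∈ Set.Ioo (0 : ℝ) Real.pi, ∀ ϕ, g θ ϕ = H (spinor θ ϕ)) :
    deriv (fun t => g t ϕ) θ = 1 / 2 * fderiv ℝ H (spinor θ ϕ) (perp (spinor θ ϕ)) := by
  have h := hd.hasFDerivAt.comp_hasDerivAt θ (hasDerivAt_spinor_left θ ϕ)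
  rw [map_smul, Complex.real_smul] at h
  have h' : HasDerivAt (fun t => g t ϕ) _ θ := h.congr_of_eventuallyEq (by
    filter_upwards [isOpen_Ioo.mem_nhds hθ] with t ht using hg t ht ϕ)
  rw [h'.deriv]
  push_cast
  ring

theorem deriv_right_of_spinor (hθ : θ ∈ Set.Ioo (0 : ℝ) Real.pi)
    (hd : DifferentiableAt ℝ H (spinor θ ϕ))
    (hg : ∀ θ ∈ Set.Ioo (0 : ℝ) Real.pi, ∀ ϕ, g θ ϕ = H (spinor θ ϕ))
    (hw : fderiv ℝ H (spinor θ ϕ) (Complex.I • spinor θ ϕ)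
      = 2 * Complex.I * p * H (spinor θ ϕ)) :
    fderiv ℝ H (spinor θ ϕ) (Complex.I • perp (spinor θ ϕ))
      = -2 / (Real.sin θ : ℂ) * deriv (fun t => g θ t) ϕ
        + ((Real.cos θ / Real.sin θ : ℝ) : ℂ) * (2 * Complex.I * p * g θ ϕ) := by
  have h := hd.hasFDerivAt.comp_hasDerivAt ϕ (hasDerivAt_spinor_right θ ϕ)
  have h' : HasDerivAt (fun t => g θ t) _ ϕ := h.congr_of_eventuallyEq
    (Filter.Eventually.of_forall fun t => hg θ hθ t)
  rw [h'.deriv, I_smul_perp_spinor hθ, map_add, map_smul, map_smul, hw, hg θ hθ]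
  simp only [Complex.real_smul]
  push_cast
  ring

theorem eth_eq_spinorEth (hθ : θ ∈ Set.Ioo (0 : ℝ) Real.pi)
    (hd : DifferentiableAt ℝ H (spinor θ ϕ))
    (hg : ∀ θ ∈ Set.Ioo (0 : ℝ) Real.pi, ∀ ϕ, g θ ϕ = H (spinor θ ϕ))
    (hw : fderiv ℝ H (spinor θ ϕ) (Complex.I • spinor θ ϕ)
      = 2 * Complex.I * p * H (spinor θ ϕ)) :
    eth p g θ ϕ = spinorEth H (spinor θ ϕ) := by
  rw [eth, spinorEth, deriv_right_of_spinor hθ hd hg hw, deriv_left_of_spinor hθ hd hg]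
  linear_combination ((√2 : ℝ) : ℂ)⁻¹ * ((Real.cos θ / Real.sin θ : ℝ) : ℂ) * p * g θ ϕ
    * (-Complex.I_sq)

theorem ethBar_eq_spinorEthBar (hθ : θ ∈ Set.Ioo (0 : ℝ) Real.pi)
    (hd : DifferentiableAt ℝ H (spinor θ ϕ))
    (hg : ∀ θ ∈ Set.Ioo (0 : ℝ) Real.pi, ∀ ϕ, g θ ϕ = H (spinor θ ϕ))
    (hw : fderiv ℝ H (spinor θ ϕ) (Complex.I • spinor θ ϕ)
      = 2 * Complex.I * p * H (spinor θ ϕ)) :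
    ethBar p g θ ϕ = spinorEthBar H (spinor θ ϕ) := by
  rw [ethBar, spinorEthBar, deriv_right_of_spinor hθ hd hg hw, deriv_left_of_spinor hθ hd hg]
  linear_combination ((√2 : ℝ) : ℂ)⁻¹ * ((Real.cos θ / Real.sin θ : ℝ) : ℂ) * p * g θ ϕ
    * (Complex.I_sq)

end Chain

/-! ### Closure properties of smooth spin-weighted functions -/

/-- The differentials are only real-linear, so a complex multiple of a direction has to be split
into the directions `v` and `I • v`. -/
theorem fderiv_complex_smul (L : ℂ × ℂ →L[ℝ] ℂ) (c : ℂ) (v : ℂ × ℂ) :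
    L (c • v) = c.re * L v + c.im * L (Complex.I • v) := by
  have : c • v = c.re • v + c.im • (Complex.I • v) := by
    conv_lhs => rw [← Complex.re_add_im c]
    rw [add_smul, mul_smul]
    simp
  rw [this, map_add, map_smul, map_smul, Complex.real_smul, Complex.real_smul]

theorem HasSpinWeight.fderiv_smul {p : ℤ} {H : ℂ × ℂ → ℂ} (hw : HasSpinWeight p H)
    (hd : Differentiable ℝ H) (ψ : ℝ) (q v : ℂ × ℂ) :
    fderiv ℝ H (Complex.exp (Complex.I * ψ) • q) (Complex.exp (Complex.I * ψ) • v)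
      = Complex.exp (2 * Complex.I * p * ψ) * fderiv ℝ H q v := by
  set e := Complex.exp (Complex.I * ψ)
  have hR : HasFDerivAt (fun q : ℂ × ℂ => e • q)
      (e • ContinuousLinearMap.id ℝ (ℂ × ℂ)) q := (hasFDerivAt_id q).const_smul e
  have h1 := (hd (e • q)).hasFDerivAt.comp q hR
  have h2 := (hd q).hasFDerivAt.const_mul (Complex.exp (2 * Complex.I * p * ψ))
  have h3 := h1.unique (h2.congr_of_eventuallyEq (Filter.Eventually.of_forall fun q => hw ψ q))
  simpa using congrArg (fun L => L v) h3

theorem perp_smul (e : ℂ) (q : ℂ × ℂ) : perp (e • q) = (starRingEnd ℂ) e • perp q := by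
  simp [perp]

theorem HasSpinWeight.fderiv_perp {p : ℤ} {H : ℂ × ℂ → ℂ} (hw : HasSpinWeight p H)
    (hd : Differentiable ℝ H) (ψ : ℝ) (q : ℂ × ℂ) (c : ℂ) :
    fderiv ℝ H (Complex.exp (Complex.I * ψ) • q)
        (c • perp (Complex.exp (Complex.I * ψ) • q))
      = Complex.exp (2 * Complex.I * p * ψ)
        * fderiv ℝ H q ((c * Complex.exp (-(2 * Complex.I * ψ))) • perp q) := by
  rw [← hw.fderiv_smul hd, perp_smul, smul_smul, smul_smul]
  congr 2
  rw [← Complex.exp_conj, map_mul, Complex.conj_I, Complex.conj_ofReal, mul_left_comm,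
    ← Complex.exp_add]
  congr 2
  ring

theorem exp_neg_two_I (ψ : ℝ) : (Complex.exp (-(2 * Complex.I * ψ))).re = Real.cos (2 * ψ) ∧
    (Complex.exp (-(2 * Complex.I * ψ))).im = -Real.sin (2 * ψ) := by
  have : -(2 * Complex.I * ψ) = ((-(2 * ψ) : ℝ) : ℂ) * Complex.I := by push_cast; ring
  rw [this, Complex.exp_ofReal_mul_I_re, Complex.exp_ofReal_mul_I_im, Real.cos_neg, Real.sin_neg]
  exact ⟨rfl, rfl⟩

theorem exp_two_I (ψ : ℝ) : Complex.exp (2 * Complex.I * ψ)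
    = Real.cos (2 * ψ) + Complex.I * Real.sin (2 * ψ) := by
  have : 2 * Complex.I * ψ = ((2 * ψ : ℝ) : ℂ) * Complex.I := by push_cast; ring
  rw [this, Complex.exp_mul_I, ← Complex.ofReal_cos, ← Complex.ofReal_sin]
  ring

theorem exp_neg_two_I' (ψ : ℝ) : Complex.exp (-(2 * Complex.I * ψ))
    = Real.cos (2 * ψ) - Complex.I * Real.sin (2 * ψ) := by
  have : -(2 * Complex.I * ψ) = ((-(2 * ψ) : ℝ) : ℂ) * Complex.I := by push_cast; ring
  rw [this, Complex.exp_mul_I, ← Complex.ofReal_cos, ← Complex.ofReal_sin, Real.cos_neg,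
    Real.sin_neg]
  push_cast
  ring

/-- A phase rotation by `ψ` multiplies `perp` by `exp (-2iψ)` relative to the rotated frame. The
functional `v ↦ L v + i L (i v)` is conjugate-linear, so it turns this into the extra factor `exp
(2iψ)` of one more unit of spin weight; the opposite sign, used for `ð̄`, gives a complex-linear
functional and one unit less. -/
theorem HasSpinWeight.spinorEth {p : ℤ} {H : ℂ × ℂ → ℂ} (hw : HasSpinWeight p H)
    (hd : Differentiable ℝ H) : HasSpinWeight (p + 1) (spinorEth H) := by
  intro ψ q
  have h1 := hw.fderiv_perp hd ψ q 1
  have h2 := hw.fderiv_perp hd ψ q Complex.I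
  rw [one_smul, one_mul, fderiv_complex_smul, (exp_neg_two_I ψ).1, (exp_neg_two_I ψ).2] at h1
  rw [mul_smul, smul_comm, fderiv_complex_smul _ (Complex.exp _), (exp_neg_two_I ψ).1, (exp_neg_two_I ψ).2,
    smul_smul, Complex.I_mul_I, neg_one_smul, map_neg] at h2
  have h3 : Complex.exp (2 * Complex.I * ((p + 1 : ℤ) : ℂ) * ψ)
      = Complex.exp (2 * Complex.I * p * ψ) * Complex.exp (2 * Complex.I * ψ) := by
    rw [← Complex.exp_add]
    push_cast
    ring_nf
  rw [ZRM.spinorEth, h1, h2, h3, exp_two_I, ZRM.spinorEth]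
  push_cast
  linear_combination ((√2 : ℝ) : ℂ)⁻¹ * (1 / 2) * Complex.exp (2 * Complex.I * p * ψ) *
    Complex.sin (2 * ψ) * fderiv ℝ H q (Complex.I • perp q) * (-Complex.I_sq)

theorem HasSpinWeight.spinorEthBar {p : ℤ} {H : ℂ × ℂ → ℂ} (hw : HasSpinWeight p H)
    (hd : Differentiable ℝ H) : HasSpinWeight (p - 1) (spinorEthBar H) := by
  intro ψ q
  have h1 := hw.fderiv_perp hd ψ q 1
  have h2 := hw.fderiv_perp hd ψ q Complex.I
  rw [one_smul, one_mul, fderiv_complex_smul, (exp_neg_two_I ψ).1, (exp_neg_two_I ψ).2] at h1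
  rw [mul_smul, smul_comm, fderiv_complex_smul _ (Complex.exp _), (exp_neg_two_I ψ).1, (exp_neg_two_I ψ).2,
    smul_smul, Complex.I_mul_I, neg_one_smul, map_neg] at h2
  have h3 : Complex.exp (2 * Complex.I * ((p - 1 : ℤ) : ℂ) * ψ)
      = Complex.exp (2 * Complex.I * p * ψ) * Complex.exp (-(2 * Complex.I * ψ)) := by
    rw [← Complex.exp_add]
    push_cast
    ring_nf
  rw [ZRM.spinorEthBar, h1, h2, h3, exp_neg_two_I', ZRM.spinorEthBar]
  push_cast
  linear_combination ((√2 : ℝ) : ℂ)⁻¹ * (1 / 2) * Complex.exp (2 * Complex.I * p * ψ) *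
    Complex.sin (2 * ψ) * fderiv ℝ H q (Complex.I • perp q) * (-Complex.I_sq)

end ZRM

/-! ### Smooth functions of spin weight `p` -/

namespace ZRM

/-- Smooth functions of spin weight `p` on the sphere. -/
def SmoothWeighted (p : ℤ) (g : ℝ → ℝ → ℂ) : Prop :=
  ∃ H : ℂ × ℂ → ℂ, ContDiff ℝ ∞ H ∧ HasSpinWeight p H ∧
    ∀ θ ∈ Set.Ioo (0 : ℝ) Real.pi, ∀ ϕ, g θ ϕ = H (spinor θ ϕ)

theorem isSmoothSpinWeighted_iff {p : ℤ} {f : ScriFun} :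
    IsSmoothSpinWeighted p f ↔ ∃ F : ℝ × ℂ × ℂ → ℂ, ContDiff ℝ ∞ F ∧
      (∀ u, HasSpinWeight p (fun q => F (u, q))) ∧
      ∀ u, ∀ θ ∈ Set.Ioo (0 : ℝ) Real.pi, ∀ ϕ, f u θ ϕ = F (u, spinor θ ϕ) := by
  constructor
  · rintro ⟨F, h1, h2, h3⟩
    exact ⟨F, h1, fun u ψ q => h2 u ψ q.1 q.2, fun u θ hθ ϕ => h3 u ϕ θ hθ⟩
  · rintro ⟨F, h1, h2, h3⟩
    exact ⟨F, h1, fun u ψ z w => h2 u ψ (z, w), fun u ϕ θ hθ => h3 u θ hθ ϕ⟩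

theorem IsSmoothSpinWeighted.smoothWeighted {p : ℤ} {f : ScriFun}
    (hf : IsSmoothSpinWeighted p f) (u : ℝ) : SmoothWeighted p (f u) := by
  obtain ⟨F, h1, h2, h3⟩ := isSmoothSpinWeighted_iff.1 hf
  exact ⟨fun q => F (u, q), h1.comp (contDiff_const.prodMk contDiff_id), h2 u, h3 u⟩

theorem SmoothWeighted.isSmooth {p : ℤ} {g : ℝ → ℝ → ℂ} (hg : SmoothWeighted p g) :
    IsSmoothSpinWeighted p (fun _ => g) := by
  obtain ⟨H, h1, h2, h3⟩ := hg
  exact isSmoothSpinWeighted_iff.2 ⟨fun x => H x.2, h1.comp contDiff_snd, fun _ => h2, fun _ => h3⟩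

namespace IsSmoothSpinWeighted

variable {p : ℤ} {f g : ScriFun}

theorem congr (hf : IsSmoothSpinWeighted p f) (h : SphEq g f) : IsSmoothSpinWeighted p g := by
  obtain ⟨F, h1, h2, h3⟩ := hf
  exact ⟨F, h1, h2, fun u ϕ θ hθ => (h u ϕ θ hθ).trans (h3 u ϕ θ hθ)⟩

theorem zero : IsSmoothSpinWeighted p 0 :=
  ⟨fun _ => 0, contDiff_const, by simp, by simp⟩

theorem add (hf : IsSmoothSpinWeighted p f) (hg : IsSmoothSpinWeighted p g) :
    IsSmoothSpinWeighted p (f + g) := by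
  obtain ⟨F, h1, h2, h3⟩ := isSmoothSpinWeighted_iff.1 hf
  obtain ⟨G, k1, k2, k3⟩ := isSmoothSpinWeighted_iff.1 hg
  refine isSmoothSpinWeighted_iff.2 ⟨fun x => F x + G x, h1.add k1, fun u ψ q => ?_,
    fun u θ hθ ϕ => ?_⟩
  · have := h2 u ψ q
    have := k2 u ψ q
    simp only at *
    simp only [*]
    ring
  · simp [h3 u θ hθ ϕ, k3 u θ hθ ϕ]

theorem time_mul (hf : IsSmoothSpinWeighted p f) {c : ℝ → ℂ} (hc : ContDiff ℝ ∞ c) :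
    IsSmoothSpinWeighted p (fun u θ ϕ => c u * f u θ ϕ) := by
  obtain ⟨F, h1, h2, h3⟩ := isSmoothSpinWeighted_iff.1 hf
  refine isSmoothSpinWeighted_iff.2 ⟨fun x => c x.1 * F x, (hc.comp contDiff_fst).mul h1,
    fun u ψ q => ?_, fun u θ hθ ϕ => ?_⟩
  · have := h2 u ψ q
    simp only at *
    simp only [*]
    ring
  · simp [h3 u θ hθ ϕ]

theorem const_smul (hf : IsSmoothSpinWeighted p f) (c : ℂ) : IsSmoothSpinWeighted p (c • f) :=
  hf.time_mul (c := fun _ => c) contDiff_const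

theorem sub (hf : IsSmoothSpinWeighted p f) (hg : IsSmoothSpinWeighted p g) :
    IsSmoothSpinWeighted p (f - g) := by
  have := hf.add (hg.const_smul (-1))
  simpa [sub_eq_add_neg] using this

theorem sum {ι : Type*} (t : Finset ι) {f : ι → ScriFun}
    (hf : ∀ i ∈ t, IsSmoothSpinWeighted p (f i)) : IsSmoothSpinWeighted p (∑ i ∈ t, f i) := by
  classical
  induction t using Finset.induction_on with
  | empty => simpa using zero
  | insert i t hi ih =>
    rw [Finset.sum_insert hi]
    exact (hf i (by simp)).add (ih fun j hj => hf j (by simp [hj]))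

end IsSmoothSpinWeighted

theorem fderiv_slice {F : ℝ × ℂ × ℂ → ℂ} (hF : Differentiable ℝ F) (u : ℝ) (q v : ℂ × ℂ) :
    fderiv ℝ (fun q => F (u, q)) q v = fderiv ℝ F (u, q) (0, v) := by
  have h := (hF (u, q)).hasFDerivAt.comp q ((hasFDerivAt_const u q).prodMk (hasFDerivAt_id q))
  have h' : fderiv ℝ (fun q => F (u, q)) q = _ := h.fderiv
  rw [h']
  simp

theorem contDiff_perp : ContDiff ℝ ∞ perp :=
  (contDiff_conj.comp contDiff_snd).neg.prodMk (contDiff_conj.comp contDiff_fst)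

theorem contDiff_fderiv_slice {F : ℝ × ℂ × ℂ → ℂ} (hF : ContDiff ℝ ∞ F) {v : ℂ × ℂ → ℂ × ℂ}
    (hv : ContDiff ℝ ∞ v) :
    ContDiff ℝ ∞ (fun x : ℝ × ℂ × ℂ => fderiv ℝ (fun q => F (x.1, q)) x.2 (v x.2)) := by
  have e : (fun x : ℝ × ℂ × ℂ => fderiv ℝ (fun q => F (x.1, q)) x.2 (v x.2))
      = fun x : ℝ × ℂ × ℂ => fderiv ℝ F x (0, v x.2) := by
    funext x
    exact fderiv_slice (hF.differentiable (by simp)) x.1 x.2 (v x.2)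
  rw [e]
  exact (hF.fderiv_right (m := ∞) le_rfl).clm_apply
    (contDiff_const.prodMk (hv.comp contDiff_snd))

namespace IsSmoothSpinWeighted

variable {p : ℤ} {f g : ScriFun}

theorem eth (hf : IsSmoothSpinWeighted p f) :
    IsSmoothSpinWeighted (p + 1) (fun u => ZRM.eth p (f u)) := by
  obtain ⟨F, h1, h2, h3⟩ := isSmoothSpinWeighted_iff.1 hf
  have hd : ∀ u, Differentiable ℝ (fun q => F (u, q)) := fun u =>
    (h1.comp (contDiff_const.prodMk contDiff_id)).differentiable (by simp)
  refine isSmoothSpinWeighted_iff.2 ⟨fun x => spinorEth (fun q => F (x.1, q)) x.2, ?_,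
    fun u => (h2 u).spinorEth (hd u), fun u θ hθ ϕ => ?_⟩
  · exact contDiff_const.mul ((contDiff_fderiv_slice h1 contDiff_perp).add
      (contDiff_const.mul (contDiff_fderiv_slice h1
        (v := fun q => Complex.I • perp q) (contDiff_perp.const_smul _))))
  · exact eth_eq_spinorEth hθ (hd u _) (h3 u) ((h2 u).fderiv_I_smul (hd u _))

theorem ethBar (hf : IsSmoothSpinWeighted p f) :
    IsSmoothSpinWeighted (p - 1) (fun u => ZRM.ethBar p (f u)) := by
  obtain ⟨F, h1, h2, h3⟩ := isSmoothSpinWeighted_iff.1 hf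
  have hd : ∀ u, Differentiable ℝ (fun q => F (u, q)) := fun u =>
    (h1.comp (contDiff_const.prodMk contDiff_id)).differentiable (by simp)
  refine isSmoothSpinWeighted_iff.2 ⟨fun x => spinorEthBar (fun q => F (x.1, q)) x.2, ?_,
    fun u => (h2 u).spinorEthBar (hd u), fun u θ hθ ϕ => ?_⟩
  · exact contDiff_const.mul ((contDiff_fderiv_slice h1 contDiff_perp).sub
      (contDiff_const.mul (contDiff_fderiv_slice h1
        (v := fun q => Complex.I • perp q) (contDiff_perp.const_smul _))))
  · exact ethBar_eq_spinorEthBar hθ (hd u _) (h3 u) ((h2 u).fderiv_I_smul (hd u _))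

theorem hasDerivAt_time {F : ℝ × ℂ × ℂ → ℂ} (hF : Differentiable ℝ F) (u : ℝ) (q : ℂ × ℂ) :
    HasDerivAt (fun t => F (t, q)) (fderiv ℝ F (u, q) (1, 0)) u := by
  have h := (hasDerivAt_id u).prodMk (hasDerivAt_const u q)
  exact HasFDerivAt.comp_hasDerivAt (f := fun t : ℝ => (t, q)) u (hF (u, q)).hasFDerivAt h

theorem du (hf : IsSmoothSpinWeighted p f) :
    IsSmoothSpinWeighted p (fun u θ ϕ => deriv (fun t => f t θ ϕ) u) := by
  obtain ⟨F, h1, h2, h3⟩ := isSmoothSpinWeighted_iff.1 hf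
  have hd : Differentiable ℝ F := h1.differentiable (by simp)
  refine isSmoothSpinWeighted_iff.2 ⟨fun x => fderiv ℝ F x (1, 0), ?_, fun u ψ q => ?_,
    fun u θ hθ ϕ => ?_⟩
  · exact (h1.fderiv_right (m := ∞) le_rfl).clm_apply contDiff_const
  · refine (hasDerivAt_time hd u _).unique ?_
    refine ((hasDerivAt_time hd u q).const_mul _).congr_of_eventuallyEq
      (Filter.Eventually.of_forall fun t => h2 t ψ q)
  · have : (fun t => f t θ ϕ) = fun t => F (t, spinor θ ϕ) := funext fun t => h3 t θ hθ ϕ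
    rw [this, (hasDerivAt_time hd u _).deriv]

end IsSmoothSpinWeighted

namespace SmoothWeighted

variable {p r : ℤ} {f g : ℝ → ℝ → ℂ}

theorem eth (hf : SmoothWeighted p f) : SmoothWeighted (p + 1) (ZRM.eth p f) :=
  hf.isSmooth.eth.smoothWeighted 0

theorem ethBar (hf : SmoothWeighted p f) : SmoothWeighted (p - 1) (ZRM.ethBar p f) :=
  hf.isSmooth.ethBar.smoothWeighted 0

theorem add (hf : SmoothWeighted p f) (hg : SmoothWeighted p g) : SmoothWeighted p (f + g) :=
  (hf.isSmooth.add hg.isSmooth).smoothWeighted 0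

theorem sub (hf : SmoothWeighted p f) (hg : SmoothWeighted p g) : SmoothWeighted p (f - g) :=
  (hf.isSmooth.sub hg.isSmooth).smoothWeighted 0

theorem const_smul (hf : SmoothWeighted p f) (c : ℂ) : SmoothWeighted p (c • f) :=
  (hf.isSmooth.const_smul c).smoothWeighted 0

theorem mul (hf : SmoothWeighted p f) (hg : SmoothWeighted r g) :
    SmoothWeighted (p + r) (fun θ ϕ => f θ ϕ * g θ ϕ) := by
  obtain ⟨F, h1, h2, h3⟩ := hf
  obtain ⟨G, k1, k2, k3⟩ := hg
  refine ⟨fun q => F q * G q, h1.mul k1, fun ψ q => ?_, fun θ hθ ϕ => ?_⟩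
  · simp only [h2 ψ q, k2 ψ q]
    rw [show 2 * Complex.I * ((p + r : ℤ) : ℂ) * ψ
      = 2 * Complex.I * p * ψ + 2 * Complex.I * r * ψ by push_cast; ring, Complex.exp_add]
    ring
  · simp only [h3 θ hθ ϕ, k3 θ hθ ϕ]

theorem conj (hf : SmoothWeighted p f) :
    SmoothWeighted (-p) (fun θ ϕ => (starRingEnd ℂ) (f θ ϕ)) := by
  obtain ⟨F, h1, h2, h3⟩ := hf
  refine ⟨fun q => (starRingEnd ℂ) (F q), contDiff_conj.comp h1, fun ψ q => ?_, fun θ hθ ϕ => ?_⟩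
  · simp only [h2 ψ q, map_mul, ← Complex.exp_conj, Complex.conj_ofReal, Complex.conj_I, map_ofNat,
      map_intCast]
    congr 2
    push_cast
    ring
  · simp only [h3 θ hθ ϕ]

end SmoothWeighted

/-- Locality of `ð`. -/
theorem eth_congr {p : ℤ} {f g : ℝ → ℝ → ℂ}
    (h : ∀ θ ∈ Set.Ioo (0 : ℝ) Real.pi, ∀ ϕ, g θ ϕ = f θ ϕ) {θ : ℝ}
    (hθ : θ ∈ Set.Ioo (0 : ℝ) Real.pi) (ϕ : ℝ) : eth p g θ ϕ = eth p f θ ϕ := by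
  have h1 : deriv (fun t => g t ϕ) θ = deriv (fun t => f t ϕ) θ := by
    refine Filter.EventuallyEq.deriv_eq ?_
    filter_upwards [isOpen_Ioo.mem_nhds hθ] with t ht using h t ht ϕ
  have h2 : (fun t => g θ t) = fun t => f θ t := funext fun t => h θ hθ t
  rw [eth, eth, h1, h2, h θ hθ]

/-- Locality of `ð̄`. -/
theorem ethBar_congr {p : ℤ} {f g : ℝ → ℝ → ℂ}
    (h : ∀ θ ∈ Set.Ioo (0 : ℝ) Real.pi, ∀ ϕ, g θ ϕ = f θ ϕ) {θ : ℝ}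
    (hθ : θ ∈ Set.Ioo (0 : ℝ) Real.pi) (ϕ : ℝ) : ethBar p g θ ϕ = ethBar p f θ ϕ := by
  have h1 : deriv (fun t => g t ϕ) θ = deriv (fun t => f t ϕ) θ := by
    refine Filter.EventuallyEq.deriv_eq ?_
    filter_upwards [isOpen_Ioo.mem_nhds hθ] with t ht using h t ht ϕ
  have h2 : (fun t => g θ t) = fun t => f θ t := funext fun t => h θ hθ t
  rw [ethBar, ethBar, h1, h2, h θ hθ]

theorem eth_const_mul (p : ℤ) (c : ℂ) (g : ℝ → ℝ → ℂ) (θ ϕ : ℝ) :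
    eth p (fun θ ϕ => c * g θ ϕ) θ ϕ = c * eth p g θ ϕ := by
  simp only [eth, deriv_const_mul_field]
  ring

theorem ethBar_const_mul (p : ℤ) (c : ℂ) (g : ℝ → ℝ → ℂ) (θ ϕ : ℝ) :
    ethBar p (fun θ ϕ => c * g θ ϕ) θ ϕ = c * ethBar p g θ ϕ := by
  simp only [ethBar, deriv_const_mul_field]
  ring

end ZRM

/-! ### Harmonics as functions of spinors -/

namespace ZRM

/-- The eigenvalue `((l - p) (l + p + 1) / 2) ^ (1/2)` of the raising operator on harmonics of
spin weight `p`. -/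
def ladder (p : ℤ) (l : ℕ) : ℝ := √(((l : ℝ) - p) * (l + p + 1) / 2)

/-- The factor between `_pY_{lm}` and the coefficient of `t ^ (l + m)` of
`(z t - w) ^ (l + p) (w̄ t + z̄) ^ (l - p)` that does not depend on `p`. -/
def harmonicConst (l : ℕ) (m : ℤ) : ℝ :=
  (-1 : ℝ) ^ m * √((2 * l + 1) / (4 * Real.pi) *
    ((((l : ℤ) - m).toNat.factorial : ℝ) * (((l : ℤ) + m).toNat.factorial : ℝ)))
    / (l.factorial : ℝ)

/-- The factor between `_pY_{lm}` and the coefficient of `t ^ (l + m)` of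
`(z t - w) ^ (l + p) (w̄ t + z̄) ^ (l - p)` that does not depend on `m`. -/
def weightConst (p : ℤ) (l : ℕ) : ℝ :=
  (-1 : ℝ) ^ p * (l.factorial : ℝ)
    / √((((l : ℤ) - p).toNat.factorial : ℝ) * (((l : ℤ) + p).toNat.factorial : ℝ))

/-- The spin-weighted spherical harmonics as functions of spinors. -/
def spinorY (p : ℤ) (l : ℕ) (m : ℤ) (q : ℂ × ℂ) : ℂ :=
  if |p| ≤ (l : ℤ) ∧ |m| ≤ (l : ℤ) then
    ((harmonicConst l m * weightConst p l : ℝ) : ℂ)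
      * spinCoeff ((l : ℤ) + p).toNat ((l : ℤ) - p).toNat ((l : ℤ) + m).toNat q
  else 0

/-- The azimuth enters as opposite half-angle phases of the two components. For `a + b = 2 l` and `c
= l + m` the prefactor is `exp (i m ϕ)`. -/
theorem spinCoeff_spinor (a b c : ℕ) (θ ϕ : ℝ) :
    spinCoeff a b c (spinor θ ϕ)
      = Complex.exp (Complex.I * ((c : ℂ) - ((a : ℂ) + b) / 2) * ϕ)
        * spinCoeff a b c ((Real.cos (θ / 2) : ℂ), (Real.sin (θ / 2) : ℂ)) := by
  have h : spinor θ ϕ = (Complex.exp (Complex.I * (ϕ / 2)) * (Real.cos (θ / 2) : ℂ),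
      Complex.exp (-(Complex.I * (ϕ / 2))) * (Real.sin (θ / 2) : ℂ)) := by
    simp only [spinor, mul_comm]
  have e1 : (starRingEnd ℂ) (Complex.exp (Complex.I * (ϕ / 2)))
      = Complex.exp (-(Complex.I * (ϕ / 2))) := by
    rw [← Complex.exp_conj]
    congr 1
    simp [map_ofNat]
  have e2 : (starRingEnd ℂ) (Complex.exp (-(Complex.I * (ϕ / 2))))
      = Complex.exp (Complex.I * (ϕ / 2)) := by
    rw [← e1, Complex.conj_conj]
  rw [h, spinCoeff_phase _ _ _ _ _ _ _ (by rw [e1, ← Complex.exp_add]; simp)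
    (by rw [e2, ← Complex.exp_add]; simp), e1, e2, ← Complex.exp_nat_mul, ← Complex.exp_nat_mul,
    ← Complex.exp_add, ← Complex.exp_add, ← Complex.exp_nat_mul, ← Complex.exp_add]
  congr 2
  ring

-- Rodrigues' formula as a Taylor expansion. At a real unit spinor `2 sin θ (z t - w) (w̄ t + z̄) =
-- (cos θ + t sin θ) ^ 2 - 1`, so the `l`-th power is `(X ^ 2 - 1) ^ l` expanded around `cos θ`,
-- with the variable scaled by `sin θ`.
open Polynomial in
theorem spinCoeff_diag (l c : ℕ) {θ : ℝ} (hθ : θ ∈ Set.Ioo (0 : ℝ) Real.pi) :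
    spinCoeff l l c ((Real.cos (θ / 2) : ℂ), (Real.sin (θ / 2) : ℂ))
      = ((Real.sin θ ^ ((c : ℤ) - l) / (2 ^ l * (c.factorial : ℝ))
        * (derivative^[c] ((X ^ 2 - 1 : ℝ[X]) ^ l)).eval (Real.cos θ) : ℝ) : ℂ) := by
  have hs : Real.sin θ ≠ 0 := (Real.sin_pos_of_mem_Ioo hθ).ne'
  have e1 : Real.sin θ = 2 * Real.sin (θ / 2) * Real.cos (θ / 2) := by
    rw [← Real.sin_two_mul]; ring_nf
  have e2 : Real.cos θ = 2 * Real.cos (θ / 2) ^ 2 - 1 := by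
    rw [← Real.cos_two_mul]; ring_nf
  have e3 := Real.sin_sq_add_cos_sq (θ / 2)
  have key : C ((2 * Real.sin θ : ℝ) : ℂ) ^ l * spinPoly l l
      ((Real.cos (θ / 2) : ℂ), (Real.sin (θ / 2) : ℂ))
      = (((taylor (Real.cos θ) ((X ^ 2 - 1 : ℝ[X]) ^ l)).comp (C (Real.sin θ) * X)).map
        Complex.ofRealHom) := by
    simp only [taylor_apply, pow_comp, sub_comp, X_comp, one_comp, add_comp, C_comp,
      Polynomial.map_pow, Polynomial.map_sub, Polynomial.map_add, Polynomial.map_mul, map_C,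
      map_X, Polynomial.map_one, spinPoly, Complex.conj_ofReal, ← mul_pow, Complex.ofRealHom_eq_coe]
    congr 1
    rw [e1, e2]
    generalize Real.sin (θ / 2) = x at *
    generalize Real.cos (θ / 2) = y at *
    have e3' : C (x : ℂ) ^ 2 + C (y : ℂ) ^ 2 = 1 := by
      rw [← C_pow, ← C_pow, ← C_add, ← C_1]
      exact_mod_cast congrArg (fun r : ℝ => C (r : ℂ)) e3
    push_cast
    simp only [map_mul, map_sub, map_pow, map_one, map_ofNat]
    linear_combination -(4 * C (x : ℂ) * C (y : ℂ) * X + 4 * C (y : ℂ) ^ 2) * e3'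
  have h := congrArg (fun P => P.coeff c) key
  simp only [← C_pow, coeff_C_mul, coeff_map, comp_C_mul_X_coeff] at h
  have h5 : (c.factorial : ℝ) * (taylor (Real.cos θ) ((X ^ 2 - 1 : ℝ[X]) ^ l)).coeff c
      = (derivative^[c] ((X ^ 2 - 1 : ℝ[X]) ^ l)).eval (Real.cos θ) := by
    rw [taylor_coeff, ← factorial_smul_hasseDeriv]
    simp
  rw [← h5, spinCoeff]
  have hf : (c.factorial : ℝ) ≠ 0 := by positivity
  have h2 : ((2 * Real.sin θ : ℝ) : ℂ) ^ l ≠ 0 := pow_ne_zero _ (by exact_mod_cast mul_ne_zero two_ne_zero hs)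
  rw [← mul_right_inj' h2, h, Complex.ofRealHom_eq_coe, ← Complex.ofReal_pow, ← Complex.ofReal_mul]
  congr 1
  rw [zpow_sub₀ hs, zpow_natCast, zpow_natCast, mul_pow]
  field_simp

theorem sphY_eq {l : ℕ} {m : ℤ} (hm : |m| ≤ (l : ℤ)) {θ : ℝ} (hθ : θ ∈ Set.Ioo (0 : ℝ) Real.pi)
    (ϕ : ℝ) : sphY l m θ ϕ = spinorY 0 l m (spinor θ ϕ) := by
  obtain ⟨h1, h2⟩ := abs_le.1 hm
  obtain ⟨c, hc⟩ : ∃ c : ℕ, (l : ℤ) + m = c := ⟨_, (Int.toNat_of_nonneg (by omega)).symm⟩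
  obtain ⟨d, hd⟩ : ∃ d : ℕ, (l : ℤ) - m = d := ⟨_, (Int.toNat_of_nonneg (by omega)).symm⟩
  have hmc : m = (c : ℤ) - l := by omega
  rw [spinorY, if_pos ⟨by simp, hm⟩, spinCoeff_spinor, sphY, legendreP, hc]
  simp only [add_zero, sub_zero, Int.toNat_natCast]
  rw [spinCoeff_diag l c hθ, harmonicConst, weightConst, hc, hd]
  simp only [sub_zero, add_zero, Int.toNat_natCast, zpow_zero]
  rw [Real.sqrt_mul_self (by positivity)]
  have e : Complex.exp (Complex.I * ((c : ℂ) - ((l : ℂ) + l) / 2) * ϕ)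
      = Complex.exp (Complex.I * m * ϕ) := by
    rw [hmc]; push_cast; ring_nf
  rw [e]
  have hr : √((2 * (l : ℝ) + 1) / (4 * Real.pi) * ((d.factorial : ℝ) / (c.factorial : ℝ)))
      = √((2 * (l : ℝ) + 1) / (4 * Real.pi) * ((d.factorial : ℝ) * (c.factorial : ℝ)))
        / (c.factorial : ℝ) := by
    rw [eq_div_iff (by positivity), ← Real.sqrt_sq (show (0 : ℝ) ≤ c.factorial by positivity),
      ← Real.sqrt_mul (by positivity), Real.sqrt_sq (by positivity)]
    congr 1
    field_simp
  rw [hr, ← hmc]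
  push_cast
  have hf : (c.factorial : ℂ) ≠ 0 := by exact_mod_cast c.factorial_ne_zero
  have hl : (l.factorial : ℂ) ≠ 0 := by exact_mod_cast l.factorial_ne_zero
  field_simp

theorem ladder_pred (p : ℤ) (l : ℕ) : ladder (-p - 1) l = ladder p l := by
  rw [ladder, ladder]
  congr 1
  push_cast
  ring

theorem ladder_sq {p : ℤ} {l : ℕ} (hp : |p| ≤ (l : ℤ)) :
    ladder p l ^ 2 = ((l : ℝ) - p) * (l + p + 1) / 2 := by
  obtain ⟨h1, h2⟩ := abs_le.1 hp
  have h1' : -(l : ℝ) ≤ p := by exact_mod_cast h1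
  have h2' : (p : ℝ) ≤ l := by exact_mod_cast h2
  rw [ladder, Real.sq_sqrt]
  have : (0 : ℝ) ≤ l - p := by linarith
  have : (0 : ℝ) ≤ l + p + 1 := by linarith
  positivity

theorem ladder_self (l : ℕ) : ladder l l = 0 := by simp [ladder]

theorem ladder_pos {p : ℤ} {l : ℕ} (h1 : -(l : ℤ) ≤ p) (h2 : p < l) : 0 < ladder p l := by
  have h1' : -(l : ℝ) ≤ p := by exact_mod_cast h1
  have h2' : (p : ℝ) < l := by exact_mod_cast h2
  refine Real.sqrt_pos.2 ?_
  have : (0 : ℝ) < l - p := by linarith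
  have : (0 : ℝ) < l + p + 1 := by linarith
  positivity

theorem exists_nat_add_sub {p : ℤ} {l : ℕ} (hp : |p| ≤ (l : ℤ)) :
    ∃ a b : ℕ, (l : ℤ) + p = a ∧ (l : ℤ) - p = b := by
  obtain ⟨h1, h2⟩ := abs_le.1 hp
  exact ⟨((l : ℤ) + p).toNat, ((l : ℤ) - p).toNat, (Int.toNat_of_nonneg (by omega)).symm,
    (Int.toNat_of_nonneg (by omega)).symm⟩

theorem sqrt_two_mul_ladder (p : ℤ) (l : ℕ) :
    √2 * ladder p l = √(((l : ℝ) - p) * (l + p + 1)) := by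
  rw [ladder, ← Real.sqrt_mul (by norm_num)]
  congr 1
  ring

theorem weightConst_succ {p : ℤ} {l : ℕ} (h1 : -(l : ℤ) ≤ p) (h2 : p < l) :
    weightConst p l * (l - p) = -(√2 * ladder p l * weightConst (p + 1) l) := by
  obtain ⟨a, b, ha, hb⟩ := exists_nat_add_sub (abs_le.2 ⟨h1, h2.le⟩)
  obtain ⟨b, rfl⟩ : ∃ b' : ℕ, b = b' + 1 := ⟨b - 1, by omega⟩
  have e1 : (l : ℤ) + (p + 1) = ((a + 1 : ℕ) : ℤ) := by push_cast; omega
  have e2 : (l : ℤ) - (p + 1) = (b : ℤ) := by push_cast at hb; omega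
  rw [sqrt_two_mul_ladder, weightConst, weightConst, e1, e2, ha, hb]
  have ha' : (l : ℝ) + p = a := by exact_mod_cast ha
  have hb' : (l : ℝ) - p = ((b + 1 : ℕ) : ℝ) := by exact_mod_cast hb
  rw [ha', hb', zpow_add_one₀ (by norm_num)]
  simp only [Int.toNat_natCast]
  have hbp : (0 : ℝ) < ((b + 1 : ℕ) : ℝ) := by positivity
  have e3 : √(((b + 1 : ℕ) : ℝ) * ((a : ℝ) + 1)) * √(((b + 1).factorial : ℝ) * (a.factorial : ℝ))
      = ((b + 1 : ℕ) : ℝ) * √((b.factorial : ℝ) * ((a + 1).factorial : ℝ)) := by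
    rw [← Real.sqrt_mul (by positivity), ← Real.sqrt_sq hbp.le, ← Real.sqrt_mul (by positivity),
      Real.sqrt_sq hbp.le]
    congr 1
    rw [Nat.factorial_succ, Nat.factorial_succ]
    push_cast
    ring
  have hx : √(((b + 1).factorial : ℝ) * (a.factorial : ℝ)) ≠ 0 := by positivity
  have hy : √((b.factorial : ℝ) * ((a + 1).factorial : ℝ)) ≠ 0 := by positivity
  field_simp
  linear_combination -e3

theorem weightConst_pred {p : ℤ} {l : ℕ} (h1 : -(l : ℤ) < p) (h2 : p ≤ l) :
    weightConst p l * (l + p) = -(√2 * ladder (p - 1) l * weightConst (p - 1) l) := by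
  have h := weightConst_succ (p := -p) (l := l) (by omega) (by omega)
  have hs : ∀ p : ℤ, weightConst (-p) l = weightConst p l := fun p => by
    rw [weightConst, weightConst, sub_neg_eq_add, ← sub_eq_add_neg, zpow_neg, ← inv_zpow]
    rw [mul_comm ((((l : ℤ) + p).toNat.factorial : ℝ))]
    norm_num
  rw [hs, show -p + 1 = -(p - 1) by ring, hs] at h
  rw [← ladder_pred (p - 1), show -(p - 1) - 1 = -p by ring, ← h]
  push_cast
  ring

theorem contDiff_spinorY (p : ℤ) (l : ℕ) (m : ℤ) : ContDiff ℝ ∞ (spinorY p l m) := by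
  by_cases h : |p| ≤ (l : ℤ) ∧ |m| ≤ (l : ℤ)
  · have : spinorY p l m = fun q => ((harmonicConst l m * weightConst p l : ℝ) : ℂ)
      * spinCoeff ((l : ℤ) + p).toNat ((l : ℤ) - p).toNat ((l : ℤ) + m).toNat q := by
      funext q; rw [spinorY, if_pos h]
    rw [this]
    exact contDiff_const.mul (contDiff_spinCoeff _ _ _)
  · have : spinorY p l m = fun q => 0 := by
      funext q; rw [spinorY, if_neg h]
    rw [this]
    exact contDiff_const

theorem differentiable_spinorY (p : ℤ) (l : ℕ) (m : ℤ) : Differentiable ℝ (spinorY p l m) :=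
  (contDiff_spinorY p l m).differentiable (by simp)

theorem fderiv_spinorY {p : ℤ} {l : ℕ} {m : ℤ} (h : |p| ≤ (l : ℤ) ∧ |m| ≤ (l : ℤ)) (q v : ℂ × ℂ) :
    fderiv ℝ (spinorY p l m) q v = ((harmonicConst l m * weightConst p l : ℝ) : ℂ)
      * fderiv ℝ (spinCoeff ((l : ℤ) + p).toNat ((l : ℤ) - p).toNat ((l : ℤ) + m).toNat) q v := by
  have : spinorY p l m = fun q => ((harmonicConst l m * weightConst p l : ℝ) : ℂ)
      * spinCoeff ((l : ℤ) + p).toNat ((l : ℤ) - p).toNat ((l : ℤ) + m).toNat q := by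
    funext q; rw [spinorY, if_pos h]
  rw [this, fderiv_const_mul ((contDiff_spinCoeff _ _ _).differentiable (by simp) q)]
  simp

/-- Absorbs the integer factor of the raising derivative into the normalization. At `p = l` the
truncated exponent is harmless: the factor `l - p` vanishes on the left and the ladder coefficient
on the right. -/
theorem spinorY_raise {p : ℤ} {l : ℕ} {m : ℤ} (h : |p| ≤ (l : ℤ) ∧ |m| ≤ (l : ℤ)) (q : ℂ × ℂ) :
    ((harmonicConst l m * weightConst p l : ℝ) : ℂ) * ((((l : ℤ) - p).toNat : ℂ)
      * spinCoeff (((l : ℤ) + p).toNat + 1) (((l : ℤ) - p).toNat - 1) ((l : ℤ) + m).toNat q)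
      = -((√2 * ladder p l : ℝ) : ℂ) * spinorY (p + 1) l m q := by
  obtain ⟨h1, h2⟩ := abs_le.1 h.1
  rcases h2.lt_or_eq with h2 | h2
  · rw [spinorY, if_pos ⟨abs_le.2 ⟨by omega, by omega⟩, h.2⟩]
    have e1 : ((l : ℤ) + (p + 1)).toNat = ((l : ℤ) + p).toNat + 1 := by omega
    have e2 : ((l : ℤ) - (p + 1)).toNat = ((l : ℤ) - p).toNat - 1 := by omega
    have e3 : (((l : ℤ) - p).toNat : ℝ) = l - p := by
      rw [← Int.cast_natCast (R := ℝ), Int.toNat_of_nonneg (by omega)]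
      push_cast
      rfl
    have e4 := weightConst_succ h1 h2
    rw [e1, e2, ← mul_assoc, ← mul_assoc]
    congr 1
    rw [← e3] at e4
    exact_mod_cast (by linear_combination harmonicConst l m * e4 :
      harmonicConst l m * weightConst p l * (((l : ℤ) - p).toNat : ℝ)
        = -(√2 * ladder p l) * (harmonicConst l m * weightConst (p + 1) l))
  · subst h2
    simp [ladder_self]

theorem spinorY_lower {p : ℤ} {l : ℕ} {m : ℤ} (h : |p| ≤ (l : ℤ) ∧ |m| ≤ (l : ℤ)) (q : ℂ × ℂ) :
    ((harmonicConst l m * weightConst p l : ℝ) : ℂ) * ((((l : ℤ) + p).toNat : ℂ)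
      * spinCoeff (((l : ℤ) + p).toNat - 1) (((l : ℤ) - p).toNat + 1) ((l : ℤ) + m).toNat q)
      = -((√2 * ladder (p - 1) l : ℝ) : ℂ) * spinorY (p - 1) l m q := by
  obtain ⟨h1, h2⟩ := abs_le.1 h.1
  rcases h1.lt_or_eq with h1 | h1
  · rw [spinorY, if_pos ⟨abs_le.2 ⟨by omega, by omega⟩, h.2⟩]
    have e1 : ((l : ℤ) + (p - 1)).toNat = ((l : ℤ) + p).toNat - 1 := by omega
    have e2 : ((l : ℤ) - (p - 1)).toNat = ((l : ℤ) - p).toNat + 1 := by omega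
    have e3 : (((l : ℤ) + p).toNat : ℝ) = l + p := by
      rw [← Int.cast_natCast (R := ℝ), Int.toNat_of_nonneg (by omega)]
      push_cast
      rfl
    have e4 := weightConst_pred h1 h2
    rw [e1, e2, ← mul_assoc, ← mul_assoc]
    congr 1
    rw [← e3] at e4
    exact_mod_cast (by linear_combination harmonicConst l m * e4 :
      harmonicConst l m * weightConst p l * (((l : ℤ) + p).toNat : ℝ)
        = -(√2 * ladder (p - 1) l) * (harmonicConst l m * weightConst (p - 1) l))
  · subst h1
    rw [spinorY, if_neg (by rintro ⟨h3, -⟩; have := (abs_le.1 h3).1; omega)]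
    simp

/-- Outside the admissible range a neighbouring weight can be admissible only at `p = -l - 1` or `p
= l + 1`, and there the connecting ladder coefficient is zero. The ladder formulas thus hold for all
indices without side conditions. -/
theorem ladder_mul_spinorY {p : ℤ} {l : ℕ} {m : ℤ} (h : ¬(|p| ≤ (l : ℤ) ∧ |m| ≤ (l : ℤ)))
    (q : ℂ × ℂ) : (ladder p l : ℂ) * spinorY (p + 1) l m q = 0 ∧
      (ladder (p - 1) l : ℂ) * spinorY (p - 1) l m q = 0 := by
  constructor
  · by_cases h' : |p + 1| ≤ (l : ℤ) ∧ |m| ≤ (l : ℤ)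
    · have : p = -(l : ℤ) - 1 := by
        by_contra h3
        have := abs_le.1 h'.1
        exact h ⟨abs_le.2 ⟨by omega, by omega⟩, h'.2⟩
      subst this
      rw [ladder_pred, ladder_self]
      simp
    · rw [spinorY, if_neg h', mul_zero]
  · by_cases h' : |p - 1| ≤ (l : ℤ) ∧ |m| ≤ (l : ℤ)
    · have : p = (l : ℤ) + 1 := by
        by_contra h3
        have := abs_le.1 h'.1
        exact h ⟨abs_le.2 ⟨by omega, by omega⟩, h'.2⟩
      subst this
      rw [add_sub_cancel_right, ladder_self]
      simp
    · rw [spinorY, if_neg h', mul_zero]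

theorem spinorY_of_not {p : ℤ} {l : ℕ} {m : ℤ} (h : ¬(|p| ≤ (l : ℤ) ∧ |m| ≤ (l : ℤ))) :
    spinorY p l m = fun _ => 0 := by
  funext q; rw [spinorY, if_neg h]

theorem fderiv_spinorY_perp (p : ℤ) (l : ℕ) (m : ℤ) (q : ℂ × ℂ) :
    fderiv ℝ (spinorY p l m) q (perp q) = ((√2 : ℝ) : ℂ) *
      ((ladder (p - 1) l : ℂ) * spinorY (p - 1) l m q
        - (ladder p l : ℂ) * spinorY (p + 1) l m q) := by
  by_cases h : |p| ≤ (l : ℤ) ∧ |m| ≤ (l : ℤ)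
  · rw [fderiv_spinorY h, fderiv_spinCoeff_perp]
    have h1 := spinorY_raise h q
    have h2 := spinorY_lower h q
    push_cast at *
    linear_combination h1 - h2
  · rw [(ladder_mul_spinorY h q).1, (ladder_mul_spinorY h q).2, spinorY_of_not h]
    simp

theorem fderiv_spinorY_I_perp (p : ℤ) (l : ℕ) (m : ℤ) (q : ℂ × ℂ) :
    fderiv ℝ (spinorY p l m) q (Complex.I • perp q) = Complex.I * ((√2 : ℝ) : ℂ) *
      ((ladder (p - 1) l : ℂ) * spinorY (p - 1) l m q
        + (ladder p l : ℂ) * spinorY (p + 1) l m q) := by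
  by_cases h : |p| ≤ (l : ℤ) ∧ |m| ≤ (l : ℤ)
  · rw [fderiv_spinorY h, fderiv_spinCoeff_I_perp]
    have h1 := spinorY_raise h q
    have h2 := spinorY_lower h q
    push_cast at *
    linear_combination -Complex.I * h1 - Complex.I * h2
  · rw [(ladder_mul_spinorY h q).1, (ladder_mul_spinorY h q).2, spinorY_of_not h]
    simp

theorem fderiv_spinorY_self (p : ℤ) (l : ℕ) (m : ℤ) (q : ℂ × ℂ) :
    fderiv ℝ (spinorY p l m) q q = 2 * l * spinorY p l m q := by
  by_cases h : |p| ≤ (l : ℤ) ∧ |m| ≤ (l : ℤ)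
  · rw [fderiv_spinorY h, fderiv_spinCoeff_self, spinorY, if_pos h]
    obtain ⟨a, b, ha, hb⟩ := exists_nat_add_sub h.1
    rw [ha, hb]
    simp only [Int.toNat_natCast]
    have : (a : ℂ) + b = 2 * l := by exact_mod_cast (by omega : (a : ℤ) + b = 2 * l)
    rw [this]
    ring
  · rw [spinorY_of_not h]
    simp

theorem fderiv_spinorY_I_self (p : ℤ) (l : ℕ) (m : ℤ) (q : ℂ × ℂ) :
    fderiv ℝ (spinorY p l m) q (Complex.I • q) = 2 * Complex.I * p * spinorY p l m q := by
  by_cases h : |p| ≤ (l : ℤ) ∧ |m| ≤ (l : ℤ)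
  · rw [fderiv_spinorY h, fderiv_spinCoeff_I_self, spinorY, if_pos h]
    obtain ⟨a, b, ha, hb⟩ := exists_nat_add_sub h.1
    rw [ha, hb]
    simp only [Int.toNat_natCast]
    have : (a : ℂ) - b = 2 * p := by exact_mod_cast (by omega : (a : ℤ) - b = 2 * p)
    rw [this]
    ring
  · rw [spinorY_of_not h]
    simp

theorem spinorEth_spinorY (p : ℤ) (l : ℕ) (m : ℤ) (q : ℂ × ℂ) :
    spinorEth (spinorY p l m) q = -(ladder p l : ℂ) * spinorY (p + 1) l m q := by
  have h2 : ((√2 : ℝ) : ℂ) ≠ 0 := by exact_mod_cast (by positivity : √2 ≠ 0)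
  rw [spinorEth, fderiv_spinorY_perp, fderiv_spinorY_I_perp]
  field_simp
  linear_combination (ladder (p - 1) l * spinorY (p - 1) l m q
    + ladder p l * spinorY (p + 1) l m q) * Complex.I_sq

theorem spinorEthBar_spinorY (p : ℤ) (l : ℕ) (m : ℤ) (q : ℂ × ℂ) :
    spinorEthBar (spinorY p l m) q = (ladder (p - 1) l : ℂ) * spinorY (p - 1) l m q := by
  have h2 : ((√2 : ℝ) : ℂ) ≠ 0 := by exact_mod_cast (by positivity : √2 ≠ 0)
  rw [spinorEthBar, fderiv_spinorY_perp, fderiv_spinorY_I_perp]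
  field_simp
  linear_combination -(ladder (p - 1) l * spinorY (p - 1) l m q
    + ladder p l * spinorY (p + 1) l m q) * Complex.I_sq

theorem eth_spinorY (p : ℤ) (l : ℕ) (m : ℤ) {θ : ℝ} (hθ : θ ∈ Set.Ioo (0 : ℝ) Real.pi) (ϕ : ℝ) :
    eth p (fun θ ϕ => spinorY p l m (spinor θ ϕ)) θ ϕ
      = -(ladder p l : ℂ) * spinorY (p + 1) l m (spinor θ ϕ) := by
  rw [← spinorEth_spinorY]
  exact eth_eq_spinorEth hθ (differentiable_spinorY p l m _) (fun _ _ _ => rfl)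
    (fderiv_spinorY_I_self p l m _)

theorem ethBar_spinorY (p : ℤ) (l : ℕ) (m : ℤ) {θ : ℝ} (hθ : θ ∈ Set.Ioo (0 : ℝ) Real.pi)
    (ϕ : ℝ) : ethBar p (fun θ ϕ => spinorY p l m (spinor θ ϕ)) θ ϕ
      = (ladder (p - 1) l : ℂ) * spinorY (p - 1) l m (spinor θ ϕ) := by
  rw [← spinorEthBar_spinorY]
  exact ethBar_eq_spinorEthBar hθ (differentiable_spinorY p l m _) (fun _ _ _ => rfl)
    (fderiv_spinorY_I_self p l m _)

/-- `K` is the reciprocal of an accumulated product of ladder coefficients. It normalizes the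
iterates of `ð` and `ð̄` on scalar harmonics, and it makes neighbouring components of the advanced
solution fit together. -/
theorem K_eq_ladder_mul {p : ℤ} {l : ℕ} (h1 : -(l : ℤ) ≤ p) (h2 : p < l) :
    K p l = ladder p l * K (p + 1) l := by
  obtain ⟨a, b, ha, hb⟩ := exists_nat_add_sub (abs_le.2 ⟨h1, h2.le⟩)
  obtain ⟨b, rfl⟩ : ∃ b' : ℕ, b = b' + 1 := ⟨b - 1, by omega⟩
  have e1 : (l : ℤ) + (p + 1) = ((a + 1 : ℕ) : ℤ) := by push_cast; omega
  have e2 : (l : ℤ) - (p + 1) = (b : ℤ) := by push_cast at hb; omega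
  have ha' : (l : ℝ) + p = a := by exact_mod_cast ha
  have hb' : (l : ℝ) - p = ((b + 1 : ℕ) : ℝ) := by exact_mod_cast hb
  rw [K, K, ladder, e1, e2, ha, hb, ha', hb', ← Real.sqrt_mul (by positivity)]
  simp only [Int.toNat_natCast]
  congr 1
  rw [zpow_add_one₀ two_ne_zero, Nat.factorial_succ, Nat.factorial_succ]
  push_cast
  field_simp

theorem K_zero (l : ℕ) : K 0 l = 1 := by
  rw [K]
  simp only [sub_zero, add_zero, Int.toNat_natCast, zpow_zero, one_mul]
  rw [div_self (by positivity), Real.sqrt_one]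

theorem K_pos (p : ℤ) (l : ℕ) : 0 < K p l := Real.sqrt_pos.2 (by positivity)

theorem ethIter_sphY {l : ℕ} {m : ℤ} (hm : |m| ≤ (l : ℤ)) {q : ℕ} (hq : q ≤ l) :
    ∀ θ ∈ Set.Ioo (0 : ℝ) Real.pi, ∀ ϕ, ethIter q (sphY l m) θ ϕ
      = (-1 : ℂ) ^ q * (K q l : ℂ)⁻¹ * spinorY q l m (spinor θ ϕ) := by
  induction q with
  | zero =>
    intro θ hθ ϕ
    simp [ethIter, sphY_eq hm hθ, K_zero]
  | succ q ih =>
    intro θ hθ ϕ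
    have hl : (ladder q l : ℂ) ≠ 0 := by
      exact_mod_cast (ladder_pos (p := q) (l := l) (by omega) (by omega)).ne'
    rw [ethIter, eth_congr (ih (by omega)) hθ, eth_const_mul, eth_spinorY _ _ _ hθ,
      K_eq_ladder_mul (p := q) (by omega) (by omega)]
    push_cast
    rw [pow_succ]
    field_simp

theorem ethBarIter_sphY {l : ℕ} {m : ℤ} (hm : |m| ≤ (l : ℤ)) {q : ℕ} (hq : q ≤ l) :
    ∀ θ ∈ Set.Ioo (0 : ℝ) Real.pi, ∀ ϕ, ethBarIter q (sphY l m) θ ϕ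
      = (K q l : ℂ)⁻¹ * spinorY (-q) l m (spinor θ ϕ) := by
  induction q with
  | zero =>
    intro θ hθ ϕ
    simp [ethBarIter, sphY_eq hm hθ, K_zero]
  | succ q ih =>
    intro θ hθ ϕ
    have hl : (ladder q l : ℂ) ≠ 0 := by
      exact_mod_cast (ladder_pos (p := q) (l := l) (by omega) (by omega)).ne'
    rw [ethBarIter, ethBar_congr (ih (by omega)) hθ, ethBar_const_mul, ethBar_spinorY _ _ _ hθ,
      K_eq_ladder_mul (p := q) (by omega) (by omega), ladder_pred]
    push_cast
    rw [show (-(q : ℤ) - 1) = -1 + -(q : ℤ) by ring, show -((q : ℤ) + 1) = -1 + -(q : ℤ) by ring]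
    field_simp

/-- The spin-weighted harmonics come from functions of spinors. -/
theorem spinY_eq (p : ℤ) (l : ℕ) (m : ℤ) {θ : ℝ} (hθ : θ ∈ Set.Ioo (0 : ℝ) Real.pi) (ϕ : ℝ) :
    spinY p l m θ ϕ = spinorY p l m (spinor θ ϕ) := by
  by_cases h : |p| ≤ (l : ℤ) ∧ |m| ≤ (l : ℤ)
  · rw [spinY, if_pos h]
    have hK : (K |p| l : ℂ) ≠ 0 := by exact_mod_cast (K_pos _ l).ne'
    split_ifs with hp
    · lift p to ℕ using hp
      have hpl : p ≤ l := by simpa using h.1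
      rw [Int.toNat_natCast, ethIter_sphY h.2 hpl θ hθ, zpow_natCast]
      rw [Nat.abs_cast] at hK
      field_simp
      rw [← pow_mul, mul_comm p 2, pow_mul]
      norm_num
    · obtain ⟨q, hq⟩ : ∃ q : ℕ, p = -(q : ℤ) := ⟨(-p).toNat, by omega⟩
      subst hq
      have hpl : q ≤ l := by simpa using h.1
      rw [neg_neg, Int.toNat_natCast, ethBarIter_sphY h.2 hpl θ hθ]
      rw [abs_neg, Nat.abs_cast] at hK
      field_simp
  · rw [spinY, if_neg h, spinorY, if_neg h]

end ZRM

/-! ### Bounds for the harmonics -/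

namespace ZRM

theorem conj_spinCoeff (a b c : ℕ) (x y : ℝ) :
    (starRingEnd ℂ) (spinCoeff a b c ((x : ℂ), (y : ℂ))) = spinCoeff a b c ((x : ℂ), (y : ℂ)) := by
  have h : (spinPoly a b ((x : ℂ), (y : ℂ))).map (starRingEnd ℂ)
      = spinPoly a b ((x : ℂ), (y : ℂ)) := by
    simp [spinPoly]
  rw [spinCoeff]
  conv_rhs => rw [← h]
  rw [Polynomial.coeff_map]

theorem spinor_zero_right (θ : ℝ) :
    spinor θ 0 = ((Real.cos (θ / 2) : ℂ), (Real.sin (θ / 2) : ℂ)) := by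
  simp [spinor]

theorem hasDerivAt_spinCoeff_spinor (a b c : ℕ) (θ : ℝ) :
    HasDerivAt (fun θ => spinCoeff a b c (spinor θ 0))
      (1 / 2 * (-(a : ℂ) * spinCoeff (a - 1) (b + 1) c (spinor θ 0)
        + b * spinCoeff (a + 1) (b - 1) c (spinor θ 0))) θ := by
  have h := ((contDiff_spinCoeff a b c).differentiable (by simp)
    (spinor θ 0)).hasFDerivAt.comp_hasDerivAt θ (hasDerivAt_spinor_left θ 0)
  rw [map_smul, fderiv_spinCoeff_perp, Complex.real_smul] at h
  refine HasDerivAt.congr_deriv h ?_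
  push_cast
  ring

/-- Unitarity of the representation of `SU(2)` on polynomials of degree `N`, proved on a real
one-parameter family: the sum does not depend on `θ`, and at `θ = 0` a single coefficient survives.
-/
theorem sum_choose_mul_sq_spinCoeff (N c : ℕ) (θ : ℝ) :
    ∑ a ∈ Finset.range (N + 1), (N.choose a : ℂ) * spinCoeff a (N - a) c (spinor θ 0) ^ 2
      = N.choose c := by
  set f : ℝ → ℂ := fun θ =>
    ∑ a ∈ Finset.range (N + 1), (N.choose a : ℂ) * spinCoeff a (N - a) c (spinor θ 0) ^ 2
  have hd : ∀ θ, HasDerivAt f 0 θ := by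
    intro θ
    have h : HasDerivAt f _ θ := HasDerivAt.fun_sum fun a _ =>
      ((hasDerivAt_spinCoeff_spinor a (N - a) c θ).pow 2).const_mul (N.choose a : ℂ)
    refine h.congr_deriv ?_
    -- The derivative of the `a`-th summand is `T (a + 1) - T a`. The boundary terms vanish, at `0`
    -- through the factor `a` and at `N + 1` through the binomial coefficient.
    set T : ℕ → ℂ := fun a => (N.choose a : ℂ) * a * spinCoeff a (N - a) c (spinor θ 0)
      * spinCoeff (a - 1) (N - (a - 1)) c (spinor θ 0)
    have : ∑ a ∈ Finset.range (N + 1), (T (a + 1) - T a) = 0 := by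
      rw [Finset.sum_range_sub]
      simp [T]
    rw [← this]
    refine Finset.sum_congr rfl fun a ha => ?_
    have ha' : a ≤ N := by simpa [Nat.lt_succ_iff] using ha
    have e1 : ((N.choose (a + 1) : ℂ) * ((a + 1 : ℕ) : ℂ)) = N.choose a * ((N - a : ℕ) : ℂ) := by
      exact_mod_cast Nat.choose_succ_right_eq N a
    have e2 : N - a - 1 = N - (a + 1) := by omega
    have e3 : (a : ℂ) * spinCoeff (a - 1) (N - a + 1) c (spinor θ 0)
        = a * spinCoeff (a - 1) (N - (a - 1)) c (spinor θ 0) := by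
      rcases a with _ | a
      · simp
      · rw [show N - (a + 1) + 1 = N - (a + 1 - 1) by omega]
    simp only [T, e2, e1, Nat.add_sub_cancel, Nat.cast_ofNat]
    linear_combination -(N.choose a : ℂ) * spinCoeff a (N - a) c (spinor θ 0) * e3
  have hc : f θ = f 0 := is_const_of_deriv_eq_zero (fun x => (hd x).differentiableAt)
    (fun x => (hd x).deriv) θ 0
  change f θ = _
  rw [hc]
  have h0 : ∀ a b : ℕ, spinCoeff a b c (spinor 0 0) = if c = a then 1 else 0 := by
    intro a b
    simp [spinCoeff, spinPoly, spinor, Polynomial.coeff_X_pow]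
  simp only [f, h0]
  by_cases h : c ≤ N
  · rw [Finset.sum_eq_single c]
    · simp
    · intro a _ ha
      simp [Ne.symm ha]
    · intro h'
      simp at h'
      omega
  · rw [Nat.choose_eq_zero_of_lt (not_le.1 h)]
    refine (Finset.sum_eq_zero fun a ha => ?_).trans (by simp)
    have ha' : a ≤ N := by simpa [Nat.lt_succ_iff] using ha
    rw [if_neg (by omega)]
    simp

/-- The squared norm on `ℂ²`. -/
def normSqPair (q : ℂ × ℂ) : ℝ := Complex.normSq q.1 + Complex.normSq q.2

/-- Independent phases of the two components change the coefficients only by phases, so absolute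
values may be computed at the nonnegative real spinor `(‖z‖, ‖w‖)`. -/
theorem exists_angle {q : ℂ × ℂ} (hq : normSqPair q = 1) : ∃ θ : ℝ, ∀ a b c : ℕ,
    ‖spinCoeff a b c q‖ = ‖spinCoeff a b c (spinor θ 0)‖ := by
  obtain ⟨z, w⟩ := q
  have hq' : ‖z‖ ^ 2 + ‖w‖ ^ 2 = 1 := by
    simpa [normSqPair, Complex.normSq_eq_norm_sq] using hq
  have hw : ‖w‖ ≤ 1 := by nlinarith [sq_nonneg ‖z‖, norm_nonneg w]
  refine ⟨2 * Real.arcsin ‖w‖, fun a b c => ?_⟩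
  have h1 : spinor (2 * Real.arcsin ‖w‖) 0 = ((‖z‖ : ℂ), (‖w‖ : ℂ)) := by
    rw [spinor_zero_right, mul_div_cancel_left₀ _ two_ne_zero, Real.cos_arcsin,
      Real.sin_arcsin (by linarith [norm_nonneg w]) hw, ← hq', add_sub_cancel_right,
      Real.sqrt_sq (norm_nonneg z)]
  have hu : ∀ z : ℂ, ∃ e : ℂ, ‖e‖ = 1 ∧ z = e * ‖z‖ := fun z =>
    ⟨Complex.exp (z.arg * Complex.I), by rw [Complex.norm_exp_ofReal_mul_I], by
      rw [mul_comm]; exact (Complex.norm_mul_exp_arg_mul_I z).symm⟩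
  obtain ⟨e, he, hz⟩ := hu z
  obtain ⟨f, hf, hw⟩ := hu w
  have hconj : ∀ e : ℂ, ‖e‖ = 1 → (starRingEnd ℂ) e * e = 1 := fun e he => by
    rw [mul_comm, Complex.mul_conj, Complex.normSq_eq_norm_sq, he]
    simp
  rw [h1]
  conv_lhs => rw [hz, hw]
  rw [spinCoeff_phase _ _ _ _ _ _ _ (hconj e he) (hconj f hf)]
  simp [he, hf]

theorem sum_choose_mul_norm_sq_spinCoeff (N c : ℕ) {q : ℂ × ℂ} (hq : normSqPair q = 1) :
    ∑ a ∈ Finset.range (N + 1), (N.choose a : ℝ) * ‖spinCoeff a (N - a) c q‖ ^ 2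
      = N.choose c := by
  obtain ⟨θ, hθ⟩ := exists_angle hq
  have h := sum_choose_mul_sq_spinCoeff N c θ
  have hr : ∀ a b, spinCoeff a b c (spinor θ 0) ^ 2
      = ((‖spinCoeff a b c (spinor θ 0)‖ ^ 2 : ℝ) : ℂ) := by
    intro a b
    rw [← Complex.normSq_eq_norm_sq, ← Complex.mul_conj, spinor_zero_right, conj_spinCoeff, sq]
  simp only [hr, ← hθ] at h
  exact_mod_cast h

theorem harmonicConst_mul_weightConst_sq {p : ℤ} {l : ℕ} {m : ℤ} (hp : |p| ≤ (l : ℤ))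
    (hm : |m| ≤ (l : ℤ)) :
    (harmonicConst l m * weightConst p l) ^ 2 * ((2 * l).choose ((l : ℤ) + m).toNat : ℝ)
      = (2 * l + 1) / (4 * Real.pi) * ((2 * l).choose ((l : ℤ) + p).toNat : ℝ) := by
  obtain ⟨a, b, ha, hb⟩ := exists_nat_add_sub hp
  obtain ⟨c, d, hc, hd⟩ := exists_nat_add_sub hm
  rw [harmonicConst, weightConst, ha, hb, hc, hd]
  simp only [Int.toNat_natCast]
  have h1 : ∀ p : ℤ, ((-1 : ℝ) ^ p) ^ 2 = 1 := fun p => by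
    rw [← zpow_natCast, ← zpow_mul, mul_comm, zpow_mul]; norm_num
  rw [mul_pow, div_pow, div_pow, mul_pow, mul_pow, h1, h1, Real.sq_sqrt (by positivity),
    Real.sq_sqrt (by positivity), Nat.cast_choose ℝ (by omega : a ≤ 2 * l),
    Nat.cast_choose ℝ (by omega : c ≤ 2 * l), show 2 * l - a = b by omega,
    show 2 * l - c = d by omega]
  have := Real.pi_pos
  field_simp

theorem norm_spinorY_sq {p : ℤ} {l : ℕ} {m : ℤ} (hp : |p| ≤ (l : ℤ)) (hm : |m| ≤ (l : ℤ))
    (q : ℂ × ℂ) : ((2 * l).choose ((l : ℤ) + m).toNat : ℝ) * ‖spinorY p l m q‖ ^ 2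
      = (2 * l + 1) / (4 * Real.pi) * (((2 * l).choose ((l : ℤ) + p).toNat : ℝ)
        * ‖spinCoeff ((l : ℤ) + p).toNat ((l : ℤ) - p).toNat ((l : ℤ) + m).toNat q‖ ^ 2) := by
  rw [spinorY, if_pos ⟨hp, hm⟩, norm_mul, mul_pow, Complex.norm_real, Real.norm_eq_abs, sq_abs]
  linear_combination ‖spinCoeff ((l : ℤ) + p).toNat ((l : ℤ) - p).toNat
    ((l : ℤ) + m).toNat q‖ ^ 2 * harmonicConst_mul_weightConst_sq hp hm

/-- An addition theorem in which the sum runs over the spin weight at fixed `m`. It serves twice: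
for the uniform bound of the harmonics, and after integration for their normalization. -/
theorem sum_norm_spinorY_sq {l : ℕ} {m : ℤ} (hm : |m| ≤ (l : ℤ)) {q : ℂ × ℂ}
    (hq : normSqPair q = 1) :
    ∑ a ∈ Finset.range (2 * l + 1), ‖spinorY ((a : ℤ) - l) l m q‖ ^ 2
      = (2 * l + 1) / (4 * Real.pi) := by
  have hc : ((2 * l).choose ((l : ℤ) + m).toNat : ℝ) ≠ 0 := by
    have := abs_le.1 hm
    exact_mod_cast (Nat.choose_pos (by omega : ((l : ℤ) + m).toNat ≤ 2 * l)).ne'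
  have hs := congrArg (fun x => (2 * (l : ℝ) + 1) / (4 * Real.pi) * x)
    (sum_choose_mul_norm_sq_spinCoeff (2 * l) ((l : ℤ) + m).toNat hq)
  simp only [Finset.mul_sum] at hs
  rw [← mul_right_inj' hc, Finset.mul_sum, mul_comm _ ((2 * (l : ℝ) + 1) / (4 * Real.pi)), ← hs]
  refine Finset.sum_congr rfl fun a ha => ?_
  have ha' : a ≤ 2 * l := by simpa [Nat.lt_succ_iff] using ha
  rw [norm_spinorY_sq (abs_le.2 ⟨by omega, by omega⟩) hm,
    show ((l : ℤ) + ((a : ℤ) - l)).toNat = a by omega,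
    show ((l : ℤ) - ((a : ℤ) - l)).toNat = 2 * l - a by omega]

/-- The uniform bound for the harmonics on unit spinors. -/
theorem norm_spinorY_le (p : ℤ) (l : ℕ) (m : ℤ) {q : ℂ × ℂ} (hq : normSqPair q = 1) :
    ‖spinorY p l m q‖ ≤ l + 1 := by
  by_cases h : |p| ≤ (l : ℤ) ∧ |m| ≤ (l : ℤ)
  · have hs := sum_norm_spinorY_sq h.2 hq
    have hp := abs_le.1 h.1
    have h1 : ‖spinorY p l m q‖ ^ 2
        ≤ ∑ a ∈ Finset.range (2 * l + 1), ‖spinorY ((a : ℤ) - l) l m q‖ ^ 2 := by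
      have := Finset.single_le_sum (f := fun a : ℕ => ‖spinorY ((a : ℤ) - l) l m q‖ ^ 2)
        (fun _ _ => by positivity)
        (Finset.mem_range.2 (by omega : ((l : ℤ) + p).toNat < 2 * l + 1))
      rwa [show ((((l : ℤ) + p).toNat : ℕ) : ℤ) - l = p by omega] at this
    rw [hs] at h1
    have h2 : (2 * (l : ℝ) + 1) / (4 * Real.pi) ≤ 2 * l + 1 :=
      div_le_self (by positivity) (by linarith [Real.pi_gt_three])
    refine abs_le_of_sq_le_sq' ?_ (by positivity) |>.2
    nlinarith [(by positivity : (0 : ℝ) ≤ l)]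
  · rw [spinorY, if_neg h, norm_zero]
    positivity

end ZRM

/-! ### Homogeneous extensions of the harmonics -/

namespace ZRM

theorem normSqPair_spinor (θ ϕ : ℝ) : normSqPair (spinor θ ϕ) = 1 := by
  have h1 : Complex.I * ((ϕ : ℂ) / 2) = ((ϕ / 2 : ℝ) : ℂ) * Complex.I := by push_cast; ring
  have h2 : -(Complex.I * ((ϕ : ℂ) / 2)) = ((-(ϕ / 2) : ℝ) : ℂ) * Complex.I := by push_cast; ring
  have e1 : ‖Complex.exp (Complex.I * ((ϕ : ℂ) / 2))‖ = 1 := by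
    rw [h1, Complex.norm_exp_ofReal_mul_I]
  have e2 : ‖Complex.exp (-(Complex.I * ((ϕ : ℂ) / 2)))‖ = 1 := by
    rw [h2, Complex.norm_exp_ofReal_mul_I]
  rw [normSqPair, spinor]
  simp only [Complex.normSq_eq_norm_sq, norm_mul, e1, e2, Complex.norm_real, Real.norm_eq_abs,
    mul_one, sq_abs]
  exact Real.cos_sq_add_sin_sq _

theorem normSqPair_pos {q : ℂ × ℂ} (hq : q ≠ 0) : 0 < normSqPair q := by
  rw [normSqPair]
  by_contra h
  have h1 := Complex.normSq_nonneg q.1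
  have h2 := Complex.normSq_nonneg q.2
  exact hq (Prod.ext (Complex.normSq_eq_zero.1 (by linarith)) (Complex.normSq_eq_zero.1 (by linarith)))

theorem contDiff_normSqPair : ContDiff ℝ ∞ normSqPair := by
  have : normSqPair = fun q : ℂ × ℂ => ‖q.1‖ ^ 2 + ‖q.2‖ ^ 2 := by
    funext q; simp [normSqPair, Complex.normSq_eq_norm_sq]
  rw [this]
  exact (contDiff_fst.norm_sq ℝ).add (contDiff_snd.norm_sq ℝ)

theorem fderiv_normSqPair (q v : ℂ × ℂ) : fderiv ℝ normSqPair q v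
    = 2 * ((starRingEnd ℂ) q.1 * v.1 + (starRingEnd ℂ) q.2 * v.2).re := by
  have : normSqPair = fun q : ℂ × ℂ => ‖q.1‖ ^ 2 + ‖q.2‖ ^ 2 := by
    funext q; simp [normSqPair, Complex.normSq_eq_norm_sq]
  have h := (HasFDerivAt.norm_sq (hasFDerivAt_fst (𝕜 := ℝ) (p := q))).add
    (HasFDerivAt.norm_sq (hasFDerivAt_snd (𝕜 := ℝ) (p := q)))
  rw [this]
  have h' := h.fderiv
  simp only [Pi.add_def] at h'
  rw [h']
  simp [Complex.inner]
  ring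

theorem spinorY_real_smul (p : ℤ) (l : ℕ) (m : ℤ) (r : ℝ) (q : ℂ × ℂ) :
    spinorY p l m (r • q) = (r : ℂ) ^ (2 * l) * spinorY p l m q := by
  by_cases h : |p| ≤ (l : ℤ) ∧ |m| ≤ (l : ℤ)
  · obtain ⟨a, b, ha, hb⟩ := exists_nat_add_sub h.1
    rw [spinorY, if_pos h, spinCoeff_real_smul, spinorY, if_pos h, ha, hb]
    simp only [Int.toNat_natCast]
    rw [show a + b = 2 * l by omega]
    ring
  · simp [spinorY_of_not h]

theorem hasSpinWeight_spinorY (p : ℤ) (l : ℕ) (m : ℤ) : HasSpinWeight p (spinorY p l m) := by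
  intro ψ q
  by_cases h : |p| ≤ (l : ℤ) ∧ |m| ≤ (l : ℤ)
  · obtain ⟨a, b, ha, hb⟩ := exists_nat_add_sub h.1
    have hc : (starRingEnd ℂ) (Complex.exp (Complex.I * ψ)) = Complex.exp (-(Complex.I * ψ)) := by
      rw [← Complex.exp_conj]
      simp
    have h1 : (starRingEnd ℂ) (Complex.exp (Complex.I * ψ)) * Complex.exp (Complex.I * ψ) = 1 := by
      rw [hc, ← Complex.exp_add]
      simp
    have h2 := spinCoeff_phase a b ((l : ℤ) + m).toNat q.1 q.2 _ _ h1 h1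
    rw [spinorY, if_pos h, spinorY, if_pos h, ha, hb]
    simp only [Int.toNat_natCast]
    rw [show Complex.exp (Complex.I * ψ) • q
      = (Complex.exp (Complex.I * ψ) * q.1, Complex.exp (Complex.I * ψ) * q.2) from rfl, h2,
      mul_comm (Complex.exp (Complex.I * ψ)) ((starRingEnd ℂ) _), h1, one_pow, mul_one, hc,
      ← Complex.exp_nat_mul, ← Complex.exp_nat_mul, ← Complex.exp_add]
    have : (a : ℂ) * (Complex.I * ψ) + b * -(Complex.I * ψ) = 2 * Complex.I * p * ψ := by
      have : (a : ℂ) - b = 2 * p := by exact_mod_cast (by omega : (a : ℤ) - b = 2 * p)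
      linear_combination Complex.I * ψ * this
    rw [this]
    ring
  · simp [spinorY_of_not h]

/-- The extension of a harmonic from the unit sphere of `ℂ²` which is homogeneous of degree `0`. -/
def homY (p : ℤ) (l : ℕ) (m : ℤ) (q : ℂ × ℂ) : ℂ :=
  spinorY p l m q * ((((normSqPair q) ^ l)⁻¹ : ℝ) : ℂ)

theorem homY_of_unit (p : ℤ) (l : ℕ) (m : ℤ) {q : ℂ × ℂ} (hq : normSqPair q = 1) :
    homY p l m q = spinorY p l m q := by
  simp [homY, hq]

theorem norm_homY_le (p : ℤ) (l : ℕ) (m : ℤ) {q : ℂ × ℂ} (hq : q ≠ 0) :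
    ‖homY p l m q‖ ≤ l + 1 := by
  have hρ := normSqPair_pos hq
  set r := √(normSqPair q)
  have hr : 0 < r := Real.sqrt_pos.2 hρ
  have hr2 : r ^ 2 = normSqPair q := Real.sq_sqrt hρ.le
  have h1 : normSqPair (r⁻¹ • q) = 1 := by
    rw [normSqPair]
    simp only [Prod.smul_fst, Prod.smul_snd, Complex.real_smul, map_mul, Complex.normSq_ofReal]
    rw [← mul_add]
    change r⁻¹ * r⁻¹ * normSqPair q = 1
    rw [← hr2]
    field_simp
  have h2 := norm_spinorY_le p l m h1
  have h3 : homY p l m q = spinorY p l m (r⁻¹ • q) := by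
    rw [spinorY_real_smul, homY, ← hr2]
    push_cast
    rw [← pow_mul, inv_pow]
    ring
  rwa [h3]

/-- The real-linear forms in terms of which the differentials of the extended harmonics are
expressed. -/
def raiseForm (q : ℂ × ℂ) : ℂ × ℂ →L[ℝ] ℂ :=
  (((√2 / normSqPair q : ℝ) : ℂ) * (starRingEnd ℂ) q.1) •
      ((Complex.conjCLE : ℂ →L[ℝ] ℂ).comp (ContinuousLinearMap.snd ℝ ℂ ℂ))
    - (((√2 / normSqPair q : ℝ) : ℂ) * (starRingEnd ℂ) q.2) •
      ((Complex.conjCLE : ℂ →L[ℝ] ℂ).comp (ContinuousLinearMap.fst ℝ ℂ ℂ))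

/-- See `raiseForm`. -/
def lowerForm (q : ℂ × ℂ) : ℂ × ℂ →L[ℝ] ℂ :=
  (((√2 / normSqPair q : ℝ) : ℂ) * q.1) • (ContinuousLinearMap.snd ℝ ℂ ℂ)
    - (((√2 / normSqPair q : ℝ) : ℂ) * q.2) • (ContinuousLinearMap.fst ℝ ℂ ℂ)

/-- See `raiseForm`. -/
def gaugeForm (q : ℂ × ℂ) : ℂ × ℂ →L[ℝ] ℂ :=
  ((((normSqPair q)⁻¹ : ℝ) : ℂ) * (starRingEnd ℂ) q.1) • (ContinuousLinearMap.fst ℝ ℂ ℂ)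
    + ((((normSqPair q)⁻¹ : ℝ) : ℂ) * (starRingEnd ℂ) q.2) • (ContinuousLinearMap.snd ℝ ℂ ℂ)
    - (((((normSqPair q)⁻¹ : ℝ) : ℂ) * q.1) •
      ((Complex.conjCLE : ℂ →L[ℝ] ℂ).comp (ContinuousLinearMap.fst ℝ ℂ ℂ))
    + ((((normSqPair q)⁻¹ : ℝ) : ℂ) * q.2) •
      ((Complex.conjCLE : ℂ →L[ℝ] ℂ).comp (ContinuousLinearMap.snd ℝ ℂ ℂ)))

theorem contDiffAt_ofReal_div_normSqPair (c : ℝ) {q : ℂ × ℂ} (hq : q ≠ 0) :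
    ContDiffAt ℝ ∞ (fun q => ((c / normSqPair q : ℝ) : ℂ)) q :=
  Complex.ofRealCLM.contDiff.contDiffAt.comp q
    (contDiffAt_const.div contDiff_normSqPair.contDiffAt (normSqPair_pos hq).ne')

theorem contDiffAt_inv_normSqPair {q : ℂ × ℂ} (hq : q ≠ 0) :
    ContDiffAt ℝ ∞ (fun q => (((normSqPair q)⁻¹ : ℝ) : ℂ)) q := by
  simpa only [one_div] using contDiffAt_ofReal_div_normSqPair 1 hq

theorem contDiffAt_raiseForm {q : ℂ × ℂ} (hq : q ≠ 0) : ContDiffAt ℝ ∞ raiseForm q := by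
  have h := contDiffAt_ofReal_div_normSqPair (√2) hq
  exact ((h.mul (contDiff_conj.comp contDiff_fst).contDiffAt).smul contDiffAt_const).sub
    ((h.mul (contDiff_conj.comp contDiff_snd).contDiffAt).smul contDiffAt_const)

theorem contDiffAt_lowerForm {q : ℂ × ℂ} (hq : q ≠ 0) : ContDiffAt ℝ ∞ lowerForm q := by
  have h := contDiffAt_ofReal_div_normSqPair (√2) hq
  exact ((h.mul contDiffAt_fst).smul contDiffAt_const).sub
    ((h.mul contDiffAt_snd).smul contDiffAt_const)

theorem contDiffAt_gaugeForm {q : ℂ × ℂ} (hq : q ≠ 0) : ContDiffAt ℝ ∞ gaugeForm q := by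
  have h := contDiffAt_inv_normSqPair hq
  exact (((h.mul (contDiff_conj.comp contDiff_fst).contDiffAt).smul contDiffAt_const).add
    ((h.mul (contDiff_conj.comp contDiff_snd).contDiffAt).smul contDiffAt_const)).sub
    (((h.mul contDiffAt_fst).smul contDiffAt_const).add
    ((h.mul contDiffAt_snd).smul contDiffAt_const))

/-- The vectors `q` and `perp q` are Hermitian-orthogonal and of equal length, hence a complex basis
of `ℂ²`. Together with their multiples by `I` they span all real directions, and along these the
derivatives of the harmonics are known. -/
theorem frame_decomposition {q : ℂ × ℂ} (hq : q ≠ 0) (v : ℂ × ℂ) :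
    v = ((((normSqPair q)⁻¹ : ℝ) : ℂ) * (q.1 * v.2 - q.2 * v.1)) • perp q
      + ((((normSqPair q)⁻¹ : ℝ) : ℂ)
        * ((starRingEnd ℂ) q.1 * v.1 + (starRingEnd ℂ) q.2 * v.2)) • q := by
  have hρ : ((normSqPair q : ℝ) : ℂ) ≠ 0 := by exact_mod_cast (normSqPair_pos hq).ne'
  have hρ' : ((normSqPair q : ℝ) : ℂ)
      = q.1 * (starRingEnd ℂ) q.1 + q.2 * (starRingEnd ℂ) q.2 := by
    rw [Complex.mul_conj, Complex.mul_conj, normSqPair]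
    push_cast
    rfl
  push_cast
  ext
  · simp only [perp, Prod.smul_mk, Prod.fst_add, Prod.smul_fst, smul_eq_mul]
    field_simp
    rw [hρ']
    ring
  · simp only [perp, Prod.smul_mk, Prod.snd_add, Prod.smul_snd, smul_eq_mul]
    field_simp
    rw [hρ']
    ring

/-- Homogeneity of degree zero removes the radial derivative, so the differential involves only the
same and the two neighbouring spin weights, with ladder coefficients, multiplied by forms that do
not depend on `l` and `m`. This closure permits repeated termwise differentiation of series. -/
theorem hasFDerivAt_homY (p : ℤ) (l : ℕ) (m : ℤ) {q : ℂ × ℂ} (hq : q ≠ 0) :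
    HasFDerivAt (homY p l m)
      (((ladder (p - 1) l : ℂ) * homY (p - 1) l m q) • lowerForm q
        - ((ladder p l : ℂ) * homY (p + 1) l m q) • raiseForm q
        + ((p : ℂ) * homY p l m q) • gaugeForm q) q := by
  have hρ := normSqPair_pos hq
  have hN : HasFDerivAt normSqPair (fderiv ℝ normSqPair q) q :=
    (contDiff_normSqPair.differentiable (by simp) q).hasFDerivAt
  have hr := Complex.ofRealCLM.hasFDerivAt.comp q
    (((hasDerivAt_pow l (normSqPair q)).inv (pow_ne_zero l hρ.ne')).comp_hasFDerivAt q hN)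
  have h : HasFDerivAt (homY p l m) _ q := (differentiable_spinorY p l m q).hasFDerivAt.mul hr
  refine h.congr_fderiv ?_
  refine ContinuousLinearMap.ext fun v => ?_
  set ρ := normSqPair q with hρdef
  set a : ℂ := ((ρ⁻¹ : ℝ) : ℂ) * (q.1 * v.2 - q.2 * v.1) with ha
  set b : ℂ := ((ρ⁻¹ : ℝ) : ℂ) * ((starRingEnd ℂ) q.1 * v.1 + (starRingEnd ℂ) q.2 * v.2) with hb
  have hv : v = a • perp q + b • q := frame_decomposition hq v
  have e1 : lowerForm q v = ((√2 : ℝ) : ℂ) * a := by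
    simp only [lowerForm, sub_apply, smul_apply, ContinuousLinearMap.coe_fst',
      ContinuousLinearMap.coe_snd', smul_eq_mul, ha]
    push_cast
    ring
  have e2 : raiseForm q v = ((√2 : ℝ) : ℂ) * (starRingEnd ℂ) a := by
    simp only [raiseForm, sub_apply, smul_apply, ContinuousLinearMap.coe_comp, Function.comp_apply,
      ContinuousLinearMap.coe_fst', ContinuousLinearMap.coe_snd', smul_eq_mul, ha, map_mul, map_sub,
      Complex.conj_ofReal]
    simp
    ring
  have e3 : gaugeForm q v = b - (starRingEnd ℂ) b := by
    simp only [gaugeForm, sub_apply, add_apply, smul_apply, ContinuousLinearMap.coe_comp,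
      Function.comp_apply,
      ContinuousLinearMap.coe_fst', ContinuousLinearMap.coe_snd', smul_eq_mul, hb, map_mul, map_add,
      Complex.conj_ofReal, Complex.conj_conj]
    simp
    ring
  have e4 : fderiv ℝ normSqPair q v = 2 * ρ * b.re := by
    rw [fderiv_normSqPair, hb, Complex.re_ofReal_mul]
    field_simp
  have e5 : fderiv ℝ (spinorY p l m) q v
      = (a.re * (((√2 : ℝ) : ℂ) * ((ladder (p - 1) l : ℂ) * spinorY (p - 1) l m q
          - (ladder p l : ℂ) * spinorY (p + 1) l m q))
        + a.im * (Complex.I * ((√2 : ℝ) : ℂ) * ((ladder (p - 1) l : ℂ) * spinorY (p - 1) l m q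
          + (ladder p l : ℂ) * spinorY (p + 1) l m q)))
        + (b.re * (2 * l * spinorY p l m q) + b.im * (2 * Complex.I * p * spinorY p l m q)) := by
    conv_lhs => rw [hv]
    rw [map_add, fderiv_complex_smul _ a, fderiv_complex_smul _ b, fderiv_spinorY_perp,
      fderiv_spinorY_I_perp, fderiv_spinorY_self, fderiv_spinorY_I_self]
  have e6 : (l : ℝ) * ρ ^ (l - 1) * ρ = l * ρ ^ l := by
    rcases l with _ | l
    · simp
    · rw [Nat.add_sub_cancel, pow_succ, mul_assoc]
  have e7 : -(↑l * ρ ^ (l - 1)) / (ρ ^ l) ^ 2 * (2 * ρ * b.re) = -(2 * l * b.re * (ρ ^ l)⁻¹) := by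
    have : ρ ^ l ≠ 0 := pow_ne_zero l hρ.ne'
    field_simp
    linear_combination -b.re * e6
  have ea : (starRingEnd ℂ) a = a.re - a.im * Complex.I := by
    apply Complex.ext <;> simp
  have eb : b - (starRingEnd ℂ) b = 2 * b.im * Complex.I := by
    apply Complex.ext <;> simp
    ring
  rw [← Complex.re_add_im a] at e1
  simp only [sub_apply, add_apply, smul_apply, ContinuousLinearMap.coe_comp, Function.comp_apply,
    e1, e2, e3, e4, e5, smul_eq_mul, Complex.ofRealCLM_apply, e7, ea, eb]
  simp only [homY, ← hρdef]
  push_cast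
  ring

end ZRM

/-! ### Superpositions of harmonics -/

namespace ZRM

/-- Families of multipole moments which decay faster than every power of `l`. -/
def RapidDecay (c : ℕ → ℤ → ℂ) : Prop :=
  ∀ k : ℕ, ∃ C : ℝ, ∀ (l : ℕ) (m : ℤ), |m| ≤ (l : ℤ) → ‖c l m‖ * ((l : ℝ) + 1) ^ k ≤ C

namespace RapidDecay

variable {c d : ℕ → ℤ → ℂ}

theorem of_le (hc : RapidDecay c) (C : ℝ) (N : ℕ)
    (h : ∀ (l : ℕ) (m : ℤ), |m| ≤ (l : ℤ) → ‖d l m‖ ≤ C * ((l : ℝ) + 1) ^ N * ‖c l m‖) :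
    RapidDecay d := by
  intro k
  obtain ⟨D, hD⟩ := hc (N + k)
  refine ⟨|C| * D, fun l m hm => ?_⟩
  calc ‖d l m‖ * ((l : ℝ) + 1) ^ k
      ≤ |C| * ((l : ℝ) + 1) ^ N * ‖c l m‖ * ((l : ℝ) + 1) ^ k := by
        refine mul_le_mul_of_nonneg_right ((h l m hm).trans ?_) (by positivity)
        gcongr
        exact le_abs_self C
    _ = |C| * (‖c l m‖ * ((l : ℝ) + 1) ^ (N + k)) := by rw [pow_add]; ring
    _ ≤ |C| * D := mul_le_mul_of_nonneg_left (hD l m hm) (abs_nonneg C)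

theorem zero : RapidDecay (fun _ _ => 0) := fun _ => ⟨0, by simp⟩

theorem add (hc : RapidDecay c) (hd : RapidDecay d) : RapidDecay (fun l m => c l m + d l m) := by
  intro k
  obtain ⟨C, hC⟩ := hc k
  obtain ⟨D, hD⟩ := hd k
  refine ⟨C + D, fun l m hm => ?_⟩
  calc ‖c l m + d l m‖ * ((l : ℝ) + 1) ^ k
      ≤ (‖c l m‖ + ‖d l m‖) * ((l : ℝ) + 1) ^ k :=
        mul_le_mul_of_nonneg_right (norm_add_le _ _) (by positivity)
    _ ≤ C + D := by rw [add_mul]; exact add_le_add (hC l m hm) (hD l m hm)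

theorem const_mul (hc : RapidDecay c) (a : ℂ) : RapidDecay (fun l m => a * c l m) :=
  hc.of_le ‖a‖ 0 fun l m _ => by simp

theorem sub (hc : RapidDecay c) (hd : RapidDecay d) : RapidDecay (fun l m => c l m - d l m) := by
  simpa [sub_eq_add_neg] using hc.add (hd.const_mul (-1))

theorem sum {ι : Type*} (t : Finset ι) {c : ι → ℕ → ℤ → ℂ} (hc : ∀ i ∈ t, RapidDecay (c i)) :
    RapidDecay (fun l m => ∑ i ∈ t, c i l m) := by
  classical
  induction t using Finset.induction_on with
  | empty => simpa using zero
  | insert i t hi ih =>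
    simp only [Finset.sum_insert hi]
    exact (hc i (by simp)).add (ih fun j hj => hc j (by simp [hj]))

theorem congr (hc : RapidDecay c) (h : ∀ (l : ℕ) (m : ℤ), |m| ≤ (l : ℤ) → d l m = c l m) :
    RapidDecay d := fun k => by
  obtain ⟨C, hC⟩ := hc k
  exact ⟨C, fun l m hm => by rw [h l m hm]; exact hC l m hm⟩

end RapidDecay

theorem ladder_nonneg (p : ℤ) (l : ℕ) : 0 ≤ ladder p l := Real.sqrt_nonneg _

theorem ladder_le (p : ℤ) (l : ℕ) : ladder p l ≤ (|(p : ℝ)| + 1) * (l + 1) := by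
  have h1 := abs_nonneg (p : ℝ)
  have h2 := le_abs_self (p : ℝ)
  have h3 := neg_abs_le (p : ℝ)
  have h4 : (0 : ℝ) ≤ l := by positivity
  refine Real.sqrt_le_iff.2 ⟨by positivity, ?_⟩
  have : ((l : ℝ) - p) * (l + p + 1) ≤ (l + |(p : ℝ)|) * (l + |(p : ℝ)| + 1) := by
    rcases le_or_gt 0 (l + (p : ℝ) + 1) with h | h
    · exact mul_le_mul (by linarith) (by linarith) h (by linarith)
    · have : (0 : ℝ) ≤ (l + |(p : ℝ)|) * (l + |(p : ℝ)| + 1) := by positivity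
      nlinarith
  nlinarith [mul_nonneg h1 h4, mul_nonneg (mul_nonneg h1 h4) h4, mul_nonneg h1 h1,
    mul_nonneg (mul_nonneg h1 h1) h4]

theorem RapidDecay.ladder_mul {c : ℕ → ℤ → ℂ} (hc : RapidDecay c) (p : ℤ) :
    RapidDecay (fun l m => (ladder p l : ℂ) * c l m) :=
  hc.of_le (|(p : ℝ)| + 1) 1 fun l m _ => by
    rw [norm_mul, Complex.norm_real, Real.norm_eq_abs, abs_of_nonneg (ladder_nonneg p l), pow_one]
    exact mul_le_mul_of_nonneg_right (ladder_le p l) (norm_nonneg _)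

/-- A summable majorant on the set of all `(l, m)`. -/
def multipoleWeight (x : ℕ × ℤ) : ℝ := (((x.1 : ℝ) + 1) ^ 2)⁻¹ * ((|(x.2 : ℝ)| + 1) ^ 2)⁻¹

theorem multipoleWeight_nonneg (x : ℕ × ℤ) : 0 ≤ multipoleWeight x := by
  unfold multipoleWeight; positivity

theorem summable_multipoleWeight : Summable multipoleWeight := by
  have h1 : Summable fun n : ℕ => (((n : ℝ) + 1) ^ 2)⁻¹ := by
    have := (summable_nat_add_iff 1).2 (Real.summable_nat_pow_inv.2 (by norm_num : 1 < 2))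
    simpa using this
  have h2 : Summable fun n : ℤ => ((|(n : ℝ)| + 1) ^ 2)⁻¹ := by
    refine Summable.of_nat_of_neg ?_ ?_
    · simpa using h1
    · simpa using h1
  exact h1.mul_of_nonneg h2 (fun _ => by positivity) (fun _ => by positivity)

theorem RapidDecay.exists_bound {c : ℕ → ℤ → ℂ} (hc : RapidDecay c) :
    ∃ C : ℝ, 0 ≤ C ∧ ∀ (l : ℕ) (m : ℤ), |m| ≤ (l : ℤ) →
      ‖c l m‖ * ((l : ℝ) + 1) ≤ C * multipoleWeight (l, m) := by
  -- One power pays for the bound `l + 1` of the harmonics, two make the sum over `l` converge, and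
  -- two are exchanged by `|m| ≤ l` for convergence of the sum over `m`.
  obtain ⟨C, hC⟩ := hc 5
  refine ⟨|C|, abs_nonneg C, fun l m hm => ?_⟩
  have hm' : |(m : ℝ)| + 1 ≤ l + 1 := by
    have : (|m| : ℝ) ≤ l := by exact_mod_cast hm
    linarith
  have h1 : ‖c l m‖ * ((l : ℝ) + 1) = ‖c l m‖ * ((l : ℝ) + 1) ^ 5
      * ((((l : ℝ) + 1) ^ 2)⁻¹ * (((l : ℝ) + 1) ^ 2)⁻¹) := by
    have : (l : ℝ) + 1 ≠ 0 := by positivity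
    field_simp
  rw [h1, multipoleWeight]
  refine mul_le_mul ((hC l m hm).trans (le_abs_self C)) ?_ (by positivity) (abs_nonneg C)
  gcongr

theorem homY_eq_zero {p : ℤ} {l : ℕ} {m : ℤ} (h : ¬|m| ≤ (l : ℤ)) (q : ℂ × ℂ) :
    homY p l m q = 0 := by
  rw [homY, spinorY_of_not fun h' => h h'.2, zero_mul]

theorem RapidDecay.exists_homY_bound {c : ℕ → ℤ → ℂ} (hc : RapidDecay c) (p : ℤ) :
    ∃ C : ℝ, 0 ≤ C ∧ ∀ (x : ℕ × ℤ) (q : ℂ × ℂ), q ≠ 0 →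
      ‖c x.1 x.2 * homY p x.1 x.2 q‖ ≤ C * multipoleWeight x := by
  obtain ⟨C, hC0, hC⟩ := hc.exists_bound
  refine ⟨C, hC0, fun x q hq => ?_⟩
  by_cases h : |x.2| ≤ (x.1 : ℤ)
  · rw [norm_mul]
    exact (mul_le_mul_of_nonneg_left (norm_homY_le _ _ _ hq) (norm_nonneg _)).trans (hC _ _ h)
  · rw [homY_eq_zero h, mul_zero, norm_zero]
    exact mul_nonneg hC0 (multipoleWeight_nonneg x)

/-- The superposition of the extended harmonics of spin weight `p` with coefficients `c`. -/
def homSynth (p : ℤ) (c : ℕ → ℤ → ℂ) (q : ℂ × ℂ) : ℂ :=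
  ∑' x : ℕ × ℤ, c x.1 x.2 * homY p x.1 x.2 q

theorem RapidDecay.summable_homY {c : ℕ → ℤ → ℂ} (hc : RapidDecay c) (p : ℤ) {q : ℂ × ℂ}
    (hq : q ≠ 0) : Summable fun x : ℕ × ℤ => c x.1 x.2 * homY p x.1 x.2 q := by
  obtain ⟨C, -, hC⟩ := hc.exists_homY_bound p
  exact Summable.of_norm_bounded (summable_multipoleWeight.mul_left C) fun x => hC x q hq

/-- Termwise differentiation is allowed on a small ball around `q`: the three forms are bounded
there, and the ladder factors do not destroy rapid decay. The result is again made of superpositions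
of the same type. -/
theorem RapidDecay.hasFDerivAt_homSynth {c : ℕ → ℤ → ℂ} (hc : RapidDecay c) (p : ℤ) {q : ℂ × ℂ}
    (hq : q ≠ 0) :
    HasFDerivAt (homSynth p c)
      ((homSynth (p - 1) (fun l m => (ladder (p - 1) l : ℂ) * c l m) q) • lowerForm q
        - (homSynth (p + 1) (fun l m => (ladder p l : ℂ) * c l m) q) • raiseForm q
        + ((p : ℂ) * homSynth p c q) • gaugeForm q) q := by
  obtain ⟨C₁, hC₁0, hC₁⟩ := (hc.ladder_mul (p - 1)).exists_homY_bound (p - 1)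
  obtain ⟨C₂, hC₂0, hC₂⟩ := (hc.ladder_mul p).exists_homY_bound (p + 1)
  obtain ⟨C₃, hC₃0, hC₃⟩ := (hc.const_mul p).exists_homY_bound p
  have hev : ∀ᶠ x in nhds q, x ≠ 0 ∧ ‖lowerForm x‖ < ‖lowerForm q‖ + 1 ∧
      ‖raiseForm x‖ < ‖raiseForm q‖ + 1 ∧ ‖gaugeForm x‖ < ‖gaugeForm q‖ + 1 := by
    refine Filter.Eventually.and (isOpen_ne.mem_nhds hq) (Filter.Eventually.and ?_
      (Filter.Eventually.and ?_ ?_))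
    · exact (contDiffAt_lowerForm hq).continuousAt.norm.eventually_lt_const (lt_add_one _)
    · exact (contDiffAt_raiseForm hq).continuousAt.norm.eventually_lt_const (lt_add_one _)
    · exact (contDiffAt_gaugeForm hq).continuousAt.norm.eventually_lt_const (lt_add_one _)
  obtain ⟨ε, hε, hball⟩ := Metric.eventually_nhds_iff_ball.1 hev
  set f' : ℕ × ℤ → ℂ × ℂ → (ℂ × ℂ →L[ℝ] ℂ) := fun x q =>
    ((ladder (p - 1) x.1 : ℂ) * c x.1 x.2 * homY (p - 1) x.1 x.2 q) • lowerForm q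
      - ((ladder p x.1 : ℂ) * c x.1 x.2 * homY (p + 1) x.1 x.2 q) • raiseForm q
      + ((p : ℂ) * c x.1 x.2 * homY p x.1 x.2 q) • gaugeForm q with hf'
  have key := hasFDerivAt_tsum_of_isPreconnected
    (f := fun x : ℕ × ℤ => fun q => c x.1 x.2 * homY p x.1 x.2 q) (f' := f')
    (u := fun x => (C₁ * multipoleWeight x) * (‖lowerForm q‖ + 1)
      + (C₂ * multipoleWeight x) * (‖raiseForm q‖ + 1)
      + (C₃ * multipoleWeight x) * (‖gaugeForm q‖ + 1))
    ((((summable_multipoleWeight.mul_left C₁).mul_right _).add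
      ((summable_multipoleWeight.mul_left C₂).mul_right _)).add
      ((summable_multipoleWeight.mul_left C₃).mul_right _))
    (s := Metric.ball q ε) Metric.isOpen_ball (convex_ball q ε).isPreconnected
    (fun x y hy => ?_) (fun x y hy => ?_) (Metric.mem_ball_self hε)
    (hc.summable_homY p hq) (Metric.mem_ball_self hε)
  · refine HasFDerivAt.congr_fderiv key ?_
    have h1 := ((hc.ladder_mul (p - 1)).summable_homY (p - 1) hq).hasSum.smul_const (lowerForm q)
    have h2 := ((hc.ladder_mul p).summable_homY (p + 1) hq).hasSum.smul_const (raiseForm q)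
    have h3 := ((hc.summable_homY p hq).hasSum.mul_left (p : ℂ)).smul_const (gaugeForm q)
    have h := ((h1.sub h2).add h3).tsum_eq
    rw [homSynth, homSynth, homSynth, ← h]
    refine tsum_congr fun x => ?_
    simp only [hf', mul_assoc]
  · refine ((hasFDerivAt_homY p x.1 x.2 (hball y hy).1).const_mul (c x.1 x.2)).congr_fderiv ?_
    simp only [hf', smul_add, smul_sub, smul_smul, mul_comm (c x.1 x.2), mul_right_comm _ (c x.1 x.2)]
  · obtain ⟨hy0, h1, h2, h3⟩ := hball y hy
    refine (norm_add_le _ _).trans (add_le_add ((norm_sub_le _ _).trans (add_le_add ?_ ?_)) ?_)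
    · rw [norm_smul]
      exact mul_le_mul (hC₁ x y hy0) h1.le (norm_nonneg _)
        (mul_nonneg hC₁0 (multipoleWeight_nonneg x))
    · rw [norm_smul]
      exact mul_le_mul (hC₂ x y hy0) h2.le (norm_nonneg _)
        (mul_nonneg hC₂0 (multipoleWeight_nonneg x))
    · rw [norm_smul]
      exact mul_le_mul (hC₃ x y hy0) h3.le (norm_nonneg _)
        (mul_nonneg hC₃0 (multipoleWeight_nonneg x))

/-- The differential is a combination of smooth forms with coefficients of the same kind as the
function itself, for other spin weights and other rapidly decreasing moments. Hence the induction
must range over all weights and all families at once. -/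
theorem RapidDecay.contDiffOn_homSynth (N : ℕ) : ∀ {c : ℕ → ℤ → ℂ}, RapidDecay c → ∀ p : ℤ,
    ContDiffOn ℝ N (homSynth p c) {0}ᶜ := by
  induction N with
  | zero =>
    intro c hc p
    refine contDiffOn_zero.2 fun q hq => ?_
    exact (hc.hasFDerivAt_homSynth p hq).continuousAt.continuousWithinAt
  | succ N ih =>
    intro c hc p
    have ho : IsOpen ({0}ᶜ : Set (ℂ × ℂ)) := isOpen_compl_singleton
    push_cast
    refine (contDiffOn_succ_iff_fderiv_of_isOpen ho).2 ⟨fun q hq =>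
      (hc.hasFDerivAt_homSynth p hq).differentiableAt.differentiableWithinAt, by simp, ?_⟩
    have hsm : ∀ {L : ℂ × ℂ → (ℂ × ℂ →L[ℝ] ℂ)}, (∀ {q}, q ≠ 0 → ContDiffAt ℝ ∞ L q) →
        ContDiffOn ℝ N L {0}ᶜ := fun h q hq =>
      ((h hq).of_le (by exact_mod_cast le_top)).contDiffWithinAt
    refine ContDiffOn.congr (f := fun q =>
      (homSynth (p - 1) (fun l m => (ladder (p - 1) l : ℂ) * c l m) q) • lowerForm q
        - (homSynth (p + 1) (fun l m => (ladder p l : ℂ) * c l m) q) • raiseForm q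
        + ((p : ℂ) * homSynth p c q) • gaugeForm q) ?_ fun q hq =>
      (hc.hasFDerivAt_homSynth p hq).fderiv
    exact (((ih (hc.ladder_mul _) _).smul (hsm contDiffAt_lowerForm)).sub
      ((ih (hc.ladder_mul _) _).smul (hsm contDiffAt_raiseForm))).add
      ((contDiffOn_const.mul (ih hc p)).smul (hsm contDiffAt_gaugeForm))

theorem HasSpinWeight.homSynth (p : ℤ) (c : ℕ → ℤ → ℂ) : HasSpinWeight p (homSynth p c) := by
  intro ψ q
  have hn : normSqPair (Complex.exp (Complex.I * ψ) • q) = normSqPair q := by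
    have : Complex.normSq (Complex.exp (Complex.I * ψ)) = 1 := by
      rw [Complex.normSq_eq_norm_sq, mul_comm, Complex.norm_exp_ofReal_mul_I, one_pow]
    simp [normSqPair, this]
  rw [ZRM.homSynth, ZRM.homSynth, ← tsum_mul_left]
  refine tsum_congr fun x => ?_
  rw [homY, homY, hn, hasSpinWeight_spinorY]
  ring

/-- The superposition of the harmonics of spin weight `p` with coefficients `c`. -/
def synth (p : ℤ) (c : ℕ → ℤ → ℂ) (θ ϕ : ℝ) : ℂ := homSynth p c (spinor θ ϕ)

theorem spinor_ne_zero (θ ϕ : ℝ) : spinor θ ϕ ≠ 0 := by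
  intro h
  have := normSqPair_spinor θ ϕ
  rw [h] at this
  simp [normSqPair] at this

theorem RapidDecay.hasSum_synth {c : ℕ → ℤ → ℂ} (hc : RapidDecay c) (p : ℤ) (θ ϕ : ℝ) :
    HasSum (fun x : ℕ × ℤ => c x.1 x.2 * spinorY p x.1 x.2 (spinor θ ϕ)) (synth p c θ ϕ) := by
  have : HasSum _ (synth p c θ ϕ) := (hc.summable_homY p (spinor_ne_zero θ ϕ)).hasSum
  simpa only [homY_of_unit _ _ _ (normSqPair_spinor θ ϕ)] using this

/-- Superpositions of harmonics with rapidly decreasing coefficients are smooth. -/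
theorem RapidDecay.smoothWeighted_synth {c : ℕ → ℤ → ℂ} (hc : RapidDecay c) (p : ℤ) :
    SmoothWeighted p (synth p c) := by
  -- The extension of degree zero is in general singular at the origin. The cutoff is invariant
  -- under phases, equals one where the squared norm is at least one, and vanishes where it is at
  -- most one half, so unit spinors are unaffected.
  set χ : ℂ × ℂ → ℂ := fun q => ((Real.smoothTransition (2 * normSqPair q - 1) : ℝ) : ℂ) with hχ
  have hχs : ContDiff ℝ ∞ χ := Complex.ofRealCLM.contDiff.comp
    (Real.smoothTransition.contDiff.comp
      ((contDiff_const.mul contDiff_normSqPair).sub contDiff_const))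
  refine ⟨fun q => χ q * homSynth p c q, ?_, fun ψ q => ?_, fun θ _ ϕ => ?_⟩
  · refine contDiff_infty.2 fun N => contDiff_iff_contDiffAt.2 fun q => ?_
    by_cases hq : q = 0
    · subst hq
      refine (contDiffAt_const (c := (0 : ℂ))).congr_of_eventuallyEq ?_
      have h0 : normSqPair 0 < 1 / 2 := by simp [normSqPair]
      filter_upwards [contDiff_normSqPair.continuous.continuousAt.eventually_lt_const h0] with q hq
      simp only [hχ]
      rw [Real.smoothTransition.zero_of_nonpos (by linarith)]
      simp
    · exact (hχs.contDiffAt.of_le (by exact_mod_cast le_top)).mul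
        ((contDiffOn_homSynth N hc p).contDiffAt (isOpen_compl_singleton.mem_nhds hq))
  · have hn : normSqPair (Complex.exp (Complex.I * ψ) • q) = normSqPair q := by
      have : Complex.normSq (Complex.exp (Complex.I * ψ)) = 1 := by
        rw [Complex.normSq_eq_norm_sq, mul_comm, Complex.norm_exp_ofReal_mul_I, one_pow]
      simp [normSqPair, this]
    simp only [hχ, hn, HasSpinWeight.homSynth p c ψ q]
    ring
  · simp only [hχ, normSqPair_spinor, synth]
    rw [Real.smoothTransition.one_of_one_le (by norm_num)]
    simp

end ZRM

/-! ### Integration over the sphere -/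

namespace ZRM

open MeasureTheory

/-- The coordinate rectangle of the sphere, with Lebesgue measure. -/
def chartMeasure : Measure (ℝ × ℝ) :=
  (volume.restrict (Set.Ioo (0 : ℝ) Real.pi)).prod (volume.restrict (Set.Ioc 0 (2 * Real.pi)))

instance : IsFiniteMeasure chartMeasure := by unfold chartMeasure; infer_instance

/-- The integral over the unit sphere. -/
def sphInt (g : ℝ → ℝ → ℂ) : ℂ := ∫ x, g x.1 x.2 * (Real.sin x.1 : ℂ) ∂chartMeasure

/-- Functions on the sphere without poles which are given by continuous functions of the
coordinates. -/
def ChartContinuous (g : ℝ → ℝ → ℂ) : Prop :=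
  ∃ h : ℝ × ℝ → ℂ, Continuous h ∧ ∀ θ ∈ Set.Ioo (0 : ℝ) Real.pi, ∀ ϕ, g θ ϕ = h (θ, ϕ)

theorem chartMeasure_eq : chartMeasure
    = (volume : Measure (ℝ × ℝ)).restrict (Set.Ioo (0 : ℝ) Real.pi ×ˢ Set.Ioc 0 (2 * Real.pi)) := by
  rw [chartMeasure, Measure.prod_restrict, Measure.volume_eq_prod]

theorem ae_chartMeasure_mem : ∀ᵐ x ∂chartMeasure, x.1 ∈ Set.Ioo (0 : ℝ) Real.pi := by
  rw [chartMeasure_eq]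
  filter_upwards [ae_restrict_mem (measurableSet_Ioo.prod measurableSet_Ioc)] with x hx using hx.1

theorem integrable_of_continuous {h : ℝ × ℝ → ℂ} (hh : Continuous h) :
    Integrable h chartMeasure := by
  rw [chartMeasure_eq]
  refine (hh.continuousOn.integrableOn_compact
    (isCompact_Icc.prod isCompact_Icc (s := Set.Icc (0 : ℝ) Real.pi)
      (t := Set.Icc (0 : ℝ) (2 * Real.pi)))).mono_set ?_
  exact Set.prod_mono Set.Ioo_subset_Icc_self Set.Ioc_subset_Icc_self

theorem ChartContinuous.integrable {g : ℝ → ℝ → ℂ} (hg : ChartContinuous g) :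
    Integrable (fun x : ℝ × ℝ => g x.1 x.2 * (Real.sin x.1 : ℂ)) chartMeasure := by
  obtain ⟨h, hh, he⟩ := hg
  refine (integrable_of_continuous (h := fun x => h x * (Real.sin x.1 : ℂ))
    (by fun_prop)).congr ?_
  filter_upwards [ae_chartMeasure_mem] with x hx
  rw [he _ hx]

theorem sphInt_congr {g h : ℝ → ℝ → ℂ}
    (e : ∀ θ ∈ Set.Ioo (0 : ℝ) Real.pi, ∀ ϕ, g θ ϕ = h θ ϕ) : sphInt g = sphInt h := by
  refine integral_congr_ae ?_
  filter_upwards [ae_chartMeasure_mem] with x hx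
  rw [e _ hx]

theorem sphInt_eq {g : ℝ → ℝ → ℂ} (hg : ChartContinuous g) :
    sphInt g = ∫ θ in (0 : ℝ)..Real.pi, ∫ ϕ in (0 : ℝ)..(2 * Real.pi),
      g θ ϕ * (Real.sin θ : ℂ) := by
  rw [sphInt, chartMeasure, integral_prod _ hg.integrable,
    intervalIntegral.integral_of_le Real.pi_pos.le, integral_Ioc_eq_integral_Ioo]
  simp only [intervalIntegral.integral_of_le Real.two_pi_pos.le]

theorem sphInt_add {g h : ℝ → ℝ → ℂ} (hg : ChartContinuous g) (hh : ChartContinuous h) :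
    sphInt (fun θ ϕ => g θ ϕ + h θ ϕ) = sphInt g + sphInt h := by
  rw [sphInt, sphInt, sphInt, ← integral_add hg.integrable hh.integrable]
  simp only [add_mul]

theorem sphInt_const_mul (c : ℂ) (g : ℝ → ℝ → ℂ) :
    sphInt (fun θ ϕ => c * g θ ϕ) = c * sphInt g := by
  rw [sphInt, sphInt, ← integral_const_mul]
  simp only [mul_assoc]

theorem norm_sphInt_le {g : ℝ → ℝ → ℂ} {B : ℝ}
    (hB : ∀ θ ∈ Set.Ioo (0 : ℝ) Real.pi, ∀ ϕ, ‖g θ ϕ‖ ≤ B) :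
    ‖sphInt g‖ ≤ B * chartMeasure.real Set.univ := by
  refine norm_integral_le_of_norm_le_const ?_
  filter_upwards [ae_chartMeasure_mem] with x hx
  have hs : |Real.sin x.1| ≤ 1 := Real.abs_sin_le_one _
  rw [norm_mul, Complex.norm_real, Real.norm_eq_abs]
  exact (mul_le_of_le_one_right (norm_nonneg _) hs).trans (hB _ hx _)

theorem contDiff_spinor : ContDiff ℝ ∞ (fun x : ℝ × ℝ => spinor x.1 x.2) := by
  unfold spinor
  have hre : ContDiff ℝ ∞ (fun x : ℝ => (x : ℂ)) := Complex.ofRealCLM.contDiff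
  have h1 : ContDiff ℝ ∞ (fun x : ℝ × ℝ => Complex.I * ((x.2 : ℂ) / 2)) :=
    contDiff_const.mul ((hre.comp contDiff_snd).div_const 2)
  exact ((hre.comp (Real.contDiff_cos.comp (contDiff_fst.div_const 2))).mul h1.cexp).prodMk
    ((hre.comp (Real.contDiff_sin.comp (contDiff_fst.div_const 2))).mul h1.neg.cexp)

theorem continuous_spinor : Continuous (fun x : ℝ × ℝ => spinor x.1 x.2) :=
  contDiff_spinor.continuous

theorem spinor_add_two_pi (θ ϕ : ℝ) :
    spinor θ (ϕ + 2 * Real.pi) = Complex.exp (Complex.I * (Real.pi : ℝ)) • spinor θ ϕ := by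
  have e : Complex.exp (Complex.I * (Real.pi : ℝ)) = -1 := by
    rw [mul_comm]; exact Complex.exp_pi_mul_I
  have e' : Complex.exp (-(Complex.I * (Real.pi : ℝ))) = -1 := by
    rw [Complex.exp_neg, e]; norm_num
  have h1 : Complex.I * (((ϕ + 2 * Real.pi : ℝ) : ℂ) / 2)
      = Complex.I * ((ϕ : ℂ) / 2) + Complex.I * (Real.pi : ℝ) := by push_cast; ring
  rw [spinor, spinor, h1, neg_add, Complex.exp_add, Complex.exp_add, e, e']
  simp

/-- The spinor itself changes sign after a full turn; an integral spin weight does not see the sign.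
-/
theorem HasSpinWeight.spinor_add_two_pi {p : ℤ} {H : ℂ × ℂ → ℂ} (hw : HasSpinWeight p H)
    (θ ϕ : ℝ) : H (spinor θ (ϕ + 2 * Real.pi)) = H (spinor θ ϕ) := by
  rw [ZRM.spinor_add_two_pi, hw]
  have : 2 * Complex.I * p * (Real.pi : ℝ) = p * (2 * Real.pi * Complex.I) := by ring
  rw [this, Complex.exp_int_mul_two_pi_mul_I, one_mul]

theorem SmoothWeighted.chartContinuous {p : ℤ} {g : ℝ → ℝ → ℂ} (hg : SmoothWeighted p g) :
    ChartContinuous g := by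
  obtain ⟨H, h1, -, h3⟩ := hg
  exact ⟨fun x => H (spinor x.1 x.2), h1.continuous.comp continuous_spinor, h3⟩

theorem SmoothWeighted.exists_bound {p : ℤ} {g : ℝ → ℝ → ℂ} (hg : SmoothWeighted p g) :
    ∃ B : ℝ, 0 ≤ B ∧ ∀ θ ∈ Set.Ioo (0 : ℝ) Real.pi, ∀ ϕ, ‖g θ ϕ‖ ≤ B := by
  obtain ⟨H, h1, hw, h3⟩ := hg
  have hc : IsCompact {q : ℂ × ℂ | normSqPair q = 1} := by
    refine Metric.isCompact_of_isClosed_isBounded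
      (isClosed_eq contDiff_normSqPair.continuous continuous_const) ?_
    refine (Metric.isBounded_closedBall (x := (0 : ℂ × ℂ)) (r := 1)).subset fun q hq => ?_
    have hq' : ‖q.1‖ ^ 2 + ‖q.2‖ ^ 2 = 1 := by
      simpa [normSqPair, Complex.normSq_eq_norm_sq] using hq
    rw [mem_closedBall_zero_iff, Prod.norm_def, max_le_iff]
    constructor
    · nlinarith [norm_nonneg q.1, sq_nonneg ‖q.2‖]
    · nlinarith [norm_nonneg q.2, sq_nonneg ‖q.1‖]
  obtain ⟨B, hB⟩ := hc.exists_bound_of_continuousOn h1.continuous.continuousOn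
  exact ⟨|B|, abs_nonneg B, fun θ hθ ϕ => by
    rw [h3 θ hθ]
    exact (hB _ (normSqPair_spinor θ ϕ)).trans (le_abs_self B)⟩

theorem SmoothWeighted.hasDerivAt_left {p : ℤ} {g : ℝ → ℝ → ℂ} (hg : SmoothWeighted p g) {θ : ℝ}
    (hθ : θ ∈ Set.Ioo (0 : ℝ) Real.pi) (ϕ : ℝ) : DifferentiableAt ℝ (fun t => g t ϕ) θ := by
  obtain ⟨H, h1, -, h3⟩ := hg
  have h := (h1.differentiable (by simp) (spinor θ ϕ)).hasFDerivAt.comp_hasDerivAt θ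
    (hasDerivAt_spinor_left θ ϕ)
  refine (h.congr_of_eventuallyEq ?_).differentiableAt
  filter_upwards [isOpen_Ioo.mem_nhds hθ] with t ht using h3 t ht ϕ

theorem SmoothWeighted.hasDerivAt_right {p : ℤ} {g : ℝ → ℝ → ℂ} (hg : SmoothWeighted p g) {θ : ℝ}
    (hθ : θ ∈ Set.Ioo (0 : ℝ) Real.pi) (ϕ : ℝ) : DifferentiableAt ℝ (fun t => g θ t) ϕ := by
  obtain ⟨H, h1, -, h3⟩ := hg
  have h := (h1.differentiable (by simp) (spinor θ ϕ)).hasFDerivAt.comp_hasDerivAt ϕ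
    (hasDerivAt_spinor_right θ ϕ)
  exact (h.congr_of_eventuallyEq
    (Filter.Eventually.of_forall fun t => h3 θ hθ t)).differentiableAt

/-- The divergence theorem on the sphere, for the vector field `g ∂_θ`. -/
theorem integral_divergence_left {h : ℝ × ℝ → ℂ} (hh : ContDiff ℝ ∞ h) :
    (∫ θ in (0 : ℝ)..Real.pi, ∫ ϕ in (0 : ℝ)..(2 * Real.pi),
      (fderiv ℝ h (θ, ϕ) (1, 0) * (Real.sin θ : ℂ) + h (θ, ϕ) * (Real.cos θ : ℂ))) = 0 := by
  have hc : Continuous fun x : ℝ × ℝ => fderiv ℝ h x (1, 0) :=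
    (hh.continuous_fderiv (by simp)).clm_apply continuous_const
  have hcont : Continuous fun x : ℝ × ℝ =>
      fderiv ℝ h x (1, 0) * (Real.sin x.1 : ℂ) + h x * (Real.cos x.1 : ℂ) := by
    have := hh.continuous
    fun_prop
  rw [intervalIntegral_intervalIntegral_swap]
  · refine intervalIntegral.integral_zero_ae (Filter.Eventually.of_forall fun ϕ _ => ?_)
    have hd : ∀ θ : ℝ, HasDerivAt (fun θ : ℝ => h (θ, ϕ) * (Real.sin θ : ℂ))
        (fderiv ℝ h (θ, ϕ) (1, 0) * (Real.sin θ : ℂ) + h (θ, ϕ) * (Real.cos θ : ℂ)) θ := by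
      intro θ
      have h1 : HasDerivAt (fun θ : ℝ => h (θ, ϕ)) (fderiv ℝ h (θ, ϕ) (1, 0)) θ :=
        HasFDerivAt.comp_hasDerivAt (f := fun t : ℝ => (t, ϕ)) θ
          (hh.differentiable (by simp) (θ, ϕ)).hasFDerivAt
          ((hasDerivAt_id θ).prodMk (hasDerivAt_const θ ϕ))
      exact h1.mul (Real.hasDerivAt_sin θ).ofReal_comp
    rw [intervalIntegral.integral_eq_sub_of_hasDerivAt (fun θ _ => hd θ)
      ((hcont.comp (continuous_id.prodMk continuous_const)).intervalIntegrable _ _)]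
    simp
  · rw [Set.uIoc_of_le Real.pi_pos.le, Set.uIoc_of_le Real.two_pi_pos.le]
    refine (hcont.continuousOn.integrableOn_compact
      (isCompact_Icc.prod isCompact_Icc (s := Set.Icc (0 : ℝ) Real.pi)
        (t := Set.Icc (0 : ℝ) (2 * Real.pi)))).mono_set ?_
    exact Set.prod_mono Set.Ioc_subset_Icc_self Set.Ioc_subset_Icc_self

theorem integral_divergence_right {h : ℝ × ℝ → ℂ} (hh : ContDiff ℝ ∞ h)
    (hp : ∀ θ, h (θ, 2 * Real.pi) = h (θ, 0)) :
    (∫ θ in (0 : ℝ)..Real.pi, ∫ ϕ in (0 : ℝ)..(2 * Real.pi), fderiv ℝ h (θ, ϕ) (0, 1)) = 0 := by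
  have hc : Continuous fun x : ℝ × ℝ => fderiv ℝ h x (0, 1) :=
    (hh.continuous_fderiv (by simp)).clm_apply continuous_const
  refine intervalIntegral.integral_zero_ae (Filter.Eventually.of_forall fun θ _ => ?_)
  have hd : ∀ ϕ : ℝ, HasDerivAt (fun ϕ : ℝ => h (θ, ϕ)) (fderiv ℝ h (θ, ϕ) (0, 1)) ϕ := fun ϕ =>
    HasFDerivAt.comp_hasDerivAt (f := fun t : ℝ => (θ, t)) ϕ
      (hh.differentiable (by simp) (θ, ϕ)).hasFDerivAt
      ((hasDerivAt_const ϕ θ).prodMk (hasDerivAt_id ϕ))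
  rw [intervalIntegral.integral_eq_sub_of_hasDerivAt (fun ϕ _ => hd ϕ)
    ((hc.comp (continuous_const.prodMk continuous_id)).intervalIntegrable _ _), hp, sub_self]

/-- The integral of a total derivative vanishes. -/
theorem sphInt_divergence {p : ℤ} {g : ℝ → ℝ → ℂ} (hg : SmoothWeighted p g) (a b : ℂ) :
    sphInt (fun θ ϕ => a * (deriv (fun t => g t ϕ) θ
        + ((Real.cos θ / Real.sin θ : ℝ) : ℂ) * g θ ϕ)
      + b / (Real.sin θ : ℂ) * deriv (fun t => g θ t) ϕ) = 0 := by
  obtain ⟨H, h1, hw, h3⟩ := hg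
  set h : ℝ × ℝ → ℂ := fun x => H (spinor x.1 x.2) with hdef
  have hh : ContDiff ℝ ∞ h := h1.comp contDiff_spinor
  have hp : ∀ θ, h (θ, 2 * Real.pi) = h (θ, 0) := fun θ => by
    have := hw.spinor_add_two_pi θ 0
    rwa [zero_add] at this
  have hc1 : Continuous fun x : ℝ × ℝ => fderiv ℝ h x (1, 0) :=
    (hh.continuous_fderiv (by simp)).clm_apply continuous_const
  have hc2 : Continuous fun x : ℝ × ℝ => fderiv ℝ h x (0, 1) :=
    (hh.continuous_fderiv (by simp)).clm_apply continuous_const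
  have hc0 := hh.continuous
  have e : ∀ θ ∈ Set.Ioo (0 : ℝ) Real.pi, ∀ ϕ, (a * (deriv (fun t => g t ϕ) θ
        + ((Real.cos θ / Real.sin θ : ℝ) : ℂ) * g θ ϕ)
      + b / (Real.sin θ : ℂ) * deriv (fun t => g θ t) ϕ) * (Real.sin θ : ℂ)
      = a * (fderiv ℝ h (θ, ϕ) (1, 0) * (Real.sin θ : ℂ) + h (θ, ϕ) * (Real.cos θ : ℂ))
        + b * fderiv ℝ h (θ, ϕ) (0, 1) := by
    intro θ hθ ϕ
    have hs : (Real.sin θ : ℂ) ≠ 0 := by exact_mod_cast (Real.sin_pos_of_mem_Ioo hθ).ne'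
    have d1 : HasDerivAt (fun θ : ℝ => h (θ, ϕ)) (fderiv ℝ h (θ, ϕ) (1, 0)) θ :=
      HasFDerivAt.comp_hasDerivAt (f := fun t : ℝ => (t, ϕ)) θ
        (hh.differentiable (by simp) (θ, ϕ)).hasFDerivAt
        ((hasDerivAt_id θ).prodMk (hasDerivAt_const θ ϕ))
    have d2 : HasDerivAt (fun ϕ : ℝ => h (θ, ϕ)) (fderiv ℝ h (θ, ϕ) (0, 1)) ϕ :=
      HasFDerivAt.comp_hasDerivAt (f := fun t : ℝ => (θ, t)) ϕ
        (hh.differentiable (by simp) (θ, ϕ)).hasFDerivAt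
        ((hasDerivAt_const ϕ θ).prodMk (hasDerivAt_id ϕ))
    have d1' : deriv (fun t => g t ϕ) θ = fderiv ℝ h (θ, ϕ) (1, 0) := by
      rw [← d1.deriv]
      refine Filter.EventuallyEq.deriv_eq ?_
      filter_upwards [isOpen_Ioo.mem_nhds hθ] with t ht using h3 t ht ϕ
    have d2' : deriv (fun t => g θ t) ϕ = fderiv ℝ h (θ, ϕ) (0, 1) := by
      rw [← d2.deriv]
      exact congrArg (fun f => deriv f ϕ) (funext fun t => h3 θ hθ t)
    rw [d1', d2', h3 θ hθ]
    push_cast at *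
    field_simp
    simp only [hdef]
  have key : sphInt (fun θ ϕ => a * (deriv (fun t => g t ϕ) θ
        + ((Real.cos θ / Real.sin θ : ℝ) : ℂ) * g θ ϕ)
      + b / (Real.sin θ : ℂ) * deriv (fun t => g θ t) ϕ)
      = ∫ x, (a * (fderiv ℝ h x (1, 0) * (Real.sin x.1 : ℂ) + h x * (Real.cos x.1 : ℂ))
        + b * fderiv ℝ h x (0, 1)) ∂chartMeasure := by
    refine integral_congr_ae ?_
    filter_upwards [ae_chartMeasure_mem] with x hx using e x.1 hx x.2
  have hi1 : Integrable (fun x : ℝ × ℝ => fderiv ℝ h x (1, 0) * (Real.sin x.1 : ℂ)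
      + h x * (Real.cos x.1 : ℂ)) chartMeasure := integrable_of_continuous (by fun_prop)
  have hi2 : Integrable (fun x : ℝ × ℝ => fderiv ℝ h x (0, 1)) chartMeasure :=
    integrable_of_continuous hc2
  rw [key, integral_add (hi1.const_mul a) (hi2.const_mul b), integral_const_mul,
    integral_const_mul]
  have z1 := integral_divergence_left hh
  have z2 := integral_divergence_right hh hp
  rw [intervalIntegral.integral_of_le Real.pi_pos.le, integral_Ioc_eq_integral_Ioo] at z1 z2
  simp only [intervalIntegral.integral_of_le Real.two_pi_pos.le] at z1 z2
  unfold chartMeasure at *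
  rw [integral_prod _ hi1, integral_prod _ hi2, z1, z2]
  simp

end ZRM

/-! ### Multipole moments -/

namespace ZRM

open MeasureTheory

theorem smoothWeighted_spinorY (p : ℤ) (l : ℕ) (m : ℤ) :
    SmoothWeighted p (fun θ ϕ => spinorY p l m (spinor θ ϕ)) :=
  ⟨spinorY p l m, contDiff_spinorY p l m, hasSpinWeight_spinorY p l m, fun _ _ _ => rfl⟩

theorem SmoothWeighted.mul_conj {p r : ℤ} {f g : ℝ → ℝ → ℂ} (hf : SmoothWeighted p f)
    (hg : SmoothWeighted r g) :
    SmoothWeighted (p - r) (fun θ ϕ => f θ ϕ * (starRingEnd ℂ) (g θ ϕ)) := by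
  rw [sub_eq_add_neg]
  exact hf.mul hg.conj

theorem multipole_eq {p : ℤ} {f : ℝ → ℝ → ℂ} (hf : SmoothWeighted p f) (l : ℕ) (m : ℤ) :
    multipole p l m f
      = sphInt (fun θ ϕ => f θ ϕ * (starRingEnd ℂ) (spinorY p l m (spinor θ ϕ))) := by
  rw [sphInt_eq (hf.mul_conj (smoothWeighted_spinorY p l m)).chartContinuous, multipole,
    intervalIntegral.integral_of_le Real.pi_pos.le, intervalIntegral.integral_of_le Real.pi_pos.le,
    integral_Ioc_eq_integral_Ioo, integral_Ioc_eq_integral_Ioo]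
  refine setIntegral_congr_fun measurableSet_Ioo fun θ hθ => ?_
  simp only [spinY_eq p l m hθ]

theorem sphInt_conj (g : ℝ → ℝ → ℂ) :
    sphInt (fun θ ϕ => (starRingEnd ℂ) (g θ ϕ)) = (starRingEnd ℂ) (sphInt g) := by
  rw [sphInt, sphInt, ← integral_conj]
  simp only [map_mul, Complex.conj_ofReal]

theorem eth_mul_conj {p : ℤ} {f g : ℝ → ℝ → ℂ} (hf : SmoothWeighted p f)
    (hg : SmoothWeighted (p + 1) g) {θ : ℝ} (hθ : θ ∈ Set.Ioo (0 : ℝ) Real.pi) (ϕ : ℝ) :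
    eth (-1) (fun θ ϕ => f θ ϕ * (starRingEnd ℂ) (g θ ϕ)) θ ϕ
      = eth p f θ ϕ * (starRingEnd ℂ) (g θ ϕ)
        + f θ ϕ * (starRingEnd ℂ) (ethBar (p + 1) g θ ϕ) := by
  have f1 := (hf.hasDerivAt_left hθ ϕ).hasDerivAt
  have f2 := (hf.hasDerivAt_right hθ ϕ).hasDerivAt
  have g1 := (hg.hasDerivAt_left hθ ϕ).hasDerivAt.star
  have g2 := (hg.hasDerivAt_right hθ ϕ).hasDerivAt.star
  have e1 := (f1.mul g1).deriv
  have e2 := (f2.mul g2).deriv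
  simp only [Pi.mul_def, ← starRingEnd_apply] at e1 e2
  rw [eth, e1, e2]
  simp only [eth, ethBar, map_mul, map_add, map_div₀, Complex.conj_I, Complex.conj_ofReal,
    map_inv₀, map_intCast]
  push_cast
  ring

/-- At spin weight `-1` the term `-p cot θ` equals `+cot θ`, exactly what turns `ð g` into the
divergence of a vector field. -/
theorem sphInt_eth {g : ℝ → ℝ → ℂ} (hg : SmoothWeighted (-1) g) : sphInt (eth (-1) g) = 0 := by
  have := sphInt_divergence hg (((√2 : ℝ) : ℂ)⁻¹) (-(((√2 : ℝ) : ℂ)⁻¹ * Complex.I))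
  rw [← this]
  congr 1
  funext θ ϕ
  rw [eth]
  push_cast
  ring

/-- Integration by parts for `ð`. -/
theorem sphInt_eth_mul {p : ℤ} {f g : ℝ → ℝ → ℂ} (hf : SmoothWeighted p f)
    (hg : SmoothWeighted (p + 1) g) :
    sphInt (fun θ ϕ => eth p f θ ϕ * (starRingEnd ℂ) (g θ ϕ))
      = -sphInt (fun θ ϕ => f θ ϕ * (starRingEnd ℂ) (ethBar (p + 1) g θ ϕ)) := by
  have h := hf.mul_conj hg
  rw [show p - (p + 1) = -1 by ring] at h
  have h0 := sphInt_eth h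
  rw [sphInt_congr (fun θ hθ ϕ => eth_mul_conj hf hg hθ ϕ), sphInt_add
    (hf.eth.mul_conj hg).chartContinuous (hf.mul_conj hg.ethBar).chartContinuous] at h0
  exact eq_neg_of_add_eq_zero_left h0

/-- Integration by parts for `ð̄`. -/
theorem sphInt_ethBar_mul {p : ℤ} {f g : ℝ → ℝ → ℂ} (hf : SmoothWeighted p f)
    (hg : SmoothWeighted (p - 1) g) :
    sphInt (fun θ ϕ => ethBar p f θ ϕ * (starRingEnd ℂ) (g θ ϕ))
      = -sphInt (fun θ ϕ => f θ ϕ * (starRingEnd ℂ) (eth (p - 1) g θ ϕ)) := by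
  have hf' : SmoothWeighted (p - 1 + 1) f := by rwa [sub_add_cancel]
  have h := congrArg (starRingEnd ℂ) (sphInt_eth_mul hg hf')
  rw [map_neg, ← sphInt_conj, ← sphInt_conj] at h
  simp only [map_mul, Complex.conj_conj, sub_add_cancel] at h
  simp only [mul_comm (f _ _), mul_comm (ethBar p f _ _)]
  rw [h, neg_neg]

theorem multipole_eth {p : ℤ} {f : ℝ → ℝ → ℂ} (hf : SmoothWeighted p f) (l : ℕ) (m : ℤ) :
    multipole (p + 1) l m (eth p f) = -(ladder p l : ℂ) * multipole p l m f := by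
  rw [multipole_eq hf.eth, multipole_eq hf, sphInt_eth_mul hf (smoothWeighted_spinorY _ l m),
    neg_mul, ← sphInt_const_mul]
  congr 1
  refine sphInt_congr fun θ hθ ϕ => ?_
  rw [ethBar_spinorY _ l m hθ]
  simp only [add_sub_cancel_right, map_mul, Complex.conj_ofReal]
  ring

theorem multipole_ethBar {p : ℤ} {f : ℝ → ℝ → ℂ} (hf : SmoothWeighted p f) (l : ℕ) (m : ℤ) :
    multipole (p - 1) l m (ethBar p f) = (ladder (p - 1) l : ℂ) * multipole p l m f := by
  rw [multipole_eq hf.ethBar, multipole_eq hf, sphInt_ethBar_mul hf (smoothWeighted_spinorY _ l m),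
    ← sphInt_const_mul, ← neg_one_mul, ← sphInt_const_mul]
  refine sphInt_congr fun θ hθ ϕ => ?_
  rw [eth_spinorY _ l m hθ]
  simp only [sub_add_cancel, map_mul, Complex.conj_ofReal, map_neg]
  ring

theorem multipole_of_not {p : ℤ} {l : ℕ} {m : ℤ} (h : ¬(|p| ≤ (l : ℤ) ∧ |m| ≤ (l : ℤ)))
    (f : ℝ → ℝ → ℂ) : multipole p l m f = 0 := by
  have : spinY p l m = fun _ _ => 0 := by
    funext θ ϕ; rw [spinY, if_neg h]
  simp [multipole, this]

theorem multipole_add {p : ℤ} {f g : ℝ → ℝ → ℂ} (hf : SmoothWeighted p f)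
    (hg : SmoothWeighted p g) (l : ℕ) (m : ℤ) :
    multipole p l m (f + g) = multipole p l m f + multipole p l m g := by
  rw [multipole_eq hf, multipole_eq hg, multipole_eq (hf.add hg), ← sphInt_add
    (hf.mul_conj (smoothWeighted_spinorY p l m)).chartContinuous
    (hg.mul_conj (smoothWeighted_spinorY p l m)).chartContinuous]
  simp only [Pi.add_apply, add_mul]

theorem multipole_const_smul (p : ℤ) (l : ℕ) (m : ℤ) (c : ℂ) (f : ℝ → ℝ → ℂ) :
    multipole p l m (c • f) = c * multipole p l m f := by
  simp only [multipole, Pi.smul_apply, smul_eq_mul, mul_assoc,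
    intervalIntegral.integral_const_mul]

theorem multipole_sub {p : ℤ} {f g : ℝ → ℝ → ℂ} (hf : SmoothWeighted p f)
    (hg : SmoothWeighted p g) (l : ℕ) (m : ℤ) :
    multipole p l m (f - g) = multipole p l m f - multipole p l m g := by
  have h := multipole_add hf (hg.const_smul (-1)) l m
  rw [multipole_const_smul, neg_one_smul, ← sub_eq_add_neg] at h
  rw [h]
  ring

theorem multipole_congr {p : ℤ} {f g : ℝ → ℝ → ℂ}
    (h : ∀ θ ∈ Set.Ioo (0 : ℝ) Real.pi, ∀ ϕ, g θ ϕ = f θ ϕ) (l : ℕ) (m : ℤ) :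
    multipole p l m g = multipole p l m f := by
  rw [multipole, multipole, intervalIntegral.integral_of_le Real.pi_pos.le,
    intervalIntegral.integral_of_le Real.pi_pos.le,
    integral_Ioc_eq_integral_Ioo, integral_Ioc_eq_integral_Ioo]
  refine setIntegral_congr_fun measurableSet_Ioo fun θ hθ => ?_
  simp only [h θ hθ]

theorem exists_norm_multipole_le {p : ℤ} {f : ℝ → ℝ → ℂ} (hf : SmoothWeighted p f) :
    ∃ C : ℝ, ∀ (l : ℕ) (m : ℤ), ‖multipole p l m f‖ ≤ C * ((l : ℝ) + 1) := by
  obtain ⟨B, hB0, hB⟩ := hf.exists_bound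
  refine ⟨B * chartMeasure.real Set.univ, fun l m => ?_⟩
  rw [multipole_eq hf]
  refine (norm_sphInt_le (B := B * ((l : ℝ) + 1)) fun θ hθ ϕ => ?_).trans_eq (by ring)
  rw [norm_mul, RCLike.norm_conj]
  exact mul_le_mul (hB θ hθ ϕ) (norm_spinorY_le p l m (normSqPair_spinor θ ϕ)) (norm_nonneg _) hB0

/-! ### Rapid decay of the moments of smooth functions. -/

/-- The invariant Laplacian shifted such that its eigenvalues are `l (l + 1) + 1`. -/
def shiftedLaplacian (p : ℤ) (f : ℝ → ℝ → ℂ) : ℝ → ℝ → ℂ :=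
  (-2 : ℂ) • ethBar (p + 1) (eth p f) + ((p : ℂ) * (p + 1) + 1) • f

theorem SmoothWeighted.ethBar_eth {p : ℤ} {f : ℝ → ℝ → ℂ} (hf : SmoothWeighted p f) :
    SmoothWeighted p (ZRM.ethBar (p + 1) (ZRM.eth p f)) := by
  have := hf.eth.ethBar
  rwa [add_sub_cancel_right] at this

theorem SmoothWeighted.shiftedLaplacian {p : ℤ} {f : ℝ → ℝ → ℂ} (hf : SmoothWeighted p f) :
    SmoothWeighted p (ZRM.shiftedLaplacian p f) :=
  (hf.ethBar_eth.const_smul _).add (hf.const_smul _)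

theorem multipole_ethBar_eth {p : ℤ} {f : ℝ → ℝ → ℂ} (hf : SmoothWeighted p f) (l : ℕ) (m : ℤ) :
    multipole p l m (ethBar (p + 1) (eth p f)) = -(ladder p l : ℂ) ^ 2 * multipole p l m f := by
  have := multipole_ethBar hf.eth l m
  rw [add_sub_cancel_right, multipole_eth hf] at this
  rw [this]
  ring

theorem multipole_shiftedLaplacian {p : ℤ} {f : ℝ → ℝ → ℂ} (hf : SmoothWeighted p f) (l : ℕ)
    (m : ℤ) : multipole p l m (shiftedLaplacian p f)
      = ((l : ℂ) * (l + 1) + 1) * multipole p l m f := by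
  by_cases h : |p| ≤ (l : ℤ) ∧ |m| ≤ (l : ℤ)
  · rw [shiftedLaplacian, multipole_add (hf.ethBar_eth.const_smul _) (hf.const_smul _),
      multipole_const_smul, multipole_const_smul, multipole_ethBar_eth hf]
    have : ((ladder p l : ℝ) : ℂ) ^ 2 = ((l : ℂ) - p) * (l + p + 1) / 2 := by
      exact_mod_cast congrArg (fun x : ℝ => (x : ℂ)) (ladder_sq h.1)
    rw [this]
    ring
  · rw [multipole_of_not h, multipole_of_not h, mul_zero]

/-- Each application of the shifted Laplacian multiplies the moments by `l (l + 1) + 1 ≥ l + 1`,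
while the moments of any smooth function grow at most linearly. Using `k + 1` applications leaves a
gain of `k` powers. -/
theorem SmoothWeighted.rapidDecay_multipole {p : ℤ} {f : ℝ → ℝ → ℂ} (hf : SmoothWeighted p f) :
    RapidDecay (fun l m => multipole p l m f) := by
  have key : ∀ k : ℕ, ∃ g, SmoothWeighted p g ∧ ∀ (l : ℕ) (m : ℤ),
      multipole p l m g = ((l : ℂ) * (l + 1) + 1) ^ k * multipole p l m f := by
    intro k
    induction k with
    | zero => exact ⟨f, hf, by simp⟩
    | succ k ih =>
      obtain ⟨g, hg, h⟩ := ih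
      exact ⟨_, hg.shiftedLaplacian, fun l m => by
        rw [multipole_shiftedLaplacian hg, h, pow_succ]; ring⟩
  intro k
  obtain ⟨g, hg, h⟩ := key (k + 1)
  obtain ⟨C, hC⟩ := exists_norm_multipole_le hg
  refine ⟨C, fun l m _ => ?_⟩
  have h1 := hC l m
  have hl : (0 : ℝ) ≤ l := by positivity
  have e : ‖((l : ℂ) * (l + 1) + 1) ^ (k + 1)‖ = ((l : ℝ) * (l + 1) + 1) ^ (k + 1) := by
    rw [norm_pow]
    congr 1
    rw [show (l : ℂ) * (l + 1) + 1 = (((l : ℝ) * (l + 1) + 1 : ℝ) : ℂ) by push_cast; ring,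
      Complex.norm_real, Real.norm_of_nonneg (by positivity)]
  rw [h, norm_mul, e] at h1
  have h2 : ((l : ℝ) + 1) ^ (k + 1) ≤ ((l : ℝ) * (l + 1) + 1) ^ (k + 1) :=
    pow_le_pow_left₀ (by positivity) (by nlinarith) _
  have h3 := (mul_le_mul_of_nonneg_right h2 (norm_nonneg (multipole p l m f))).trans h1
  have h4 : (0 : ℝ) < l + 1 := by positivity
  rw [pow_succ] at h3
  nlinarith

/-! ### Orthonormality of the harmonics. -/

theorem spinorY_spinor (p : ℤ) (l : ℕ) (m : ℤ) (θ ϕ : ℝ) :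
    spinorY p l m (spinor θ ϕ) = Complex.exp (Complex.I * m * ϕ)
      * spinorY p l m ((Real.cos (θ / 2) : ℂ), (Real.sin (θ / 2) : ℂ)) := by
  by_cases h : |p| ≤ (l : ℤ) ∧ |m| ≤ (l : ℤ)
  · rw [spinorY, if_pos h, spinorY, if_pos h, spinCoeff_spinor]
    obtain ⟨a, b, ha, hb⟩ := exists_nat_add_sub h.1
    obtain ⟨c, -, hc, -⟩ := exists_nat_add_sub h.2
    have e : (c : ℂ) - ((a : ℂ) + b) / 2 = m := by
      have h1 : (a : ℂ) + b = 2 * l := by exact_mod_cast (by omega : (a : ℤ) + b = 2 * l)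
      have h2 : (c : ℂ) = l + m := by exact_mod_cast hc.symm
      rw [h1, h2]
      ring
    rw [ha, hb, hc, Int.toNat_natCast, Int.toNat_natCast, Int.toNat_natCast, e]
    ring
  · rw [spinorY_of_not h]
    simp

theorem multipole_spinorY_of_ne_right {p : ℤ} {l l' : ℕ} {m m' : ℤ} (h : m' ≠ m) :
    multipole p l m (fun θ ϕ => spinorY p l' m' (spinor θ ϕ)) = 0 := by
  rw [multipole_eq (smoothWeighted_spinorY p l' m'), sphInt_eq ((smoothWeighted_spinorY p l'
    m').mul_conj (smoothWeighted_spinorY p l m)).chartContinuous]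
  refine intervalIntegral.integral_zero_ae (Filter.Eventually.of_forall fun θ _ => ?_)
  have hc : Complex.I * (m' - m) ≠ 0 :=
    mul_ne_zero Complex.I_ne_zero (sub_ne_zero.2 (by exact_mod_cast h))
  have e : ∀ ϕ : ℝ, spinorY p l' m' (spinor θ ϕ)
      * (starRingEnd ℂ) (spinorY p l m (spinor θ ϕ)) * (Real.sin θ : ℂ)
      = Complex.exp (Complex.I * (m' - m) * ϕ)
        * (spinorY p l' m' ((Real.cos (θ / 2) : ℂ), (Real.sin (θ / 2) : ℂ))
        * (starRingEnd ℂ) (spinorY p l m ((Real.cos (θ / 2) : ℂ), (Real.sin (θ / 2) : ℂ)))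
        * (Real.sin θ : ℂ)) := by
    intro ϕ
    rw [spinorY_spinor p l' m', spinorY_spinor p l m, map_mul, ← Complex.exp_conj]
    simp only [map_mul, Complex.conj_I, Complex.conj_ofReal, map_intCast]
    rw [show Complex.I * (m' - m) * ϕ = Complex.I * m' * ϕ + -Complex.I * m * ϕ by ring,
      Complex.exp_add]
    ring
  simp only [e, intervalIntegral.integral_mul_const]
  rw [integral_exp_mul_complex hc]
  have : Complex.I * (m' - m) * ((2 * Real.pi : ℝ) : ℂ)
      = ((m' - m : ℤ) : ℂ) * (2 * Real.pi * Complex.I) := by push_cast; ring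
  rw [this, Complex.exp_int_mul_two_pi_mul_I]
  simp

/-- The two harmonics are eigenfunctions of the symmetric operator `shiftedLaplacian`, and the
difference of the eigenvalues is `(l' - l) (l' + l + 1) ≠ 0`. -/
theorem multipole_spinorY_of_ne_left {p : ℤ} {l l' : ℕ} {m m' : ℤ} (h : l' ≠ l) :
    multipole p l m (fun θ ϕ => spinorY p l' m' (spinor θ ϕ)) = 0 := by
  have h1 := multipole_shiftedLaplacian (smoothWeighted_spinorY p l' m') l m
  by_cases hp : |p| ≤ (l' : ℤ)
  swap
  · rw [multipole_congr (f := 0), ← zero_smul ℂ (0 : ℝ → ℝ → ℂ), multipole_const_smul, zero_mul]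
    intro θ _ ϕ
    rw [spinorY_of_not fun h' => hp h'.1]
    rfl
  have h2 : multipole p l m (shiftedLaplacian p fun θ ϕ => spinorY p l' m' (spinor θ ϕ))
      = ((l' : ℂ) * (l' + 1) + 1) * multipole p l m fun θ ϕ => spinorY p l' m' (spinor θ ϕ) := by
    rw [← multipole_const_smul]
    refine multipole_congr (fun θ hθ ϕ => ?_) l m
    have h3 := ethBar_congr (p := p + 1) (fun θ hθ ϕ => eth_spinorY p l' m' hθ ϕ) hθ ϕ
    rw [ethBar_const_mul, ethBar_spinorY _ l' m' hθ, add_sub_cancel_right] at h3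
    have : ((ladder p l' : ℝ) : ℂ) ^ 2 = ((l' : ℂ) - p) * (l' + p + 1) / 2 := by
      exact_mod_cast congrArg (fun x : ℝ => (x : ℂ)) (ladder_sq hp)
    simp only [shiftedLaplacian, Pi.add_apply, Pi.smul_apply, smul_eq_mul, h3]
    linear_combination (2 * spinorY p l' m' (spinor θ ϕ)) * this
  rw [h2] at h1
  have h3 : ((l' : ℂ) - l) * (l' + l + 1)
      * multipole p l m (fun θ ϕ => spinorY p l' m' (spinor θ ϕ)) = 0 := by
    linear_combination h1
  have h4 : (l' : ℂ) - l ≠ 0 := sub_ne_zero.2 (by exact_mod_cast h)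
  have h5 : (l' : ℂ) + l + 1 ≠ 0 := by exact_mod_cast (by omega : l' + l + 1 ≠ 0)
  exact (mul_eq_zero.1 h3).resolve_left (mul_ne_zero h4 h5)

theorem sphInt_one : sphInt (fun _ _ => 1) = 4 * Real.pi := by
  rw [sphInt_eq ⟨fun _ => 1, continuous_const, fun _ _ _ => rfl⟩]
  simp only [one_mul, intervalIntegral.integral_const, sub_zero, Complex.real_smul,
    intervalIntegral.integral_const_mul, intervalIntegral.integral_ofReal, integral_sin]
  simp
  ring

theorem multipole_spinorY_succ {p : ℤ} {l : ℕ} {m : ℤ} (h1 : -(l : ℤ) ≤ p) (h2 : p < l) :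
    multipole (p + 1) l m (fun θ ϕ => spinorY (p + 1) l m (spinor θ ϕ))
      = multipole p l m (fun θ ϕ => spinorY p l m (spinor θ ϕ)) := by
  have h := multipole_eth (smoothWeighted_spinorY p l m) l m
  rw [multipole_congr (fun θ hθ ϕ => eth_spinorY p l m hθ ϕ)] at h
  have e := multipole_const_smul (p + 1) l m (-(ladder p l : ℂ))
    (fun θ ϕ => spinorY (p + 1) l m (spinor θ ϕ))
  simp only [Pi.smul_def, smul_eq_mul] at e
  rw [e] at h
  exact mul_left_cancel₀ (neg_ne_zero.2 (by exact_mod_cast (ladder_pos h1 h2).ne')) h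

/-- No integral of a single harmonic is computed. The square norm is the same for all spin weights,
since `ð` and `ð̄` are adjoint up to sign, and by `sum_norm_spinorY_sq` the `2 l + 1` norms add up
to `2 l + 1`. -/
theorem multipole_spinorY_self {p : ℤ} {l : ℕ} {m : ℤ} (hp : |p| ≤ (l : ℤ)) (hm : |m| ≤ (l : ℤ)) :
    multipole p l m (fun θ ϕ => spinorY p l m (spinor θ ϕ)) = 1 := by
  set N : ℤ → ℂ := fun p => multipole p l m (fun θ ϕ => spinorY p l m (spinor θ ϕ)) with hN
  have h1 : ∀ a : ℕ, a ≤ 2 * l → N (a - l) = N (-l) := by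
    intro a ha
    induction a with
    | zero => simp
    | succ a ih =>
      rw [← ih (by omega)]
      have := multipole_spinorY_succ (p := (a : ℤ) - l) (l := l) (m := m) (by omega) (by omega)
      rw [show ((a + 1 : ℕ) : ℤ) - l = a - l + 1 by push_cast; ring]
      exact this
  have h2 : ∑ a ∈ Finset.range (2 * l + 1), N (a - l) = 2 * l + 1 := by
    have e1 : ∀ a : ℕ, N (a - l) = ∫ x, spinorY ((a : ℤ) - l) l m (spinor x.1 x.2)
        * (starRingEnd ℂ) (spinorY ((a : ℤ) - l) l m (spinor x.1 x.2))
        * (Real.sin x.1 : ℂ) ∂chartMeasure := fun a =>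
      multipole_eq (smoothWeighted_spinorY _ l m) l m
    simp only [e1]
    rw [← integral_finsetSum _ fun a _ => ((smoothWeighted_spinorY _ l m).mul_conj
      (smoothWeighted_spinorY _ l m)).chartContinuous.integrable]
    have e2 : ∀ x : ℝ × ℝ, ∑ a ∈ Finset.range (2 * l + 1),
        spinorY ((a : ℤ) - l) l m (spinor x.1 x.2)
        * (starRingEnd ℂ) (spinorY ((a : ℤ) - l) l m (spinor x.1 x.2)) * (Real.sin x.1 : ℂ)
        = (((2 * l + 1) / (4 * Real.pi) : ℝ) : ℂ) * (1 * (Real.sin x.1 : ℂ)) := by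
      intro x
      rw [← Finset.sum_mul, one_mul, ← sum_norm_spinorY_sq hm (normSqPair_spinor x.1 x.2)]
      congr 1
      push_cast
      exact Finset.sum_congr rfl fun a _ => by rw [Complex.mul_conj, Complex.normSq_eq_norm_sq]; simp
    simp only [e2]
    have := sphInt_one
    rw [sphInt] at this
    rw [integral_const_mul, this]
    have hpi : (Real.pi : ℂ) ≠ 0 := by exact_mod_cast Real.pi_ne_zero
    push_cast
    field_simp
  obtain ⟨a, b, ha, hb⟩ := exists_nat_add_sub hp
  have h3 : N p = N (-l) := by
    rw [← h1 a (by omega)]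
    congr 1
    omega
  rw [Finset.sum_congr rfl fun a ha => h1 a (by simp at ha; omega), Finset.sum_const,
    Finset.card_range, nsmul_eq_mul] at h2
  have h4 : (2 * (l : ℂ) + 1) ≠ 0 := by exact_mod_cast (by omega : 2 * l + 1 ≠ 0)
  push_cast at h2
  change N p = 1
  rw [h3]
  exact mul_left_cancel₀ h4 (by rw [h2, mul_one])

/-- The multipole moments of a synthesized function are the given coefficients. -/
theorem RapidDecay.multipole_synth {c : ℕ → ℤ → ℂ} (hc : RapidDecay c) {p : ℤ} {l : ℕ} {m : ℤ}
    (hp : |p| ≤ (l : ℤ)) (hm : |m| ≤ (l : ℤ)) : multipole p l m (synth p c) = c l m := by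
  rw [multipole_eq (hc.smoothWeighted_synth p)]
  set F : ℕ × ℤ → ℝ × ℝ → ℂ := fun x y => c x.1 x.2 * (spinorY p x.1 x.2 (spinor y.1 y.2)
    * (starRingEnd ℂ) (spinorY p l m (spinor y.1 y.2)) * (Real.sin y.1 : ℂ)) with hF
  have hint : ∀ x, Integrable (F x) chartMeasure := fun x =>
    ((smoothWeighted_spinorY p x.1 x.2).mul_conj
      (smoothWeighted_spinorY p l m)).chartContinuous.integrable.const_mul _
  obtain ⟨C, hC0, hC⟩ := hc.exists_homY_bound p
  have hb : ∀ x y, ‖F x y‖ ≤ C * multipoleWeight x * (l + 1) := by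
    intro x y
    have h1 := hC x _ (spinor_ne_zero y.1 y.2)
    rw [homY_of_unit _ _ _ (normSqPair_spinor y.1 y.2)] at h1
    have h2 : ‖(starRingEnd ℂ) (spinorY p l m (spinor y.1 y.2))‖ ≤ l + 1 := by
      rw [RCLike.norm_conj]; exact norm_spinorY_le p l m (normSqPair_spinor y.1 y.2)
    have h3 : ‖(Real.sin y.1 : ℂ)‖ ≤ 1 := by
      rw [Complex.norm_real]; exact Real.abs_sin_le_one _
    calc ‖F x y‖ = ‖c x.1 x.2 * spinorY p x.1 x.2 (spinor y.1 y.2)‖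
        * ‖(starRingEnd ℂ) (spinorY p l m (spinor y.1 y.2))‖ * ‖(Real.sin y.1 : ℂ)‖ := by
          simp only [hF, norm_mul]; ring
      _ ≤ C * multipoleWeight x * (l + 1) * 1 := by
          have := norm_nonneg (c x.1 x.2 * spinorY p x.1 x.2 (spinor y.1 y.2))
          have h0 := mul_nonneg hC0 (multipoleWeight_nonneg x)
          gcongr
      _ = _ := mul_one _
  -- Absolute convergence, uniform on the sphere of finite measure, justifies exchanging the sum
  -- over the harmonics with the integral.
  have hsum : Summable fun x => ∫ y, ‖F x y‖ ∂chartMeasure := by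
    refine Summable.of_nonneg_of_le (fun x => integral_nonneg fun y => norm_nonneg _)
      (f := fun x => C * multipoleWeight x * (l + 1) * chartMeasure.real Set.univ) (fun x => ?_)
      (((summable_multipoleWeight.mul_left C).mul_right _).mul_right _)
    have := norm_integral_le_of_norm_le_const (μ := chartMeasure) (f := fun y => ‖F x y‖)
      (C := C * multipoleWeight x * (l + 1))
      (Filter.Eventually.of_forall fun y => by rw [norm_norm]; exact hb x y)
    exact (le_abs_self _).trans this
  have hs := hasSum_integral_of_summable_integral_norm hint hsum
  have e1 : ∀ y : ℝ × ℝ, ∑' x, F x y = synth p c y.1 y.2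
      * (starRingEnd ℂ) (spinorY p l m (spinor y.1 y.2)) * (Real.sin y.1 : ℂ) := by
    intro y
    have h := (hc.hasSum_synth p y.1 y.2).mul_right
      ((starRingEnd ℂ) (spinorY p l m (spinor y.1 y.2)) * (Real.sin y.1 : ℂ))
    rw [mul_assoc, ← h.tsum_eq]
    exact tsum_congr fun x => by simp only [hF]; ring
  simp only [e1] at hs
  have e2 : ∀ x : ℕ × ℤ, ∫ y, F x y ∂chartMeasure = if x = (l, m) then c l m else 0 := by
    intro x
    have h1 : ∫ y, F x y ∂chartMeasure = c x.1 x.2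
        * multipole p l m (fun θ ϕ => spinorY p x.1 x.2 (spinor θ ϕ)) := by
      rw [multipole_eq (smoothWeighted_spinorY p x.1 x.2), sphInt, ← integral_const_mul]
    rw [h1]
    by_cases hx1 : x.1 = l
    · by_cases hx2 : x.2 = m
      · have hx : x = (l, m) := Prod.ext hx1 hx2
        rw [if_pos hx, hx, multipole_spinorY_self hp hm, mul_one]
      · rw [multipole_spinorY_of_ne_right hx2, if_neg (fun h => hx2 (by rw [h])), mul_zero]
    · rw [multipole_spinorY_of_ne_left hx1, if_neg (fun h => hx1 (by rw [h])), mul_zero]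
  simp only [e2] at hs
  exact hs.unique (hasSum_ite_eq (l, m) (c l m))

end ZRM

/-! ### Completeness of the harmonics -/

namespace ZRM

open MeasureTheory

section Products

open Polynomial

variable {q : ℂ × ℂ}

theorem normSqPair_eq_mul (q : ℂ × ℂ) :
    ((normSqPair q : ℝ) : ℂ) = q.1 * (starRingEnd ℂ) q.1 + q.2 * (starRingEnd ℂ) q.2 := by
  rw [normSqPair, Complex.mul_conj, Complex.mul_conj]
  push_cast
  rfl

theorem derivative_spinPoly (a b : ℕ) (q : ℂ × ℂ) :
    derivative (spinPoly a b q) = C (a : ℂ) * C q.1 * spinPoly (a - 1) b q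
      + C (b : ℂ) * C ((starRingEnd ℂ) q.2) * spinPoly a (b - 1) q := by
  simp only [spinPoly, derivative_mul, derivative_pow, derivative_sub, derivative_add,
    derivative_C, derivative_X, mul_one, add_zero, sub_zero, zero_mul, zero_add]
  ring

theorem C_mul_add_C_mul (hq : normSqPair q = 1) :
    C q.1 * C ((starRingEnd ℂ) q.1) + C q.2 * C ((starRingEnd ℂ) q.2) = (1 : ℂ[X]) := by
  rw [← C_mul, ← C_mul, ← C_add, ← normSqPair_eq_mul, hq]
  simp

/-- The Clebsch-Gordan decomposition for a product with spin one half. On unit spinors `z (w̄ t +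
z̄) - w̄ (z t - w) = 1`, and with this the derivative of `spinPoly (a + 1) b` in `t` becomes `(a + b
+ 1) z` times `spinPoly a b` plus a term of lower degree. The three companions for the other
coordinates rest on the same relation. -/
theorem fst_mul_spinPoly (hq : normSqPair q = 1) (a b : ℕ) :
    C ((a : ℂ) + b + 1) * (C q.1 * spinPoly a b q)
      = derivative (spinPoly (a + 1) b q) + C (b : ℂ) * spinPoly a (b - 1) q := by
  have h := C_mul_add_C_mul hq
  rw [derivative_spinPoly, Nat.add_sub_cancel]
  rcases b with _ | b
  · simp
    ring
  · rw [Nat.add_sub_cancel, spinPoly_succ_left, spinPoly_succ_right]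
    simp only [Nat.cast_add, Nat.cast_one, map_add, map_one]
    linear_combination (-(C (b : ℂ) + 1) * spinPoly a b q) * -h

theorem conj_snd_mul_spinPoly (hq : normSqPair q = 1) (a b : ℕ) :
    C ((a : ℂ) + b + 1) * (C ((starRingEnd ℂ) q.2) * spinPoly a b q)
      = derivative (spinPoly a (b + 1) q) - C (a : ℂ) * spinPoly (a - 1) b q := by
  have h := C_mul_add_C_mul hq
  rw [derivative_spinPoly, Nat.add_sub_cancel]
  rcases a with _ | a
  · simp
    ring
  · rw [Nat.add_sub_cancel, spinPoly_succ_left, spinPoly_succ_right]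
    simp only [Nat.cast_add, Nat.cast_one, map_add, map_one]
    linear_combination ((C (a : ℂ) + 1) * spinPoly a b q) * -h

theorem snd_mul_spinPoly (hq : normSqPair q = 1) (a b : ℕ) :
    C ((a : ℂ) + b + 1) * (C q.2 * spinPoly a b q)
      = C (b : ℂ) * (X * spinPoly a (b - 1) q) - C ((a : ℂ) + b + 1) * spinPoly (a + 1) b q
        + X * derivative (spinPoly (a + 1) b q) := by
  have h := C_mul_add_C_mul hq
  rw [derivative_spinPoly, Nat.add_sub_cancel]
  rcases b with _ | b
  · simp only [spinPoly_succ_left, Nat.cast_add, Nat.cast_one, map_add, map_one, Nat.cast_zero,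
      map_zero]
    ring
  · rw [Nat.add_sub_cancel, spinPoly_succ_left, spinPoly_succ_right, spinPoly_succ_left]
    simp only [Nat.cast_add, Nat.cast_one, map_add, map_one]
    linear_combination ((C (b : ℂ) + 1) * X * spinPoly a b q) * h

theorem conj_fst_mul_spinPoly (hq : normSqPair q = 1) (a b : ℕ) :
    C ((a : ℂ) + b + 1) * (C ((starRingEnd ℂ) q.1) * spinPoly a b q)
      = C (a : ℂ) * (X * spinPoly (a - 1) b q) + C ((a : ℂ) + b + 1) * spinPoly a (b + 1) q
        - X * derivative (spinPoly a (b + 1) q) := by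
  have h := C_mul_add_C_mul hq
  rw [derivative_spinPoly, Nat.add_sub_cancel]
  rcases a with _ | a
  · simp only [spinPoly_succ_right, Nat.cast_add, Nat.cast_one, map_add, map_one, Nat.cast_zero,
      map_zero]
    ring
  · rw [Nat.add_sub_cancel, spinPoly_succ_right (a + 1) b, spinPoly_succ_right a b,
      spinPoly_succ_left a b]
    simp only [Nat.cast_add, Nat.cast_one, map_add, map_one]
    linear_combination ((C (a : ℂ) + 1) * X * spinPoly a b q) * h

end Products

/-- The unit sphere of `ℂ²`. -/
abbrev UnitSpinor : Type := {q : ℂ × ℂ // normSqPair q = 1}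

theorem isCompact_unitSpinor : IsCompact {q : ℂ × ℂ | normSqPair q = 1} := by
  refine Metric.isCompact_of_isClosed_isBounded
    (isClosed_eq contDiff_normSqPair.continuous continuous_const) ?_
  refine (Metric.isBounded_closedBall (x := (0 : ℂ × ℂ)) (r := 1)).subset fun q hq => ?_
  have hq' : ‖q.1‖ ^ 2 + ‖q.2‖ ^ 2 = 1 := by
    simpa [normSqPair, Complex.normSq_eq_norm_sq] using hq
  rw [mem_closedBall_zero_iff, Prod.norm_def, max_le_iff]
  constructor
  · nlinarith [norm_nonneg q.1, sq_nonneg ‖q.2‖]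
  · nlinarith [norm_nonneg q.2, sq_nonneg ‖q.1‖]

instance : CompactSpace UnitSpinor := isCompact_iff_compactSpace.1 isCompact_unitSpinor

/-- A coefficient `spinCoeff a b c` as a continuous function on the unit sphere. -/
def spinCoeffC (a b c : ℕ) : C(UnitSpinor, ℂ) :=
  ⟨fun q => spinCoeff a b c q.1, (contDiff_spinCoeff a b c).continuous.comp continuous_subtype_val⟩

/-- The span of all `spinCoeff a b c`. -/
def spinSpan : Submodule ℂ C(UnitSpinor, ℂ) :=
  Submodule.span ℂ (Set.range fun x : ℕ × ℕ × ℕ => spinCoeffC x.1 x.2.1 x.2.2)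

theorem spinCoeffC_mem (a b c : ℕ) : spinCoeffC a b c ∈ spinSpan :=
  Submodule.subset_span ⟨(a, b, c), rfl⟩

/-- The coordinate functions on the unit sphere. -/
def coordFst : C(UnitSpinor, ℂ) := ⟨fun q => q.1.1, by fun_prop⟩

/-- The coordinate functions on the unit sphere. -/
def coordSnd : C(UnitSpinor, ℂ) := ⟨fun q => q.1.2, by fun_prop⟩

theorem mem_spinSpan_of_mul {f g : C(UnitSpinor, ℂ)} {a b : ℕ} (hg : g ∈ spinSpan)
    (h : ∀ q : UnitSpinor, ((a : ℂ) + b + 1) * f q = g q) : f ∈ spinSpan := by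
  have hne : (a : ℂ) + b + 1 ≠ 0 := by exact_mod_cast (by omega : a + b + 1 ≠ 0)
  have : f = ((a : ℂ) + b + 1)⁻¹ • g := by
    ext q
    rw [ContinuousMap.smul_apply, ← h q, smul_eq_mul, inv_mul_cancel_left₀ hne]
  rw [this]
  exact spinSpan.smul_mem _ hg

/-- The coefficient functions with the convention that those with negative index vanish. -/
def spinCoeffPred (a b c : ℕ) : C(UnitSpinor, ℂ) := if c = 0 then 0 else spinCoeffC a b (c - 1)

theorem spinCoeffPred_mem (a b c : ℕ) : spinCoeffPred a b c ∈ spinSpan := by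
  rw [spinCoeffPred]
  split_ifs
  exacts [spinSpan.zero_mem, spinCoeffC_mem _ _ _]

theorem coeff_X_mul_spinPoly (a b c : ℕ) (q : UnitSpinor) :
    (Polynomial.X * spinPoly a b q.1).coeff c = spinCoeffPred a b c q := by
  rcases c with _ | c
  · simp [spinCoeffPred]
  · rw [Polynomial.coeff_X_mul]
    simp [spinCoeffPred, spinCoeffC, spinCoeff]

theorem coeff_X_mul_derivative (a b c : ℕ) (q : UnitSpinor) :
    (Polynomial.X * Polynomial.derivative (spinPoly a b q.1)).coeff c
      = c * spinCoeffC a b c q := by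
  rcases c with _ | c
  · simp
  · rw [Polynomial.coeff_X_mul, Polynomial.coeff_derivative]
    simp [spinCoeffC, spinCoeff]
    ring

theorem coordFst_mul_mem (a b c : ℕ) : coordFst * spinCoeffC a b c ∈ spinSpan := by
  refine mem_spinSpan_of_mul (a := a) (b := b)
    (g := ((c : ℂ) + 1) • spinCoeffC (a + 1) b (c + 1) + (b : ℂ) • spinCoeffC a (b - 1) c)
    (spinSpan.add_mem (spinSpan.smul_mem _ (spinCoeffC_mem _ _ _))
      (spinSpan.smul_mem _ (spinCoeffC_mem _ _ _))) fun q => ?_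
  have h := congrArg (fun P => Polynomial.coeff P c) (fst_mul_spinPoly q.2 a b)
  simp only [Polynomial.coeff_C_mul, Polynomial.coeff_add, Polynomial.coeff_derivative] at h
  simpa [coordFst, spinCoeffC, spinCoeff, mul_comm] using h

theorem star_coordSnd_mul_mem (a b c : ℕ) : star coordSnd * spinCoeffC a b c ∈ spinSpan := by
  refine mem_spinSpan_of_mul (a := a) (b := b)
    (g := ((c : ℂ) + 1) • spinCoeffC a (b + 1) (c + 1) - (a : ℂ) • spinCoeffC (a - 1) b c)
    (spinSpan.sub_mem (spinSpan.smul_mem _ (spinCoeffC_mem _ _ _))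
      (spinSpan.smul_mem _ (spinCoeffC_mem _ _ _))) fun q => ?_
  have h := congrArg (fun P => Polynomial.coeff P c) (conj_snd_mul_spinPoly q.2 a b)
  simp only [Polynomial.coeff_C_mul, Polynomial.coeff_sub, Polynomial.coeff_derivative] at h
  simpa [coordSnd, spinCoeffC, spinCoeff, mul_comm] using h

theorem coordSnd_mul_mem (a b c : ℕ) : coordSnd * spinCoeffC a b c ∈ spinSpan := by
  refine mem_spinSpan_of_mul (a := a) (b := b)
    (g := (b : ℂ) • spinCoeffPred a (b - 1) c - ((a : ℂ) + b + 1) • spinCoeffC (a + 1) b c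
      + (c : ℂ) • spinCoeffC (a + 1) b c)
    (spinSpan.add_mem (spinSpan.sub_mem (spinSpan.smul_mem _ (spinCoeffPred_mem _ _ _))
      (spinSpan.smul_mem _ (spinCoeffC_mem _ _ _)))
      (spinSpan.smul_mem _ (spinCoeffC_mem _ _ _))) fun q => ?_
  have h := congrArg (fun P => Polynomial.coeff P c) (snd_mul_spinPoly q.2 a b)
  simp only [Polynomial.coeff_C_mul, Polynomial.coeff_sub, Polynomial.coeff_add,
    coeff_X_mul_derivative, coeff_X_mul_spinPoly] at h
  simpa [coordSnd, spinCoeffC, spinCoeff] using h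

theorem star_coordFst_mul_mem (a b c : ℕ) : star coordFst * spinCoeffC a b c ∈ spinSpan := by
  refine mem_spinSpan_of_mul (a := a) (b := b)
    (g := (a : ℂ) • spinCoeffPred (a - 1) b c + ((a : ℂ) + b + 1) • spinCoeffC a (b + 1) c
      - (c : ℂ) • spinCoeffC a (b + 1) c)
    (spinSpan.sub_mem (spinSpan.add_mem (spinSpan.smul_mem _ (spinCoeffPred_mem _ _ _))
      (spinSpan.smul_mem _ (spinCoeffC_mem _ _ _)))
      (spinSpan.smul_mem _ (spinCoeffC_mem _ _ _))) fun q => ?_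
  have h := congrArg (fun P => Polynomial.coeff P c) (conj_fst_mul_spinPoly q.2 a b)
  simp only [Polynomial.coeff_C_mul, Polynomial.coeff_sub, Polynomial.coeff_add,
    coeff_X_mul_derivative, coeff_X_mul_spinPoly] at h
  simpa [coordFst, spinCoeffC, spinCoeff] using h

/-- The span is stable under multiplication by the two coordinates and their conjugates and contains
`1`. The elements that multiply the span into itself form an algebra, which settles the claim
without showing that the span is one. -/
theorem adjoin_le_spinSpan (f : C(UnitSpinor, ℂ))
    (hf : f ∈ StarAlgebra.adjoin ℂ {coordFst, coordSnd}) : f ∈ spinSpan := by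
  have h1 : f ∈ Algebra.adjoin ℂ (({coordFst, coordSnd} : Set C(UnitSpinor, ℂ))
      ∪ star {coordFst, coordSnd}) := by
    rw [← StarAlgebra.adjoin_toSubalgebra]; exact hf
  clear hf
  have key : ∀ v ∈ spinSpan, f * v ∈ spinSpan := by
    induction h1 using Algebra.adjoin_induction with
    | mem x hx =>
      have hgen : ∀ a b c, x * spinCoeffC a b c ∈ spinSpan := by
        rcases hx with hx | hx
        · rcases hx with rfl | rfl
          exacts [coordFst_mul_mem, coordSnd_mul_mem]
        · rcases hx with hx | hx
          · rw [← star_star x, hx]; exact star_coordFst_mul_mem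
          · rw [← star_star x, hx]; exact star_coordSnd_mul_mem
      intro v hv
      induction hv using Submodule.span_induction with
      | mem v hv => obtain ⟨y, rfl⟩ := hv; exact hgen _ _ _
      | zero => rw [mul_zero]; exact spinSpan.zero_mem
      | add v w _ _ h1 h2 => rw [mul_add]; exact spinSpan.add_mem h1 h2
      | smul c v _ h => rw [mul_smul_comm]; exact spinSpan.smul_mem _ h
    | algebraMap c =>
      intro v hv
      rw [← Algebra.smul_def]
      exact spinSpan.smul_mem _ hv
    | add x y _ _ h1 h2 =>
      intro v hv
      rw [add_mul]
      exact spinSpan.add_mem (h1 v hv) (h2 v hv)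
    | mul x y _ _ h1 h2 =>
      intro v hv
      rw [mul_assoc]
      exact h1 _ (h2 v hv)
  have h0 : (1 : C(UnitSpinor, ℂ)) ∈ spinSpan := by
    have : (1 : C(UnitSpinor, ℂ)) = spinCoeffC 0 0 0 := by
      ext q; simp [spinCoeffC, spinCoeff, spinPoly]
    rw [this]
    exact spinCoeffC_mem 0 0 0
  simpa using key 1 h0

/-- Stone-Weierstrass on the compact three-sphere, whose points are separated by the coordinates. -/
theorem exists_mem_spinSpan_dist_lt (f : C(UnitSpinor, ℂ)) {ε : ℝ} (hε : 0 < ε) :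
    ∃ g ∈ spinSpan, dist f g < ε := by
  have h := ContinuousMap.starSubalgebra_topologicalClosure_eq_top_of_separatesPoints
    (StarAlgebra.adjoin ℂ {coordFst, coordSnd}) (by
      intro x y hxy
      by_cases h1 : x.1.1 = y.1.1
      · have h2 : x.1.2 ≠ y.1.2 := fun h2 => hxy (Subtype.ext (Prod.ext h1 h2))
        exact ⟨coordSnd, ⟨coordSnd, StarAlgebra.subset_adjoin _ _ (by simp), rfl⟩, h2⟩
      · exact ⟨coordFst, ⟨coordFst, StarAlgebra.subset_adjoin _ _ (by simp), rfl⟩, h1⟩)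
  have hf : f ∈ (StarAlgebra.adjoin ℂ {coordFst, coordSnd}).topologicalClosure := by
    rw [h]; exact StarSubalgebra.mem_top
  have hf' : f ∈ closure ((StarAlgebra.adjoin ℂ {coordFst, coordSnd} :
      StarSubalgebra ℂ C(UnitSpinor, ℂ)) : Set C(UnitSpinor, ℂ)) := hf
  obtain ⟨g, hg, hd⟩ := Metric.mem_closure_iff.1 hf' ε hε
  exact ⟨g, adjoin_le_spinSpan g hg, hd⟩

/-- Haar measure on the group of unit spinors, in coordinates. -/
def phaseMeasure : Measure (ℝ × ℝ × ℝ) :=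
  (volume.restrict (Set.Ioc (0 : ℝ) (2 * Real.pi))).prod chartMeasure

instance : IsFiniteMeasure phaseMeasure := by unfold phaseMeasure; infer_instance

theorem normSqPair_phase (ψ : ℝ) (q : ℂ × ℂ) :
    normSqPair (Complex.exp (Complex.I * ψ) • q) = normSqPair q := by
  have : Complex.normSq (Complex.exp (Complex.I * ψ)) = 1 := by
    rw [Complex.normSq_eq_norm_sq, mul_comm, Complex.norm_exp_ofReal_mul_I, one_pow]
  simp [normSqPair, Complex.normSq_mul, this]

/-- The parametrization of the unit spinors. -/
def phaseSpinor (y : ℝ × ℝ × ℝ) : UnitSpinor :=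
  ⟨Complex.exp (Complex.I * y.1) • spinor y.2.1 y.2.2,
    (normSqPair_phase _ _).trans (normSqPair_spinor _ _)⟩

theorem continuous_phaseSpinor : Continuous phaseSpinor := by
  refine Continuous.subtype_mk ?_ _
  have h : Continuous fun y : ℝ × ℝ × ℝ => Complex.exp (Complex.I * y.1) := by fun_prop
  exact h.smul (continuous_spinor.comp continuous_snd)

/-- The pairing of two functions of unit spinors. -/
def spinorPairing (h : ℂ × ℂ → ℂ) (g : C(UnitSpinor, ℂ)) : ℂ :=
  ∫ y, (starRingEnd ℂ) (h (phaseSpinor y).1) * g (phaseSpinor y) * (Real.sin y.2.1 : ℂ) ∂phaseMeasure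

theorem spinorPairing_integrable {h : ℂ × ℂ → ℂ} (hh : Continuous h) (g : C(UnitSpinor, ℂ)) :
    Integrable (fun y => (starRingEnd ℂ) (h (phaseSpinor y).1) * g (phaseSpinor y)
      * (Real.sin y.2.1 : ℂ)) phaseMeasure := by
  have hc : Continuous fun y => (starRingEnd ℂ) (h (phaseSpinor y).1) * g (phaseSpinor y)
      * (Real.sin y.2.1 : ℂ) := by
    have := continuous_phaseSpinor
    have h2 : Continuous fun y => h (phaseSpinor y).1 :=
      hh.comp (continuous_subtype_val.comp this)
    exact ((Complex.continuous_conj.comp h2).mul (g.continuous.comp this)).mul (by fun_prop)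
  obtain ⟨B, hB⟩ := isCompact_unitSpinor.exists_bound_of_continuousOn hh.continuousOn
  refine Integrable.of_bound hc.aestronglyMeasurable (B * ‖g‖) (Filter.Eventually.of_forall
    fun y => ?_)
  rw [norm_mul, norm_mul, RCLike.norm_conj, Complex.norm_real]
  have h1 := hB _ (phaseSpinor y).2
  have h2 := g.norm_coe_le_norm (phaseSpinor y)
  have h3 : ‖Real.sin y.2.1‖ ≤ 1 := Real.abs_sin_le_one _
  have h0 : 0 ≤ B := (norm_nonneg _).trans h1
  calc _ ≤ B * ‖g‖ * 1 := by gcongr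
    _ = _ := mul_one _

theorem exists_spinorY_eq {a b c : ℕ} {p : ℤ} (h : (a : ℤ) - b = 2 * p) :
    ∃ (x : ℂ) (l : ℕ) (m : ℤ), ∀ q, spinCoeff a b c q = x * spinorY p l m q := by
  by_cases hc : c ≤ a + b
  · obtain ⟨l, hl⟩ : ∃ l : ℕ, (a : ℤ) = l + p ∧ (b : ℤ) = l - p :=
      ⟨((a : ℤ) - p).toNat, by omega, by omega⟩
    have h1 : |p| ≤ (l : ℤ) := abs_le.2 ⟨by omega, by omega⟩
    have h2 : |(c : ℤ) - l| ≤ (l : ℤ) := abs_le.2 ⟨by omega, by omega⟩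
    have hne : ((harmonicConst l ((c : ℤ) - l) * weightConst p l : ℝ) : ℂ) ≠ 0 := by
      have hpi := Real.pi_pos
      refine Complex.ofReal_ne_zero.2 (mul_ne_zero ?_ ?_)
      · rw [harmonicConst]
        exact div_ne_zero (mul_ne_zero (zpow_ne_zero _ (by norm_num))
          (Real.sqrt_pos.2 (by positivity)).ne') (by positivity)
      · rw [weightConst]
        exact div_ne_zero (mul_ne_zero (zpow_ne_zero _ (by norm_num)) (by positivity))
          (Real.sqrt_pos.2 (by positivity)).ne'
    refine ⟨((harmonicConst l ((c : ℤ) - l) * weightConst p l : ℝ) : ℂ)⁻¹, l, (c : ℤ) - l,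
      fun q => ?_⟩
    rw [spinorY, if_pos ⟨h1, h2⟩, inv_mul_cancel_left₀ hne, ← hl.1, ← hl.2,
      show (l : ℤ) + (c - l) = c by ring]
    simp
  · exact ⟨0, 0, 0, fun q => by rw [spinCoeff_eq_zero (by omega), zero_mul]⟩

/-- The integral over the phase vanishes unless `a - b = 2 p`. In that case the coefficient is a
multiple of a harmonic of weight `p`, and the integral over the sphere is the conjugate of a
multipole moment. -/
theorem spinorPairing_spinCoeffC {p : ℤ} {H : ℂ × ℂ → ℂ} (h1 : ContDiff ℝ ∞ H)
    (hw : HasSpinWeight p H)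
    (h0 : ∀ l m, multipole p l m (fun θ ϕ => H (spinor θ ϕ)) = 0) (a b c : ℕ) :
    spinorPairing H (spinCoeffC a b c) = 0 := by
  have e : ∀ y : ℝ × ℝ × ℝ, (starRingEnd ℂ) (H (phaseSpinor y).1)
      * spinCoeffC a b c (phaseSpinor y) * (Real.sin y.2.1 : ℂ)
      = Complex.exp (Complex.I * ((a : ℤ) - b - 2 * p : ℤ) * y.1)
        * ((starRingEnd ℂ) (H (spinor y.2.1 y.2.2))
          * spinCoeff a b c (spinor y.2.1 y.2.2) * (Real.sin y.2.1 : ℂ)) := by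
    intro y
    have hu : (starRingEnd ℂ) (Complex.exp (Complex.I * y.1)) * Complex.exp (Complex.I * y.1)
        = 1 := by
      rw [← Complex.exp_conj, ← Complex.exp_add]
      simp
    have e1 : spinCoeffC a b c (phaseSpinor y) = Complex.exp (Complex.I * ((a : ℤ) - b : ℤ) * y.1)
        * spinCoeff a b c (spinor y.2.1 y.2.2) := by
      have := spinCoeff_phase a b c (spinor y.2.1 y.2.2).1 (spinor y.2.1 y.2.2).2 _ _ hu hu
      refine this.trans ?_
      rw [mul_comm (Complex.exp (Complex.I * y.1)) ((starRingEnd ℂ) _), hu, one_pow, mul_one]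
      congr 1
      rw [← Complex.exp_conj, ← Complex.exp_nat_mul, ← Complex.exp_nat_mul, ← Complex.exp_add]
      congr 1
      simp
      ring
    have e2 : (starRingEnd ℂ) (H (phaseSpinor y).1) = Complex.exp (-(2 * Complex.I * p * y.1))
        * (starRingEnd ℂ) (H (spinor y.2.1 y.2.2)) := by
      have := hw y.1 (spinor y.2.1 y.2.2)
      change (starRingEnd ℂ) (H (Complex.exp (Complex.I * y.1) • spinor y.2.1 y.2.2)) = _
      rw [this, map_mul, ← Complex.exp_conj]
      simp [map_ofNat]
    rw [e1, e2]
    have : Complex.exp (Complex.I * ((a : ℤ) - b - 2 * p : ℤ) * y.1)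
        = Complex.exp (-(2 * Complex.I * p * y.1))
          * Complex.exp (Complex.I * ((a : ℤ) - b : ℤ) * y.1) := by
      rw [← Complex.exp_add]
      congr 1
      push_cast
      ring
    rw [this]
    ring
  rw [spinorPairing]
  simp only [e]
  rw [phaseMeasure, integral_prod_mul (fun ψ : ℝ => Complex.exp (Complex.I * ((a : ℤ) - b - 2 * p : ℤ) * ψ))
    (fun x : ℝ × ℝ => (starRingEnd ℂ) (H (spinor x.1 x.2))
          * spinCoeff a b c (spinor x.1 x.2) * (Real.sin x.1 : ℂ))]
  by_cases hab : (a : ℤ) - b = 2 * p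
  · obtain ⟨x, l, m, hx⟩ := exists_spinorY_eq (c := c) hab
    refine mul_eq_zero_of_right _ ?_
    have hH : SmoothWeighted p (fun θ ϕ => H (spinor θ ϕ)) := ⟨H, h1, hw, fun _ _ _ => rfl⟩
    have h2 := congrArg (starRingEnd ℂ) (h0 l m)
    rw [multipole_eq hH, ← sphInt_conj, map_zero] at h2
    simp only [map_mul, Complex.conj_conj] at h2
    have h3 := sphInt_const_mul x (fun θ ϕ => (starRingEnd ℂ) (H (spinor θ ϕ))
      * spinorY p l m (spinor θ ϕ))
    rw [h2, mul_zero, sphInt] at h3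
    rw [← h3]
    refine integral_congr_ae (Filter.Eventually.of_forall fun y => ?_)
    simp only [hx]
    ring
  · refine mul_eq_zero_of_left ?_ _
    have hc : Complex.I * ((a : ℤ) - b - 2 * p : ℤ) ≠ 0 :=
      mul_ne_zero Complex.I_ne_zero (Int.cast_ne_zero.2 (sub_ne_zero.2 hab))
    rw [← intervalIntegral.integral_of_le Real.two_pi_pos.le, integral_exp_mul_complex hc]
    have : Complex.I * ((a : ℤ) - b - 2 * p : ℤ) * ((2 * Real.pi : ℝ) : ℂ)
        = ((a : ℤ) - b - 2 * p : ℤ) * (2 * Real.pi * Complex.I) := by push_cast; ring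
    rw [this, Complex.exp_int_mul_two_pi_mul_I]
    simp

theorem spinorPairing_eq_zero {p : ℤ} {H : ℂ × ℂ → ℂ} (h1 : ContDiff ℝ ∞ H)
    (hw : HasSpinWeight p H)
    (h0 : ∀ l m, multipole p l m (fun θ ϕ => H (spinor θ ϕ)) = 0) {g : C(UnitSpinor, ℂ)}
    (hg : g ∈ spinSpan) : spinorPairing H g = 0 := by
  induction hg using Submodule.span_induction with
  | mem v hv => obtain ⟨y, rfl⟩ := hv; exact spinorPairing_spinCoeffC h1 hw h0 _ _ _
  | zero => simp [spinorPairing]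
  | add v w _ _ hv hw =>
    rw [spinorPairing] at *
    simp only [ContinuousMap.add_apply, mul_add, add_mul]
    rw [integral_add (spinorPairing_integrable h1.continuous v)
      (spinorPairing_integrable h1.continuous w), hv, hw, add_zero]
  | smul c v _ h =>
    rw [spinorPairing] at *
    have : ∀ y, (starRingEnd ℂ) (H (phaseSpinor y).1) * (c • v) (phaseSpinor y)
        * (Real.sin y.2.1 : ℂ) = c * ((starRingEnd ℂ) (H (phaseSpinor y).1) * v (phaseSpinor y)
        * (Real.sin y.2.1 : ℂ)) := fun y => by simp; ring
    simp only [this]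
    rw [integral_const_mul, h, mul_zero]

/-- Completeness of the spin-weighted harmonics. -/
theorem SmoothWeighted.eq_zero {p : ℤ} {f : ℝ → ℝ → ℂ} (hf : SmoothWeighted p f)
    (h0 : ∀ l m, multipole p l m f = 0) :
    ∀ θ ∈ Set.Ioo (0 : ℝ) Real.pi, ∀ ϕ, f θ ϕ = 0 := by
  obtain ⟨H, h1, hw, h3⟩ := hf
  have h0' : ∀ l m, multipole p l m (fun θ ϕ => H (spinor θ ϕ)) = 0 := fun l m => by
    rw [multipole_congr (f := f) (fun θ hθ ϕ => (h3 θ hθ ϕ).symm)]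
    exact h0 l m
  set HC : C(UnitSpinor, ℂ) := ⟨fun q => H q.1, h1.continuous.comp continuous_subtype_val⟩ with hHC
  obtain ⟨B, hB⟩ := isCompact_unitSpinor.exists_bound_of_continuousOn h1.continuous.continuousOn
  -- The function is orthogonal to the span and is uniformly approximated by it, so it is orthogonal
  -- to itself.
  have hself : spinorPairing H HC = 0 := by
    have hle : ∀ ε > 0, ‖spinorPairing H HC‖ ≤ B * ε * phaseMeasure.real Set.univ := by
      intro ε hε
      obtain ⟨g, hg, hd⟩ := exists_mem_spinSpan_dist_lt HC hε
      have e : spinorPairing H HC = ∫ y, ((starRingEnd ℂ) (H (phaseSpinor y).1)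
          * HC (phaseSpinor y) * (Real.sin y.2.1 : ℂ) - (starRingEnd ℂ) (H (phaseSpinor y).1)
          * g (phaseSpinor y) * (Real.sin y.2.1 : ℂ)) ∂phaseMeasure := by
        rw [integral_sub (spinorPairing_integrable h1.continuous HC)
          (spinorPairing_integrable h1.continuous g)]
        have := spinorPairing_eq_zero h1 hw h0' hg
        rw [spinorPairing] at this
        rw [this, sub_zero, spinorPairing]
      rw [e]
      refine norm_integral_le_of_norm_le_const (Filter.Eventually.of_forall fun y => ?_)
      rw [← sub_mul, ← mul_sub, norm_mul, norm_mul, RCLike.norm_conj, Complex.norm_real]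
      have k1 := hB _ (phaseSpinor y).2
      have k2 : ‖HC (phaseSpinor y) - g (phaseSpinor y)‖ ≤ ε := by
        rw [← dist_eq_norm]
        exact (ContinuousMap.dist_apply_le_dist _).trans hd.le
      have k3 : ‖Real.sin y.2.1‖ ≤ 1 := Real.abs_sin_le_one _
      have k0 : 0 ≤ B := (norm_nonneg _).trans k1
      calc _ ≤ B * ε * 1 := by gcongr
        _ = _ := mul_one _
    have hlim : Filter.Tendsto (fun ε : ℝ => B * ε * phaseMeasure.real Set.univ)
        (nhdsWithin 0 (Set.Ioi 0)) (nhds 0) := by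
      have : Continuous fun ε : ℝ => B * ε * phaseMeasure.real Set.univ := by fun_prop
      have h := this.tendsto 0
      simp only [mul_zero, zero_mul] at h
      exact h.mono_left nhdsWithin_le_nhds
    have := ge_of_tendsto hlim (by
      filter_upwards [self_mem_nhdsWithin] with ε hε using hle ε hε)
    exact norm_eq_zero.1 (le_antisymm this (norm_nonneg _))
  have hreal : ∫ x, Complex.normSq (H (spinor x.1 x.2)) * Real.sin x.1 ∂chartMeasure = 0 := by
    have e : ∀ y : ℝ × ℝ × ℝ, (starRingEnd ℂ) (H (phaseSpinor y).1) * HC (phaseSpinor y)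
        * (Real.sin y.2.1 : ℂ)
        = 1 * ((Complex.normSq (H (spinor y.2.1 y.2.2)) * Real.sin y.2.1 : ℝ) : ℂ) := by
      intro y
      have hH : HC (phaseSpinor y) = H (phaseSpinor y).1 := rfl
      have hn : Complex.normSq (H (phaseSpinor y).1)
          = Complex.normSq (H (spinor y.2.1 y.2.2)) := by
        change Complex.normSq (H (Complex.exp (Complex.I * y.1) • spinor y.2.1 y.2.2)) = _
        rw [hw, Complex.normSq_mul]
        have : Complex.normSq (Complex.exp (2 * Complex.I * p * y.1)) = 1 := by
          rw [Complex.normSq_eq_norm_sq, show 2 * Complex.I * p * y.1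
            = ((2 * p * y.1 : ℝ) : ℂ) * Complex.I by push_cast; ring,
            Complex.norm_exp_ofReal_mul_I, one_pow]
        rw [this, one_mul]
      rw [hH, mul_comm ((starRingEnd ℂ) _), Complex.mul_conj, hn]
      push_cast
      ring
    rw [spinorPairing] at hself
    simp only [e] at hself
    rw [phaseMeasure, integral_prod_mul (fun _ : ℝ => (1 : ℂ)) (fun x : ℝ × ℝ =>
      ((Complex.normSq (H (spinor x.1 x.2)) * Real.sin x.1 : ℝ) : ℂ)), integral_complex_ofReal] at hself
    have h2 := (mul_eq_zero.1 hself).resolve_left (by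
      have := Real.pi_pos
      simp [this.ne', Real.two_pi_pos.le])
    exact_mod_cast h2
  have hc : Continuous fun x : ℝ × ℝ => Complex.normSq (H (spinor x.1 x.2)) * Real.sin x.1 :=
    (Complex.continuous_normSq.comp (h1.continuous.comp continuous_spinor)).mul (by fun_prop)
  have hint : Integrable (fun x : ℝ × ℝ => Complex.normSq (H (spinor x.1 x.2)) * Real.sin x.1)
      chartMeasure := by
    rw [chartMeasure_eq]
    refine (hc.continuousOn.integrableOn_compact
      (isCompact_Icc.prod isCompact_Icc (s := Set.Icc (0 : ℝ) Real.pi)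
        (t := Set.Icc (0 : ℝ) (2 * Real.pi)))).mono_set ?_
    exact Set.prod_mono Set.Ioo_subset_Icc_self Set.Ioc_subset_Icc_self
  have hae := (integral_eq_zero_iff_of_nonneg_ae (by
    filter_upwards [ae_chartMeasure_mem] with x hx
    exact mul_nonneg (Complex.normSq_nonneg _) (Real.sin_pos_of_mem_Ioo hx).le) hint).1 hreal
  -- Vanishing almost everywhere becomes vanishing everywhere on the coordinate rectangle by
  -- continuity, since the rectangle lies in the closure of its interior.
  rw [chartMeasure_eq] at hae
  have hzero := Measure.eqOn_of_ae_eq hae hc.continuousOn continuousOn_const (by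
    rw [interior_prod_eq, interior_Ioo, interior_Ioc, closure_prod_eq,
      closure_Ioo Real.pi_pos.ne, closure_Ioo Real.two_pi_pos.ne]
    exact Set.prod_mono Set.Ioo_subset_Icc_self Set.Ioc_subset_Icc_self)
  intro θ hθ ϕ
  have hper : Function.Periodic (fun ϕ => H (spinor θ ϕ)) (2 * Real.pi) := fun ϕ =>
    hw.spinor_add_two_pi θ ϕ
  obtain ⟨ϕ', hϕ', he⟩ := hper.exists_mem_Ioc Real.two_pi_pos ϕ 0
  rw [zero_add] at hϕ'
  have h4 := hzero (x := (θ, ϕ')) ⟨hθ, hϕ'⟩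
  simp only [Pi.zero_apply] at h4
  have h5 := (mul_eq_zero.1 h4).resolve_right (Real.sin_pos_of_mem_Ioo hθ).ne'
  rw [h3 θ hθ ϕ]
  exact he.trans (Complex.normSq_eq_zero.1 h5)

theorem SmoothWeighted.eq_synth {p : ℤ} {f : ℝ → ℝ → ℂ} (hf : SmoothWeighted p f) :
    ∀ θ ∈ Set.Ioo (0 : ℝ) Real.pi, ∀ ϕ, f θ ϕ = synth p (fun l m => multipole p l m f) θ ϕ := by
  have hs := hf.rapidDecay_multipole.smoothWeighted_synth p
  intro θ hθ ϕ
  refine sub_eq_zero.1 ((hf.sub hs).eq_zero (fun l m => ?_) θ hθ ϕ)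
  rw [multipole_sub hf hs]
  by_cases h : |p| ≤ (l : ℤ) ∧ |m| ≤ (l : ℤ)
  · rw [hf.rapidDecay_multipole.multipole_synth h.1 h.2, sub_self]
  · rw [multipole_of_not h, multipole_of_not h, sub_self]

/-- The expansion of a smooth function in spin-weighted harmonics. -/
theorem SmoothWeighted.hasSum_multipole {p : ℤ} {f : ℝ → ℝ → ℂ} (hf : SmoothWeighted p f) {θ : ℝ}
    (hθ : θ ∈ Set.Ioo (0 : ℝ) Real.pi) (ϕ : ℝ) :
    HasSum (fun x : ℕ × ℤ => multipole p x.1 x.2 f * spinY p x.1 x.2 θ ϕ) (f θ ϕ) := by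
  rw [hf.eq_synth θ hθ ϕ]
  simp only [spinY_eq p _ _ hθ]
  exact hf.rapidDecay_multipole.hasSum_synth p θ ϕ

theorem SmoothWeighted.congr_of_multipole {p : ℤ} {f g : ℝ → ℝ → ℂ} (hf : SmoothWeighted p f)
    (hg : SmoothWeighted p g)
    (h : ∀ (l : ℕ) (m : ℤ), |p| ≤ (l : ℤ) → |m| ≤ (l : ℤ) → multipole p l m f = multipole p l m g) :
    ∀ θ ∈ Set.Ioo (0 : ℝ) Real.pi, ∀ ϕ, f θ ϕ = g θ ϕ := by
  intro θ hθ ϕ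
  refine sub_eq_zero.1 ((hf.sub hg).eq_zero (fun l m => ?_) θ hθ ϕ)
  rw [multipole_sub hf hg]
  by_cases hlm : |p| ≤ (l : ℤ) ∧ |m| ≤ (l : ℤ)
  · rw [h l m hlm.1 hlm.2, sub_self]
  · rw [multipole_of_not hlm, multipole_of_not hlm, sub_self]

/-! ### Dependence of the multipole moments on retarded time. -/

namespace IsSmoothSpinWeighted

variable {p : ℤ} {f : ScriFun}

theorem hasDerivAt_multipole (hf : IsSmoothSpinWeighted p f) (l : ℕ) (m : ℤ) (u : ℝ) :
    HasDerivAt (fun u => multipole p l m (f u))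
      (multipole p l m (fun θ ϕ => deriv (fun t => f t θ ϕ) u)) u := by
  have e0 : (fun u => multipole p l m (f u)) = fun u => sphInt (fun θ ϕ =>
      f u θ ϕ * (starRingEnd ℂ) (spinorY p l m (spinor θ ϕ))) :=
    funext fun u => multipole_eq (hf.smoothWeighted u) l m
  rw [e0, multipole_eq (hf.du.smoothWeighted u)]
  obtain ⟨F, h1, h2, h3⟩ := isSmoothSpinWeighted_iff.1 hf
  have hd : Differentiable ℝ F := h1.differentiable (by simp)
  set W : ℝ × ℝ → ℂ := fun x => (starRingEnd ℂ) (spinorY p l m (spinor x.1 x.2))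
    * (Real.sin x.1 : ℂ) with hW
  have hWc : Continuous W := (Complex.continuous_conj.comp
    ((contDiff_spinorY p l m).continuous.comp continuous_spinor)).mul (by fun_prop)
  have e1 : ∀ u, sphInt (fun θ ϕ => f u θ ϕ * (starRingEnd ℂ) (spinorY p l m (spinor θ ϕ)))
      = ∫ x, F (u, spinor x.1 x.2) * W x ∂chartMeasure := by
    intro u
    refine integral_congr_ae ?_
    filter_upwards [ae_chartMeasure_mem] with x hx
    simp only [hW, h3 u x.1 hx x.2, mul_assoc]
  have e2 : sphInt (fun θ ϕ => deriv (fun t => f t θ ϕ) u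
      * (starRingEnd ℂ) (spinorY p l m (spinor θ ϕ)))
      = ∫ x, fderiv ℝ F (u, spinor x.1 x.2) (1, 0) * W x ∂chartMeasure := by
    refine integral_congr_ae ?_
    filter_upwards [ae_chartMeasure_mem] with x hx
    have : (fun t => f t x.1 x.2) = fun t => F (t, spinor x.1 x.2) :=
      funext fun t => h3 t x.1 hx x.2
    simp only [hW, this, (hasDerivAt_time hd u _).deriv, mul_assoc]
  simp only [e1]
  rw [e2]
  have hFc : Continuous fun y : ℝ × ℝ × ℝ =>
      fderiv ℝ F (y.1, spinor y.2.1 y.2.2) (1, 0) * W y.2 :=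
    (((h1.continuous_fderiv (by simp)).comp (continuous_fst.prodMk
      (continuous_spinor.comp continuous_snd))).clm_apply continuous_const).mul
      (hWc.comp continuous_snd)
  obtain ⟨B, hB⟩ := ((isCompact_Icc (a := u - 1) (b := u + 1)).prod
    ((isCompact_Icc (a := (0 : ℝ)) (b := Real.pi)).prod
      (isCompact_Icc (a := (0 : ℝ)) (b := 2 * Real.pi)))).exists_bound_of_continuousOn
      hFc.continuousOn
  have hmem : ∀ᵐ x ∂chartMeasure, x ∈ Set.Icc (0 : ℝ) Real.pi ×ˢ Set.Icc 0 (2 * Real.pi) := by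
    rw [chartMeasure_eq]
    filter_upwards [ae_restrict_mem (measurableSet_Ioo.prod measurableSet_Ioc)] with x hx
    exact Set.prod_mono Set.Ioo_subset_Icc_self Set.Ioc_subset_Icc_self hx
  have hc : ∀ t : ℝ, Continuous fun x : ℝ × ℝ => F (t, spinor x.1 x.2) * W x := fun t =>
    (h1.continuous.comp (continuous_const.prodMk continuous_spinor)).mul hWc
  refine (hasDerivAt_integral_of_dominated_loc_of_deriv_le (bound := fun _ => B)
    (F' := fun t x => fderiv ℝ F (t, spinor x.1 x.2) (1, 0) * W x)
    (Icc_mem_nhds (by linarith : u - 1 < u) (by linarith : u < u + 1))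
    (Filter.Eventually.of_forall fun t => (hc t).aestronglyMeasurable)
    (integrable_of_continuous (hc u))
    (hFc.comp (continuous_const.prodMk continuous_id)).aestronglyMeasurable
    ?_ (integrable_const B) ?_).2
  · filter_upwards [hmem] with x hx t ht
    exact hB (t, x) ⟨ht, hx⟩
  · exact Filter.Eventually.of_forall fun x t _ => (hasDerivAt_time hd t _).mul_const _

theorem contDiff_multipole (hf : IsSmoothSpinWeighted p f) (l : ℕ) (m : ℤ) :
    ContDiff ℝ ∞ (fun u => multipole p l m (f u)) := by
  have key : ∀ n : ℕ, ∀ g : ScriFun, IsSmoothSpinWeighted p g →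
      ContDiff ℝ n (fun u => multipole p l m (g u)) := by
    intro n
    induction n with
    | zero =>
      intro g hg
      exact contDiff_zero.2 (continuous_iff_continuousAt.2 fun u =>
        (hg.hasDerivAt_multipole l m u).continuousAt)
    | succ n ih =>
      intro g hg
      have hd : deriv (fun u => multipole p l m (g u))
          = fun u => multipole p l m (fun θ ϕ => deriv (fun t => g t θ ϕ) u) :=
        funext fun u => (hg.hasDerivAt_multipole l m u).deriv
      push_cast
      rw [contDiff_succ_iff_deriv]
      refine ⟨fun u => (hg.hasDerivAt_multipole l m u).differentiableAt, by simp, ?_⟩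
      rw [hd]
      exact ih _ hg.du
  exact contDiff_infty.2 fun n => key n f hf

end IsSmoothSpinWeighted

end ZRM

/-! ### The field equations for the multipoles -/

namespace ZRM

theorem rmul_rmul {A : Type} (a b : ℤ) (f : PolyLog A) : rmul a (rmul b f) = rmul (a + b) f := by
  funext k j
  simp only [rmul, add_assoc]

theorem rmul_zero_left {A : Type} (f : PolyLog A) : rmul 0 f = f := by
  funext k j
  simp only [rmul, add_zero]

theorem rmul_add {A : Type} [AddCommGroup A] (a : ℤ) (f g : PolyLog A) :
    rmul a (f + g) = rmul a f + rmul a g := rfl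

section PolyLogAlgebra

variable {A : Type} [AddCommGroup A] [Module ℂ A]

theorem rmul_smul (a : ℤ) (c : ℂ) (f : PolyLog A) : rmul a (c • f) = c • rmul a f := rfl

/-- The formal derivative as a linear map. -/
def drL (A : Type) [AddCommGroup A] [Module ℂ A] : Module.End ℂ (PolyLog A) where
  toFun := dr
  map_add' f g := by
    funext k j
    simp only [dr, Pi.add_apply, smul_add]
    abel
  map_smul' c f := by
    funext k j
    simp only [dr, Pi.smul_apply, smul_add, RingHom.id_apply, smul_comm c]

theorem dr_iterate (N : ℕ) (f : PolyLog A) : dr^[N] f = (drL A ^ N) f := by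
  rw [Module.End.pow_apply]
  rfl

/-- Linear operators which act like `∂_r` on products with powers of `r`. -/
def IsRadial (T : Module.End ℂ (PolyLog A)) : Prop :=
  ∀ (a : ℤ) (f : PolyLog A), T (rmul a f) = rmul a (T f) + (a : ℂ) • rmul (a - 1) f

theorem isRadial_drL : IsRadial (drL A) := by
  intro a f
  funext k j
  change dr (rmul a f) k j = rmul a (dr f) k j + (a : ℂ) • rmul (a - 1) f k j
  simp only [dr, rmul]
  rw [show k - 1 + a = k + a - 1 by ring, show k + (a - 1) = k + a - 1 by ring]
  push_cast
  module

variable {T : Module.End ℂ (PolyLog A)}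

/-- Leibniz' rule for a factor `r`: only two terms survive, because `T` acts on `r` like `∂_r`. The
abstract operator covers both `∂_r` and `∂_r - 2 ∂_u`. -/
theorem IsRadial.pow_succ_rmul_one (hT : IsRadial T) (N : ℕ) (g : PolyLog A) :
    (T ^ (N + 1)) (rmul 1 g) = rmul 1 ((T ^ (N + 1)) g) + ((N : ℂ) + 1) • (T ^ N) g := by
  induction N with
  | zero =>
    have h := hT 1 g
    rw [sub_self, rmul_zero_left] at h
    simpa using h
  | succ N ih =>
    have h := hT 1 ((T ^ (N + 1)) g)
    rw [sub_self, rmul_zero_left] at h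
    rw [pow_succ' T (N + 1), Module.End.mul_apply, ih, map_add, map_smul, h, Module.End.mul_apply,
      ← Module.End.mul_apply T (T ^ N), ← pow_succ' T N]
    push_cast
    module

/-- The passage from `N` to `N + 1` derivatives is a first-order operator in `r`. For `∂_r` this is
the radial equation of the advanced solutions, for `∂_r - 2 ∂_u` the evolution equation of the
retarded ones. -/
theorem IsRadial.lower (hT : IsRadial T) (e : ℤ) (N : ℕ) (g : PolyLog A) :
    T (rmul e ((T ^ N) g)) + ((N : ℂ) + 1 - e) • rmul (-1) (rmul e ((T ^ N) g))
      = rmul (-1) (rmul e ((T ^ (N + 1)) (rmul 1 g))) := by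
  rw [hT, hT.pow_succ_rmul_one, pow_succ', Module.End.mul_apply, rmul_add, rmul_add, rmul_smul,
    rmul_smul, rmul_rmul e 1, rmul_rmul (-1) (e + 1), rmul_rmul (-1) e,
    show (-1 : ℤ) + (e + 1) = e by ring, show e - 1 = -1 + e by ring]
  module

/-- Moves a derivative of the profile through the operator. A function of `u + 2 r` satisfies `2 ∂_u
= ∂_r`, so this computes the `u`-derivative of an advanced component. -/
theorem IsRadial.advance (hT : IsRadial T) (e a : ℤ) (N : ℕ) (F : PolyLog A) :
    rmul e ((T ^ (N + 1)) (rmul (-a) (T F)))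
      = T (rmul e ((T ^ (N + 1)) (rmul (-a) F)))
        + ((a : ℂ) - e) • rmul (-1) (rmul e ((T ^ (N + 1)) (rmul (-a) F)))
        - ((a : ℂ) * (N + 1)) • rmul (-1) (rmul e ((T ^ N) (rmul (-(a + 1)) F))) := by
  have h1 : rmul (-a) (T F) = T (rmul (-a) F) + (a : ℂ) • rmul (-(a + 1)) F := by
    rw [hT, show -a - 1 = -(a + 1) by ring]
    push_cast
    module
  have h2 : rmul (-a) F = rmul 1 (rmul (-(a + 1)) F) := by
    rw [rmul_rmul, show 1 + -(a + 1) = -a by ring]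
  have h3 : (T ^ (N + 1)) (T (rmul (-a) F)) = T ((T ^ (N + 1)) (rmul (-a) F)) := by
    rw [← Module.End.mul_apply, ← pow_succ, pow_succ', Module.End.mul_apply]
  rw [h1, map_add, map_smul, h3, hT, rmul_add, rmul_smul, h2, hT.pow_succ_rmul_one]
  simp only [rmul_add, rmul_smul, rmul_rmul]
  rw [show -1 + (e + 1) = e by ring, show e - 1 = -1 + e by ring,
    show -1 + e + 1 = e by ring]
  module

/-- Here `Ph` stands for the `u`-derivative of the seed `h = b (u) r ^ (-c)`; the hypothesis
eliminates it in favour of `T = ∂_r - 2 ∂_u`. The result is the radial equation of the retarded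
solutions. -/
theorem IsRadial.retard (hT : IsRadial T) (e c : ℤ) (M : ℕ) (h Ph : PolyLog A)
    (hP : (2 : ℂ) • Ph = -T h - (c : ℂ) • rmul (-1) h) :
    T (rmul e ((T ^ (M + 1)) h)) + (2 : ℂ) • rmul e ((T ^ (M + 1)) Ph)
      + ((c : ℂ) - e) • rmul (-1) (rmul e ((T ^ (M + 1)) h))
      = ((c : ℂ) * (M + 1)) • rmul (-1) (rmul e ((T ^ M) (rmul (-1) h))) := by
  have h2 : h = rmul 1 (rmul (-1) h) := by
    rw [rmul_rmul, add_neg_cancel, rmul_zero_left]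
  have h3 : (T ^ (M + 1)) (T h) = T ((T ^ (M + 1)) h) := by
    rw [← Module.End.mul_apply, ← pow_succ, pow_succ', Module.End.mul_apply]
  have h4 : (T ^ (M + 1)) h = rmul 1 ((T ^ (M + 1)) (rmul (-1) h))
      + ((M : ℂ) + 1) • (T ^ M) (rmul (-1) h) := by
    conv_lhs => rw [h2]
    exact hT.pow_succ_rmul_one M _
  rw [← rmul_smul, ← map_smul, hP, map_sub, map_neg, h3, hT, map_smul]
  have h5 : rmul e (-T ((T ^ (M + 1)) h) - (c : ℂ) • (T ^ (M + 1)) (rmul (-1) h))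
      = -rmul e (T ((T ^ (M + 1)) h)) - (c : ℂ) • rmul e ((T ^ (M + 1)) (rmul (-1) h)) := rfl
  have h6 : rmul (-1) (rmul e ((T ^ (M + 1)) h)) = rmul e ((T ^ (M + 1)) (rmul (-1) h))
      + ((M : ℂ) + 1) • rmul (-1) (rmul e ((T ^ M) (rmul (-1) h))) := by
    conv_lhs => rw [h4]
    simp only [rmul_add, rmul_smul, rmul_rmul]
    rw [show -1 + (e + 1) = e by ring]
  have h7 : rmul (e - 1) ((T ^ (M + 1)) h) = rmul (-1) (rmul e ((T ^ (M + 1)) h)) := by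
    rw [rmul_rmul, show -1 + e = e - 1 by ring]
  rw [h5, h7, h6]
  module

end PolyLogAlgebra

/-- The coefficients of the field equations in the `l`-th multipole sector. -/
def modeLadder (s l n : ℕ) : ℝ := ladder ((s : ℤ) - n - 1) l

theorem modeLadder_pos {s l n : ℕ} (hl : s ≤ l) (hn : n < 2 * s) : 0 < modeLadder s l n :=
  ladder_pos (by omega) (by omega)

/-- The field equations without `u`-derivatives for the multipoles of a field. -/
def RadialEqs (s l : ℕ) (D : ℕ → PolyLog ℂ) : Prop :=
  ∀ n < 2 * s, ∀ (k : ℤ) (j : ℕ), (2 * (s : ℂ) - n - k) * D (n + 1) k j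
    + ((j : ℂ) + 1) * D (n + 1) k (j + 1) = (modeLadder s l n : ℂ) * D n k j

/-- The right-hand side of the evolution equations for the multipoles of a field. -/
def evolution (s l : ℕ) (D : ℕ → PolyLog ℂ) (n : ℕ) (k : ℤ) (j : ℕ) : ℂ :=
  1 / 2 * (((n : ℂ) + 1 - k) * D n k j + ((j : ℂ) + 1) * D n k (j + 1))
    - (modeLadder s l n : ℂ) * D (n + 1) k j

/-- The field equations for the multipoles of a field. -/
def ModeEqs (s l : ℕ) (f : ℕ → PolyLog (ℝ → ℂ)) : Prop :=
  ∀ u : ℝ, RadialEqs s l (fun n k j => f n k j u) ∧ ∀ n < 2 * s, ∀ (k : ℤ) (j : ℕ),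
    deriv (f n (k + 1) j) u = evolution s l (fun n k j => f n k j u) n k j

theorem modeEqs_congr {s l : ℕ} {f g : ℕ → PolyLog (ℝ → ℂ)} (hf : ModeEqs s l f)
    (h : ∀ n ≤ 2 * s, ∀ k j, g n k j = f n k j) : ModeEqs s l g := by
  intro u
  refine ⟨fun n hn k j => ?_, fun n hn k j => ?_⟩
  · have := (hf u).1 n hn k j
    simp only [h n hn.le, h (n + 1) hn] at this ⊢
    exact this
  · have := (hf u).2 n hn k j
    simp only [evolution, h n hn.le, h (n + 1) hn] at this ⊢
    exact this

/-- Fields with a single multipole. -/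
theorem satisfiesZRM_of_modeEqs {s l : ℕ} {m : ℤ} {φ : FieldExp} {f : ℕ → PolyLog (ℝ → ℂ)}
    (hf : ModeEqs s l f) (hφ : ∀ n ≤ 2 * s, ∀ k j u θ ϕ,
      φ n k j u θ ϕ = f n k j u * spinY ((s : ℤ) - n) l m θ ϕ) : SatisfiesZRM s φ := by
  intro n hn1 hn k j
  obtain ⟨n, rfl⟩ : ∃ n', n = n' + 1 := ⟨n - 1, by omega⟩
  have hp : (s : ℤ) - (n + 1 : ℕ) = (s : ℤ) - n - 1 := by push_cast; ring
  rw [Nat.add_sub_cancel, hp]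
  have e0 : φ n = fun k j u θ ϕ => f n k j u * spinY ((s : ℤ) - n) l m θ ϕ := by
    funext k j u θ ϕ; exact hφ n (by omega) k j u θ ϕ
  have e1 : φ (n + 1) = fun k j u θ ϕ => f (n + 1) k j u * spinY ((s : ℤ) - n - 1) l m θ ϕ := by
    funext k j u θ ϕ; rw [hφ (n + 1) hn k j u θ ϕ, hp]
  rw [sub_add_cancel, e0, e1]
  constructor
  · intro u ϕ θ hθ
    have h1 := (hf u).1 n (by omega) (k - 1) j
    have h2 : ethBar ((s : ℤ) - n) (fun θ ϕ => f n (k - 1) j u * spinY ((s : ℤ) - n) l m θ ϕ) θ ϕ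
        = f n (k - 1) j u * ((modeLadder s l n : ℂ) * spinY ((s : ℤ) - n - 1) l m θ ϕ) := by
      rw [ethBar_const_mul, ethBar_congr (fun θ hθ ϕ => spinY_eq _ l m hθ ϕ) hθ,
        ethBar_spinorY _ l m hθ, spinY_eq _ l m hθ, modeLadder]
    simp only [Pi.sub_apply, Pi.smul_apply, Pi.add_apply, smul_eq_mul, dr, ethBarField, rmul,
      ← sub_eq_add_neg, h2]
    push_cast at h1 ⊢
    linear_combination (spinY ((s : ℤ) - n - 1) l m θ ϕ) * h1
  · intro u ϕ θ hθ
    have h1 := (hf u).2 n (by omega) (k - 1) j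
    rw [sub_add_cancel] at h1
    have h2 : eth ((s : ℤ) - n - 1)
        (fun θ ϕ => f (n + 1) (k - 1) j u * spinY ((s : ℤ) - n - 1) l m θ ϕ) θ ϕ
        = f (n + 1) (k - 1) j u * (-(modeLadder s l n : ℂ) * spinY ((s : ℤ) - n) l m θ ϕ) := by
      rw [eth_const_mul, eth_congr (fun θ hθ ϕ => spinY_eq _ l m hθ ϕ) hθ,
        eth_spinorY _ l m hθ, sub_add_cancel, spinY_eq _ l m hθ, modeLadder]
    simp only [Pi.sub_apply, Pi.smul_apply, Pi.add_apply, smul_eq_mul, dr, ethField, duField, rmul,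
      ← sub_eq_add_neg, h2, deriv_mul_const_field, h1, evolution]
    push_cast
    ring

/-- The multipoles of the components of a field. -/
def fieldMode (s : ℕ) (φ : FieldExp) (l : ℕ) (m : ℤ) : ℕ → PolyLog (ℝ → ℂ) :=
  fun n k j u => multipole ((s : ℤ) - n) l m (φ n k j u)

theorem multipole_lin {p : ℤ} {f g : ℝ → ℝ → ℂ} (hf : SmoothWeighted p f)
    (hg : SmoothWeighted p g) (a b : ℂ) (l : ℕ) (m : ℤ) :
    multipole p l m (a • f + b • g) = a * multipole p l m f + b * multipole p l m g := by
  rw [multipole_add (hf.const_smul a) (hg.const_smul b), multipole_const_smul,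
    multipole_const_smul]

section Dictionary

variable {s : ℕ} {φ : FieldExp}
  (hφ : ∀ n ≤ 2 * s, ∀ k j, IsSmoothSpinWeighted ((s : ℤ) - n) (φ n k j))

include hφ

theorem multipole_radial_left {n : ℕ} (hn : n < 2 * s) (k : ℤ) (j : ℕ) (u : ℝ) :
    SmoothWeighted ((s : ℤ) - n - 1) ((dr (φ (n + 1)) k j
        - ethBarField ((s : ℤ) - n) (φ n) k j) u) ∧
      ∀ l m, multipole ((s : ℤ) - n - 1) l m ((dr (φ (n + 1)) k j
        - ethBarField ((s : ℤ) - n) (φ n) k j) u)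
        = -((k : ℂ) - 1) * fieldMode s φ l m (n + 1) (k - 1) j u
          + ((j : ℂ) + 1) * fieldMode s φ l m (n + 1) (k - 1) (j + 1) u
          - (modeLadder s l n : ℂ) * fieldMode s φ l m n (k - 1) j u := by
  have hp : (s : ℤ) - (n + 1 : ℕ) = (s : ℤ) - n - 1 := by push_cast; ring
  have h1 : ∀ k j, SmoothWeighted ((s : ℤ) - n - 1) (φ (n + 1) k j u) := fun k j => by
    rw [← hp]; exact (hφ (n + 1) hn k j).smoothWeighted u
  have h0 : SmoothWeighted ((s : ℤ) - n) (φ n (k - 1) j u) :=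
    (hφ n hn.le (k - 1) j).smoothWeighted u
  have hA := ((h1 (k - 1) j).const_smul (-((k : ℂ) - 1))).add
    ((h1 (k - 1) (j + 1)).const_smul ((j : ℂ) + 1))
  refine ⟨hA.sub h0.ethBar, fun l m => ?_⟩
  refine (multipole_sub hA h0.ethBar l m).trans ?_
  rw [multipole_lin (h1 (k - 1) j) (h1 (k - 1) (j + 1)), multipole_ethBar h0]
  simp only [fieldMode, hp, modeLadder]

theorem multipole_radial_right {n : ℕ} (hn : n < 2 * s) (k : ℤ) (j : ℕ) (u : ℝ) (c : ℂ) :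
    SmoothWeighted ((s : ℤ) - n - 1) ((c • rmul (-1) (φ (n + 1)) k j) u) ∧
      ∀ l m, multipole ((s : ℤ) - n - 1) l m ((c • rmul (-1) (φ (n + 1)) k j) u)
        = c * fieldMode s φ l m (n + 1) (k - 1) j u := by
  have hp : (s : ℤ) - (n + 1 : ℕ) = (s : ℤ) - n - 1 := by push_cast; ring
  have h1 : SmoothWeighted ((s : ℤ) - n - 1) (φ (n + 1) (k - 1) j u) := by
    rw [← hp]; exact (hφ (n + 1) hn (k - 1) j).smoothWeighted u
  refine ⟨h1.const_smul c, fun l m => ?_⟩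
  refine (multipole_const_smul _ l m c _).trans ?_
  simp only [fieldMode, hp]
  rfl

theorem multipole_evolution_left {n : ℕ} (hn : n < 2 * s) (k : ℤ) (j : ℕ) (u : ℝ) :
    SmoothWeighted ((s : ℤ) - n) ((duField (φ n) k j - (1 / 2 : ℂ) • dr (φ n) k j
        - ethField ((s : ℤ) - n - 1) (φ (n + 1)) k j) u) ∧
      ∀ l m, multipole ((s : ℤ) - n) l m ((duField (φ n) k j - (1 / 2 : ℂ) • dr (φ n) k j
        - ethField ((s : ℤ) - n - 1) (φ (n + 1)) k j) u)
        = deriv (fieldMode s φ l m n k j) u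
          - 1 / 2 * (-((k : ℂ) - 1) * fieldMode s φ l m n (k - 1) j u
            + ((j : ℂ) + 1) * fieldMode s φ l m n (k - 1) (j + 1) u)
          + (modeLadder s l n : ℂ) * fieldMode s φ l m (n + 1) (k - 1) j u := by
  have hp : (s : ℤ) - (n + 1 : ℕ) = (s : ℤ) - n - 1 := by push_cast; ring
  have h1 : SmoothWeighted ((s : ℤ) - n - 1) (φ (n + 1) (k - 1) j u) := by
    rw [← hp]; exact (hφ (n + 1) hn (k - 1) j).smoothWeighted u
  have h0 : ∀ k j, SmoothWeighted ((s : ℤ) - n) (φ n k j u) := fun k j =>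
    (hφ n hn.le k j).smoothWeighted u
  have hA := ((h0 (k - 1) j).const_smul (-((k : ℂ) - 1))).add
    ((h0 (k - 1) (j + 1)).const_smul ((j : ℂ) + 1))
  have hd := (hφ n hn.le k j).du.smoothWeighted u
  have he : SmoothWeighted ((s : ℤ) - n) (eth ((s : ℤ) - n - 1) (φ (n + 1) (k - 1) j u)) := by
    have := h1.eth
    rwa [sub_add_cancel] at this
  have hm : ∀ l m, multipole ((s : ℤ) - n) l m (eth ((s : ℤ) - n - 1) (φ (n + 1) (k - 1) j u))
      = -(modeLadder s l n : ℂ) * fieldMode s φ l m (n + 1) (k - 1) j u := fun l m => by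
    have := multipole_eth h1 l m
    rw [sub_add_cancel] at this
    rw [this, fieldMode, hp, modeLadder]
  refine ⟨(hd.sub (hA.const_smul (1 / 2))).sub he, fun l m => ?_⟩
  refine (multipole_sub (hd.sub (hA.const_smul (1 / 2))) he l m).trans ?_
  rw [multipole_sub hd (hA.const_smul _), multipole_const_smul,
    multipole_lin (h0 (k - 1) j) (h0 (k - 1) (j + 1)), hm]
  have hderiv : deriv (fieldMode s φ l m n k j) u
      = multipole ((s : ℤ) - n) l m (fun θ ϕ => deriv (fun t => φ n k j t θ ϕ) u) :=
    ((hφ n hn.le k j).hasDerivAt_multipole l m u).deriv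
  rw [hderiv]
  simp only [fieldMode]
  ring

theorem multipole_evolution_right {n : ℕ} (hn : n < 2 * s) (k : ℤ) (j : ℕ) (u : ℝ) (c : ℂ) :
    SmoothWeighted ((s : ℤ) - n) ((c • rmul (-1) (φ n) k j) u) ∧
      ∀ l m, multipole ((s : ℤ) - n) l m ((c • rmul (-1) (φ n) k j) u)
        = c * fieldMode s φ l m n (k - 1) j u := by
  refine ⟨((hφ n hn.le (k - 1) j).smoothWeighted u).const_smul c, fun l m => ?_⟩
  exact multipole_const_smul _ l m c _

/-- The field equations hold iff they hold for all multipoles. -/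
theorem satisfiesZRM_iff :
    SatisfiesZRM s φ ↔ ∀ (l : ℕ) (m : ℤ), ModeEqs s l (fieldMode s φ l m) := by
  have hp : ∀ n : ℕ, (s : ℤ) - (n + 1 : ℕ) = (s : ℤ) - n - 1 := fun n => by push_cast; ring
  constructor
  · intro h l m u
    refine ⟨fun n hn k j => ?_, fun n hn k j => ?_⟩
    · have h1 := (h (n + 1) (by omega) (by omega) (k + 1) j).1
      rw [Nat.add_sub_cancel, hp, sub_add_cancel] at h1
      have h2 := multipole_congr (p := (s : ℤ) - n - 1) (fun θ hθ ϕ => h1 u ϕ θ hθ) l m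
      rw [(multipole_radial_left hφ hn (k + 1) j u).2,
        (multipole_radial_right hφ hn (k + 1) j u _).2, add_sub_cancel_right] at h2
      push_cast at h2
      linear_combination h2
    · have h1 := (h (n + 1) (by omega) (by omega) (k + 1) j).2
      rw [Nat.add_sub_cancel, hp] at h1
      have h2 := multipole_congr (p := (s : ℤ) - n) (fun θ hθ ϕ => h1 u ϕ θ hθ) l m
      rw [(multipole_evolution_left hφ hn (k + 1) j u).2,
        (multipole_evolution_right hφ hn (k + 1) j u _).2, add_sub_cancel_right] at h2
      push_cast at h2
      rw [evolution]
      linear_combination h2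
  · intro h n hn1 hn k j
    obtain ⟨n, rfl⟩ : ∃ n', n = n' + 1 := ⟨n - 1, by omega⟩
    rw [Nat.add_sub_cancel, hp, sub_add_cancel]
    constructor
    · intro u ϕ θ hθ
      obtain ⟨a1, a2⟩ := multipole_radial_left hφ (by omega : n < 2 * s) k j u
      obtain ⟨b1, b2⟩ := multipole_radial_right hφ (by omega : n < 2 * s) k j u
        (-(2 * (s : ℂ) - (n + 1 : ℕ) + 1))
      -- Completeness enters here: both sides are smooth of the same spin weight, so equality of all
      -- moments gives pointwise equality.
      refine a1.congr_of_multipole b1 (fun l m _ _ => ?_) θ hθ ϕ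
      have h1 := (h l m u).1 n (by omega) (k - 1) j
      rw [a2, b2]
      push_cast at h1 ⊢
      linear_combination h1
    · intro u ϕ θ hθ
      obtain ⟨a1, a2⟩ := multipole_evolution_left hφ (by omega : n < 2 * s) k j u
      obtain ⟨b1, b2⟩ := multipole_evolution_right hφ (by omega : n < 2 * s) k j u
        (((n + 1 : ℕ) : ℂ) / 2)
      refine a1.congr_of_multipole b1 (fun l m _ _ => ?_) θ hθ ϕ
      have h1 := (h l m u).2 n (by omega) (k - 1) j
      rw [sub_add_cancel, evolution] at h1
      rw [a2, b2, h1]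
      push_cast
      ring

end Dictionary

/-- Vanishing of a function on `ℝ × S²` in terms of multipoles. -/
theorem IsSmoothSpinWeighted.sphEq_zero_iff {p : ℤ} {f : ScriFun} (hf : IsSmoothSpinWeighted p f) :
    SphEq f 0 ↔ ∀ (l : ℕ) (m : ℤ), |p| ≤ (l : ℤ) → |m| ≤ (l : ℤ) → ∀ u, multipole p l m (f u) = 0 := by
  constructor
  · intro h l m _ _ u
    rw [multipole_congr (f := 0) (fun θ hθ ϕ => h u ϕ θ hθ), ← zero_smul ℂ (0 : ℝ → ℝ → ℂ),
      multipole_const_smul, zero_mul]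
  · intro h u ϕ θ hθ
    refine (hf.smoothWeighted u).eq_zero (fun l m => ?_) θ hθ ϕ
    by_cases hlm : |p| ≤ (l : ℤ) ∧ |m| ≤ (l : ℤ)
    · exact h l m hlm.1 hlm.2 u
    · exact multipole_of_not hlm _

end ZRM

/-! ### Advanced solutions -/

namespace ZRM

/-- The series contains only powers `r ^ (-k)` with `k ≥ κ`. -/
def SuppGE {A : Type} [Zero A] (κ : ℤ) (f : PolyLog A) : Prop := ∀ k < κ, ∀ j, f k j = 0

/-- At every order the series is polynomial in `log r`. -/
def FiniteLogs {A : Type} [Zero A] (f : PolyLog A) : Prop := ∀ k, ∃ N : ℕ, ∀ j > N, f k j = 0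

theorem SuppGE.mono {A : Type} [Zero A] {κ κ' : ℤ} {f : PolyLog A} (hf : SuppGE κ f) (h : κ' ≤ κ) : SuppGE κ' f :=
  fun k hk j => hf k (hk.trans_le h) j

theorem SuppGE.rmul {A : Type} [Zero A] {κ : ℤ} {f : PolyLog A} (hf : SuppGE κ f) (a : ℤ) :
    SuppGE (κ - a) (rmul a f) := fun k hk j => hf (k + a) (by omega) j

theorem FiniteLogs.rmul {A : Type} [Zero A] {f : PolyLog A} (hf : FiniteLogs f) (a : ℤ) : FiniteLogs (rmul a f) :=
  fun k => hf (k + a)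

theorem FiniteLogs.sub {A : Type} [AddCommGroup A] {f g : PolyLog A} (hf : FiniteLogs f) (hg : FiniteLogs g) :
    FiniteLogs (f - g) := fun k => by
  obtain ⟨N, hN⟩ := hf k
  obtain ⟨M, hM⟩ := hg k
  exact ⟨max N M, fun j hj => by
    simp [hN j (lt_of_le_of_lt (le_max_left _ _) hj), hM j (lt_of_le_of_lt (le_max_right _ _) hj)]⟩

section Support

variable {A : Type} [AddCommGroup A] [Module ℂ A]

theorem SuppGE.smul {κ : ℤ} {f : PolyLog A} (hf : SuppGE κ f) (c : ℂ) : SuppGE κ (c • f) :=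
  fun k hk j => by simp [hf k hk j]

theorem SuppGE.dr {κ : ℤ} {f : PolyLog A} (hf : SuppGE κ f) : SuppGE (κ + 1) (dr f) :=
  fun k hk j => by simp [ZRM.dr, hf (k - 1) (by omega)]

theorem SuppGE.dr_iterate {κ : ℤ} {f : PolyLog A} (hf : SuppGE κ f) (N : ℕ) :
    SuppGE (κ + N) (ZRM.dr^[N] f) := by
  induction N with
  | zero => simpa using hf
  | succ N ih =>
    rw [Function.iterate_succ_apply']
    have := ih.dr
    push_cast
    rwa [← add_assoc]

theorem FiniteLogs.smul {f : PolyLog A} (hf : FiniteLogs f) (c : ℂ) : FiniteLogs (c • f) :=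
  fun k => by
    obtain ⟨N, hN⟩ := hf k
    exact ⟨N, fun j hj => by simp [hN j hj]⟩

theorem FiniteLogs.dr {f : PolyLog A} (hf : FiniteLogs f) : FiniteLogs (dr f) := fun k => by
  obtain ⟨N, hN⟩ := hf (k - 1)
  exact ⟨N, fun j hj => by simp [ZRM.dr, hN j hj, hN (j + 1) (by omega)]⟩

theorem FiniteLogs.dr_iterate {f : PolyLog A} (hf : FiniteLogs f) (N : ℕ) :
    FiniteLogs (ZRM.dr^[N] f) := by
  induction N with
  | zero => exact hf
  | succ N ih => rw [Function.iterate_succ_apply']; exact ih.dr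

/-- The linear map `F ↦ K_{s-n} r ^ (l-s) ∂_r ^ (l+s-n) (F / r ^ (l-s+n+1))`. -/
def advOp (s l n : ℕ) (F : PolyLog A) : PolyLog A :=
  (K ((s : ℤ) - n) l : ℂ) •
    rmul ((l : ℤ) - s) (ZRM.dr^[l + s - n] (rmul (-((l : ℤ) - s + n + 1)) F))

theorem advOp_add (s l n : ℕ) (F G : PolyLog A) :
    advOp s l n (F + G) = advOp s l n F + advOp s l n G := by
  simp only [advOp, dr_iterate, rmul_add, map_add, smul_add]

theorem advOp_smul (s l n : ℕ) (c : ℂ) (F : PolyLog A) :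
    advOp s l n (c • F) = c • advOp s l n F := by
  simp only [advOp, dr_iterate, rmul_smul, map_smul, smul_comm c]

theorem advOp_sum (s l n : ℕ) {ι : Type*} (t : Finset ι) (F : ι → PolyLog A) :
    advOp s l n (∑ i ∈ t, F i) = ∑ i ∈ t, advOp s l n (F i) := by
  classical
  induction t using Finset.induction_on with
  | empty => simpa using advOp_smul s l n 0 (0 : PolyLog A)
  | insert i t hi ih => rw [Finset.sum_insert hi, Finset.sum_insert hi, advOp_add, ih]

/-- The power `-(l-s+n+1)`, the `l+s-n` derivatives and the factor `r ^ (l-s)` shift the order by `l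
+ s + 1` in total, independently of `n`. -/
theorem SuppGE.advOp {κ : ℤ} {F : PolyLog A} (hF : SuppGE κ F) {s l n : ℕ} (hl : s ≤ l)
    (hn : n ≤ 2 * s) : SuppGE (κ + l + s + 1) (advOp s l n F) := by
  refine (((hF.rmul _).dr_iterate (l + s - n)).rmul ((l : ℤ) - s)).smul _ |>.mono ?_
  have : ((l + s - n : ℕ) : ℤ) = l + s - n := by omega
  omega

theorem FiniteLogs.advOp {F : PolyLog A} (hF : FiniteLogs F) (s l n : ℕ) :
    FiniteLogs (advOp s l n F) := (((hF.rmul _).dr_iterate _).rmul _).smul _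

/-- `IsRadial.lower` with `e = l - s` and `N = l + s - n - 1`, so that `N + 1 - e = 2s - n`; the
ratio of neighbouring `K` is the ladder coefficient. -/
theorem advOp_radial {s l n : ℕ} (hl : s ≤ l) (hn : n < 2 * s) (F : PolyLog A) :
    ZRM.dr (advOp s l (n + 1) F) + (2 * (s : ℂ) - n) • rmul (-1) (advOp s l (n + 1) F)
      = (modeLadder s l n : ℂ) • rmul (-1) (advOp s l n F) := by
  obtain ⟨N, hN⟩ : ∃ N : ℕ, l + s = n + N + 1 := ⟨l + s - n - 1, by omega⟩
  have hK := K_eq_ladder_mul (p := (s : ℤ) - n - 1) (l := l) (by omega) (by omega)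
  rw [sub_add_cancel] at hK
  have h := (isRadial_drL (A := A)).lower ((l : ℤ) - s) N (rmul (-((l : ℤ) - s + n + 2)) F)
  have hc : ((N : ℂ) + 1 - ((l : ℤ) - s : ℤ)) = 2 * (s : ℂ) - n := by
    have : (l : ℂ) + s = n + N + 1 := by exact_mod_cast hN
    push_cast
    linear_combination -this
  rw [hc, rmul_rmul 1, show 1 + -((l : ℤ) - s + n + 2) = -((l : ℤ) - s + n + 1) by ring] at h
  simp only [advOp]
  rw [show l + s - (n + 1) = N by omega, show l + s - n = N + 1 by omega, dr_iterate, dr_iterate,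
    show (s : ℤ) - (n + 1 : ℕ) = (s : ℤ) - n - 1 by push_cast; ring,
    show -((l : ℤ) - s + (n + 1 : ℕ) + 1) = -((l : ℤ) - s + n + 2) by push_cast; ring,
    rmul_smul, rmul_smul]
  change drL A _ + _ = _
  rw [map_smul, smul_comm (2 * (s : ℂ) - n), ← smul_add, h, hK, smul_smul, modeLadder]
  push_cast
  rfl

/-- `IsRadial.advance` with `a = l - s + n + 1`. The product `a (l + s - n)` is twice the squared
ladder coefficient; one factor is absorbed by the ratio of the `K`. -/
theorem advOp_dr {s l n : ℕ} (hl : s ≤ l) (hn : n < 2 * s) (F : PolyLog A) :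
    advOp s l n (ZRM.dr F) = ZRM.dr (advOp s l n F) + ((n : ℂ) + 1) • rmul (-1) (advOp s l n F)
      - (2 * (modeLadder s l n : ℂ)) • rmul (-1) (advOp s l (n + 1) F) := by
  obtain ⟨N, hN⟩ : ∃ N : ℕ, l + s = n + N + 1 := ⟨l + s - n - 1, by omega⟩
  have hK := K_eq_ladder_mul (p := (s : ℤ) - n - 1) (l := l) (by omega) (by omega)
  rw [sub_add_cancel] at hK
  have h := (isRadial_drL (A := A)).advance ((l : ℤ) - s) ((l : ℤ) - s + n + 1) N F
  have hc : ((((l : ℤ) - s + n + 1 : ℤ) : ℂ) - ((l : ℤ) - s : ℤ)) = n + 1 := by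
    push_cast
    ring
  have hL : (((l : ℤ) - s + n + 1 : ℤ) : ℂ) * (N + 1) = 2 * (modeLadder s l n : ℂ) ^ 2 := by
    have h1 := ladder_sq (p := (s : ℤ) - n - 1) (l := l) (abs_le.2 ⟨by omega, by omega⟩)
    have h2 : ((ladder ((s : ℤ) - n - 1) l : ℝ) : ℂ) ^ 2
        = ((l : ℂ) - (s - n - 1)) * (l + (s - n - 1) + 1) / 2 := by
      have := congrArg (fun x : ℝ => (x : ℂ)) h1
      push_cast at this
      exact this
    have h3 : (l : ℂ) + s = n + N + 1 := by exact_mod_cast hN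
    rw [modeLadder, h2]
    push_cast
    linear_combination (-(l : ℂ) + s - n - 1) * h3
  rw [hc, hL] at h
  simp only [advOp]
  rw [show l + s - (n + 1) = N by omega, show l + s - n = N + 1 by omega, dr_iterate, dr_iterate,
    dr_iterate, show (s : ℤ) - (n + 1 : ℕ) = (s : ℤ) - n - 1 by push_cast; ring,
    show -((l : ℤ) - s + (n + 1 : ℕ) + 1) = -((l : ℤ) - s + n + 1 + 1) by push_cast; ring,
    rmul_smul, rmul_smul]
  change _ • rmul _ ((drL A ^ (N + 1)) (rmul _ (drL A F))) = drL A _ + _ - _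
  rw [h, map_smul, hK, modeLadder]
  push_cast
  module

end Support

theorem dr_apply_time (F : PolyLog (ℝ → ℂ)) (u : ℝ) :
    (fun k j => dr F k j u) = dr (fun k j => F k j u) := rfl

theorem advOp_apply_time (s l n : ℕ) (F : PolyLog (ℝ → ℂ)) (u : ℝ) :
    (fun k j => advOp s l n F k j u) = advOp s l n (fun k j => F k j u) := by
  have h : ∀ (N : ℕ) (G : PolyLog (ℝ → ℂ)),
      (fun k j => (dr^[N] G) k j u) = dr^[N] (fun k j => G k j u) := by
    intro N
    induction N with
    | zero => intro G; rfl
    | succ N ih =>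
      intro G
      rw [Function.iterate_succ_apply, ih, dr_apply_time, Function.iterate_succ_apply]
  funext k j
  have h1 := h (l + s - n) (rmul (-((l : ℤ) - s + n + 1)) F)
  have h2 := congrFun (congrFun h1 (k + ((l : ℤ) - s))) j
  exact congrArg (fun x => (K ((s : ℤ) - n) l : ℂ) * x) h2

/-- Coefficientwise time derivative. -/
def HasTimeDeriv (F F' : PolyLog (ℝ → ℂ)) : Prop := ∀ k j u, HasDerivAt (F k j) (F' k j u) u

namespace HasTimeDeriv

variable {F F' : PolyLog (ℝ → ℂ)}

theorem rmul (h : HasTimeDeriv F F') (a : ℤ) : HasTimeDeriv (rmul a F) (rmul a F') :=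
  fun k j u => h (k + a) j u

theorem smul (h : HasTimeDeriv F F') (c : ℂ) : HasTimeDeriv (c • F) (c • F') :=
  fun k j u => (h k j u).const_mul c

theorem dr (h : HasTimeDeriv F F') : HasTimeDeriv (dr F) (dr F') := fun k j u =>
  ((h (k - 1) j u).const_mul _).add ((h (k - 1) (j + 1) u).const_mul _)

theorem dr_iterate (h : HasTimeDeriv F F') (N : ℕ) :
    HasTimeDeriv (ZRM.dr^[N] F) (ZRM.dr^[N] F') := by
  induction N with
  | zero => exact h
  | succ N ih => rw [Function.iterate_succ_apply', Function.iterate_succ_apply']; exact ih.dr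

theorem advOp (h : HasTimeDeriv F F') (s l n : ℕ) :
    HasTimeDeriv (advOp s l n F) (advOp s l n F') :=
  (((h.rmul _).dr_iterate _).rmul _).smul _

end HasTimeDeriv

/-- The expansion of `B (2 r)`. -/
def atDouble (B : PolyLog ℂ) : PolyLog ℂ := fun k j =>
  (2 : ℂ) ^ (-k) * ∑ᶠ q : ℕ, (q.choose j : ℂ) * ((Real.log 2 : ℝ) : ℂ) ^ (q - j) * B k q

theorem atDouble_eq_sum {B : PolyLog ℂ} {k : ℤ} {N : ℕ} (hN : ∀ q > N, B k q = 0) (j : ℕ) {M : ℕ}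
    (hM : N < M) : atDouble B k j = (2 : ℂ) ^ (-k) * ∑ q ∈ Finset.range M,
      (q.choose j : ℂ) * ((Real.log 2 : ℝ) : ℂ) ^ (q - j) * B k q := by
  rw [atDouble, finsum_eq_sum_of_support_subset]
  intro q hq
  rw [Finset.coe_range, Set.mem_Iio]
  by_contra h
  exact hq (by simp [hN q (by omega)])

theorem SuppGE.atDouble {κ : ℤ} {B : PolyLog ℂ} (hB : SuppGE κ B) : SuppGE κ (atDouble B) :=
  fun k hk j => by simp [ZRM.atDouble, hB k hk]

/-- The chain rule for `B (2r)`. Expanding `(log 2 + log r) ^ q` reduces it to `(q + 1) (q choose j)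
= (j + 1) (q + 1 choose j + 1)`. -/
theorem atDouble_dr {B : PolyLog ℂ} (hB : FiniteLogs B) :
    (2 : ℂ) • atDouble (dr B) = dr (atDouble B) := by
  funext k j
  obtain ⟨N, hN⟩ := hB (k - 1)
  have h1 : ∀ q > N, dr B k q = 0 := fun q hq => by
    simp [dr, hN q hq, hN (q + 1) (by omega)]
  rw [Pi.smul_apply, Pi.smul_apply, atDouble_eq_sum h1 j (Nat.lt_succ_self N), dr,
    atDouble_eq_sum hN j (Nat.lt_succ_self N),
    atDouble_eq_sum hN (j + 1) (by omega : N < N + 1 + 1)]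
  have h2 : (2 : ℂ) ^ (-(k - 1)) = 2 * (2 : ℂ) ^ (-k) := by
    rw [neg_sub, sub_eq_add_neg, zpow_add₀ two_ne_zero, zpow_one]
  rw [Finset.sum_range_succ' _ (N + 1)]
  simp only [h2, smul_eq_mul, dr, Nat.choose_zero_succ, Nat.cast_zero, zero_mul, add_zero]
  have h3 : ∀ q : ℕ, (q.choose j : ℂ) * ((Real.log 2 : ℝ) : ℂ) ^ (q - j)
      * (-((k : ℂ) - 1) * B (k - 1) q + ((q : ℂ) + 1) * B (k - 1) (q + 1))
      = -((k : ℂ) - 1) * ((q.choose j : ℂ) * ((Real.log 2 : ℝ) : ℂ) ^ (q - j) * B (k - 1) q)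
        + ((j : ℂ) + 1) * (((q + 1).choose (j + 1) : ℂ)
          * ((Real.log 2 : ℝ) : ℂ) ^ (q + 1 - (j + 1)) * B (k - 1) (q + 1)) := by
    intro q
    have h4 : ((q : ℂ) + 1) * (q.choose j : ℂ) = ((q + 1).choose (j + 1) : ℂ) * (j + 1) := by
      exact_mod_cast Nat.add_one_mul_choose_eq q j
    rw [Nat.add_sub_add_right]
    linear_combination (((Real.log 2 : ℝ) : ℂ) ^ (q - j) * B (k - 1) (q + 1)) * h4
  simp only [h3, Finset.sum_add_distrib, ← Finset.mul_sum]
  ring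

theorem IsProfile.finiteLogs {B : PolyLog ℂ} (hB : IsProfile B) : FiniteLogs B := hB.2

theorem IsProfile.dr {B : PolyLog ℂ} (hB : IsProfile B) : IsProfile (dr B) := by
  obtain ⟨κ, hκ⟩ := hB.1
  exact ⟨⟨κ + 1, SuppGE.dr hκ⟩, FiniteLogs.dr hB.2⟩

theorem FiniteLogs.atDouble {B : PolyLog ℂ} (hB : FiniteLogs B) : FiniteLogs (atDouble B) := by
  intro k
  obtain ⟨N, hN⟩ := hB k
  refine ⟨N, fun j hj => ?_⟩
  rw [atDouble_eq_sum hN j (Nat.lt_succ_self N)]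
  refine mul_eq_zero_of_right _ (Finset.sum_eq_zero fun q hq => ?_)
  rw [Finset.mem_range] at hq
  rw [Nat.choose_eq_zero_of_lt (by omega)]
  simp

/-- Every derivative of the profile lowers the power of `v` by one, so at a fixed order only
finitely many Taylor terms in `u` contribute. -/
theorem atAdvancedTime_eq_sum {κ : ℤ} {B : PolyLog ℂ} (hB : SuppGE κ B) {k : ℤ} {D : ℕ}
    (hD : k < κ + D) (j : ℕ) (u : ℝ) : atAdvancedTime B k j u
      = ∑ d ∈ Finset.range D, ((u : ℂ) ^ d / (d.factorial : ℂ)) * atDouble (dr^[d] B) k j := by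
  rw [atAdvancedTime, finsum_eq_sum_of_support_subset (s := Finset.range D)]
  · simp only [atDouble, mul_assoc]
  · intro d hd
    rw [Finset.coe_range, Set.mem_Iio]
    by_contra h
    refine hd ?_
    have h1 := (hB.dr_iterate d).atDouble k (by omega) j
    rw [atDouble] at h1
    exact (mul_assoc _ _ _).trans (mul_eq_zero_of_right _ h1)

theorem hasTimeDeriv_atAdvancedTime {B : PolyLog ℂ} (hB : IsProfile B) :
    HasTimeDeriv (atAdvancedTime B) (atAdvancedTime (dr B)) := by
  obtain ⟨κ, hκ⟩ := hB.1
  intro k j u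
  obtain ⟨D, hD⟩ : ∃ D : ℕ, k < κ + D := ⟨(k - κ + 1).toNat, by omega⟩
  have e : atAdvancedTime B k j = fun u : ℝ => ∑ d ∈ Finset.range (D + 1),
      ((u : ℂ) ^ d / (d.factorial : ℂ)) * atDouble (dr^[d] B) k j :=
    funext fun u => atAdvancedTime_eq_sum hκ (by push_cast; omega) j u
  rw [e, atAdvancedTime_eq_sum (SuppGE.dr hκ) (D := D) (by omega)]
  simp only [← Function.iterate_succ_apply dr]
  simp only [Finset.sum_range_succ' _ D]
  have h1 : ∀ d : ℕ, HasDerivAt (fun u : ℝ => (u : ℂ) ^ (d + 1) / ((d + 1).factorial : ℂ)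
      * atDouble (dr^[d + 1] B) k j)
      ((u : ℂ) ^ d / (d.factorial : ℂ) * atDouble (dr^[d + 1] B) k j) u := by
    intro d
    have h2 := ((Complex.ofRealCLM.hasDerivAt (x := u)).pow (d + 1)).div_const
      ((d + 1).factorial : ℂ)
    refine (h2.mul_const (atDouble (dr^[d + 1] B) k j)).congr_deriv ?_
    have h3 : (d.factorial : ℂ) ≠ 0 := by exact_mod_cast d.factorial_ne_zero
    have h4 : (d : ℂ) + 1 ≠ 0 := by exact_mod_cast d.succ_ne_zero
    simp only [Complex.ofRealCLM_apply, Nat.factorial_succ, Nat.add_sub_cancel, Complex.ofReal_one]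
    push_cast
    field_simp
  have h2 := (HasDerivAt.fun_sum (u := Finset.range D) fun d _ => h1 d).add_const
    ((1 : ℂ) / (Nat.factorial 0 : ℂ) * atDouble (dr^[0] B) k j)
  simpa using h2

theorem atAdvancedTime_dr {B : PolyLog ℂ} (hB : IsProfile B) :
    (2 : ℂ) • atAdvancedTime (dr B) = dr (atAdvancedTime B) := by
  obtain ⟨κ, hκ⟩ := hB.1
  funext k j u
  obtain ⟨D, hD⟩ : ∃ D : ℕ, k < κ + D := ⟨(k - κ + 1).toNat, by omega⟩
  have h1 : ∀ d : ℕ, (2 : ℂ) * atDouble (dr^[d] (dr B)) k j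
      = -((k : ℂ) - 1) * atDouble (dr^[d] B) (k - 1) j
        + ((j : ℂ) + 1) * atDouble (dr^[d] B) (k - 1) (j + 1) := fun d => by
    have h := congrFun (congrFun (atDouble_dr (hB.finiteLogs.dr_iterate d)) k) j
    rw [← Function.iterate_succ_apply, Function.iterate_succ_apply']
    exact h
  simp only [Pi.smul_apply, smul_eq_mul, dr, Pi.add_apply]
  rw [atAdvancedTime_eq_sum (SuppGE.dr hκ) (D := D) (by omega),
    atAdvancedTime_eq_sum hκ (D := D) (by omega), atAdvancedTime_eq_sum hκ (D := D) (by omega),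
    Finset.mul_sum, Finset.mul_sum, Finset.mul_sum, ← Finset.sum_add_distrib]
  refine Finset.sum_congr rfl fun d _ => ?_
  linear_combination ((u : ℂ) ^ d / (d.factorial : ℂ)) * h1 d

/-- The multipoles of the advanced solution. -/
def advMode (s l : ℕ) (B : PolyLog ℂ) : ℕ → PolyLog (ℝ → ℂ) :=
  fun n => advOp s l n (atAdvancedTime B)

/-- The values at `u = 0` of the multipoles of the advanced solution. -/
def advData (s l : ℕ) (B : PolyLog ℂ) : ℕ → PolyLog ℂ := fun n => advOp s l n (atDouble B)

theorem advTerm_eq (s l : ℕ) (m : ℤ) (B : PolyLog ℂ) (n : ℕ) (k : ℤ) (j : ℕ) (u θ ϕ : ℝ) :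
    advTerm s l m B n k j u θ ϕ = advMode s l B n k j u * spinY ((s : ℤ) - n) l m θ ϕ := rfl

/-- The Taylor expansion in `u` passes through the radial operator: the omitted tail `R` starts so
high that it cannot reach order `k`. All statements about advanced solutions thereby reduce to data
at `u = 0` of derivatives of the profile. -/
theorem advMode_eq_sum {s l n : ℕ} (hl : s ≤ l) (hn : n ≤ 2 * s) {κ : ℤ} {B : PolyLog ℂ}
    (hB : SuppGE κ B) {k : ℤ} {D : ℕ} (hD : k < κ + l + s + 1 + D) (j : ℕ) (u : ℝ) :
    advMode s l B n k j u = ∑ d ∈ Finset.range D,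
      ((u : ℂ) ^ d / (d.factorial : ℂ)) * advData s l (dr^[d] B) n k j := by
  set P : PolyLog ℂ := ∑ d ∈ Finset.range D,
    ((u : ℂ) ^ d / (d.factorial : ℂ)) • atDouble (dr^[d] B) with hP
  set R : PolyLog ℂ := (fun k j => atAdvancedTime B k j u) + (-1 : ℂ) • P with hR
  have hsupp : SuppGE (κ + D) R := by
    intro k hk j
    simp only [hR, hP, Pi.add_apply, Pi.smul_apply, Finset.sum_apply, smul_eq_mul]
    rw [atAdvancedTime_eq_sum hB hk]
    ring
  have e1 : (fun k j => atAdvancedTime B k j u) = P + R := by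
    rw [hR]
    module
  have e2 := congrFun (congrFun (advOp_apply_time s l n (atAdvancedTime B) u) k) j
  rw [advMode, e2, e1, advOp_add, Pi.add_apply, Pi.add_apply,
    hsupp.advOp hl hn k (by omega) j, add_zero, hP, advOp_sum]
  simp only [Finset.sum_apply, advOp_smul, Pi.smul_apply, smul_eq_mul, advData]

theorem radialEqs_of_dr {s l : ℕ} {D : ℕ → PolyLog ℂ}
    (h : ∀ n < 2 * s, dr (D (n + 1)) + (2 * (s : ℂ) - n) • rmul (-1) (D (n + 1))
      = (modeLadder s l n : ℂ) • rmul (-1) (D n)) : RadialEqs s l D := by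
  intro n hn k j
  have h1 := congrFun (congrFun (h n hn) (k + 1)) j
  simp only [Pi.add_apply, Pi.smul_apply, smul_eq_mul, dr, rmul, add_sub_cancel_right,
    add_neg_cancel_right] at h1
  push_cast at h1
  linear_combination h1

theorem radialEqs_advOp {s l : ℕ} (hl : s ≤ l) (F : PolyLog ℂ) :
    RadialEqs s l (fun n => advOp s l n F) :=
  radialEqs_of_dr fun _ hn => advOp_radial hl hn F

theorem evolution_advOp {s l n : ℕ} (hl : s ≤ l) (hn : n < 2 * s) (F : PolyLog ℂ) (k : ℤ) (j : ℕ) :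
    evolution s l (fun n => advOp s l n F) n k j = 1 / 2 * advOp s l n (dr F) (k + 1) j := by
  have h1 := congrFun (congrFun (advOp_dr hl hn F) (k + 1)) j
  simp only [Pi.add_apply, Pi.sub_apply, Pi.smul_apply, smul_eq_mul, dr, rmul,
    add_neg_cancel_right] at h1
  rw [add_sub_cancel_right] at h1
  push_cast at h1
  rw [h1, evolution]
  ring

/-- On initial data the evolution amounts to replacing the profile by its derivative. -/
theorem evolution_advData {s l n : ℕ} (hl : s ≤ l) (hn : n < 2 * s) {B : PolyLog ℂ}
    (hB : FiniteLogs B) (k : ℤ) (j : ℕ) :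
    evolution s l (advData s l B) n k j = advData s l (dr B) n (k + 1) j := by
  have h := evolution_advOp hl hn (atDouble B) k j
  rw [← atDouble_dr hB, advOp_smul, Pi.smul_apply, Pi.smul_apply, smul_eq_mul] at h
  rw [show advData s l B = fun n => advOp s l n (atDouble B) from rfl, h, advData]
  ring

theorem modeEqs_advMode {s l : ℕ} (hl : s ≤ l) {B : PolyLog ℂ} (hB : IsProfile B) :
    ModeEqs s l (advMode s l B) := by
  intro u
  have e : (fun n k j => advMode s l B n k j u)
      = fun n => advOp s l n (fun k j => atAdvancedTime B k j u) :=
    funext fun n => advOp_apply_time s l n (atAdvancedTime B) u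
  rw [e]
  refine ⟨radialEqs_advOp hl _, fun n hn k j => ?_⟩
  have h1 : dr (fun k j => atAdvancedTime B k j u)
      = (2 : ℂ) • fun k j => atAdvancedTime (dr B) k j u := by
    rw [← dr_apply_time, ← atAdvancedTime_dr hB]
    rfl
  have h2 := congrFun (congrFun (advOp_apply_time s l n (atAdvancedTime (dr B)) u) (k + 1)) j
  rw [evolution_advOp hl hn, h1, advOp_smul, Pi.smul_apply, Pi.smul_apply, smul_eq_mul, ← h2,
    advMode, ((hasTimeDeriv_atAdvancedTime hB).advOp s l n (k + 1) j u).deriv]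
  ring

theorem atAdvancedTime_zero : atAdvancedTime 0 = 0 := by
  funext k j u
  rw [atAdvancedTime_eq_sum (B := 0) (κ := k + 1) (D := 0) (fun _ _ _ => rfl) (by simp)]
  simp

theorem advMode_zero (s l n : ℕ) : advMode s l 0 n = 0 := by
  have := advOp_smul s l n 0 (0 : PolyLog (ℝ → ℂ))
  rw [zero_smul, zero_smul] at this
  rw [advMode, atAdvancedTime_zero, this]

end ZRM

/-! ### Retarded solutions -/

namespace ZRM

/-- The smooth functions as a subspace. -/
def smoothSubmodule : Submodule ℂ (ℝ → ℂ) where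
  carrier := {f | ContDiff ℝ ∞ f}
  add_mem' := fun {f g} (hf : ContDiff ℝ ∞ f) (hg : ContDiff ℝ ∞ g) => hf.add hg
  zero_mem' := (contDiff_const : ContDiff ℝ ∞ fun _ : ℝ => (0 : ℂ))
  smul_mem' := fun c {f} (hf : ContDiff ℝ ∞ f) => (contDiff_const (c := c)).mul hf

/-- Smooth functions of retarded time. -/
def SmoothFn : Type := smoothSubmodule

instance : AddCommGroup SmoothFn := inferInstanceAs (AddCommGroup smoothSubmodule)

instance : Module ℂ SmoothFn := inferInstanceAs (Module ℂ smoothSubmodule)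

namespace SmoothFn

/-- The underlying function. -/
def fn (f : SmoothFn) : ℝ → ℂ := Subtype.val (p := (· ∈ smoothSubmodule)) f

/-- A smooth function, bundled. -/
def of (f : ℝ → ℂ) (hf : ContDiff ℝ ∞ f) : SmoothFn :=
  Subtype.mk (p := (· ∈ smoothSubmodule)) f hf

theorem smooth (f : SmoothFn) : ContDiff ℝ ∞ f.fn := Subtype.property (p := (· ∈ smoothSubmodule)) f

theorem ext {f g : SmoothFn} (h : ∀ u, f.fn u = g.fn u) : f = g :=
  Subtype.ext (p := (· ∈ smoothSubmodule)) (funext h)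

end SmoothFn

theorem contDiff_deriv {f : ℝ → ℂ} (hf : ContDiff ℝ ∞ f) : ContDiff ℝ ∞ (deriv f) :=
  (contDiff_infty_iff_deriv.1 hf).2

/-- The derivative on smooth functions. -/
def derivEnd : Module.End ℂ SmoothFn where
  toFun f := SmoothFn.of (deriv f.fn) (contDiff_deriv f.smooth)
  map_add' f g := SmoothFn.ext fun u =>
    deriv_add (f.smooth.differentiable (by simp) u) (g.smooth.differentiable (by simp) u)
  map_smul' c f := SmoothFn.ext fun u => deriv_const_mul_field (v := f.fn) c

/-- The coefficientwise time derivative. -/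
def duL : Module.End ℂ (PolyLog SmoothFn) where
  toFun f := fun k j => derivEnd (f k j)
  map_add' f g := by funext k j; exact map_add derivEnd _ _
  map_smul' c f := by funext k j; exact map_smul derivEnd _ _

/-- The operator `∂_r - 2 ∂_u`. -/
def retL : Module.End ℂ (PolyLog SmoothFn) := drL SmoothFn - (2 : ℂ) • duL

/-- Powers of `r` are constant in `u`, so the additional term `-2 ∂_u` commutes with them. -/
theorem isRadial_retL : IsRadial retL := by
  intro a f
  have h1 := isRadial_drL (A := SmoothFn) a f
  have h2 : duL (rmul a f) = rmul a (duL f) := rfl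
  simp only [retL, LinearMap.sub_apply, LinearMap.smul_apply, h1, h2]
  have h3 : rmul a (drL SmoothFn f - (2 : ℂ) • duL f)
    = rmul a (drL SmoothFn f) - (2 : ℂ) • rmul a (duL f) := rfl
  rw [h3]
  abel

theorem duL_commute_retL : Commute duL retL := by
  have h : Commute duL (drL SmoothFn) := by
    refine LinearMap.ext fun f => ?_
    funext k j
    change derivEnd (dr f k j) = dr (duL f) k j
    simp only [dr, map_add, map_smul]
    rfl
  exact h.sub_right ((Commute.refl _).smul_right _)

/-- `b (u) r ^ (-a)` for smooth `b`. -/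
def retSeedL (b : SmoothFn) (a : ℤ) : PolyLog SmoothFn := fun k j => if k = a ∧ j = 0 then b else 0

theorem rmul_retSeedL (b : SmoothFn) (a c : ℤ) : rmul c (retSeedL b a) = retSeedL b (a - c) := by
  funext k j
  simp only [rmul, retSeedL, eq_sub_iff_add_eq]

theorem dr_retSeedL (b : SmoothFn) (a : ℤ) :
    dr (retSeedL b a) = -((a : ℂ) • retSeedL b (a + 1)) := by
  funext k j
  simp only [dr, retSeedL, Pi.neg_apply, Pi.smul_apply, sub_eq_iff_eq_add]
  by_cases hk : k = a + 1
  · subst hk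
    by_cases hj : j = 0
    · simp [hj]
    · simp [hj]
  · simp [hk]

theorem two_smul_duL_retSeedL (b : SmoothFn) (a : ℤ) : (2 : ℂ) • duL (retSeedL b a)
    = -retL (retSeedL b a) - (a : ℂ) • rmul (-1) (retSeedL b a) := by
  have h : drL SmoothFn (retSeedL b a) = -((a : ℂ) • retSeedL b (a + 1)) := dr_retSeedL b a
  rw [rmul_retSeedL, sub_neg_eq_add, retL, LinearMap.sub_apply, LinearMap.smul_apply, h]
  abel

/-- The components of the retarded solution as smooth functions. -/
def retSmooth (s l : ℕ) (b : SmoothFn) (n : ℕ) : PolyLog SmoothFn :=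
  (KRet ((s : ℤ) - n) l : ℂ) • rmul ((l : ℤ) - s)
    ((retL ^ (l + n - s)) (retSeedL b ((l : ℤ) + s - n + 1)))

theorem KRet_pos (p : ℤ) (l : ℕ) : 0 < KRet p l := Real.sqrt_pos.2 (by positivity)

theorem KRet_succ {p : ℤ} {l : ℕ} (h1 : -(l : ℤ) ≤ p) (h2 : p < l) :
    KRet (p + 1) l = 2 * ladder p l * KRet p l := by
  obtain ⟨a, b, ha, hb⟩ := exists_nat_add_sub (abs_le.2 ⟨h1, h2.le⟩)
  obtain ⟨b, rfl⟩ : ∃ b' : ℕ, b = b' + 1 := ⟨b - 1, by omega⟩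
  have e1 : (l : ℤ) + (p + 1) = ((a + 1 : ℕ) : ℤ) := by push_cast; omega
  have e2 : (l : ℤ) - (p + 1) = (b : ℤ) := by push_cast at hb; omega
  have e3 : (l : ℝ) - p = b + 1 := by exact_mod_cast hb
  have e4 : (l : ℝ) + p = a := by exact_mod_cast ha
  have e5 : (2 : ℝ) = √4 := by rw [show (4 : ℝ) = 2 ^ 2 by norm_num, Real.sqrt_sq (by norm_num)]
  rw [KRet, KRet, ladder, e1, e2, ha, hb, e3, e4, e5, ← Real.sqrt_mul (by norm_num),
    ← Real.sqrt_mul (by positivity), zpow_add₀ (by norm_num), zpow_one]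
  congr 1
  rw [Int.toNat_natCast, Int.toNat_natCast, Int.toNat_natCast, Int.toNat_natCast,
    Nat.factorial_succ, Nat.factorial_succ]
  push_cast
  field_simp
  ring

theorem retSmooth_evolution {s l n : ℕ} (h1 : s ≤ l + n) (h2 : n < s + l) (b : SmoothFn) :
    retL (retSmooth s l b n) + ((n : ℂ) + 1) • rmul (-1) (retSmooth s l b n)
      = (2 * (modeLadder s l n : ℂ)) • rmul (-1) (retSmooth s l b (n + 1)) := by
  obtain ⟨M, hM⟩ : ∃ M : ℕ, l + n = s + M := ⟨l + n - s, by omega⟩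
  have hK := KRet_succ (p := (s : ℤ) - n - 1) (l := l) (by omega) (by omega)
  rw [sub_add_cancel] at hK
  have h := isRadial_retL.lower ((l : ℤ) - s) M (retSeedL b ((l : ℤ) + s - n + 1))
  have hc : ((M : ℂ) + 1 - ((l : ℤ) - s : ℤ)) = n + 1 := by
    have : (l : ℂ) + n = s + M := by exact_mod_cast hM
    push_cast
    linear_combination -this
  rw [hc, rmul_retSeedL, add_sub_cancel_right] at h
  simp only [retSmooth]
  rw [show l + n - s = M by omega, show l + (n + 1) - s = M + 1 by omega,
    show (s : ℤ) - (n + 1 : ℕ) = (s : ℤ) - n - 1 by push_cast; ring,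
    show (l : ℤ) + s - (n + 1 : ℕ) + 1 = (l : ℤ) + s - n by push_cast; ring,
    rmul_smul, rmul_smul, map_smul, smul_comm ((n : ℂ) + 1), ← smul_add, h, hK, smul_smul,
    modeLadder]
  push_cast
  rfl

theorem retSmooth_radial {s l n : ℕ} (h1 : s ≤ l + n) (h2 : n < s + l) (b : SmoothFn) :
    dr (retSmooth s l b (n + 1)) + (2 * (s : ℂ) - n) • rmul (-1) (retSmooth s l b (n + 1))
      = (modeLadder s l n : ℂ) • rmul (-1) (retSmooth s l b n) := by
  obtain ⟨M, hM⟩ : ∃ M : ℕ, l + n = s + M := ⟨l + n - s, by omega⟩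
  have hK := KRet_succ (p := (s : ℤ) - n - 1) (l := l) (by omega) (by omega)
  rw [sub_add_cancel] at hK
  have h := isRadial_retL.retard ((l : ℤ) - s) ((l : ℤ) + s - n) M _ _
    (two_smul_duL_retSeedL b ((l : ℤ) + s - n))
  have hc : (((l : ℤ) + s - n : ℤ) : ℂ) - ((l : ℤ) - s : ℤ) = 2 * s - n := by
    push_cast; ring
  have hL : (((l : ℤ) + s - n : ℤ) : ℂ) * (M + 1) = 2 * (modeLadder s l n : ℂ) ^ 2 := by
    have h1 := ladder_sq (p := (s : ℤ) - n - 1) (l := l) (abs_le.2 ⟨by omega, by omega⟩)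
    have h2 : ((ladder ((s : ℤ) - n - 1) l : ℝ) : ℂ) ^ 2
        = ((l : ℂ) - (s - n - 1)) * (l + (s - n - 1) + 1) / 2 := by
      have := congrArg (fun x : ℝ => (x : ℂ)) h1
      push_cast at this
      exact this
    have h3 : (l : ℂ) + n = s + M := by exact_mod_cast hM
    rw [modeLadder, h2]
    push_cast
    linear_combination (-(l : ℂ) - s + n) * h3
  have hcomm : (retL ^ (M + 1)) (duL (retSeedL b ((l : ℤ) + s - n)))
      = duL ((retL ^ (M + 1)) (retSeedL b ((l : ℤ) + s - n))) := by
    rw [← Module.End.mul_apply, ← Module.End.mul_apply, (duL_commute_retL.pow_right _).eq]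
  have hr : ∀ F : PolyLog SmoothFn, rmul ((l : ℤ) - s) (duL F) = duL (rmul ((l : ℤ) - s) F) :=
    fun _ => rfl
  have hdr : ∀ F : PolyLog SmoothFn, retL F + (2 : ℂ) • duL F = dr F := fun F => by
    have : dr F = drL SmoothFn F := rfl
    rw [this, retL, LinearMap.sub_apply, LinearMap.smul_apply, sub_add_cancel]
  rw [hc, hL, hcomm, hr, hdr, rmul_retSeedL, sub_neg_eq_add] at h
  simp only [retSmooth]
  rw [show l + n - s = M by omega, show l + (n + 1) - s = M + 1 by omega,
    show (s : ℤ) - (n + 1 : ℕ) = (s : ℤ) - n - 1 by push_cast; ring,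
    show (l : ℤ) + s - (n + 1 : ℕ) + 1 = (l : ℤ) + s - n by push_cast; ring,
    rmul_smul, rmul_smul, hK]
  change drL SmoothFn _ + _ = _
  rw [map_smul, smul_comm (2 * (s : ℂ) - n), ← smul_add]
  change (KRet ((s : ℤ) - n - 1) l : ℂ) • (dr _ + _) = _
  rw [h, modeLadder]
  push_cast
  module

/-- The multipoles of the retarded solution. -/
def retMode (s l : ℕ) (b : ℝ → ℂ) : ℕ → PolyLog (ℝ → ℂ) := fun n =>
  (KRet ((s : ℤ) - n) l : ℂ) • rmul ((l : ℤ) - s)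
    (drMinusTwoDu^[l + n - s] (retSeed b ((l : ℤ) + s - n + 1)))

theorem retTerm_eq (s l : ℕ) (m : ℤ) (b : ℝ → ℂ) (n : ℕ) (k : ℤ) (j : ℕ) (u θ ϕ : ℝ) :
    retTerm s l m b n k j u θ ϕ = retMode s l b n k j u * spinY ((s : ℤ) - n) l m θ ϕ := rfl

theorem coe_retL_pow (N : ℕ) (F : PolyLog SmoothFn) :
    (fun k j => ((retL ^ N) F k j).fn)
      = drMinusTwoDu^[N] (fun k j => (F k j).fn) := by
  induction N with
  | zero => rfl
  | succ N ih =>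
    rw [Function.iterate_succ_apply', ← ih, pow_succ', Module.End.mul_apply]
    rfl

theorem coe_retSmooth (s l : ℕ) (b : SmoothFn) (n : ℕ) :
    (fun k j => (retSmooth s l b n k j).fn) = retMode s l b.fn n := by
  have h := coe_retL_pow (l + n - s) (retSeedL b ((l : ℤ) + s - n + 1))
  have h2 : (fun k j => (retSeedL b ((l : ℤ) + s - n + 1) k j).fn)
      = retSeed b.fn ((l : ℤ) + s - n + 1) := by
    funext k j
    simp only [retSeedL, retSeed]
    split_ifs <;> rfl
  rw [h2] at h
  rw [retMode, ← h]
  rfl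

theorem retMode_eq_fn (s l n : ℕ) {b : ℝ → ℂ} (hb : ContDiff ℝ ∞ b) :
    retMode s l b n = fun k j => (retSmooth s l (.of b hb) n k j).fn :=
  (coe_retSmooth s l (.of b hb) n).symm

section RetMode

variable {s l : ℕ} {b : ℝ → ℂ} (hb : ContDiff ℝ ∞ b)

include hb

theorem contDiff_retMode (n : ℕ) (k : ℤ) (j : ℕ) : ContDiff ℝ ∞ (retMode s l b n k j) := by
  rw [retMode_eq_fn s l n hb]
  exact (retSmooth s l (.of b hb) n k j).smooth

theorem retMode_evolution {n : ℕ} (h1 : s ≤ l + n) (h2 : n < s + l) (k : ℤ) (j : ℕ) (u : ℝ) :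
    deriv (retMode s l b n (k + 1) j) u
      = evolution s l (fun n k j => retMode s l b n k j u) n k j := by
  have h := congrArg (fun F : PolyLog SmoothFn => (F (k + 1) j).fn u)
    (retSmooth_evolution h1 h2 (.of b hb))
  simp only [retMode_eq_fn s l _ hb, evolution]
  have e : (retL (retSmooth s l (.of b hb) n) (k + 1) j).fn u
      = -(((k + 1 : ℤ) : ℂ) - 1) * (retSmooth s l (.of b hb) n (k + 1 - 1) j).fn u
        + ((j : ℂ) + 1) * (retSmooth s l (.of b hb) n (k + 1 - 1) (j + 1)).fn u
        - 2 * deriv (retSmooth s l (.of b hb) n (k + 1) j).fn u := rfl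
  change (retL (retSmooth s l (.of b hb) n) (k + 1) j).fn u
    + ((n : ℂ) + 1) * (retSmooth s l (.of b hb) n (k + 1 + -1) j).fn u
    = 2 * (modeLadder s l n : ℂ) * (retSmooth s l (.of b hb) (n + 1) (k + 1 + -1) j).fn u at h
  rw [e, add_sub_cancel_right, add_neg_cancel_right] at h
  push_cast at h
  linear_combination (-1 / 2 : ℂ) * h

theorem modeEqs_retMode (hl : s ≤ l) : ModeEqs s l (retMode s l b) := by
  intro u
  refine ⟨radialEqs_of_dr fun n hn => ?_, fun n hn k j =>
    retMode_evolution hb (by omega) (by omega) k j u⟩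
  have h := retSmooth_radial (s := s) (l := l) (n := n) (by omega) (by omega) (.of b hb)
  funext k j
  have h' := congrArg (fun F : PolyLog SmoothFn => (F k j).fn u) h
  simp only [retMode_eq_fn s l _ hb]
  exact h'

end RetMode

/-- The absolute values of the coefficients in `(∂_r - 2 ∂_u) ^ M (b (u) r ^ (-a))`. -/
def retCoeff (a : ℕ) : ℕ → ℕ → ℝ
  | 0, 0 => 1
  | 0, _ + 1 => 0
  | M + 1, 0 => 2 * retCoeff a M 0
  | M + 1, i + 1 => (a + i) * retCoeff a M i + 2 * retCoeff a M (i + 1)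

theorem retCoeff_of_lt (a : ℕ) {M i : ℕ} (h : M < i) : retCoeff a M i = 0 := by
  induction M generalizing i with
  | zero =>
    obtain ⟨i, rfl⟩ : ∃ i', i = i' + 1 := ⟨i - 1, by omega⟩
    rfl
  | succ M ih =>
    obtain ⟨i, rfl⟩ : ∃ i', i = i' + 1 := ⟨i - 1, by omega⟩
    rw [retCoeff, ih (by omega), ih (by omega)]
    ring

theorem retCoeff_nonneg (a M i : ℕ) : 0 ≤ retCoeff a M i := by
  induction M generalizing i with
  | zero => rcases i with _ | i <;> simp [retCoeff]
  | succ M ih =>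
    rcases i with _ | i
    · have := ih 0
      rw [retCoeff]
      positivity
    · have h1 := ih i
      have h2 := ih (i + 1)
      rw [retCoeff]
      positivity

/-- No coefficient in the expansion of the retarded solution vanishes, so each of its orders can be
used to fix one derivative of `b`. -/
theorem retCoeff_pos {a : ℕ} (ha : 0 < a) {M i : ℕ} (h : i ≤ M) : 0 < retCoeff a M i := by
  induction M generalizing i with
  | zero =>
    obtain rfl : i = 0 := by omega
    simp [retCoeff]
  | succ M ih =>
    rcases i with _ | i
    · have := ih (Nat.zero_le M)
      rw [retCoeff]
      positivity
    · have h1 := ih (by omega : i ≤ M)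
      have h2 := retCoeff_nonneg a M (i + 1)
      rw [retCoeff]
      positivity

/-- Of the `M` factors `i` act on the power of `r` and `M - i` on `b`. Each contributes a minus
sign, so the sign `(-1) ^ M` is common to all terms and nothing cancels; logarithms never arise. -/
theorem drMinusTwoDu_iterate_retSeed (b : ℝ → ℂ) (a M : ℕ) :
    (∀ i u, (drMinusTwoDu^[M] (retSeed b a)) (a + i : ℕ) 0 u
      = (-1) ^ M * (retCoeff a M i : ℂ) * iteratedDeriv (M - i) b u) ∧
    SuppGE a (drMinusTwoDu^[M] (retSeed b a)) ∧
    ∀ k, ∀ j > 0, (drMinusTwoDu^[M] (retSeed b a)) k j = 0 := by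
  induction M with
  | zero =>
    refine ⟨fun i u => ?_, fun k hk j => ?_, fun k j hj => ?_⟩
    · rcases i with _ | i
      · simp [retSeed, retCoeff]
      · rw [retCoeff]
        have : (i : ℤ) + 1 ≠ 0 := by omega
        simp [retSeed, this]
    · simp only [Function.iterate_zero, id, retSeed]
      rw [if_neg (by omega)]
    · simp only [Function.iterate_zero, id, retSeed]
      rw [if_neg (by omega)]
  | succ M ih =>
    obtain ⟨h1, h2, h3⟩ := ih
    set F := drMinusTwoDu^[M] (retSeed b a) with hF
    have hD : ∀ i u, deriv (F (a + i : ℕ) 0) u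
        = (-1) ^ M * (retCoeff a M i : ℂ) * iteratedDeriv (M - i + 1) b u := by
      intro i u
      have : F (a + i : ℕ) 0 = fun u => (-1) ^ M * (retCoeff a M i : ℂ)
        * iteratedDeriv (M - i) b u := funext fun u => h1 i u
      rw [this, deriv_const_mul_field, iteratedDeriv_succ]
    rw [Function.iterate_succ_apply', ← hF]
    refine ⟨fun i u => ?_, fun k hk j => ?_, fun k j hj => ?_⟩
    · simp only [drMinusTwoDu, dr, Pi.add_apply, Pi.smul_apply, smul_eq_mul]
      rw [hD, h3 _ (0 + 1) (by omega)]
      rcases i with _ | i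
      · rw [h2 _ (by omega), retCoeff]
        simp only [Pi.zero_apply, Nat.sub_zero]
        push_cast
        ring
      · rw [show ((a + (i + 1) : ℕ) : ℤ) - 1 = (a + i : ℕ) by push_cast; ring, h1, retCoeff,
          Nat.add_sub_add_right]
        rcases lt_or_ge M (i + 1) with h | h
        · rw [retCoeff_of_lt a h]
          simp only [Pi.zero_apply]
          push_cast
          ring
        · rw [show M - (i + 1) + 1 = M - i by omega]
          simp only [Pi.zero_apply]
          push_cast
          ring
    · funext u
      simp only [drMinusTwoDu, dr, h2 (k - 1) (by omega), h2 k hk]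
      simp
    · funext u
      simp only [drMinusTwoDu, dr, h3 _ j hj, h3 _ (j + 1) (by omega)]
      simp

theorem retMode_eq {s l n : ℕ} (hn : n ≤ l + s) (b : ℝ → ℂ) :
    retMode s l b n = (KRet ((s : ℤ) - n) l : ℂ) • rmul ((l : ℤ) - s)
      (drMinusTwoDu^[l + n - s] (retSeed b ((l + s - n + 1 : ℕ) : ℤ))) := by
  rw [retMode, show ((l + s - n + 1 : ℕ) : ℤ) = (l : ℤ) + s - n + 1 by omega]

theorem suppGE_retMode {s l n : ℕ} (b : ℝ → ℂ) (hn : n ≤ l + s) : SuppGE (2 * (s : ℤ) - n + 1) (retMode s l b n) := by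
  rw [retMode_eq hn]
  exact (((drMinusTwoDu_iterate_retSeed b (l + s - n + 1) (l + n - s)).2.1.rmul _).smul _).mono
    (by omega)

theorem retMode_log {s l n : ℕ} (b : ℝ → ℂ) (hn : n ≤ l + s) (k : ℤ) {j : ℕ} (hj : 0 < j) : retMode s l b n k j = 0 := by
  rw [retMode_eq hn]
  have := (drMinusTwoDu_iterate_retSeed b (l + s - n + 1) (l + n - s)).2.2
    (k + ((l : ℤ) - s)) j hj
  rw [Pi.smul_apply, Pi.smul_apply, rmul, this, smul_zero]

theorem retMode_last {s l : ℕ} (b : ℝ → ℂ) (hl : s ≤ l) (i : ℕ) (u : ℝ) :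
    retMode s l b (2 * s) (i + 1 : ℕ) 0 u = (KRet (-s) l : ℂ) * (-1) ^ (l + s)
      * (retCoeff (l - s + 1) (l + s) i : ℂ) * iteratedDeriv (l + s - i) b u := by
  rw [retMode_eq (by omega)]
  have := (drMinusTwoDu_iterate_retSeed b (l + s - 2 * s + 1) (l + 2 * s - s)).1 i u
  simp only [rmul, Pi.smul_apply, smul_eq_mul]
  rw [show ((i + 1 : ℕ) : ℤ) + ((l : ℤ) - s) = ((l + s - 2 * s + 1 + i : ℕ) : ℤ) by omega, this,
    show l + 2 * s - s = l + s by omega, show l + s - 2 * s + 1 = l - s + 1 by omega,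
    show (s : ℤ) - (2 * s : ℕ) = -s by push_cast; ring]
  ring

/-- The lowest component of a non-radiative multipole. -/
theorem retMode_first {s l : ℕ} (hl : l < s) (b : ℝ → ℂ) (k : ℤ) (j : ℕ) (u : ℝ) :
    retMode s l b (s - l) k j u
      = (KRet l l : ℂ) * if k = (s : ℤ) + l + 1 ∧ j = 0 then b u else 0 := by
  rw [retMode, show l + (s - l) - s = 0 by omega, show (s : ℤ) - ((s - l : ℕ) : ℤ) = l by omega]
  simp only [Function.iterate_zero, id, Pi.smul_apply, smul_eq_mul, rmul, retSeed]
  congr 1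
  by_cases h : k = (s : ℤ) + l + 1 ∧ j = 0
  · rw [if_pos h, if_pos (by omega)]
  · rw [if_neg h, if_neg (by omega)]
    rfl

end ZRM

/-! ### Decomposition of a multipole -/

namespace ZRM

/-- At a fixed power of `r` the derivative acts on polynomials in the logarithm as `κ` plus a
nilpotent operator. This is invertible for `κ ≠ 0`, and the degree does not grow; the induction
removes the top coefficient. -/
theorem exists_shift_solution {κ : ℂ} (hκ : κ ≠ 0) (N : ℕ) : ∀ g : ℕ → ℂ, (∀ j ≥ N, g j = 0) →
    ∃ h : ℕ → ℂ, (∀ j ≥ N, h j = 0) ∧ ∀ j : ℕ, κ * h j + ((j : ℂ) + 1) * h (j + 1) = g j := by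
  induction N with
  | zero => exact fun g hg => ⟨0, fun _ _ => rfl, fun j => by simp [hg j (Nat.zero_le j)]⟩
  | succ N ih =>
    intro g hg
    set t : ℂ := κ⁻¹ * g N with ht
    set e : ℕ → ℂ := fun j => if j = N then t else 0 with he
    obtain ⟨h, h1, h2⟩ := ih (fun j => g j - (κ * e j + ((j : ℂ) + 1) * e (j + 1))) (by
      intro j hj
      rcases hj.eq_or_lt with rfl | hj
      · simp [he, ht, hκ]
      · simp only [he]
        rw [if_neg (by omega), if_neg (by omega), hg j hj]
        simp)
    refine ⟨fun j => h j + e j, fun j hj => ?_, fun j => ?_⟩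
    · simp only [he]
      rw [if_neg (by omega), h1 j (by omega), add_zero]
    · linear_combination h2 j

/-- Back substitution from the highest logarithm. The lower bound `M` covers right-hand sides that
vanish only from some power of the logarithm on. -/
theorem eq_zero_of_shift_of_le {κ : ℂ} (hκ : κ ≠ 0) {h : ℕ → ℂ} {M : ℕ}
    (h1 : ∀ j ≥ M, κ * h j + ((j : ℂ) + 1) * h (j + 1) = 0) {N : ℕ} (h2 : ∀ j > N, h j = 0) :
    ∀ j ≥ M, h j = 0 := by
  have key : ∀ i, ∀ j ≥ M, N < j + i → h j = 0 := by
    intro i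
    induction i with
    | zero => exact fun j _ hj => h2 j hj
    | succ i ih =>
      intro j hM hj
      have h3 := h1 j hM
      rw [ih (j + 1) (by omega) (by omega), mul_zero, add_zero] at h3
      exact (mul_eq_zero.1 h3).resolve_left hκ
  exact fun j hM => key (N + 1) j hM (by omega)

theorem eq_zero_of_shift {κ : ℂ} (hκ : κ ≠ 0) {h : ℕ → ℂ}
    (h1 : ∀ j : ℕ, κ * h j + ((j : ℂ) + 1) * h (j + 1) = 0) {N : ℕ} (h2 : ∀ j > N, h j = 0)
    (j : ℕ) : h j = 0 :=
  eq_zero_of_shift_of_le hκ (M := 0) (fun j _ => h1 j) h2 j (Nat.zero_le j)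

/-- Without a term `r⁻¹` in `G` the factor `-k` to be inverted is never zero. The primitive is taken
without constant of integration, so it vanishes at every order at which `G` does one order higher.
-/
theorem exists_dr_eq {G : PolyLog ℂ} (hG : SuppGE 2 G) (hl : FiniteLogs G) :
    ∃ F : PolyLog ℂ, dr F = G ∧ FiniteLogs F ∧ ∀ k, (∀ j, G (k + 1) j = 0) → ∀ j, F k j = 0 := by
  have key : ∀ k : ℤ, ∃ h : ℕ → ℂ, (∃ N : ℕ, ∀ j > N, h j = 0) ∧
      (∀ j : ℕ, -(k : ℂ) * h j + ((j : ℂ) + 1) * h (j + 1) = G (k + 1) j) ∧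
      ((∀ j, G (k + 1) j = 0) → ∀ j, h j = 0) := by
    intro k
    by_cases hz : ∀ j, G (k + 1) j = 0
    · exact ⟨0, ⟨0, fun _ _ => rfl⟩, fun j => by simp [hz j], fun _ _ => rfl⟩
    · have hk : 1 ≤ k := by
        by_contra h
        exact hz fun j => hG (k + 1) (by omega) j
      obtain ⟨N, hN⟩ := hl (k + 1)
      obtain ⟨h, h1, h2⟩ := exists_shift_solution (κ := -(k : ℂ))
        (neg_ne_zero.2 (by exact_mod_cast (by omega : k ≠ 0))) (N + 1) (G (k + 1))
        fun j hj => hN j hj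
      exact ⟨h, ⟨N, fun j hj => h1 j hj⟩, h2, fun h' => absurd h' hz⟩
  choose F h1 h2 h3 using key
  refine ⟨F, ?_, h1, h3⟩
  funext k j
  have := h2 (k - 1) j
  rw [sub_add_cancel] at this
  rw [← this]
  simp [dr]

theorem exists_dr_iterate_eq (M : ℕ) : ∀ {G : PolyLog ℂ}, SuppGE (M + 1) G → FiniteLogs G →
    ∃ F : PolyLog ℂ, dr^[M] F = G ∧ FiniteLogs F ∧
      ∀ k, (∀ j, G (k + M) j = 0) → ∀ j, F k j = 0 := by
  induction M with
  | zero => exact fun {G} _ hl => ⟨G, rfl, hl, fun k h j => by simpa using h j⟩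
  | succ M ih =>
    intro G hG hl
    obtain ⟨F, h1, h2, h3⟩ := exists_dr_eq (hG.mono (by push_cast; omega)) hl
    obtain ⟨E, k1, k2, k3⟩ := ih (G := F) (fun k hk => h3 k fun j =>
      hG (k + 1) (by push_cast; omega) j) h2
    refine ⟨E, ?_, k2, fun k hk => k3 k (h3 _ fun j => ?_)⟩
    · rw [Function.iterate_succ_apply', k1, h1]
    · have := hk j
      push_cast at this
      rwa [← add_assoc] at this

-- The substitution `log r ↦ log r + a` is undone by the Taylor shift by `-a`. The sum may extend
-- over any range beyond the degree.
open Polynomial in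
theorem exists_taylor_coeff {a : ℂ} {g : ℕ → ℂ} {N : ℕ} (hg : ∀ j > N, g j = 0) :
    ∃ P : ℂ[X], ∀ j, ∀ M > P.natDegree, ∑ q ∈ Finset.range M,
      (q.choose j : ℂ) * a ^ (q - j) * P.coeff q = g j := by
  set Q : ℂ[X] := ∑ j ∈ Finset.range (N + 1), monomial j (g j) with hQ
  have hQc : ∀ j, Q.coeff j = g j := by
    intro j
    simp only [hQ, finsetSum_coeff, coeff_monomial]
    rw [Finset.sum_ite_eq' (Finset.range (N + 1)) j]
    split_ifs with h
    · rfl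
    · rw [hg j (by simpa using h)]
  refine ⟨taylor (-a) Q, fun j M hM => ?_⟩
  have h1 : (taylor a (taylor (-a) Q)).coeff j = g j := by
    rw [taylor_taylor, add_neg_cancel, taylor_zero, hQc]
  rw [← h1, taylor_coeff, hasseDeriv_apply, sum_over_range' _ (by simp) M hM, eval_finsetSum]
  refine Finset.sum_congr rfl fun q _ => ?_
  rw [eval_monomial]
  ring

theorem exists_atDouble_eq {F : PolyLog ℂ} (hF : FiniteLogs F) :
    ∃ B : PolyLog ℂ, atDouble B = F ∧ FiniteLogs B ∧ ∀ k, (∀ j, F k j = 0) → ∀ q, B k q = 0 := by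
  have key : ∀ k : ℤ, ∃ B : ℕ → ℂ, (∃ N : ℕ, (∀ q > N, B q = 0) ∧ ∀ j, (2 : ℂ) ^ (-k) *
      ∑ q ∈ Finset.range (N + 1), (q.choose j : ℂ) * ((Real.log 2 : ℝ) : ℂ) ^ (q - j) * B q
      = F k j) ∧ ((∀ j, F k j = 0) → ∀ q, B q = 0) := by
    intro k
    by_cases hz : ∀ j, F k j = 0
    · exact ⟨0, ⟨0, fun _ _ => rfl, fun j => by simp [hz]⟩, fun _ _ => rfl⟩
    · obtain ⟨N, hN⟩ := hF k
      obtain ⟨P, hP⟩ := exists_taylor_coeff (a := ((Real.log 2 : ℝ) : ℂ)) hN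
      refine ⟨fun q => (2 : ℂ) ^ k * P.coeff q, ⟨P.natDegree, fun q hq => ?_, fun j => ?_⟩,
        fun h => absurd h hz⟩
      · change (2 : ℂ) ^ k * P.coeff q = 0
        rw [Polynomial.coeff_eq_zero_of_natDegree_lt hq, mul_zero]
      · rw [← hP j _ (Nat.lt_succ_self _), Finset.mul_sum]
        refine Finset.sum_congr rfl fun q _ => ?_
        rw [zpow_neg]
        have : (2 : ℂ) ^ k ≠ 0 := zpow_ne_zero _ two_ne_zero
        field_simp
  choose B h1 h2 using key
  refine ⟨B, ?_, fun k => ?_, h2⟩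
  · funext k j
    obtain ⟨N, hN, h3⟩ := h1 k
    rw [atDouble_eq_sum hN j (Nat.lt_succ_self N), ← h3 j]
  · obtain ⟨N, hN, -⟩ := h1 k
    exact ⟨N, hN⟩

/-- The last component at `u = 0` of an advanced solution can be prescribed. -/
theorem exists_profile {s l : ℕ} (hl : s ≤ l) {D : PolyLog ℂ} (hD : SuppGE 1 D)
    (hlog : FiniteLogs D) : ∃ B : PolyLog ℂ, IsProfile B ∧ advData s l B (2 * s) = D ∧
      ∀ k, (∀ j, D (k + l + s + 1) j = 0) → ∀ q, B k q = 0 := by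
  have hK : (K ((s : ℤ) - (2 * s : ℕ)) l : ℂ) ≠ 0 := by exact_mod_cast (K_pos _ l).ne'
  obtain ⟨M, rfl⟩ : ∃ M : ℕ, l = s + M := ⟨l - s, by omega⟩
  -- For `n = 2s` the advanced operator is `K r ^ M ∂_r ^ M` after multiplication by `r ^ (-(M + 2s
  -- + 1))`. Since `r ^ (-M) D` starts at order `M + 1`, all `M` integrations avoid the term `r⁻¹`.
  obtain ⟨F, h1, h2, h3⟩ := exists_dr_iterate_eq M
    (G := (K ((s : ℤ) - (2 * s : ℕ)) (s + M : ℕ) : ℂ)⁻¹ • rmul (-(M : ℤ)) D)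
    (((hD.rmul _).smul _).mono (by omega)) ((hlog.rmul _).smul _)
  obtain ⟨B, k1, k2, k3⟩ := exists_atDouble_eq (h2.rmul ((M : ℤ) + 2 * s + 1))
  have hzero : ∀ k, (∀ j, D (k + (s + M : ℕ) + s + 1) j = 0) → ∀ q, B k q = 0 := by
    intro k hk
    refine k3 k (h3 (k + ((M : ℤ) + 2 * s + 1)) fun j => ?_)
    have := hk j
    simp only [Pi.smul_apply, rmul]
    rw [show k + ((M : ℤ) + 2 * s + 1) + M + -(M : ℤ) = k + (s + M : ℕ) + s + 1 by push_cast; ring,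
      this, smul_zero]
  refine ⟨B, ⟨⟨-((s + M : ℕ) + s : ℤ), fun k hk => hzero k fun j => hD _ (by omega) j⟩, k2⟩,
    ?_, hzero⟩
  rw [advData, k1, advOp, rmul_rmul, show s + M + s - 2 * s = M by omega,
    show -(((s + M : ℕ) : ℤ) - s + (2 * s : ℕ) + 1) + ((M : ℤ) + 2 * s + 1) = 0 by
      push_cast; ring, rmul_zero_left, h1, rmul_smul, rmul_rmul,
    show ((s + M : ℕ) : ℤ) - s + -(M : ℤ) = 0 by push_cast; ring, rmul_zero_left, smul_smul,
    mul_inv_cancel₀ hK, one_smul]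

theorem RadialEqs.sub {s l : ℕ} {D D' : ℕ → PolyLog ℂ} (h : RadialEqs s l D)
    (h' : RadialEqs s l D') : RadialEqs s l (fun n k j => D n k j - D' n k j) := by
  intro n hn k j
  linear_combination h n hn k j - h' n hn k j

/-- The last component determines the others. -/
theorem RadialEqs.eq_zero {s l : ℕ} (hl : s ≤ l) {D : ℕ → PolyLog ℂ} (h : RadialEqs s l D) {k : ℤ}
    (h0 : ∀ j, D (2 * s) k j = 0) : ∀ n ≤ 2 * s, ∀ j, D n k j = 0 := by
  intro n hn
  induction hn using Nat.decreasingInduction with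
  | self => exact h0
  | of_succ n hn ih =>
    intro j
    have h1 := h n hn k j
    rw [ih, ih, mul_zero, mul_zero, add_zero] at h1
    exact (mul_eq_zero.1 h1.symm).resolve_left
      (Complex.ofReal_ne_zero.2 (modeLadder_pos hl hn).ne')

theorem RadialEqs.congr_of_last {s l : ℕ} (hl : s ≤ l) {D D' : ℕ → PolyLog ℂ}
    (h : RadialEqs s l D) (h' : RadialEqs s l D') {k : ℤ}
    (h0 : ∀ j, D (2 * s) k j = D' (2 * s) k j) : ∀ n ≤ 2 * s, ∀ j, D n k j = D' n k j :=
  fun n hn j => sub_eq_zero.1 ((h.sub h').eq_zero hl (fun j => sub_eq_zero.2 (h0 j)) n hn j)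

/-- The multipoles of polyhomogeneous fields. -/
structure IsMode (s l : ℕ) (f : ℕ → PolyLog (ℝ → ℂ)) : Prop where
  smooth : ∀ n ≤ 2 * s, ∀ k j, ContDiff ℝ ∞ (f n k j)
  supp : ∀ n ≤ 2 * s, SuppGE 1 (f n)
  logs : ∀ n ≤ 2 * s, FiniteLogs (f n)
  eqs : ModeEqs s l f

theorem evolution_sub (s l : ℕ) (D D' : ℕ → PolyLog ℂ) (n : ℕ) (k : ℤ) (j : ℕ) :
    evolution s l (fun n k j => D n k j - D' n k j) n k j
      = evolution s l D n k j - evolution s l D' n k j := by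
  simp only [evolution]
  ring

theorem IsMode.sub {s l : ℕ} {f g : ℕ → PolyLog (ℝ → ℂ)} (hf : IsMode s l f) (hg : IsMode s l g) :
    IsMode s l (fun n => f n - g n) where
  smooth n hn k j := (hf.smooth n hn k j).sub (hg.smooth n hn k j)
  supp n hn k hk j := by simp [hf.supp n hn k hk j, hg.supp n hn k hk j]
  logs n hn := (hf.logs n hn).sub (hg.logs n hn)
  eqs u := by
    refine ⟨((hf.eqs u).1).sub (hg.eqs u).1, fun n hn k j => ?_⟩
    have h1 := (hf.eqs u).2 n hn k j
    have h2 := (hg.eqs u).2 n hn k j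
    have h3 := evolution_sub s l (fun n k j => f n k j u) (fun n k j => g n k j u) n k j
    have h4 : deriv (f n (k + 1) j - g n (k + 1) j) u
        = deriv (f n (k + 1) j) u - deriv (g n (k + 1) j) u :=
      deriv_sub ((hf.smooth n hn.le _ _).differentiable (by simp) u)
        ((hg.smooth n hn.le _ _).differentiable (by simp) u)
    exact h4.trans (by rw [h1, h2]; exact h3.symm)

theorem eq_of_deriv_eq_zero {f : ℝ → ℂ} (hf : ContDiff ℝ ∞ f) (h : ∀ u, deriv f u = 0) (u : ℝ) :
    f u = f 0 := is_const_of_deriv_eq_zero (hf.differentiable (by simp)) h u 0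

/-- A mode is determined by the last component at `u = 0` and its leading coefficient. -/
theorem IsMode.eq_zero {s l : ℕ} (hs : 1 ≤ s) (hl : s ≤ l) {g : ℕ → PolyLog (ℝ → ℂ)}
    (hg : IsMode s l g) (h0 : ∀ k j, g (2 * s) k j 0 = 0) (h1 : g (2 * s) 1 0 = 0) :
    ∀ n ≤ 2 * s, ∀ k j, g n k j = 0 := by
  have key : ∀ i : ℕ, ∀ n ≤ 2 * s, ∀ k ≤ (i : ℤ), ∀ j, g n k j = 0 := by
    intro i
    induction i with
    | zero => exact fun n hn k hk j => hg.supp n hn k (by push_cast at hk; omega) j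
    | succ i ih =>
      have hlow : ∀ n < 2 * s, ∀ j, g n ((i : ℤ) + 1) j = 0 := by
        intro n hn j
        funext u
        have hd : ∀ u, deriv (g n ((i : ℤ) + 1) j) u = 0 := by
          intro u
          rw [(hg.eqs u).2 n hn i j, evolution, ih n hn.le i le_rfl, ih n hn.le i le_rfl,
            ih (n + 1) hn i le_rfl]
          simp
        rw [eq_of_deriv_eq_zero (hg.smooth n hn.le _ _) hd]
        exact (hg.eqs 0).1.eq_zero hl (h0 _) n hn.le j
      have hlast : ∀ j, g (2 * s) ((i : ℤ) + 1) j = 0 := by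
        have h2 : ∀ (u : ℝ) (j : ℕ), -(i : ℂ) * g (2 * s) ((i : ℤ) + 1) j u
            + ((j : ℂ) + 1) * g (2 * s) ((i : ℤ) + 1) (j + 1) u = 0 := by
          intro u j
          have h3 := (hg.eqs u).1 (2 * s - 1) (by omega) ((i : ℤ) + 1) j
          simp only [Nat.sub_add_cancel (by omega : 1 ≤ 2 * s)] at h3
          rw [hlow (2 * s - 1) (by omega) j, Pi.zero_apply, mul_zero] at h3
          rw [← h3]
          push_cast [Nat.cast_sub (by omega : 1 ≤ 2 * s)]
          ring
        -- At order one the radial factor vanishes: the equation kills the logarithmic terms of the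
        -- last component but leaves its coefficient of `r⁻¹` free, and that is the additional
        -- hypothesis. At higher orders everything is forced.
        rcases Nat.eq_zero_or_pos i with rfl | hi
        · intro j
          rcases j with _ | j
          · simpa using h1
          · funext u
            have h3 := h2 u j
            simp only [Nat.cast_zero, neg_zero, zero_mul, zero_add] at h3 ⊢
            exact (mul_eq_zero.1 h3).resolve_left (by exact_mod_cast j.succ_ne_zero)
        · intro j
          funext u
          obtain ⟨N, hN⟩ := hg.logs (2 * s) le_rfl ((i : ℤ) + 1)
          exact eq_zero_of_shift (neg_ne_zero.2 (by exact_mod_cast hi.ne'))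
            (h2 u) (N := N) (fun j hj => by rw [hN j hj]; rfl) j
      intro n hn k hk j
      rcases (show k ≤ i ∨ k = (i : ℤ) + 1 by push_cast at hk; omega) with h | rfl
      · exact ih n hn k h j
      · rcases hn.lt_or_eq with hn | rfl
        · exact hlow n hn j
        · exact hlast j
  exact fun n hn k j => key k.toNat n hn k (Int.self_le_toNat k) j

/-- Repeated integration from `0`; each constant of integration sets one derivative at `0`. -/
theorem exists_iteratedDeriv_eq (N : ℕ) : ∀ {β : ℝ → ℂ}, ContDiff ℝ ∞ β → ∀ c : ℕ → ℂ,
    ∃ b : ℝ → ℂ, ContDiff ℝ ∞ b ∧ iteratedDeriv N b = β ∧ ∀ i < N, iteratedDeriv i b 0 = c i := by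
  induction N with
  | zero => exact fun {β} hβ c => ⟨β, hβ, iteratedDeriv_zero, fun i hi => absurd hi (by omega)⟩
  | succ N ih =>
    intro β hβ c
    have hd : ∀ u, HasDerivAt (fun u => c N + ∫ t in (0 : ℝ)..u, β t) (β u) u := fun u =>
      ((hβ.continuous.integral_hasStrictDerivAt 0 u).hasDerivAt).const_add _
    have hd' : deriv (fun u => c N + ∫ t in (0 : ℝ)..u, β t) = β := funext fun u => (hd u).deriv
    have hsm : ContDiff ℝ ∞ (fun u => c N + ∫ t in (0 : ℝ)..u, β t) :=
      contDiff_infty_iff_deriv.2 ⟨fun u => (hd u).differentiableAt, by rwa [hd']⟩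
    obtain ⟨b, h1, h2, h3⟩ := ih hsm c
    refine ⟨b, h1, by rw [iteratedDeriv_succ, h2, hd'], fun i hi => ?_⟩
    rcases (Nat.lt_succ_iff.1 hi).lt_or_eq with hi | rfl
    · exact h3 i hi
    · rw [h2]
      simp

theorem isMode_advMode {s l : ℕ} (hl : s ≤ l) {B : PolyLog ℂ} (hB : IsProfile B)
    (hsupp : SuppGE (-((l : ℤ) + s)) B) : IsMode s l (advMode s l B) := by
  have hD : ∀ k : ℤ, k < -((l : ℤ) + s) + l + s + 1 + k.toNat := fun k => by
    have := Int.self_le_toNat k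
    omega
  refine ⟨fun n hn k j => ?_, fun n hn k hk j => ?_, fun n hn k => ?_, modeEqs_advMode hl hB⟩
  · have e : advMode s l B n k j = fun u : ℝ => ∑ d ∈ Finset.range k.toNat,
        ((u : ℂ) ^ d / (d.factorial : ℂ)) * advData s l (dr^[d] B) n k j :=
      funext fun u => advMode_eq_sum hl hn hsupp (hD k) j u
    rw [e]
    refine ContDiff.sum fun d _ => ContDiff.mul (ContDiff.div_const (ContDiff.pow ?_ d) _)
      contDiff_const
    exact Complex.ofRealCLM.contDiff
  · funext u
    rw [advMode_eq_sum hl hn hsupp (D := 0) (by push_cast; omega)]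
    rfl
  · have hl' : ∀ d, FiniteLogs (advData s l (dr^[d] B) n) := fun d =>
      (hB.finiteLogs.dr_iterate d).atDouble.advOp s l n
    choose N hN using fun d => hl' d k
    refine ⟨(Finset.range k.toNat).sup N, fun j hj => funext fun u => ?_⟩
    rw [advMode_eq_sum hl hn hsupp (hD k)]
    refine Finset.sum_eq_zero fun d hd => ?_
    rw [hN d j (lt_of_le_of_lt (Finset.le_sup hd) hj), mul_zero]

theorem isMode_retMode {s l : ℕ} (hl : s ≤ l) {b : ℝ → ℂ} (hb : ContDiff ℝ ∞ b) :
    IsMode s l (retMode s l b) :=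
  ⟨fun n _ k j => contDiff_retMode hb n k j, fun _ hn => (suppGE_retMode b (by omega)).mono (by omega),
    fun _ hn _ => ⟨0, fun _ hj => retMode_log b (by omega) _ hj⟩, modeEqs_retMode hb hl⟩

theorem advMode_at_zero {s l n : ℕ} (hl : s ≤ l) (hn : n ≤ 2 * s) {B : PolyLog ℂ}
    (hsupp : SuppGE (-((l : ℤ) + s)) B) (k : ℤ) (j : ℕ) :
    advMode s l B n k j 0 = advData s l B n k j := by
  rw [advMode_eq_sum hl hn hsupp (D := k.toNat + 1)
    (by have := Int.self_le_toNat k; push_cast; omega), Finset.sum_range_succ']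
  simp

theorem suppGE_advMode {s l n : ℕ} (hl : s ≤ l) (hn : n ≤ 2 * s) {κ : ℤ} {B : PolyLog ℂ}
    (hsupp : SuppGE κ B) : SuppGE (κ + l + s + 1) (advMode s l B n) := fun k hk j => funext fun u => by
  rw [advMode_eq_sum hl hn hsupp (D := 0) (by push_cast; omega)]
  rfl

/-- A radiative mode which peels is the sum of a retarded solution and of an advanced solution
which does not contain growing powers. -/
theorem IsMode.exists_mixed {s l : ℕ} (hs : 1 ≤ s) (hl : s ≤ l) {h : ℕ → PolyLog (ℝ → ℂ)}
    (hh : IsMode s l h) (hp : ∀ n ≤ 2 * s, ∀ k ≤ 2 * (s : ℤ), ∀ j,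
      ViolatesPeeling s n k j → h n k j = 0) :
    ∃ (b : ℝ → ℂ) (B : PolyLog ℂ), ContDiff ℝ ∞ b ∧ IsProfile B ∧ SuppGE ((s : ℤ) - l) B ∧
      (∀ n ≤ 2 * s, ∀ k j, advData s l B n k j
        = if 2 * (s : ℤ) + 1 ≤ k then h n k j 0 else 0) ∧
      ∀ n ≤ 2 * s, ∀ k j u, h n k j u = retMode s l b n k j u + advMode s l B n k j u := by
  -- Peeling excludes logarithms up to its threshold order. Beyond the threshold the radial factor
  -- is nonzero, so logarithms in a component would need logarithms in the preceding one at the same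
  -- order; `φ_0` has no terms there at all.
  have hlog : ∀ k ≤ 2 * (s : ℤ), ∀ n ≤ 2 * s, ∀ j ≥ 1, h n k j = 0 := by
    intro k hk n hn
    induction n with
    | zero => exact fun j _ => hp 0 hn k hk j (Or.inl (by push_cast; omega))
    | succ n ih =>
      intro j hj
      rcases lt_trichotomy k (2 * (s : ℤ) + 1 - (n + 1 : ℕ)) with hk' | hk' | hk'
      · exact hp _ hn k hk j (Or.inl hk')
      · exact hp _ hn k hk j (Or.inr ⟨hk', hj⟩)
      · funext u
        obtain ⟨N, hN⟩ := hh.logs (n + 1) hn k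
        have hne : 2 * (s : ℂ) - n - k ≠ 0 := by
          have : (2 * (s : ℤ) - n - k : ℤ) ≠ 0 := by push_cast at hk'; omega
          exact_mod_cast this
        refine eq_zero_of_shift_of_le (h := fun j => h (n + 1) k j u) hne (fun i hi => ?_) (N := N)
          (fun i hi => by simp only [hN i hi, Pi.zero_apply]) j hj
        have h2 := (hh.eqs u).1 n (by omega) k i
        simp only at h2
        rwa [ih (by omega) i hi, Pi.zero_apply, mul_zero] at h2
  set κ : ℕ → ℂ := fun i => (KRet (-s) l : ℂ) * (-1) ^ (l + s)
    * (retCoeff (l - s + 1) (l + s) i : ℂ) with hκ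
  have hκne : ∀ i ≤ l + s, κ i ≠ 0 := fun i hi => by
    refine mul_ne_zero (mul_ne_zero (Complex.ofReal_ne_zero.2 (KRet_pos _ l).ne') ?_)
      (Complex.ofReal_ne_zero.2 (retCoeff_pos (Nat.succ_pos _) hi).ne')
    exact pow_ne_zero _ (by norm_num)
  -- The derivative of order `l + s` is dictated by the `r⁻¹` coefficient. The derivative of order
  -- `l + s - i` at `0` controls order `i + 1` of the last component; it is matched for `i < 2s` and
  -- set to zero otherwise, leaving orders above `2s` to the advanced part.
  obtain ⟨b, hb, hbN, hb0⟩ := exists_iteratedDeriv_eq (l + s)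
    (β := fun u => (κ 0)⁻¹ * h (2 * s) 1 0 u)
    (contDiff_const.mul (hh.smooth (2 * s) le_rfl 1 0))
    (fun i => if l + s - i < 2 * s then (κ (l + s - i))⁻¹ * h (2 * s) (l + s - i + 1 : ℕ) 0 0 else 0)
  have hret1 : ∀ u, retMode s l b (2 * s) 1 0 u = h (2 * s) 1 0 u := by
    intro u
    have := retMode_last b hl 0 u
    rw [Nat.sub_zero, hbN] at this
    push_cast at this
    rw [this]
    exact mul_inv_cancel_left₀ (hκne 0 (by omega)) _
  have hret : ∀ k j, retMode s l b (2 * s) k j 0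
      = if 2 * (s : ℤ) + 1 ≤ k then 0 else h (2 * s) k j 0 := by
    intro k j
    rcases Nat.eq_zero_or_pos j with rfl | hj
    · rcases lt_or_ge k 1 with hk | hk
      · rw [suppGE_retMode b (by omega) k (by push_cast; omega), hh.supp _ le_rfl k hk]
        simp
      · obtain ⟨i, rfl⟩ : ∃ i : ℕ, k = (i + 1 : ℕ) := ⟨(k - 1).toNat, by omega⟩
        rcases Nat.eq_zero_or_pos i with rfl | hi
        · rw [if_neg (by push_cast; omega)]
          exact hret1 0
        · rw [retMode_last b hl i 0]
          rcases lt_or_ge (l + s) i with hi' | hi'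
          · rw [retCoeff_of_lt _ hi', if_pos (by push_cast; omega)]
            simp
          · rw [hb0 _ (by omega)]
            simp only [show l + s - (l + s - i) = i by omega]
            by_cases h2 : i < 2 * s
            · rw [if_pos h2, if_neg (by push_cast; omega)]
              exact mul_inv_cancel_left₀ (hκne i hi') _
            · rw [if_neg h2, if_pos (by push_cast; omega), mul_zero]
    · rw [retMode_log b (by omega) k hj]
      split_ifs with h2
      · rfl
      · rw [hlog k (by omega) _ le_rfl j hj]
  set D : PolyLog ℂ := fun k j => if 2 * (s : ℤ) + 1 ≤ k then h (2 * s) k j 0 else 0 with hDdef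
  obtain ⟨B, hB, hBD, hB0⟩ := exists_profile hl (D := D)
    (fun k hk j => if_neg (by omega)) (fun k => by
      obtain ⟨N, hN⟩ := hh.logs (2 * s) le_rfl k
      exact ⟨N, fun j hj => by simp [hDdef, hN j hj]⟩)
  have hBs : SuppGE ((s : ℤ) - l) B := fun k hk => hB0 k fun j => if_neg (by omega)
  have hBs' : SuppGE (-((l : ℤ) + s)) B := hBs.mono (by omega)
  refine ⟨b, B, hb, hB, hBs, ?_, ?_⟩
  · have hr := (hh.eqs 0).1
    have hr' : RadialEqs s l (fun n k j => if 2 * (s : ℤ) + 1 ≤ k then h n k j 0 else 0) := by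
      intro n hn k j
      simp only
      split_ifs
      · exact hr n hn k j
      · simp
    intro n hn k j
    refine (radialEqs_advOp hl (atDouble B)).congr_of_last hl hr' (fun j => ?_) n hn j
    exact congrFun (congrFun hBD k) j
  -- The difference has no data in the last component at `u = 0`. Its `r⁻¹` coefficient vanishes for
  -- all `u`, because the advanced part starts at order `2s + 1`.
  · have hg := (hh.sub (isMode_retMode hl hb)).sub (isMode_advMode hl hB hBs')
    have hz := hg.eq_zero hs hl (fun k j => ?_) ?_
    · intro n hn k j u
      have := congrFun (hz n hn k j) u
      simp only [Pi.sub_apply, Pi.zero_apply] at this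
      linear_combination this
    · have h1 := congrFun (congrFun hBD k) j
      simp only [Pi.sub_apply]
      rw [hret, advMode_at_zero hl le_rfl hBs', h1, hDdef]
      simp only
      split_ifs <;> simp
    · funext u
      have h1 := suppGE_advMode hl (le_refl (2 * s)) hBs 1 (by omega) 0
      simp only [Pi.sub_apply, Pi.zero_apply, h1, hret1, sub_self]

/-- A non-radiative mode is a retarded solution. -/
theorem IsMode.exists_retMode {s l : ℕ} (hl : l < s) {h : ℕ → PolyLog (ℝ → ℂ)}
    (hh : IsMode s l h) (hz : ∀ n ≤ 2 * s, (l : ℤ) < |(s : ℤ) - n| → ∀ k j, h n k j = 0) :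
    ∃ b : ℝ → ℂ, ContDiff ℝ ∞ b ∧
      ∀ n ≤ 2 * s, |(s : ℤ) - n| ≤ (l : ℤ) → ∀ k j u, h n k j u = retMode s l b n k j u := by
  have hK : (KRet l l : ℂ) ≠ 0 := Complex.ofReal_ne_zero.2 (KRet_pos _ l).ne'
  refine ⟨fun u => (KRet l l : ℂ)⁻¹ * h (s - l) ((s : ℤ) + l + 1) 0 u,
    contDiff_const.mul (hh.smooth _ (by omega) _ _), ?_⟩
  set b : ℝ → ℂ := fun u => (KRet l l : ℂ)⁻¹ * h (s - l) ((s : ℤ) + l + 1) 0 u with hb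
  have hbs : ContDiff ℝ ∞ b := contDiff_const.mul (hh.smooth _ (by omega) _ _)
  have key : ∀ i ≤ 2 * l, ∀ k j u, h (s - l + i) k j u = retMode s l b (s - l + i) k j u := by
    intro i hi
    induction i with
    | zero =>
      intro k j u
      rw [add_zero, retMode_first hl]
      -- The component before `s - l` vanishes since its spin weight exceeds `l`. The radial
      -- equation without right-hand side then leaves only the term `r ^ (-(s+l+1))` without
      -- logarithm, from which `b` is read off.
      have h1 : ∀ j : ℕ, ((s : ℂ) + l + 1 - k) * h (s - l) k j u
          + ((j : ℂ) + 1) * h (s - l) k (j + 1) u = 0 := by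
        intro j
        have h2 := (hh.eqs u).1 (s - l - 1) (by omega) k j
        simp only [show s - l - 1 + 1 = s - l by omega] at h2
        rw [hz (s - l - 1) (by omega) (by
          rw [show ((s - l - 1 : ℕ) : ℤ) = s - l - 1 by omega]
          rw [lt_abs]; omega) k j, Pi.zero_apply, mul_zero] at h2
        rw [← h2]
        have : ((s - l - 1 : ℕ) : ℂ) = s - l - 1 := by
          have : (((s - l - 1 : ℕ) : ℤ) : ℂ) = ((s - l - 1 : ℤ) : ℂ) := by congr 1; omega
          push_cast at this
          exact this
        rw [this]
        ring
      obtain ⟨N, hN⟩ := hh.logs (s - l) (by omega) k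
      by_cases hk : k = (s : ℤ) + l + 1
      · subst hk
        rcases j with _ | j
        · simp only [and_self, if_true, hb]
          rw [mul_inv_cancel_left₀ hK]
        · rw [if_neg (by omega), mul_zero]
          have h2 := h1 j
          push_cast at h2
          rw [sub_self, zero_mul, zero_add] at h2
          exact (mul_eq_zero.1 h2).resolve_left (by exact_mod_cast j.succ_ne_zero)
      · rw [if_neg (fun h => hk h.1), mul_zero]
        refine eq_zero_of_shift ?_ h1 (N := N) (fun j hj => by rw [hN j hj]; rfl) j
        have : ((s : ℤ) + l + 1 - k : ℤ) ≠ 0 := by omega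
        exact_mod_cast this
    -- The evolution equation is read backwards, as an algebraic equation for the next component;
    -- its ladder coefficient is positive in the range concerned.
    | succ i ih =>
      intro k j u
      have ih' := ih (by omega)
      have h1 := (hh.eqs u).2 (s - l + i) (by omega) k j
      have h2 := retMode_evolution hbs (s := s) (l := l) (n := s - l + i) (by omega) (by omega) k j u
      have h3 : h (s - l + i) (k + 1) j = retMode s l b (s - l + i) (k + 1) j :=
        funext fun u => ih' (k + 1) j u
      rw [h3, h2] at h1
      simp only [evolution, ih'] at h1
      have hpos : (modeLadder s l (s - l + i) : ℂ) ≠ 0 :=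
        Complex.ofReal_ne_zero.2 (ladder_pos (by omega) (by omega)).ne'
      have h4 : (modeLadder s l (s - l + i) : ℂ) * retMode s l b (s - l + i + 1) k j u
          = (modeLadder s l (s - l + i) : ℂ) * h (s - l + i + 1) k j u := by
        linear_combination -h1
      exact (mul_left_cancel₀ hpos h4).symm
  intro n hn habs k j u
  obtain ⟨h1, h2⟩ := abs_le.1 habs
  obtain ⟨i, rfl⟩ : ∃ i, n = s - l + i := ⟨n - (s - l), by omega⟩
  exact key i (by omega) k j u

end ZRM

/-! ### Superpositions of solutions -/

namespace ZRM

theorem spinY_of_not {p : ℤ} {l : ℕ} {m : ℤ} (h : ¬(|p| ≤ (l : ℤ) ∧ |m| ≤ (l : ℤ))) (θ ϕ : ℝ) :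
    spinY p l m θ ϕ = 0 := by
  rw [spinY, if_neg h]

theorem synth_sum {ι : Type*} (t : Finset ι) (a : ι → ℂ) {c : ι → ℕ → ℤ → ℂ}
    (hc : ∀ i ∈ t, RapidDecay (c i)) (p : ℤ) (θ ϕ : ℝ) :
    synth p (fun l m => ∑ i ∈ t, a i * c i l m) θ ϕ = ∑ i ∈ t, a i * synth p (c i) θ ϕ := by
  have h1 := (RapidDecay.sum t (c := fun i l m => a i * c i l m)
    fun i hi => (hc i hi).const_mul (a i)).hasSum_synth p θ ϕ
  have h2 : HasSum _ _ := hasSum_sum fun i hi => ((hc i hi).hasSum_synth p θ ϕ).mul_left (a i)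
  refine h1.unique (h2.congr_fun fun x => ?_)
  simp only [Finset.sum_mul, mul_assoc]

/-- The components which appear in the field equations without `u`-derivatives inherit rapid decay
and uniform bounds on the powers of `log r`. -/
theorem rapidDecay_of_shift {κ : ℂ} (hκ : κ ≠ 0) {h g : ℕ → ℕ → ℤ → ℂ}
    (heq : ∀ j l m, κ * h j l m + ((j : ℂ) + 1) * h (j + 1) l m = g j l m)
    (hfin : ∀ l m, ∃ N : ℕ, ∀ j > N, h j l m = 0) {N : ℕ} (hN : ∀ j > N, ∀ l m, g j l m = 0)
    (hg : ∀ j, RapidDecay (g j)) :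
    (∀ j > N, ∀ l m, h j l m = 0) ∧ ∀ j, RapidDecay (h j) := by
  have h1 : ∀ j > N, ∀ l m, h j l m = 0 := by
    intro j hj l m
    obtain ⟨M, hM⟩ := hfin l m
    exact eq_zero_of_shift_of_le (h := fun j => h j l m) hκ (M := N + 1)
      (fun j hj => by rw [heq, hN j hj]) hM j hj
  refine ⟨h1, ?_⟩
  have key : ∀ i j : ℕ, N < j + i → RapidDecay (h j) := by
    intro i
    induction i with
    | zero => exact fun j hj => RapidDecay.zero.congr fun l m _ => h1 j hj l m
    | succ i ih =>
      intro j hj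
      refine (((hg j).sub ((ih (j + 1) (by omega)).const_mul ((j : ℂ) + 1))).const_mul κ⁻¹).congr
        fun l m _ => ?_
      rw [← heq, add_sub_cancel_right, inv_mul_cancel_left₀ hκ]
  exact fun j => key (N + 1) j (by omega)

theorem modeEqs_zero (s l : ℕ) : ModeEqs s l 0 := fun u =>
  ⟨fun n _ k j => by simp, fun n _ k j => by simp [evolution]⟩

theorem advData_zero (s l n : ℕ) : advData s l 0 n = 0 := by
  have h : atDouble 0 = 0 := by
    funext k j
    simp [atDouble]
  have := advOp_smul s l n 0 (0 : PolyLog ℂ)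
  rw [zero_smul, zero_smul] at this
  rw [advData, h, this]

theorem dr_zero : dr (0 : PolyLog ℂ) = 0 := by
  funext k j
  simp [dr]

/-- Families of profiles whose advanced solutions can be superposed. -/
structure IsSummableFamily (s : ℕ) (B : ℕ → ℤ → PolyLog ℂ) : Prop where
  profile : ∀ l m, IsProfile (B l m)
  low : ∀ l < s, ∀ m, B l m = 0
  supp : ∀ (l : ℕ) (m : ℤ), SuppGE (-((l : ℤ) + s)) (B l m)
  logs : ∀ n ≤ 2 * s, ∀ k, ∃ N : ℕ, ∀ j > N, ∀ l m, advData s l (B l m) n k j = 0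
  rapid : ∀ n ≤ 2 * s, ∀ k j, RapidDecay (fun l m => advData s l (B l m) n k j)

namespace IsSummableFamily

variable {s : ℕ} {B : ℕ → ℤ → PolyLog ℂ}

theorem evolution_eq (hB : IsSummableFamily s B) {n : ℕ} (hn : n < 2 * s) (k : ℤ) (j l : ℕ) (m : ℤ) :
    advData s l (dr (B l m)) n (k + 1) j = evolution s l (advData s l (B l m)) n k j := by
  rcases lt_or_ge l s with hl | hl
  · simp [hB.low l hl, dr_zero, advData_zero, evolution]
  · exact (evolution_advData hl hn (hB.profile l m).finiteLogs k j).symm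

/-- Needed because the Taylor coefficients in `u` are the data of derivatives of the profiles. For
`n < 2s` the evolution equation gives them from the old data one order lower; the last component is
recovered from the radial equation. -/
theorem dr (hs : 1 ≤ s) (hB : IsSummableFamily s B) : IsSummableFamily s (fun l m => dr (B l m)) := by
  have hprof : ∀ l m, IsProfile (ZRM.dr (B l m)) := fun l m => (hB.profile l m).dr
  have hlow : ∀ l < s, ∀ m, ZRM.dr (B l m) = 0 := fun l hl m => by rw [hB.low l hl, dr_zero]
  have hsupp : ∀ (l : ℕ) (m : ℤ), SuppGE (-((l : ℤ) + s) + 1) (ZRM.dr (B l m)) := fun l m => (hB.supp l m).dr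
  have hlt : ∀ n < 2 * s, ∀ k, (∃ N : ℕ, ∀ j > N, ∀ l m, advData s l (ZRM.dr (B l m)) n k j = 0)
      ∧ ∀ j, RapidDecay (fun l m => advData s l (ZRM.dr (B l m)) n k j) := by
    intro n hn k
    have e : ∀ j l m, advData s l (ZRM.dr (B l m)) n k j
        = evolution s l (advData s l (B l m)) n (k - 1) j := fun j l m => by
      rw [← hB.evolution_eq hn, sub_add_cancel]
    constructor
    · obtain ⟨N, hN⟩ := hB.logs n hn.le (k - 1)
      obtain ⟨M, hM⟩ := hB.logs (n + 1) hn (k - 1)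
      refine ⟨max N M, fun j hj l m => ?_⟩
      rw [e, evolution, hN j (by omega), hN (j + 1) (by omega), hM j (by omega)]
      simp
    · intro j
      simp only [e, evolution]
      exact ((((hB.rapid n hn.le (k - 1) j).const_mul _).add
        ((hB.rapid n hn.le (k - 1) (j + 1)).const_mul _)).const_mul _).sub
        ((hB.rapid (n + 1) hn (k - 1) j).ladder_mul _)
  have hradial : ∀ l m, RadialEqs s l (advData s l (ZRM.dr (B l m))) := by
    intro l m
    rcases lt_or_ge l s with hl | hl
    · intro n _ k j
      simp [hlow l hl, advData_zero]
    · exact radialEqs_advOp hl _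
  have hlast : ∀ k, (∃ N : ℕ, ∀ j > N, ∀ l m, advData s l (ZRM.dr (B l m)) (2 * s) k j = 0)
      ∧ ∀ j, RapidDecay (fun l m => advData s l (ZRM.dr (B l m)) (2 * s) k j) := by
    intro k
    -- Order one, where the radial factor `1 - k` vanishes, causes no problem: differentiation of
    -- the profiles raises the lowest order of the data to two.
    rcases lt_or_ge k 2 with hk | hk
    · have hz : ∀ j l m, advData s l (ZRM.dr (B l m)) (2 * s) k j = 0 := by
        intro j l m
        rcases lt_or_ge l s with hl | hl
        · rw [hlow l hl, advData_zero]
          rfl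
        · exact ((hsupp l m).atDouble.advOp hl le_rfl) k (by omega) j
      exact ⟨⟨0, fun j _ => hz j⟩, fun j => RapidDecay.zero.congr fun l m _ => hz j l m⟩
    · obtain ⟨⟨N, hN⟩, hr⟩ := hlt (2 * s - 1) (by omega) k
      have hne : (1 : ℂ) - k ≠ 0 := by
        have : (1 - k : ℤ) ≠ 0 := by omega
        exact_mod_cast this
      obtain ⟨h1, h2⟩ := rapidDecay_of_shift hne
        (h := fun j l m => advData s l (ZRM.dr (B l m)) (2 * s) k j)
        (g := fun j l m => (modeLadder s l (2 * s - 1) : ℂ)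
          * advData s l (ZRM.dr (B l m)) (2 * s - 1) k j) (fun j l m => by
          have h3 := hradial l m (2 * s - 1) (by omega) k j
          simp only [Nat.sub_add_cancel (by omega : 1 ≤ 2 * s)] at h3
          rw [← h3]
          push_cast [Nat.cast_sub (by omega : 1 ≤ 2 * s)]
          ring)
        (fun l m => ((hprof l m).finiteLogs.atDouble.advOp s l (2 * s)) k) (N := N)
        (fun j hj l m => by rw [hN j hj, mul_zero]) (fun j => (hr j).ladder_mul _)
      exact ⟨⟨N, h1⟩, h2⟩
  refine ⟨hprof, hlow, fun l m => (hsupp l m).mono (by omega), fun n hn k => ?_, fun n hn k => ?_⟩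
  · rcases hn.lt_or_eq with hn | rfl
    exacts [(hlt n hn k).1, (hlast k).1]
  · rcases hn.lt_or_eq with hn | rfl
    exacts [(hlt n hn k).2, (hlast k).2]

theorem dr_iterate (hs : 1 ≤ s) (hB : IsSummableFamily s B) (d : ℕ) :
    IsSummableFamily s (fun l m => ZRM.dr^[d] (B l m)) := by
  induction d with
  | zero => exact hB
  | succ d ih =>
    simp only [Function.iterate_succ_apply']
    exact ih.dr hs

theorem advMode_eq (hB : IsSummableFamily s B) {n : ℕ} (hn : n ≤ 2 * s) (k : ℤ) (j l : ℕ) (m : ℤ)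
    (u : ℝ) : advMode s l (B l m) n k j u = ∑ d ∈ Finset.range k.toNat,
      ((u : ℂ) ^ d / (d.factorial : ℂ)) * advData s l (ZRM.dr^[d] (B l m)) n k j := by
  rcases lt_or_ge l s with hl | hl
  · have h0 : ∀ d, ZRM.dr^[d] (0 : PolyLog ℂ) = 0 := fun d => Function.iterate_fixed dr_zero d
    simp [hB.low l hl, advMode_zero, h0, advData_zero]
  · refine advMode_eq_sum hl hn (hB.supp l m) ?_ j u
    have := Int.self_le_toNat k
    omega

theorem modeEqs (hB : IsSummableFamily s B) (l : ℕ) (m : ℤ) : ModeEqs s l (advMode s l (B l m)) := by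
  rcases lt_or_ge l s with hl | hl
  · exact modeEqs_congr (modeEqs_zero s l) fun n _ k j => by rw [hB.low l hl, advMode_zero]; rfl
  · exact modeEqs_advMode hl (hB.profile l m)

/-- The superposition of advanced solutions. -/
theorem exists_field (hs : 1 ≤ s) (hB : IsSummableFamily s B) :
    ∃ φ : FieldExp, IsAdvanced s B φ ∧ IsPolyhomField s φ ∧ ∀ (l : ℕ) (m : ℤ), ∀ n ≤ 2 * s,
      |(s : ℤ) - n| ≤ (l : ℤ) → |m| ≤ (l : ℤ) → ∀ k j u,
        fieldMode s φ l m n k j u = advMode s l (B l m) n k j u := by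
  have hrap : ∀ n ≤ 2 * s, ∀ k j u, RapidDecay (fun l m => advMode s l (B l m) n k j u) := by
    intro n hn k j u
    simp only [hB.advMode_eq hn]
    exact RapidDecay.sum _ fun d _ => (((hB.dr_iterate hs d).rapid n hn k j).const_mul _)
  set φ : FieldExp := fun n k j u => synth ((s : ℤ) - n) (fun l m => advMode s l (B l m) n k j u)
    with hφ
  have hmode : ∀ (l : ℕ) (m : ℤ), ∀ n ≤ 2 * s, |(s : ℤ) - n| ≤ (l : ℤ) → |m| ≤ (l : ℤ) → ∀ k j u,
      fieldMode s φ l m n k j u = advMode s l (B l m) n k j u := fun l m n hn h1 h2 k j u =>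
    (hrap n hn k j u).multipole_synth h1 h2
  have hsmooth : ∀ n ≤ 2 * s, ∀ k j, IsSmoothSpinWeighted ((s : ℤ) - n) (φ n k j) := by
    intro n hn k j
    -- At each order the coefficient is a polynomial in `u` with smooth functions on the sphere as
    -- coefficients, so joint smoothness in `u` and the angles is immediate.
    have hd := fun d => (hB.dr_iterate hs d).rapid n hn k j
    refine IsSmoothSpinWeighted.congr (f := ∑ d ∈ Finset.range k.toNat, fun u θ ϕ =>
      ((u : ℂ) ^ d / (d.factorial : ℂ)) * synth ((s : ℤ) - n)
        (fun l m => advData s l (ZRM.dr^[d] (B l m)) n k j) θ ϕ) ?_ ?_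
    · refine IsSmoothSpinWeighted.sum _ fun d _ => ?_
      refine IsSmoothSpinWeighted.time_mul (c := fun u : ℝ => (u : ℂ) ^ d / (d.factorial : ℂ))
        ((hd d).smoothWeighted_synth _).isSmooth ?_
      exact (Complex.ofRealCLM.contDiff.pow d).div_const _
    · intro u ϕ θ _
      simp only [hφ, hB.advMode_eq hn, Finset.sum_apply]
      exact synth_sum _ _ (fun d _ => hd d) _ θ ϕ
  have hzero : ∀ n ≤ 2 * s, ∀ k j, (∀ l m u, advMode s l (B l m) n k j u = 0) →
      SphEq (φ n k j) 0 := fun n hn k j h =>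
    (hsmooth n hn k j).sphEq_zero_iff.2 fun l m h1 h2 u =>
      (hmode l m n hn h1 h2 k j u).trans (h l m u)
  refine ⟨φ, ⟨hB.profile, hB.low, fun l m => ?_, fun n hn k j u ϕ θ hθ => ?_⟩,
    ⟨fun n hn => ⟨fun k hk j => ?_, fun k => ?_, hsmooth n hn⟩, ?_⟩, hmode⟩
  · exact satisfiesZRM_of_modeEqs (hB.modeEqs l m) fun n _ k j u θ ϕ => advTerm_eq _ _ _ _ _ _ _ _ _ _
  · simp only [advTerm_eq, spinY_eq _ _ _ hθ]
    exact (hrap n hn k j u).hasSum_synth _ θ ϕ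
  · refine hzero n hn k j fun l m u => ?_
    rw [hB.advMode_eq hn, Int.toNat_of_nonpos (by omega)]
    rfl
  · choose N hN using fun d => (hB.dr_iterate hs d).logs n hn k
    refine ⟨(Finset.range k.toNat).sup N, fun j hj => hzero n hn k j fun l m u => ?_⟩
    rw [hB.advMode_eq hn]
    refine Finset.sum_eq_zero fun d hd => ?_
    rw [hN d j (lt_of_le_of_lt (Finset.le_sup hd) hj), mul_zero]
  · refine (satisfiesZRM_iff hsmooth).2 fun l m => ?_
    by_cases h : s ≤ l ∧ |m| ≤ (l : ℤ)
    · refine modeEqs_congr (hB.modeEqs l m) fun n hn k j => funext fun u =>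
        hmode l m n hn ?_ h.2 k j u
      rw [abs_le]
      omega
    · refine modeEqs_congr (modeEqs_zero s l) fun n hn k j => funext fun u => ?_
      by_cases h' : |(s : ℤ) - n| ≤ (l : ℤ) ∧ |m| ≤ (l : ℤ)
      · rw [hmode l m n hn h'.1 h'.2, hB.low l (by_contra fun hl => h ⟨by omega, h'.2⟩),
          advMode_zero]
        rfl
      · exact multipole_of_not h' _

end IsSummableFamily

namespace IsPolyhomField

variable {s : ℕ} {φ ψ : FieldExp}

theorem smooth (hφ : IsPolyhomField s φ) {n : ℕ} (hn : n ≤ 2 * s) (k : ℤ) (j : ℕ) :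
    IsSmoothSpinWeighted ((s : ℤ) - n) (φ n k j) := (hφ.1 n hn).2.2 k j

theorem fieldMode_of_not {n l : ℕ} {m : ℤ} (h : ¬(|(s : ℤ) - n| ≤ (l : ℤ) ∧ |m| ≤ (l : ℤ)))
    (k : ℤ) (j : ℕ) : fieldMode s φ l m n k j = 0 := funext fun _ => multipole_of_not h _

theorem fieldMode_eq_zero (hφ : IsPolyhomField s φ) {n : ℕ} (hn : n ≤ 2 * s) {k : ℤ} {j : ℕ}
    (h : SphEq (φ n k j) 0) (l : ℕ) (m : ℤ) : fieldMode s φ l m n k j = 0 := by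
  by_cases hlm : |(s : ℤ) - n| ≤ (l : ℤ) ∧ |m| ≤ (l : ℤ)
  · exact funext fun u => (hφ.smooth hn k j).sphEq_zero_iff.1 h l m hlm.1 hlm.2 u
  · exact fieldMode_of_not hlm k j

theorem sphEq_zero (hφ : IsPolyhomField s φ) {n : ℕ} (hn : n ≤ 2 * s) {k : ℤ} {j : ℕ}
    (h : ∀ (l : ℕ) (m : ℤ), |(s : ℤ) - n| ≤ (l : ℤ) → |m| ≤ (l : ℤ) → fieldMode s φ l m n k j = 0) :
    SphEq (φ n k j) 0 :=
  (hφ.smooth hn k j).sphEq_zero_iff.2 fun l m h1 h2 u => congrFun (h l m h1 h2) u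

theorem exists_logs (hφ : IsPolyhomField s φ) {n : ℕ} (hn : n ≤ 2 * s) (k : ℤ) :
    ∃ N : ℕ, ∀ j > N, ∀ l m, fieldMode s φ l m n k j = 0 := by
  obtain ⟨N, hN⟩ := (hφ.1 n hn).2.1 k
  exact ⟨N, fun j hj l m => hφ.fieldMode_eq_zero hn (hN j hj) l m⟩

theorem rapidDecay (hφ : IsPolyhomField s φ) {n : ℕ} (hn : n ≤ 2 * s) (k : ℤ) (j : ℕ) (u : ℝ) :
    RapidDecay (fun l m => fieldMode s φ l m n k j u) :=
  ((hφ.smooth hn k j).smoothWeighted u).rapidDecay_multipole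

theorem isMode (hφ : IsPolyhomField s φ) (l : ℕ) (m : ℤ) : IsMode s l (fieldMode s φ l m) where
  smooth _ hn k j := (hφ.smooth hn k j).contDiff_multipole l m
  supp n hn k hk j := hφ.fieldMode_eq_zero hn ((hφ.1 n hn).1 k hk j) l m
  logs n hn k := by
    obtain ⟨N, hN⟩ := hφ.exists_logs hn k
    exact ⟨N, fun j hj => hN j hj l m⟩
  eqs := (satisfiesZRM_iff fun n hn => (hφ.1 n hn).2.2).1 hφ.2 l m

theorem fieldMode_sub (hφ : IsPolyhomField s φ) (hψ : IsPolyhomField s ψ) (l : ℕ) (m : ℤ) {n : ℕ}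
    (hn : n ≤ 2 * s) (k : ℤ) (j : ℕ) : fieldMode s (φ - ψ) l m n k j
      = fieldMode s φ l m n k j - fieldMode s ψ l m n k j :=
  funext fun u => multipole_sub ((hφ.smooth hn k j).smoothWeighted u)
    ((hψ.smooth hn k j).smoothWeighted u) l m

theorem sub (hφ : IsPolyhomField s φ) (hψ : IsPolyhomField s ψ) : IsPolyhomField s (φ - ψ) := by
  have hsmooth : ∀ n ≤ 2 * s, ∀ k j, IsSmoothSpinWeighted ((s : ℤ) - n) ((φ - ψ) n k j) :=
    fun n hn k j => (hφ.smooth hn k j).sub (hψ.smooth hn k j)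
  have hz : ∀ n k j, SphEq (φ n k j) 0 → SphEq (ψ n k j) 0 → SphEq ((φ - ψ) n k j) 0 := by
    intro n k j h1 h2 u ϕ θ hθ
    have e1 := h1 u ϕ θ hθ
    have e2 := h2 u ϕ θ hθ
    simp only [Pi.sub_apply, e1, e2, Pi.zero_apply, sub_zero]
  refine ⟨fun n hn => ⟨fun k hk j => hz n k j ((hφ.1 n hn).1 k hk j) ((hψ.1 n hn).1 k hk j),
    fun k => ?_, hsmooth n hn⟩, (satisfiesZRM_iff hsmooth).2 fun l m => ?_⟩
  · obtain ⟨N, hN⟩ := (hφ.1 n hn).2.1 k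
    obtain ⟨M, hM⟩ := (hψ.1 n hn).2.1 k
    exact ⟨max N M, fun j hj => hz n k j (hN j (by omega)) (hM j (by omega))⟩
  · exact modeEqs_congr ((hφ.isMode l m).sub (hψ.isMode l m)).eqs fun n hn k j =>
      fieldMode_sub hφ hψ l m hn k j

/-- A field which peels up to logarithmic terms of order `r ^ (-2s-1)` is mixed. -/
theorem isMixed (hs : 1 ≤ s) (hψ : IsPolyhomField s ψ) (hp : ∀ n ≤ 2 * s, ∀ k ≤ 2 * (s : ℤ), ∀ j,
    ViolatesPeeling s n k j → SphEq (ψ n k j) 0) : IsMixed s ψ := by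
  have key : ∀ (l : ℕ) (m : ℤ), ∃ (b : ℝ → ℂ) (B : PolyLog ℂ), ContDiff ℝ ∞ b ∧ IsProfile B ∧
      (l < s → B = 0) ∧ SuppGE ((s : ℤ) - l) B ∧ (∀ n ≤ 2 * s, ∀ k j, advData s l B n k j
        = if s ≤ l ∧ 2 * (s : ℤ) + 1 ≤ k then fieldMode s ψ l m n k j 0 else 0) ∧
      SatisfiesZRM s (retTerm s l m b) ∧ ∀ n ≤ 2 * s, |(s : ℤ) - n| ≤ (l : ℤ) → ∀ k j u,
        fieldMode s ψ l m n k j u = retMode s l b n k j u + advMode s l B n k j u := by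
    intro l m
    have hm := hψ.isMode l m
    rcases lt_or_ge l s with hl | hl
    · obtain ⟨b, hb, h1⟩ := hm.exists_retMode hl fun n _ hl' k j =>
        fieldMode_of_not (fun h => absurd h.1 (not_le.2 hl')) k j
      refine ⟨b, 0, hb, ⟨⟨0, fun _ _ _ => rfl⟩, fun _ => ⟨0, fun _ _ => rfl⟩⟩, fun _ => rfl,
        fun _ _ _ => rfl, fun n _ k j => ?_, ?_, fun n hn h2 k j u => ?_⟩
      · rw [if_neg (by omega), advData_zero]
        rfl
      · refine satisfiesZRM_of_modeEqs hm.eqs (m := m) fun n hn k j u θ ϕ => ?_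
        rw [retTerm_eq]
        by_cases h : |(s : ℤ) - n| ≤ (l : ℤ) ∧ |m| ≤ (l : ℤ)
        · rw [h1 n hn h.1]
        · rw [spinY_of_not h, mul_zero, mul_zero]
      · rw [h1 n hn h2, advMode_zero]
        simp
    · obtain ⟨b, B, hb, hB, h1, h2, h3⟩ := hm.exists_mixed hs hl fun n hn k hk j hv =>
        hψ.fieldMode_eq_zero hn (hp n hn k hk j hv) l m
      refine ⟨b, B, hb, hB, fun h => absurd h (by omega), h1, fun n hn k j => ?_, ?_,
        fun n hn _ => h3 n hn⟩
      · rw [h2 n hn]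
        simp only [hl, true_and]
      · exact satisfiesZRM_of_modeEqs (modeEqs_retMode hb hl) fun n _ k j u θ ϕ =>
          retTerm_eq _ _ _ _ _ _ _ _ _ _
  choose b B hb hB hlow hsupp hdata hzrm hsum using key
  -- The advanced data are truncations of the moments of `ψ` at `u = 0`, hence inherit rapid decay
  -- and the uniform bound on logarithms.
  have hfam : IsSummableFamily s B := by
    refine ⟨hB, fun l hl m => hlow l m hl, fun l m => ?_, fun n hn k => ?_, fun n hn k j => ?_⟩
    · rcases lt_or_ge l s with hl | hl
      · rw [hlow l m hl]
        exact fun _ _ _ => rfl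
      · exact (hsupp l m).mono (by omega)
    · obtain ⟨N, hN⟩ := hψ.exists_logs hn k
      exact ⟨N, fun j hj l m => by rw [hdata l m n hn, hN j hj, Pi.zero_apply, ite_self]⟩
    · refine (hψ.rapidDecay hn k j 0).of_le 1 0 fun l m _ => ?_
      rw [hdata l m n hn]
      split_ifs <;> simp
  obtain ⟨φadv, hadv, -, -⟩ := hfam.exists_field hs
  -- The retarded field is taken to be the difference, so its multipole series converges as the
  -- difference of two convergent series, and no estimate on `b` is required.
  refine ⟨b, B, ψ - φadv, φadv, ⟨hb, hzrm, fun n hn k j u ϕ θ hθ => ?_⟩, hadv, fun l m k q h => ?_,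
    fun n _ k j u ϕ θ _ => by simp⟩
  · have h1 := ((hψ.smooth hn k j).smoothWeighted u).hasSum_multipole hθ ϕ
    refine (h1.sub (hadv.2.2.2 n hn k j u ϕ θ hθ)).congr_fun fun x => ?_
    simp only [retTerm_eq, advTerm_eq]
    rw [← sub_mul]
    by_cases h : |(s : ℤ) - n| ≤ (x.1 : ℤ) ∧ |x.2| ≤ (x.1 : ℤ)
    · have h2 := hsum x.1 x.2 n hn h.1 k j u
      rw [eq_sub_of_add_eq h2.symm]
      rfl
    · rw [spinY_of_not h, mul_zero, mul_zero]
  · by_contra hk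
    exact h (hsupp l m k (by omega) q)

end IsPolyhomField

end ZRM

/-! ### Decomposition of polyhomogeneous fields -/

namespace ZRM

/-- A mode whose initial values peel, peels. -/
theorem IsMode.peels {s l : ℕ} (hs : 1 ≤ s) {g : ℕ → PolyLog (ℝ → ℂ)} (hg : IsMode s l g)
    (h0 : ∀ n ≤ 2 * s, ∀ k ≤ 2 * (s : ℤ) + 1, ∀ j, g n k j 0 = 0) :
    ∀ n ≤ 2 * s, ∀ k j, ViolatesPeeling s n k j → g n k j = 0 := by
  have key : ∀ i : ℕ, ∀ n ≤ 2 * s, ∀ k ≤ (i : ℤ), ∀ j, ViolatesPeeling s n k j → g n k j = 0 := by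
    intro i
    induction i with
    | zero => exact fun n hn k hk j _ => hg.supp n hn k (by push_cast at hk; omega) j
    | succ i ih =>
      have hlow : ∀ n < 2 * s, ∀ j, ViolatesPeeling s n ((i : ℤ) + 1) j → g n ((i : ℤ) + 1) j = 0 := by
        intro n hn j hv
        unfold ViolatesPeeling at hv
        have hd : ∀ u, deriv (g n ((i : ℤ) + 1) j) u = 0 := by
          intro u
          rw [(hg.eqs u).2 n hn i j, evolution, ih n hn.le i le_rfl j (Or.inl (by omega)),
            ih n hn.le i le_rfl (j + 1) (Or.inl (by omega)),
            ih (n + 1) hn i le_rfl j (by unfold ViolatesPeeling; push_cast; omega)]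
          simp
        funext u
        rw [eq_of_deriv_eq_zero (hg.smooth n hn.le _ _) hd, h0 n hn.le _ (by omega)]
        rfl
      intro n hn k hk j hv
      rcases (show k ≤ i ∨ k = (i : ℤ) + 1 by push_cast at hk; omega) with h | rfl
      · exact ih n hn k h j hv
      rcases hn.lt_or_eq with hn | rfl
      · exact hlow n hn j hv
      unfold ViolatesPeeling at hv
      push_cast at hv
      obtain ⟨j, rfl⟩ : ∃ j', j = j' + 1 := ⟨j - 1, by omega⟩
      obtain rfl : i = 0 := by omega
      funext u
      have h3 := (hg.eqs u).1 (2 * s - 1) (by omega) ((0 : ℕ) + 1) j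
      simp only [Nat.sub_add_cancel (by omega : 1 ≤ 2 * s)] at h3
      rw [hlow (2 * s - 1) (by omega) j (Or.inl (by push_cast; omega)), Pi.zero_apply, mul_zero] at h3
      push_cast [Nat.cast_sub (by omega : 1 ≤ 2 * s)] at h3
      rw [show (2 * (s : ℂ) - (2 * s - 1) - 1) = 0 by ring, zero_mul, zero_add] at h3
      exact (mul_eq_zero.1 h3).resolve_left (by exact_mod_cast j.succ_ne_zero)
  exact fun n hn k j => key k.toNat n hn k (Int.self_le_toNat k) j

/-- If the first component of a mode is of order `r ^ (-2s-1)` up to logarithms, the others peel. -/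
theorem IsMode.peels_of_first {s l : ℕ} {g : ℕ → PolyLog (ℝ → ℂ)} (hg : IsMode s l g)
    (h0 : ∀ k ≤ 2 * (s : ℤ), ∀ j, g 0 k j = 0) :
    ∀ n ≤ 2 * s, ∀ k ≤ 2 * (s : ℤ), ∀ j, ViolatesPeeling s n k j → g n k j = 0 := by
  intro n hn k hk
  induction n with
  | zero => exact fun j _ => h0 k hk j
  | succ n ih =>
    intro j hv
    unfold ViolatesPeeling at hv
    have hz : ∀ j, g n k j = 0 := fun j => ih (by omega) j (Or.inl (by push_cast at hv; omega))
    funext u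
    have h1 : ∀ j : ℕ, (2 * (s : ℂ) - n - k) * g (n + 1) k j u
        + ((j : ℂ) + 1) * g (n + 1) k (j + 1) u = 0 := fun j => by
      have := (hg.eqs u).1 n (by omega) k j
      simpa only [hz, Pi.zero_apply, mul_zero] using this
    by_cases hk' : k = 2 * (s : ℤ) - n
    · obtain ⟨j, rfl⟩ : ∃ j', j = j' + 1 := ⟨j - 1, by push_cast at hv; omega⟩
      have h2 := h1 j
      rw [hk'] at h2
      push_cast at h2
      rw [sub_self, zero_mul, zero_add, ← hk'] at h2
      exact (mul_eq_zero.1 h2).resolve_left (by exact_mod_cast j.succ_ne_zero)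
    · obtain ⟨N, hN⟩ := hg.logs (n + 1) hn k
      have hne : 2 * (s : ℂ) - n - k ≠ 0 := by
        have : (2 * (s : ℤ) - n - k : ℤ) ≠ 0 := by omega
        exact_mod_cast this
      exact eq_zero_of_shift hne h1 (N := N) (fun j hj => by rw [hN j hj]; rfl) j

/-- The advanced field takes over all data at `u = 0` of order at most `2s + 1` in the sectors `l ≥
s`. Order `2s + 1` is included because logarithms of that order in `φ_0` already violate peeling. -/
theorem exists_advanced_add_mixed {s : ℕ} (hs : 1 ≤ s) {φ : FieldExp} (hφ : IsPolyhomField s φ) :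
    ∃ (B : ℕ → ℤ → PolyLog ℂ) (φadv φmix : FieldExp),
      (∀ l m k q, B l m k q ≠ 0 → -((l : ℤ) + s) ≤ k ∧ k ≤ (s : ℤ) - l) ∧
      IsAdvanced s B φadv ∧ IsPolyhomField s φadv ∧ IsMixed s φmix ∧ IsPolyhomField s φmix ∧
      IsSum s φ φadv φmix ∧ Peels s φmix := by
  have key : ∀ (l : ℕ) (m : ℤ), ∃ B : PolyLog ℂ, IsProfile B ∧ (l < s → B = 0) ∧
      (∀ k q, B k q ≠ 0 → -((l : ℤ) + s) ≤ k ∧ k ≤ (s : ℤ) - l) ∧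
      ∀ n ≤ 2 * s, ∀ k j, advData s l B n k j
        = if s ≤ l ∧ k ≤ 2 * (s : ℤ) + 1 then fieldMode s φ l m n k j 0 else 0 := by
    intro l m
    have hm := hφ.isMode l m
    rcases lt_or_ge l s with hl | hl
    · refine ⟨0, ⟨⟨0, fun _ _ _ => rfl⟩, fun _ => ⟨0, fun _ _ => rfl⟩⟩, fun _ => rfl,
        fun _ _ h => absurd rfl h, fun n _ k j => ?_⟩
      rw [if_neg (by omega), advData_zero]
      rfl
    -- The radial equations act within a single order, so truncated data still satisfy them and are
    -- reproduced in all components once the last one agrees.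
    · set D : ℕ → PolyLog ℂ := fun n k j =>
        if k ≤ 2 * (s : ℤ) + 1 then fieldMode s φ l m n k j 0 else 0 with hD
      have hsupp : SuppGE 1 (D (2 * s)) := fun k hk j => by
        simp [hD, hm.supp _ le_rfl k hk]
      obtain ⟨B, hB, hBD, hB0⟩ := exists_profile hl hsupp fun k => by
        obtain ⟨N, hN⟩ := hm.logs (2 * s) le_rfl k
        exact ⟨N, fun j hj => by simp [hD, hN j hj]⟩
      refine ⟨B, hB, fun h => absurd h (by omega), fun k q hkq => ?_, fun n hn k j => ?_⟩
      · by_contra hk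
        refine hkq (hB0 k (fun j => ?_) q)
        by_cases h : k + l + s + 1 < 1
        · exact hsupp _ h j
        · exact if_neg (by omega)
      · simp only [hl, true_and]
        refine (radialEqs_advOp hl (atDouble B)).congr_of_last hl (D' := D) ?_
          (fun j => congrFun (congrFun hBD k) j) n hn j
        intro n hn k j
        simp only [hD]
        split_ifs
        · exact (hm.eqs 0).1 n hn k j
        · simp
  choose B hB hlow hsupp hdata using key
  have hfam : IsSummableFamily s B := by
    refine ⟨hB, fun l hl m => hlow l m hl, fun l m k hk j => ?_, fun n hn k => ?_,
      fun n hn k j => ?_⟩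
    · by_contra h
      exact absurd (hsupp l m k j h).1 (by omega)
    · obtain ⟨N, hN⟩ := hφ.exists_logs hn k
      exact ⟨N, fun j hj l m => by rw [hdata l m n hn, hN j hj, Pi.zero_apply, ite_self]⟩
    · refine (hφ.rapidDecay hn k j 0).of_le 1 0 fun l m _ => ?_
      rw [hdata l m n hn]
      split_ifs <;> simp
  obtain ⟨φadv, hadv, hpoly, hmode⟩ := hfam.exists_field hs
  have hmix := hφ.sub hpoly
  have hpeels : Peels s (φ - φadv) := by
    intro n hn k j hv
    refine hmix.sphEq_zero hn fun l m h1 h2 => ?_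
    have hm := hmix.isMode l m
    -- In sectors `l < s` the remainder is a retarded solution, and these peel for every `b`. In
    -- sectors `l ≥ s` it has no initial values up to order `2s + 1`.
    rcases lt_or_ge l s with hl | hl
    · obtain ⟨b, -, hb⟩ := hm.exists_retMode hl fun n _ hl' k j =>
        IsPolyhomField.fieldMode_of_not (fun h => absurd h.1 (not_le.2 hl')) k j
      obtain ⟨h3, h4⟩ := abs_le.1 h1
      funext u
      rw [hb n hn h1]
      unfold ViolatesPeeling at hv
      rcases hv with hv | ⟨-, hv⟩
      · rw [suppGE_retMode b (by omega) k (by omega)]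
      · rw [retMode_log b (by omega) k hv]
    · refine hm.peels hs (fun n hn k hk j => ?_) n hn k j hv
      rw [hφ.fieldMode_sub hpoly l m hn, Pi.sub_apply,
        hmode l m n hn (abs_le.2 (by omega)) h2, advMode_at_zero hl hn (hfam.supp l m),
        hdata l m n hn, if_pos ⟨hl, hk⟩, sub_self]
  exact ⟨B, φadv, φ - φadv, fun l m => hsupp l m, hadv, hpoly,
    hmix.isMixed hs fun n hn k _ j hv => hpeels n hn k j hv, hmix, fun n _ k j u ϕ θ _ => by simp,
    hpeels⟩

/-! ### The logarithmic profile -/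

/-- The derivatives of `r⁻¹ log r`: besides the factor `(-1) ^ N N!` a harmonic sum appears in the
part without logarithm. -/
theorem dr_iterate_inv {f : PolyLog ℂ} (hf : ∀ k ≠ 1, ∀ j, f k j = 0) (h2 : ∀ j ≥ 2, f 1 j = 0)
    (N : ℕ) : (∀ k ≠ (N : ℤ) + 1, ∀ j, (dr^[N] f) k j = 0) ∧
      (∀ j ≥ 2, (dr^[N] f) ((N : ℤ) + 1) j = 0) ∧
      (dr^[N] f) ((N : ℤ) + 1) 1 = (-1) ^ N * (N.factorial : ℂ) * f 1 1 ∧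
      (dr^[N] f) ((N : ℤ) + 1) 0 = (-1) ^ N * (N.factorial : ℂ)
        * (f 1 0 - (∑ i ∈ Finset.range N, ((i : ℂ) + 1)⁻¹) * f 1 1) := by
  induction N with
  | zero => exact ⟨fun k hk => hf k (by simpa using hk), by simpa using h2, by simp, by simp⟩
  | succ N ih =>
    obtain ⟨i1, i2, i3, i4⟩ := ih
    rw [Function.iterate_succ_apply']
    have e : ((N + 1 : ℕ) : ℤ) + 1 - 1 = (N : ℤ) + 1 := by push_cast; ring
    have hne : (N : ℂ) + 1 ≠ 0 := by exact_mod_cast N.succ_ne_zero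
    refine ⟨fun k hk j => ?_, fun j hj => ?_, ?_, ?_⟩
    · have hk' : k - 1 ≠ (N : ℤ) + 1 := fun h => hk (by push_cast; omega)
      simp [dr, i1 _ hk']
    · simp [dr, i2 j hj, i2 (j + 1) (by omega)]
    · simp only [dr, e, i3, i2 2 le_rfl, smul_eq_mul, Nat.factorial_succ, pow_succ,
        show 1 + 1 = 2 from rfl]
      push_cast
      ring
    · simp only [dr, e, i3, i4, zero_add, smul_eq_mul, Nat.factorial_succ, pow_succ,
        Finset.sum_range_succ]
      push_cast
      field_simp
      ring

variable {s : ℕ}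

theorem logProfile_of_lt (B₀ : ℕ → ℤ → ℂ) {l : ℕ} (hl : l < s) (m : ℤ) :
    logProfile s B₀ l m = 0 := by
  funext k q
  exact if_neg (by omega)

theorem isProfile_logProfile (s : ℕ) (B₀ : ℕ → ℤ → ℂ) (l : ℕ) (m : ℤ) :
    IsProfile (logProfile s B₀ l m) :=
  ⟨⟨-((l : ℤ) + 1 - s), fun k hk q => if_neg (by omega)⟩, fun k => ⟨1, fun q hq => if_neg (by omega)⟩⟩

theorem suppGE_logProfile (s : ℕ) (B₀ : ℕ → ℤ → ℂ) (l : ℕ) (m : ℤ) :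
    SuppGE (-((l : ℤ) + 1 - s)) (logProfile s B₀ l m) := fun k hk q => if_neg (by omega)

theorem atDouble_logProfile (B₀ : ℕ → ℤ → ℂ) {l : ℕ} (hl : s ≤ l) (m k : ℤ) (j : ℕ) :
    atDouble (logProfile s B₀ l m) k j = if k = -((l : ℤ) + 1 - s) then
      if j = 0 then 2 ^ (l + 1 - s) * B₀ l m * (Real.log 2 : ℝ)
      else if j = 1 then 2 ^ (l + 1 - s) * B₀ l m else 0 else 0 := by
  rw [atDouble_eq_sum (N := 1) (M := 2) (fun q hq => if_neg (by omega)) j (by omega),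
    Finset.sum_range_succ, Finset.sum_range_one]
  simp only [logProfile, hl, true_and]
  by_cases hk : k = -((l : ℤ) + 1 - s)
  · subst hk
    rw [neg_neg, show (l : ℤ) + 1 - s = ((l + 1 - s : ℕ) : ℤ) by omega, zpow_natCast]
    rcases j with _ | _ | j
    · simp
      ring
    · simp
    · simp [Nat.choose_eq_zero_of_lt]
  · simp only [hk, false_and, if_false]
    simp

theorem dr_iterate_succ_const {f : PolyLog ℂ} (hf : ∀ k ≠ 0, ∀ j, f k j = 0)
    (h2 : ∀ j ≥ 2, f 0 j = 0) (N : ℕ) (k : ℤ) (j : ℕ) : (dr^[N + 1] f) k j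
      = if k = (N : ℤ) + 1 ∧ j = 0 then (-1) ^ N * (N.factorial : ℂ) * f 0 1 else 0 := by
  rw [Function.iterate_succ_apply]
  have e1 : ∀ j ≥ 1, dr f 1 j = 0 := fun j hj => by simp [dr, h2 (j + 1) (by omega)]
  obtain ⟨h1, h3, h4, h5⟩ := dr_iterate_inv (f := dr f) (fun k hk j => by
    have : k - 1 ≠ 0 := fun h => hk (by omega)
    simp [dr, hf _ this]) (fun j hj => e1 j (by omega)) N
  split_ifs with h
  · rw [h.1, h.2, h5, e1 1 le_rfl]
    simp [dr]
  · by_cases hk : k = (N : ℤ) + 1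
    · subst hk
      rcases (by omega : j = 1 ∨ 2 ≤ j) with rfl | hj
      · rw [h4, e1 1 le_rfl, mul_zero]
      · exact h3 j hj
    · exact h1 k hk j

theorem dr_iterate_homogeneous {κ : ℤ} {f : PolyLog ℂ} (hf : ∀ k ≠ κ, ∀ j, f k j = 0) (N : ℕ) :
    ∀ k ≠ κ + N, ∀ j, (dr^[N] f) k j = 0 := by
  induction N with
  | zero => simpa using hf
  | succ N ih =>
    intro k hk j
    have hk' : k - 1 ≠ κ + N := fun h => hk (by push_cast; omega)
    rw [Function.iterate_succ_apply']
    simp [dr, ih _ hk']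

theorem advData_logProfile_of_ne (B₀ : ℕ → ℤ → ℂ) (l : ℕ) (m : ℤ) {n : ℕ}
    (hn : n ≤ 2 * s) {k : ℤ} (hk : k ≠ 2 * s) (j : ℕ) :
    advData s l (logProfile s B₀ l m) n k j = 0 := by
  rcases lt_or_ge l s with hl | hl
  · rw [logProfile_of_lt B₀ hl, advData_zero]
    rfl
  have h := dr_iterate_homogeneous (κ := n)
    (f := rmul (-((l : ℤ) - s + n + 1)) (atDouble (logProfile s B₀ l m)))
    (fun k hk j => by rw [rmul, atDouble_logProfile B₀ hl, if_neg (by omega)]) (l + s - n)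
    (k + ((l : ℤ) - s)) (by omega) j
  simp only [advData, advOp, Pi.smul_apply, rmul] at h ⊢
  rw [h, smul_zero]

/-- For `n = 0` the power of the profile cancels against `r ^ (-(l-s+1))`, and what is
differentiated is `2 ^ (l+1-s) log (2r)`. The first of the `l + s` derivatives removes the
logarithm, the others give `(-1) ^ (l+s-1) (l+s-1)!`. -/
theorem advData_logProfile_zero (B₀ : ℕ → ℤ → ℂ) {l : ℕ} (hs : 1 ≤ s) (hl : s ≤ l) (m : ℤ) (j : ℕ) :
    advData s l (logProfile s B₀ l m) 0 (2 * s) j = if j = 0 then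
      (-1 : ℂ) ^ (l + s + 1) * 2 ^ (l + 1 - s) * ((l + s - 1).factorial : ℂ)
        * (K s l : ℂ) * B₀ l m else 0 := by
  obtain ⟨N, hN⟩ : ∃ N, l + s = N + 1 := ⟨l + s - 1, by omega⟩
  have h := dr_iterate_succ_const
    (f := rmul (-((l : ℤ) - s + (0 : ℕ) + 1)) (atDouble (logProfile s B₀ l m)))
    (fun k hk j => by rw [rmul, atDouble_logProfile B₀ hl, if_neg (by push_cast; omega)])
    (fun j hj => by
      rw [rmul, atDouble_logProfile B₀ hl, if_neg (show j ≠ 0 by omega),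
        if_neg (show j ≠ 1 by omega), ite_self]) N (2 * s + ((l : ℤ) - s)) j
  rw [← hN] at h
  simp only [advData, advOp, Pi.smul_apply, Nat.sub_zero, smul_eq_mul]
  rw [show ∀ f : PolyLog ℂ, rmul ((l : ℤ) - s) f (2 * s) j = f (2 * s + ((l : ℤ) - s)) j from
    fun _ => rfl, h, rmul, atDouble_logProfile B₀ hl]
  rcases j with _ | j
  · rw [if_pos ⟨by omega, rfl⟩, if_pos (by push_cast; omega), if_neg one_ne_zero, if_pos rfl,
      if_pos rfl, show l + s - 1 = N by omega, hN, show N + 1 + 1 = N + 2 by ring, pow_add (-1 : ℂ) N 2,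
      Nat.cast_zero, sub_zero]
    ring
  · rw [if_neg (fun h => by omega), if_neg (by omega), mul_zero]

/-- The one datum of the logarithmic profile that the radial equations do not control; here a
multiple of `r⁻¹ log (2r)` is differentiated `l + s - 1` times. -/
theorem advData_logProfile_one (B₀ : ℕ → ℤ → ℂ) {l : ℕ} (hs : 1 ≤ s) (hl : s ≤ l) (m : ℤ) :
    advData s l (logProfile s B₀ l m) 1 (2 * s) 0
      = ((Real.log 2 : ℝ) - ∑ i ∈ Finset.range (l + s - 1), ((i : ℂ) + 1)⁻¹)
        * advData s l (logProfile s B₀ l m) 1 (2 * s) 1 := by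
  obtain ⟨-, -, h4, h5⟩ := dr_iterate_inv
    (f := rmul (-((l : ℤ) - s + (1 : ℕ) + 1)) (atDouble (logProfile s B₀ l m)))
    (fun k hk j => by rw [rmul, atDouble_logProfile B₀ hl, if_neg (by push_cast; omega)])
    (fun j hj => by
      rw [rmul, atDouble_logProfile B₀ hl, if_neg (show j ≠ 0 by omega),
        if_neg (show j ≠ 1 by omega), ite_self]) (l + s - 1)
  simp only [advData, advOp, Pi.smul_apply, smul_eq_mul]
  rw [show ∀ (f : PolyLog ℂ) j, rmul ((l : ℤ) - s) f (2 * s) j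
    = f (((l + s - 1 : ℕ) : ℤ) + 1) j from fun f j => by rw [rmul]; congr 1; omega, h5,
    show ∀ (f : PolyLog ℂ) j, rmul ((l : ℤ) - s) f (2 * s) j
    = f (((l + s - 1 : ℕ) : ℤ) + 1) j from fun f j => by rw [rmul]; congr 1; omega, h4]
  have hk : (1 : ℤ) + -((l : ℤ) - s + (1 : ℕ) + 1) = -((l : ℤ) + 1 - s) := by push_cast; ring
  simp only [rmul, atDouble_logProfile B₀ hl, hk, if_true, one_ne_zero, if_false]
  ring

theorem norm_harmonic_le (N : ℕ) : ‖∑ i ∈ Finset.range N, ((i : ℂ) + 1)⁻¹‖ ≤ N := by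
  refine (norm_sum_le _ _).trans ((Finset.sum_le_card_nsmul _ _ 1 fun i _ => ?_).trans (by simp))
  rw [norm_inv, show (i : ℂ) + 1 = ((i + 1 : ℕ) : ℂ) by push_cast; rfl, Complex.norm_natCast]
  exact inv_le_one_of_one_le₀ (by push_cast; linarith [i.cast_nonneg (α := ℝ)])

/-- Logarithmic profiles whose leading coefficients decrease rapidly can be superposed. -/
theorem isSummableFamily_logProfile (hs : 1 ≤ s) {B₀ : ℕ → ℤ → ℂ}
    (hr : RapidDecay fun l m => advData s l (logProfile s B₀ l m) 0 (2 * s) 0) :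
    IsSummableFamily s (logProfile s B₀) := by
  have hradial : ∀ l m, RadialEqs s l (advData s l (logProfile s B₀ l m)) := by
    intro l m
    rcases lt_or_ge l s with hl | hl
    · intro n _ k j
      simp [logProfile_of_lt B₀ hl, advData_zero]
    · exact radialEqs_advOp hl _
  have hfin : ∀ n l m, FiniteLogs (advData s l (logProfile s B₀ l m) n) := fun n l m =>
    (isProfile_logProfile s B₀ l m).finiteLogs.atDouble.advOp s l n
  have h0 : ∀ j > 0, ∀ l m, advData s l (logProfile s B₀ l m) 0 (2 * s) j = 0 := by
    intro j hj l m
    rcases lt_or_ge l s with hl | hl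
    · rw [logProfile_of_lt B₀ hl, advData_zero]
      rfl
    · rw [advData_logProfile_zero B₀ hs hl, if_neg hj.ne']
  -- At `n = 0` and order `2s` the radial factor `2s - n - k` is zero, so the equation determines
  -- only the logarithmic part of the next component.
  have h1 : ∀ (j l : ℕ) (m : ℤ), advData s l (logProfile s B₀ l m) 1 (2 * s) (j + 1)
      = ((j : ℂ) + 1)⁻¹ * ((modeLadder s l 0 : ℂ)
        * advData s l (logProfile s B₀ l m) 0 (2 * s) j) := by
    intro j l m
    have h := hradial l m 0 (by omega) (2 * s) j
    have hne : (j : ℂ) + 1 ≠ 0 := by exact_mod_cast j.succ_ne_zero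
    rw [← h, zero_add]
    push_cast
    field_simp
    ring
  have key : ∀ n < 2 * s, (∃ N : ℕ, ∀ j > N, ∀ l m,
      advData s l (logProfile s B₀ l m) (n + 1) (2 * s) j = 0)
      ∧ ∀ j, RapidDecay (fun l m => advData s l (logProfile s B₀ l m) (n + 1) (2 * s) j) := by
    intro n hn
    induction n with
    | zero =>
      simp only [zero_add]
      have h11 : RapidDecay (fun l m => advData s l (logProfile s B₀ l m) 1 (2 * s) 1) := by
        have := fun l m => h1 0 l m
        simp only [zero_add] at this
        simp only [this]
        exact (hr.ladder_mul _).const_mul _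
      have h1j : ∀ j > 1, ∀ l m, advData s l (logProfile s B₀ l m) 1 (2 * s) j = 0 := by
        intro j hj l m
        obtain ⟨j, rfl⟩ : ∃ j', j = j' + 1 := ⟨j - 1, by omega⟩
        rw [h1, h0 j (by omega), mul_zero, mul_zero]
      refine ⟨⟨1, h1j⟩, fun j => ?_⟩
      rcases j with _ | _ | j
      -- The part without logarithm differs from the logarithmic one by the factor `log 2` minus a
      -- harmonic sum of length `l + s - 1`, which grows at most linearly in `l`.
      · refine h11.of_le (Real.log 2 + s + 1) 1 fun l m _ => ?_
        rcases lt_or_ge l s with hl | hl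
        · have := Real.log_nonneg (one_le_two (α := ℝ))
          rw [logProfile_of_lt B₀ hl, advData_zero]
          simp
        · rw [advData_logProfile_one B₀ hs hl, norm_mul]
          refine mul_le_mul_of_nonneg_right ?_ (norm_nonneg _)
          have hlog := Real.log_nonneg (one_le_two (α := ℝ))
          refine (norm_sub_le _ _).trans ?_
          rw [Complex.norm_real, Real.norm_eq_abs, abs_of_nonneg hlog]
          have h3 := norm_harmonic_le (l + s - 1)
          have h4 : ((l + s - 1 : ℕ) : ℝ) ≤ l + s := by exact_mod_cast (by omega : l + s - 1 ≤ l + s)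
          have h5 : (0 : ℝ) ≤ l := l.cast_nonneg
          have h6 : (0 : ℝ) ≤ s := s.cast_nonneg
          nlinarith [mul_nonneg hlog h5, mul_nonneg h6 h5]
      · exact h11
      · exact RapidDecay.zero.congr fun l m _ => h1j _ (by omega) l m
    | succ n ih =>
      obtain ⟨⟨N, hN⟩, hrap⟩ := ih (by omega)
      -- From the component `n = 1` on, the radial factor at order `2s` is nonzero and each
      -- component is obtained from the preceding one.
      have hne : -((n : ℂ) + 1) ≠ 0 := neg_ne_zero.2 (by exact_mod_cast n.succ_ne_zero)
      obtain ⟨k1, k2⟩ := rapidDecay_of_shift hne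
        (h := fun j l m => advData s l (logProfile s B₀ l m) (n + 1 + 1) (2 * s) j)
        (g := fun j l m => (modeLadder s l (n + 1) : ℂ)
          * advData s l (logProfile s B₀ l m) (n + 1) (2 * s) j) (fun j l m => by
          have h3 := hradial l m (n + 1) hn (2 * s) j
          rw [← h3]
          push_cast
          ring)
        (fun l m => hfin (n + 1 + 1) l m (2 * s)) (N := N)
        (fun j hj l m => by rw [hN j hj, mul_zero]) (fun j => (hrap j).ladder_mul _)
      exact ⟨⟨N, k1⟩, k2⟩
  refine ⟨isProfile_logProfile s B₀, fun l hl m => logProfile_of_lt B₀ hl m,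
    fun l m => (suppGE_logProfile s B₀ l m).mono (by omega), fun n hn k => ?_, fun n hn k j => ?_⟩
  · by_cases hk : k = 2 * s
    · subst hk
      rcases n with _ | n
      exacts [⟨0, h0⟩, (key n hn).1]
    · exact ⟨0, fun j _ l m => advData_logProfile_of_ne B₀ l m hn hk j⟩
  · by_cases hk : k = 2 * s
    · subst hk
      rcases n with _ | n
      · rcases j with _ | j
        exacts [hr, RapidDecay.zero.congr fun l m _ => h0 _ (by omega) l m]
      · exact (key n hn).2 j
    · exact RapidDecay.zero.congr fun l m _ => advData_logProfile_of_ne B₀ l m hn hk j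

theorem advMode_logProfile (B₀ : ℕ → ℤ → ℂ) {l : ℕ} (hl : s ≤ l) (m : ℤ) {n : ℕ} (hn : n ≤ 2 * s)
    {k : ℤ} (hk : k ≤ 2 * s) (j : ℕ) (u : ℝ) : advMode s l (logProfile s B₀ l m) n k j u
      = advData s l (logProfile s B₀ l m) n k j := by
  rw [advMode_eq_sum hl hn (suppGE_logProfile s B₀ l m) (D := 1) (by push_cast; omega)]
  simp

/-! ### Minimal violation of peeling -/

/-- The leading coefficient of a minimally non-peeling mode does not depend on `u`. -/
theorem IsMode.leading_const {s l : ℕ} (hs : 1 ≤ s) {f : ℕ → PolyLog (ℝ → ℂ)} (hf : IsMode s l f)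
    (h0 : ∀ k < 2 * (s : ℤ), ∀ j, f 0 k j = 0) (u : ℝ) : f 0 (2 * s) 0 u = f 0 (2 * s) 0 0 := by
  -- At order `2s - 1` the radial factor equals `1` and `φ_0` vanishes, hence `φ_1` vanishes there
  -- as well and the evolution equation has no source for the leading coefficient.
  have hz : ∀ j, f 1 (2 * s - 1) j = 0 := by
    intro j
    funext u
    obtain ⟨N, hN⟩ := hf.logs 1 (by omega) (2 * s - 1)
    refine eq_zero_of_shift (h := fun j => f 1 (2 * s - 1) j u) one_ne_zero (fun j => ?_) (N := N)
      (fun j hj => by simp only [hN j hj, Pi.zero_apply]) j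
    have h1 := (hf.eqs u).1 0 (by omega) (2 * s - 1) j
    simp only [h0 _ (show (2 * s - 1 : ℤ) < 2 * s by omega), Pi.zero_apply, mul_zero, zero_add] at h1
    rw [← h1]
    push_cast
    ring
  refine eq_of_deriv_eq_zero (hf.smooth 0 (by omega) _ _) (fun u => ?_) u
  have h1 := (hf.eqs u).2 0 (by omega) (2 * s - 1) 0
  rw [sub_add_cancel] at h1
  rw [h1, evolution, h0 _ (by omega), h0 _ (by omega), hz]
  simp

/-- `B₀` is the leading moment divided by the nonzero constant `C l`. Up to order `2s` the advanced
field does not depend on `u`, and neither does the leading moment of `φ`, so matching `φ_0` at `u =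
0` cancels it there for all `u`. -/
theorem exists_minimal_advanced_add_mixed (hs : 1 ≤ s) {φ : FieldExp} (hφ : IsPolyhomField s φ)
    (hmin : IsMinimal s φ) : ∃ (B₀ : ℕ → ℤ → ℂ) (φadv φmix : FieldExp),
      IsAdvanced s (logProfile s B₀) φadv ∧ IsPolyhomField s φadv ∧
      IsMixed s φmix ∧ IsPolyhomField s φmix ∧ IsSum s φ φadv φmix ∧ IsMinimal s φadv ∧
      (∀ k ≤ 2 * (s : ℤ), ∀ j, SphEq (φmix 0 k j) 0) ∧
      (∀ n : ℕ, 1 ≤ n → n ≤ 2 * s → ∀ (k : ℤ) (j : ℕ), ViolatesPeeling s n k j →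
        SphEq (φmix n k j) 0) ∧
      ∀ (l : ℕ) (m : ℤ), s ≤ l → ∀ u : ℝ, fieldMode s φ l m 0 (2 * s) 0 u
        = (-1 : ℂ) ^ (l + s + 1) * 2 ^ (l + 1 - s) * ((l + s - 1).factorial : ℂ)
          * (K s l : ℂ) * B₀ l m := by
  set C : ℕ → ℂ := fun l => (-1 : ℂ) ^ (l + s + 1) * 2 ^ (l + 1 - s) * ((l + s - 1).factorial : ℂ)
    * (K s l : ℂ) with hC
  have hCne : ∀ l, C l ≠ 0 := fun l => mul_ne_zero (mul_ne_zero (mul_ne_zero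
    (pow_ne_zero _ (by norm_num)) (pow_ne_zero _ two_ne_zero))
    (by exact_mod_cast Nat.factorial_ne_zero _)) (by exact_mod_cast (K_pos _ l).ne')
  set B₀ : ℕ → ℤ → ℂ := fun l m => (C l)⁻¹ * fieldMode s φ l m 0 (2 * s) 0 0 with hB₀
  have hf0 : ∀ k < 2 * (s : ℤ), ∀ j (l : ℕ) (m : ℤ), fieldMode s φ l m 0 k j = 0 :=
    fun k hk j l m => hφ.fieldMode_eq_zero (by omega) (hmin.1 k hk j) l m
  have hf1 : ∀ j ≥ 1, ∀ (l : ℕ) (m : ℤ), fieldMode s φ l m 0 (2 * s) j = 0 :=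
    fun j hj l m => hφ.fieldMode_eq_zero (by omega) (hmin.2 j hj) l m
  have hconst : ∀ (l : ℕ) (m : ℤ) (u : ℝ), fieldMode s φ l m 0 (2 * s) 0 u
      = fieldMode s φ l m 0 (2 * s) 0 0 := fun l m u =>
    (hφ.isMode l m).leading_const hs (fun k hk j => hf0 k hk j l m) u
  have hlead : ∀ (l : ℕ) (m : ℤ), s ≤ l → ∀ j u, advData s l (logProfile s B₀ l m) 0 (2 * s) j
      = fieldMode s φ l m 0 (2 * s) j u := by
    intro l m hl j u
    rw [advData_logProfile_zero B₀ hs hl]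
    rcases j with _ | j
    · rw [if_pos rfl, hconst]
      exact mul_inv_cancel_left₀ (hCne l) _
    · rw [if_neg (by omega), hf1 _ (by omega)]
      rfl
  have hfam : IsSummableFamily s (logProfile s B₀) := by
    refine isSummableFamily_logProfile hs ?_
    refine (hφ.rapidDecay (Nat.zero_le (2 * s)) (2 * s) 0 0).of_le 1 0 fun l m _ => ?_
    rcases lt_or_ge l s with hl | hl
    · rw [logProfile_of_lt B₀ hl, advData_zero]
      simp
    · rw [hlead l m hl 0 0]
      simp
  obtain ⟨φadv, hadv, hpoly, hmode⟩ := hfam.exists_field hs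
  have hmix := hφ.sub hpoly
  have hmix0 : ∀ k ≤ 2 * (s : ℤ), ∀ j (l : ℕ) (m : ℤ), fieldMode s (φ - φadv) l m 0 k j = 0 := by
    intro k hk j l m
    by_cases h : |(s : ℤ) - (0 : ℕ)| ≤ (l : ℤ) ∧ |m| ≤ (l : ℤ)
    · have hl : s ≤ l := by
        have := abs_le.1 h.1
        omega
      funext u
      rw [hφ.fieldMode_sub hpoly l m (Nat.zero_le _), Pi.sub_apply,
        hmode l m 0 (Nat.zero_le _) h.1 h.2, advMode_logProfile B₀ hl m (Nat.zero_le _) hk]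
      rcases hk.lt_or_eq with hk | rfl
      · rw [hf0 k hk, advData_logProfile_of_ne B₀ l m (Nat.zero_le _) hk.ne]
        simp
      · rw [hlead l m hl j u]
        simp
    · exact IsPolyhomField.fieldMode_of_not h k j
  have hpeels : ∀ n ≤ 2 * s, ∀ k ≤ 2 * (s : ℤ), ∀ j, ViolatesPeeling s n k j →
      SphEq ((φ - φadv) n k j) 0 := fun n hn k hk j hv => hmix.sphEq_zero hn fun l m _ _ =>
    (hmix.isMode l m).peels_of_first (fun k hk j => hmix0 k hk j l m) n hn k hk j hv
  have hadv0 : ∀ k ≤ 2 * (s : ℤ), ∀ j, (k ≠ 2 * s ∨ 1 ≤ j) → SphEq (φadv 0 k j) 0 := by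
    intro k hk j hkj
    refine hpoly.sphEq_zero (Nat.zero_le _) fun l m h1 h2 => ?_
    have hl : s ≤ l := by
      have := abs_le.1 h1
      omega
    funext u
    rw [hmode l m 0 (Nat.zero_le _) h1 h2, advMode_logProfile B₀ hl m (Nat.zero_le _) hk]
    rcases hkj with h | h
    · exact advData_logProfile_of_ne B₀ l m (Nat.zero_le _) h j
    · by_cases hk' : k = 2 * s
      · rw [hk', advData_logProfile_zero B₀ hs hl, if_neg (by omega)]
        rfl
      · exact advData_logProfile_of_ne B₀ l m (Nat.zero_le _) hk' j
  refine ⟨B₀, φadv, φ - φadv, hadv, hpoly, hmix.isMixed hs hpeels, hmix,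
    fun n _ k j u ϕ θ _ => by simp,
    ⟨fun k hk j => hadv0 k hk.le j (Or.inl hk.ne), fun j hj => hadv0 _ le_rfl j (Or.inr hj)⟩,
    fun k hk j => hmix.sphEq_zero (Nat.zero_le _) fun l m _ _ => hmix0 k hk j l m,
    fun n h1 hn k j hv => hpeels n hn k ?_ j hv, fun l m _ u => ?_⟩
  · unfold ViolatesPeeling at hv
    omega
  · rw [hconst]
    exact (mul_inv_cancel_left₀ (hCne l) _).symm

end ZRM

/-! ### The limit at null infinity -/

namespace ZRM

open Filter Topology

/-- `f x = x ^ (-N) * (a (1/x) * log x + h (1/x))` for large `x`, with smooth `a` and `h`. -/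
structure HasLogExpansion (ε : ℝ) (N : ℕ) (f a h : ℝ → ℂ) : Prop where
  smooth_log : ContDiffOn ℝ ∞ a (Set.Ioo (-ε) ε)
  smooth : ContDiffOn ℝ ∞ h (Set.Ioo (-ε) ε)
  eq : ∀ x > ε⁻¹, f x = ((x⁻¹ : ℝ) : ℂ) ^ N * (a x⁻¹ * (Real.log x : ℂ) + h x⁻¹)

namespace HasLogExpansion

variable {ε : ℝ} {N : ℕ} {f a h : ℝ → ℂ}

theorem inv_mem (hε : 0 < ε) {x : ℝ} (hx : ε⁻¹ < x) : x⁻¹ ∈ Set.Ioo (-ε) ε := by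
  have h0 : 0 < x := (inv_pos.2 hε).trans hx
  have h1 : x⁻¹ < ε := inv_lt_of_inv_lt₀ hε hx
  exact ⟨by linarith [inv_pos.2 h0], h1⟩

theorem hasDerivAt_comp_inv (hε : 0 < ε) (ha : ContDiffOn ℝ ∞ a (Set.Ioo (-ε) ε)) {x : ℝ}
    (hx : ε⁻¹ < x) : HasDerivAt (fun x => a x⁻¹) (-((x⁻¹ : ℝ) : ℂ) ^ 2 * deriv a x⁻¹) x := by
  have h0 : x ≠ 0 := ((inv_pos.2 hε).trans hx).ne'
  have h1 : HasDerivAt a (deriv a x⁻¹) x⁻¹ :=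
    ((ha.contDiffAt (isOpen_Ioo.mem_nhds (inv_mem hε hx))).differentiableAt (by simp)).hasDerivAt
  have h2 := h1.scomp x (hasDerivAt_inv h0)
  refine HasDerivAt.congr_deriv h2 ?_
  rw [Complex.real_smul]
  push_cast
  rw [inv_pow]

/-- Derivatives of asymptotic expansions are safe here because `a` and `h` are smooth in `1/x`
across infinity; only the values at `0` matter for the limit. -/
theorem deriv (hε : 0 < ε) (hf : HasLogExpansion ε N f a h) :
    HasLogExpansion ε (N + 1) (deriv f) (fun y => -(N : ℂ) * a y - y * deriv a y)
      (fun y => a y - (N : ℂ) * h y - y * deriv h y) := by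
  have hU : IsOpen (Set.Ioo (-ε) ε) := isOpen_Ioo
  have hd : ∀ {a : ℝ → ℂ}, ContDiffOn ℝ ∞ a (Set.Ioo (-ε) ε) →
      ContDiffOn ℝ ∞ (fun y : ℝ => (y : ℂ) * _root_.deriv a y) (Set.Ioo (-ε) ε) := fun ha =>
    Complex.ofRealCLM.contDiff.contDiffOn.mul
      ((contDiffOn_infty_iff_deriv_of_isOpen hU).1 ha).2
  refine ⟨(contDiffOn_const.mul hf.smooth_log).sub (hd hf.smooth_log),
    (hf.smooth_log.sub (contDiffOn_const.mul hf.smooth)).sub (hd hf.smooth), fun x hx => ?_⟩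
  have h0 : x ≠ 0 := ((inv_pos.2 hε).trans hx).ne'
  have h0' : (x : ℂ) ≠ 0 := Complex.ofReal_ne_zero.2 h0
  have e : f =ᶠ[𝓝 x] fun x => ((x⁻¹ : ℝ) : ℂ) ^ N * (a x⁻¹ * (Real.log x : ℂ) + h x⁻¹) := by
    filter_upwards [Ioi_mem_nhds hx] with y hy using hf.eq y hy
  have hlog : HasDerivAt (fun x : ℝ => (Real.log x : ℂ)) ((x⁻¹ : ℝ) : ℂ) x :=
    (Real.hasDerivAt_log h0).ofReal_comp
  have hpow : HasDerivAt (fun x : ℝ => ((x⁻¹ : ℝ) : ℂ) ^ N)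
      (-(N : ℂ) * ((x⁻¹ : ℝ) : ℂ) ^ (N + 1)) x := by
    have h1 := ((hasDerivAt_inv h0).ofReal_comp).fun_pow N
    refine HasDerivAt.congr_deriv h1 ?_
    rcases N with _ | N
    · simp
    · push_cast
      rw [← inv_pow]
      ring
  have key := hpow.mul (((hasDerivAt_comp_inv hε hf.smooth_log hx).mul hlog).add
    (hasDerivAt_comp_inv hε hf.smooth hx))
  rw [e.deriv_eq]
  refine key.deriv.trans ?_
  simp only [Pi.add_apply, Pi.mul_apply]
  ring

/-- For exponent zero the first derivative removes the leading logarithm and passes its coefficient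
to `h`. Afterwards `a` stays zero at infinity, and each derivative multiplies the leading value of
`h` by minus the current exponent. -/
theorem iteratedDeriv_succ (hε : 0 < ε) (hf : HasLogExpansion ε 0 f a h) (N : ℕ) :
    ∃ a' h' : ℝ → ℂ, HasLogExpansion ε (N + 1) (iteratedDeriv (N + 1) f) a' h' ∧ a' 0 = 0 ∧
      h' 0 = (-1) ^ N * (N.factorial : ℂ) * a 0 := by
  induction N with
  | zero =>
    refine ⟨_, _, by rw [zero_add, iteratedDeriv_one]; exact hf.deriv hε, ?_, ?_⟩ <;> simp
  | succ N ih =>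
    obtain ⟨a', h', h1, h2, h3⟩ := ih
    refine ⟨_, _, by rw [_root_.iteratedDeriv_succ]; exact h1.deriv hε, ?_, ?_⟩
    · simp [h2]
    · simp only [h2, h3, Nat.factorial_succ, pow_succ]
      push_cast
      ring

/-- With `a 0 = 0` the logarithmic term is `O (log x / x)`. -/
theorem tendsto (hε : 0 < ε) (hf : HasLogExpansion ε N f a h) (ha : a 0 = 0) :
    Tendsto (fun x : ℝ => (x : ℂ) ^ N * f x) atTop (𝓝 (h 0)) := by
  have h0 : (0 : ℝ) ∈ Set.Ioo (-ε) ε := ⟨by linarith, hε⟩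
  have hU : Set.Ioo (-ε) ε ∈ 𝓝 (0 : ℝ) := isOpen_Ioo.mem_nhds h0
  have hh : Tendsto (fun x : ℝ => h x⁻¹) atTop (𝓝 (h 0)) :=
    ((hf.smooth.contDiffAt hU).continuousAt.tendsto).comp tendsto_inv_atTop_zero
  have hal : Tendsto (fun x : ℝ => a x⁻¹ * (Real.log x : ℂ)) atTop (𝓝 0) := by
    have h1 : a =O[𝓝 0] fun y : ℝ => y := by
      have := ((hf.smooth_log.contDiffAt hU).differentiableAt (by simp)).isBigO_sub
      simpa [ha] using this
    have h2 : (fun x : ℝ => a x⁻¹) =O[atTop] fun x : ℝ => x⁻¹ :=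
      h1.comp_tendsto tendsto_inv_atTop_zero
    have h3 : (fun x : ℝ => (Real.log x : ℂ)) =o[atTop] fun x : ℝ => x :=
      (Asymptotics.isLittleO_norm_left.1 (by
        simpa only [Complex.norm_real] using! Real.isLittleO_log_id_atTop.norm_left))
    refine (Asymptotics.isLittleO_one_iff ℝ).1 ((h2.mul_isLittleO h3).congr' EventuallyEq.rfl ?_)
    filter_upwards [eventually_gt_atTop 0] with x hx using inv_mul_cancel₀ hx.ne'
  have := hal.add hh
  rw [zero_add] at this
  refine this.congr' ?_
  filter_upwards [eventually_gt_atTop ε⁻¹, eventually_gt_atTop 0] with x hx hx0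
  rw [hf.eq x hx, ← mul_assoc, ← mul_pow, ← Complex.ofReal_mul, mul_inv_cancel₀ hx0.ne',
    Complex.ofReal_one, one_pow, one_mul]

end HasLogExpansion

/-- Writing `u + 2 x = x (2 + u / x)` splits the logarithm and cancels the powers of `x`. The radius
`2 / (|u| + 1)` keeps `2 + u y` positive. -/
theorem hasLogExpansion_log (c : ℂ) (u : ℝ) (q : ℕ) :
    HasLogExpansion (2 / (|u| + 1)) 0
      (fun x => c * ((u + 2 * x : ℝ) : ℂ) ^ q * (Real.log (u + 2 * x) : ℂ) / (x : ℂ) ^ q)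
      (fun y => c * ((2 + u * y : ℝ) : ℂ) ^ q)
      (fun y => c * ((2 + u * y : ℝ) : ℂ) ^ q * (Real.log (2 + u * y) : ℂ)) := by
  have hu : 0 < |u| + 1 := by positivity
  have hpos : ∀ y ∈ Set.Ioo (-(2 / (|u| + 1))) (2 / (|u| + 1)), 0 < 2 + u * y := by
    intro y hy
    have h1 : |y| < 2 / (|u| + 1) := abs_lt.2 hy
    rw [lt_div_iff₀ hu] at h1
    have h2 := neg_abs_le (u * y)
    rw [abs_mul] at h2
    have h3 := abs_nonneg y
    rcases h3.eq_or_lt with h4 | h4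
    · rw [← h4] at h2
      linarith
    · nlinarith
  have hlin : ContDiff ℝ ∞ fun y : ℝ => 2 + u * y := contDiff_const.add (contDiff_const.mul contDiff_id)
  have ha : ContDiff ℝ ∞ fun y : ℝ => c * ((2 + u * y : ℝ) : ℂ) ^ q :=
    contDiff_const.mul ((Complex.ofRealCLM.contDiff.comp hlin).pow q)
  refine ⟨ha.contDiffOn, ha.contDiffOn.mul (Complex.ofRealCLM.contDiff.comp_contDiffOn
    (hlin.contDiffOn.log fun y hy => (hpos y hy).ne')), fun x hx => ?_⟩
  have hε : 0 < 2 / (|u| + 1) := by positivity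
  have hx0 : 0 < x := (inv_pos.2 hε).trans hx
  have h1 := hpos _ (HasLogExpansion.inv_mem hε hx)
  have h2 : u + 2 * x = x * (2 + u * x⁻¹) := by
    field_simp
    ring
  have h3 : (x : ℂ) ≠ 0 := Complex.ofReal_ne_zero.2 hx0.ne'
  rw [h2, Real.log_mul hx0.ne' h1.ne', pow_zero, one_mul, Complex.ofReal_mul, mul_pow]
  push_cast
  field_simp

theorem tendsto_advRadialZero {s l : ℕ} (hs : 1 ≤ s) (hl : s ≤ l) (c : ℂ) (u : ℝ) :
    Tendsto (fun r : ℝ => (r : ℂ) ^ (2 * s) * advRadialZero s l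
      (fun v : ℝ => c * (v : ℂ) ^ (l + 1 - s) * (Real.log v : ℂ)) u r) atTop
      (𝓝 ((-1 : ℂ) ^ (l + s + 1) * 2 ^ (l + 1 - s) * ((l + s - 1).factorial : ℂ)
        * (K s l : ℂ) * c)) := by
  have hε : 0 < 2 / (|u| + 1) := by positivity
  obtain ⟨N, hN⟩ : ∃ N, l + s = N + 1 := ⟨l + s - 1, by omega⟩
  obtain ⟨a, h, h1, h2, h3⟩ := (hasLogExpansion_log c u (l + 1 - s)).iteratedDeriv_succ hε N
  have h4 := (h1.tendsto hε h2).const_mul (K s l : ℂ)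
  rw [h3] at h4
  have e : (K s l : ℂ) * ((-1) ^ N * (N.factorial : ℂ) * (c * ((2 + u * 0 : ℝ) : ℂ) ^ (l + 1 - s)))
      = (-1 : ℂ) ^ (l + s + 1) * 2 ^ (l + 1 - s) * ((l + s - 1).factorial : ℂ) * (K s l : ℂ) * c := by
    rw [show l + s - 1 = N by omega, hN, show N + 1 + 1 = N + 2 by ring, pow_add (-1 : ℂ) N 2]
    push_cast
    rw [mul_zero, add_zero]
    ring
  rw [e] at h4
  refine h4.congr fun r => ?_
  rw [advRadialZero, ← hN, show l - s + 1 = l + 1 - s by omega]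
  have h5 : (r : ℂ) ^ (l + s) = (r : ℂ) ^ (2 * s) * (r : ℂ) ^ (l - s) := by
    rw [← pow_add]
    congr 1
    omega
  rw [h5]
  ring

end ZRM

end

/-! ### The decomposition theorem. -/

theorem proposition2 (s : ℕ) (hs : s = 1 ∨ s = 2) (φ : ZRM.FieldExp)
    (hφ : ZRM.IsPolyhomField s φ) :
    (∃ (B : ℕ → ℤ → ZRM.PolyLog ℂ) (φadv φmix : ZRM.FieldExp),
      (∀ l m k q, B l m k q ≠ 0 → -((l : ℤ) + s) ≤ k ∧ k ≤ (s : ℤ) - l) ∧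
      ZRM.IsAdvanced s B φadv ∧ ZRM.IsPolyhomField s φadv ∧
      ZRM.IsMixed s φmix ∧ ZRM.IsPolyhomField s φmix ∧
      ZRM.IsSum s φ φadv φmix ∧
      ZRM.Peels s φmix) ∧
    (ZRM.IsMinimal s φ →
      ∃ (B₀ : ℕ → ℤ → ℂ) (φadv φmix : ZRM.FieldExp),
        ZRM.IsAdvanced s (ZRM.logProfile s B₀) φadv ∧ ZRM.IsPolyhomField s φadv ∧
        ZRM.IsMixed s φmix ∧ ZRM.IsPolyhomField s φmix ∧
        ZRM.IsSum s φ φadv φmix ∧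
        ZRM.IsMinimal s φadv ∧
        (∀ k ≤ 2 * (s : ℤ), ∀ j, ZRM.SphEq (φmix 0 k j) 0) ∧
        (∀ n : ℕ, 1 ≤ n → n ≤ 2 * s → ∀ (k : ℤ) (j : ℕ), ZRM.ViolatesPeeling s n k j →
          ZRM.SphEq (φmix n k j) 0) ∧
        (∀ u ϕ : ℝ, ∀ θ ∈ Set.Ioo (0 : ℝ) Real.pi,
          HasSum (fun lm : ℕ × ℤ => ZRM.multipole s lm.1 lm.2 (φ 0 (2 * s) 0 u)
              * ZRM.spinY s lm.1 lm.2 θ ϕ)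
            (φ 0 (2 * s) 0 u θ ϕ)) ∧
        (∀ (l : ℕ) (m : ℤ), s ≤ l → |m| ≤ (l : ℤ) → ∀ u : ℝ,
          ZRM.multipole s l m (φ 0 (2 * s) 0 u)
            = (-1 : ℂ) ^ (l + s + 1) * 2 ^ (l + 1 - s) * ((l + s - 1).factorial : ℂ)
              * (ZRM.K s l : ℂ) * B₀ l m ∧
          Filter.Tendsto
            (fun r : ℝ => (r : ℂ) ^ (2 * s) * ZRM.advRadialZero s l
              (fun v : ℝ => B₀ l m * (v : ℂ) ^ (l + 1 - s) * (Real.log v : ℂ)) u r)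
            Filter.atTop (nhds (ZRM.multipole s l m (φ 0 (2 * s) 0 u))))) := by
  have hs1 : 1 ≤ s := by omega
  refine ⟨ZRM.exists_advanced_add_mixed hs1 hφ, fun hmin => ?_⟩
  obtain ⟨B₀, φadv, φmix, h1, h2, h3, h4, h5, h6, h7, h8, h9⟩ :=
    ZRM.exists_minimal_advanced_add_mixed hs1 hφ hmin
  have hcast : (s : ℤ) - (0 : ℕ) = s := by simp
  refine ⟨B₀, φadv, φmix, h1, h2, h3, h4, h5, h6, h7, h8, fun u ϕ θ hθ => ?_, fun l m hl _ u => ?_⟩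
  · have h := ((hφ.smooth (Nat.zero_le _) (2 * s) 0).smoothWeighted u).hasSum_multipole hθ ϕ
    rwa [hcast] at h
  · have h := h9 l m hl u
    rw [ZRM.fieldMode, hcast] at h
    exact ⟨h, h ▸ ZRM.tendsto_advRadialZero hs1 hl (B₀ l m) u⟩
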